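/- **Notation.** Let $\mathbb T=\mathbb R/2\pi\mathbb Z$ and $\widehat f(k)=\int_{\mathbb T}f(x)e^{-ikx}\,dx$. For an integer $s\ge0$ let $\|f\|_{H^s}^2=\frac1{2\pi}\sum_{k\in\mathbb Z}(1+|k|)^{2s}|\widehat f(k)|^2$. The discrete Hilbert transform $\mathbb H$ is given by $\widehat{\mathbb H[f]}(k)=-i\,\mathrm{sgn}(k)\,\widehat f(k)$ with $\mathrm{sgn}(0)=0$, and $[h;\mathbb H]u=h\,\mathbb H[u]-\mathbb H[hu]$. For $\gamma\ge1$ let $\|f\|^2_{L^2_\gamma(\mathbb R;H^s)}=\int_{\mathbb R}e^{-2\gamma t}\|f(t)\|^2_{H^s}\,dt$, and let $\|f\|_{L^\infty(\mathbb R;H^s)}=\operatorname{ess\,sup}_{t\in\mathbb R}\|f(t)\|_{H^s}$. All functions are real-valued. For $\mu\in\mathbb R$ and a basic state $\varphi_0$ with $\phi_0=\mathbb H[\varphi_0]$, the linearized equation for $\varphi'$, with $\phi'=\mathbb H[\varphi']$, is $$\varphi'_{tt}-\mu\varphi'_{xx}-\big(2\mathbb H[\phi_{0,x}\phi'_x]-[\phi';\mathbb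 H]\phi_{0,xx}-[\phi_0;\mathbb H]\phi'_{xx}\big)_x=g\qquad(\ast)$$ in the sense of distributions on $\mathbb R\times\mathbb T$. **Proposition 4.1.** There are functions $\gamma_1=\gamma_1(m,\delta,a,b)\ge1$ and $C=C(m,\delta,a,b)>0$ of $m\in\mathbb N$, $\delta>0$, $a,b\ge0$, nondecreasing in $m$, $1/\delta$, $a$ and $b$, with the following property. Let $m\ge1$ be an integer, let $\mu\in\mathbb R$ and $\delta>0$, and let $\varphi_0:\mathbb R\times\mathbb T\to\mathbb R$ have zero spatial mean and satisfy $$\varphi_0\in L^\infty(\mathbb R;H^5(\mathbb T))\cap L^\infty(\mathbb R;H^{m+3}(\mathbb T)),\qquad \varphi_{0,t}\in L^\infty(\mathbb R;H^2(\mathbb T)),$$ together with the stability condition $\mu-2\phi_{0,x}\ge\delta/2$ in $\mathbb R\times\mathbb T$. Put $\gamma_1=\gamma_1(m,\delta,\|\varphi_0\|_{L^\infty(\mathbb R;H^5)},\|\varphi_{0,t}\|_{L^\infty(\mathbb R;H^2)})$ and let $C$ be the value of the second function at the same arguments. Then for every $\gamma\ge\gamma_1$ and every $g\in L^2_\gamma(\mathbb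 R;H^m(\mathbb T))$ with zero spatial mean, there is a unique solution $\varphi'$ of $(\ast)$ with zero spatial mean such that $\varphi'_t,\varphi'_x\in L^2_\gamma(\mathbb R;H^m(\mathbb T))$. Moreover, it satisfies $$\gamma\big\{\|\varphi'_t\|^2_{L^2_\gamma(\mathbb R;H^m)}+\|\varphi'_x\|^2_{L^2_\gamma(\mathbb R;H^m)}\big\}\le\frac C\gamma\big\{\|\varphi_{0,x}\|^2_{L^\infty(\mathbb R;H^{m+2})}\|g\|^2_{L^2_\gamma(\mathbb R;H^2)}+\|g\|^2_{L^2_\gamma(\mathbb R;H^m)}\big\}.$$ If $m=1$, the norm $\|g\|_{L^2_\gamma(\mathbb R;H^2)}$ may be infinite, with the convention $0\cdot\infty=0$. -/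

import Mathlib

open MeasureTheory
open scoped ENNReal Real ContDiff

noncomputable section

instance fact_two_pi_pos : Fact (0 < 2 * π) := ⟨Real.two_pi_pos⟩

/-- The torus `ℝ / 2πℤ`. Its `volume` is the arc-length measure, of total mass `2π`. -/
abbrev Torus : Type := AddCircle (2 * π)

/-- The real Hilbert space `L²(𝕋)` of real-valued functions on the torus. Functions `f(t,x)` are
treated as functions of `t` with values in this space. -/
abbrev L2T : Type := Lp ℝ 2 (volume : Measure Torus)

/-- The Fourier coefficient `∫_𝕋 f(x) e^{-ikx} dx`. -/
def fcoef (f : Torus → ℝ) (k : ℤ) : ℂ := ∫ x : Torus, fourier (-k) x * (f x : ℂ)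

/-- The Fourier multiplier with symbol `A`: the element of `L²(𝕋)` whose `k`-th Fourier coefficient
is `A k` times that of `f`. It is unique when it exists; the value is `0` when it does not. -/
def fourierMultiplier (A : ℤ → ℂ) (f : L2T) : L2T :=
  open Classical in
  if h : ∃ u : L2T, ∀ k, fcoef u k = A k * fcoef f k then h.choose else 0

/-- The discrete Hilbert transform, with symbol `-i sgn k` (and `sgn 0 = 0`). -/
def hilbertT (f : L2T) : L2T :=
  fourierMultiplier (fun k => -Complex.I * (Int.sign k : ℂ)) f

/-- The derivative of an element of `H¹(𝕋)`: the Fourier multiplier with symbol `ik`. -/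
def dx (f : L2T) : L2T := fourierMultiplier (fun k => Complex.I * (k : ℂ)) f

/-- The relation `h = ∂ₓ f` in `L²(𝕋)`. -/
def IsDx (f h : L2T) : Prop := ∀ k : ℤ, fcoef h k = Complex.I * (k : ℂ) * fcoef f k

/-- The pointwise product, for factors whose product is again in `L²(𝕋)` (e.g. when one of them is
essentially bounded); `0` otherwise. -/
def mulL2 (f g : L2T) : L2T :=
  open Classical in
  if h : MemLp (fun x => f x * g x) 2 (volume : Measure Torus) then h.toLp _ else 0

/-- The commutator `[h ; ℍ] u = h ℍ[u] - ℍ[h u]`. -/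
def commH (h u : L2T) : L2T := mulL2 h (hilbertT u) - hilbertT (mulL2 h u)

/-- The flux of the linearized operator at a fixed time: with `p₀ = ℍ[f₀]` and `p = ℍ[f]`,
`2 ℍ[p₀ₓ pₓ] - [p ; ℍ] p₀ₓₓ - [p₀ ; ℍ] pₓₓ`. -/
def linFlux (f₀ f : L2T) : L2T :=
  (2 : ℝ) • hilbertT (mulL2 (dx (hilbertT f₀)) (dx (hilbertT f)))
    - commH (hilbertT f) (dx (dx (hilbertT f₀)))
    - commH (hilbertT f₀) (dx (dx (hilbertT f)))

/-- The squared norm of `H^s(𝕋)`, `(1/2π) ∑ₖ (1+|k|)^{2s} |f̂(k)|²`, possibly infinite. -/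
def hsNormSq (s : ℕ) (f : L2T) : ℝ≥0∞ :=
  ENNReal.ofReal (2 * π)⁻¹ *
    ∑' k : ℤ, ENNReal.ofReal ((1 + |(k : ℝ)|) ^ (2 * s) * ‖fcoef f k‖ ^ 2)

/-- The squared norm of `L²_γ(ℝ; H^s(𝕋))`, `∫ e^{-2γt} ‖f(t)‖²_{H^s} dt`, possibly infinite. -/
def l2gNormSq (γ : ℝ) (s : ℕ) (f : ℝ → L2T) : ℝ≥0∞ :=
  ∫⁻ t, ENNReal.ofReal (Real.exp (-(2 * γ * t))) * hsNormSq s (f t)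

/-- Membership in `L²_γ(ℝ; H^s(𝕋))`. -/
def MemL2g (γ : ℝ) (s : ℕ) (f : ℝ → L2T) : Prop :=
  AEStronglyMeasurable f volume ∧ l2gNormSq γ s f < ⊤

/-- The norm of `L^∞(ℝ; H^s(𝕋))`, `ess sup_t ‖f(t)‖_{H^s}`, possibly infinite. -/
def linfNorm (s : ℕ) (f : ℝ → L2T) : ℝ≥0∞ :=
  essSup (fun t => hsNormSq s (f t) ^ (1 / 2 : ℝ)) volume

/-- Membership in `L^∞(ℝ; H^s(𝕋))`. -/
def MemLinf (s : ℕ) (f : ℝ → L2T) : Prop :=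
  AEStronglyMeasurable f volume ∧ linfNorm s f < ⊤

/-- Zero spatial mean at almost every time. -/
def ZeroMean (f : ℝ → L2T) : Prop := ∀ᵐ t, ∫ x : Torus, f t x = 0

/-- The relation `v = ∂ₜ u` in the sense of `L²(𝕋)`-valued distributions on `ℝ`. -/
def IsWeakDt (u v : ℝ → L2T) : Prop :=
  LocallyIntegrable u volume ∧ LocallyIntegrable v volume ∧
    ∀ θ : ℝ → ℝ, ContDiff ℝ ∞ θ → HasCompactSupport θ →
      ∫ t, deriv θ t • u t = -∫ t, θ t • v t

/-- Test functions on `ℝ × 𝕋`: smooth, and compactly supported in time. -/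
def IsTest (ψ : ℝ → Torus → ℝ) : Prop :=
  ContDiff ℝ ∞ (fun p : ℝ × ℝ => ψ p.1 (p.2 : Torus)) ∧
    ∃ R : ℝ, ∀ t x, R < |t| → ψ t x = 0

/-- The `n`-th derivative of `ψ` in time. -/
def testDt (n : ℕ) (ψ : ℝ → Torus → ℝ) (t : ℝ) (x : Torus) : ℝ :=
  iteratedDeriv n (fun s => ψ s x) t

/-- The `n`-th derivative of `ψ` in space. -/
def testDx (n : ℕ) (ψ : ℝ → Torus → ℝ) (t : ℝ) (x : Torus) : ℝ :=
  iteratedDeriv n (fun y : ℝ => ψ t (x + (y : Torus))) 0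

/-- The linearized equation about `φ₀`,
`φ_tt - μ φ_xx - (2 ℍ[p₀ₓ pₓ] - [p ; ℍ] p₀ₓₓ - [p₀ ; ℍ] pₓₓ)ₓ = g` with `p = ℍ[φ]`, `p₀ = ℍ[φ₀]`,
in the sense of distributions on `ℝ × 𝕋`. -/
def LinearizedEq (μ : ℝ) (φ₀ φ g : ℝ → L2T) : Prop :=
  ∀ ψ : ℝ → Torus → ℝ, IsTest ψ →
    ∫ t, ∫ x : Torus, (φ t x * testDt 2 ψ t x - μ * (φ t x * testDx 2 ψ t x)
        + linFlux (φ₀ t) (φ t) x * testDx 1 ψ t x)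
      = ∫ t, ∫ x : Torus, g t x * ψ t x

/-- `φ` is a solution of the linearized equation with zero spatial mean whose derivatives
`φₜ = φt` and `φₓ = φx` belong to `L²_γ(ℝ; H^m(𝕋))`. -/
structure IsLinSol (μ γ : ℝ) (m : ℕ) (φ₀ g φ φt φx : ℝ → L2T) : Prop where
  zero_mean : ZeroMean φ
  deriv_t : IsWeakDt φ φt
  deriv_x : ∀ᵐ t, IsDx (φ t) (φx t)
  mem_t : MemL2g γ m φt
  mem_x : MemL2g γ m φx
  eqn : LinearizedEq μ φ₀ φ g

/-- The stability condition `μ - 2 ℍ[φ₀]ₓ ≥ δ/2` on `ℝ × 𝕋`. -/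
def StabilityCond (μ δ : ℝ) (φ₀ : ℝ → L2T) : Prop :=
  ∀ᵐ t, ∀ᵐ x : Torus, δ / 2 ≤ μ - 2 * dx (hilbertT (φ₀ t)) x

end

/-!
Put `v = e^{-γt} φₜ` and `w = e^{-γt} φₓ`. In terms of Fourier coefficients in space, the linearized
equation becomes the first-order system

  `wₖ' = i k vₖ - γ wₖ`,  `vₖ' = i k (μ wₖ - π⁻¹ ∑ⱼ κ(k,j) φ̂₀(k-j) wⱼ) + gₖ - γ vₖ`

for `k ≠ 0`, where `gₖ` are the coefficients of `e^{-γt} g` and the real kernel `κ = fluxKernel`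
collects the product and the two commutators of the flux (`hasSum_fcoef_linFlux`). Although the flux
contains second derivatives of `φ`, these cancel and `|κ(k,j)| ≤ |k-j|`. Moreover `k (|k-j| -
κ(k,j)) = O(|k-j|²)` (`abs_mul_sub_fluxKernel_le`): up to terms of order zero in `w`, the bracket is
`(μ - 2 ∂ₓ ℍ[φ₀]) w`. By the stability condition this multiplication is bounded below by `δ/2`, on
every space of trigonometric polynomials (`le_re_sum_conj_mul_princ`), so that `diag(1, μ - 2 ∂ₓ
ℍ[φ₀])` is a symmetrizer. The energy it defines grows at a rate controlled by the `H⁵` norm of `φ₀`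
and the `H²` norm of `φ₀ₜ`, and is absorbed by `γ` times the energy when `γ` is large. At the level
`m` the weights `(1+|k|)^m` are commuted with the flux: either at least two derivatives fall on the
state or all of them do (`abs_mul_kernel_sub_le`), whence an estimate that is tame in the state
(`energyRate_le`). In it the high norm of `φ₀` multiplies only the norm of level `1` of `w`, which
is bounded by `g` through the estimate of level `1`. This gives the bound with the norm of `g` in
`L²_γ(ℝ; H¹)` where the theorem has `L²_γ(ℝ; H²)`; so `m = 1` needs no separate treatment.

Existence. Truncate to the frequencies `0 < |k| ≤ N` and replace `∂ₜ` by a backward difference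
quotient. The backward difference is dissipative for the energy
(`IsSymmetrizer.le_integral_inner_sub`), so the discretized equation on the whole line is solvable
in `L²(ℝ)` by the Lax–Milgram lemma (`IsSymmetrizer.exists_backward_solution`), with bounds uniform
in the truncation and the step (`StateCoef.apriori_estimate`). A weak limit solves the system and
inherits the bounds (`StateCoef.exists_isCoefSol`). Averaging it with its reflection
`k ↦ -k` and complex conjugate gives the coefficients of real functions
(`IsCoefSol.exists_hermitian`).

Uniqueness. The truncation of a solution with `g = 0` satisfies the truncated system up to a
truncation error of the flux, which tends to `0` in `L²` since `w ∈ L²(ℝ; H¹)`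
(`norm_flux_sub_trFlux_le`). The energy inequality, applied with difference quotients that tend
weakly to the weak derivatives, shows that the solution vanishes (`IsCoefSol.ae_eq_zero`).

The equation in the sense of distributions is equivalent to the equations for the coefficients, by
Parseval's identity in one direction (`linearized_of_hasWeakDeriv`) and by testing with
`θ(t) Re (a e^{-ikx})` in the other (`hasWeakDeriv_of_linearized`).
-/

/-! ### Fourier series on the torus -/

/-- The Fourier coefficient `∫ F(x) e^{-ikx} dx` of a complex-valued function. -/
noncomputable def fcoefC (F : Torus → ℂ) (k : ℤ) : ℂ := ∫ x : Torus, fourier (-k) x * F x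

theorem fcoef_eq_fcoefC (f : Torus → ℝ) (k : ℤ) : fcoef f k = fcoefC (fun x => (f x : ℂ)) k := rfl

theorem fcoefC_eq_fourierCoeff (F : Torus → ℂ) (k : ℤ) :
    fcoefC F k = (2 * π : ℝ) * fourierCoeff F k := by
  have := Real.two_pi_pos
  rw [fourierCoeff, AddCircle.integral_haarAddCircle, Complex.real_smul, ← mul_assoc,
    ← Complex.ofReal_mul, mul_inv_cancel₀ this.ne']
  simp [fcoefC]

theorem fcoef_congr {f g : Torus → ℝ} (h : f =ᵐ[volume] g) (k : ℤ) : fcoef f k = fcoef g k := by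
  refine integral_congr_ae ?_
  filter_upwards [h] with x hx
  rw [hx]

theorem ae_volume_iff_ae_haar {p : Torus → Prop} :
    (∀ᵐ x ∂(volume : Measure Torus), p x) ↔
      ∀ᵐ x ∂(AddCircle.haarAddCircle : Measure Torus), p x := by
  rw [AddCircle.volume_eq_smul_haarAddCircle, Measure.ae_ennreal_smul_measure_iff]
  simpa using Real.pi_pos

/-- Parseval's identity for the pairing of two square-integrable functions. -/
theorem hasSum_fcoefC_mul {F G : Torus → ℂ} (hF : MemLp F 2 (volume : Measure Torus))
    (hG : MemLp G 2 (volume : Measure Torus)) :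
    HasSum (fun k => (starRingEnd ℂ) (fcoefC F k) * fcoefC G k)
      ((2 * π : ℝ) * ∫ x, (starRingEnd ℂ) (F x) * G x) := by
  have hpi := Real.two_pi_pos
  have h := fourierBasis.hasSum_inner_mul_inner hF.haarAddCircle.toLp hG.haarAddCircle.toLp
  have e1 : ∀ {H : Torus → ℂ} (hH : MemLp H 2 (volume : Measure Torus)) (k : ℤ),
      (inner ℂ (fourierBasis k) (hH.haarAddCircle.toLp H) : ℂ) = fourierCoeff H k := by
    intro H hH k
    rw [← fourierBasis.repr_apply_apply, fourierBasis_repr]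
    exact congrFun (fourierCoeff_congr_ae hH.haarAddCircle.coeFn_toLp) k
  have e2 : (inner ℂ (hF.haarAddCircle.toLp F) (hG.haarAddCircle.toLp G) : ℂ)
      = ((2 * π : ℝ) : ℂ)⁻¹ * ∫ x, (starRingEnd ℂ) (F x) * G x := by
    rw [L2.inner_def, ← Complex.ofReal_inv, ← Complex.real_smul, ← AddCircle.integral_haarAddCircle]
    refine integral_congr_ae ?_
    filter_upwards [hF.haarAddCircle.coeFn_toLp, hG.haarAddCircle.coeFn_toLp] with x h1 h2
    rw [h1, h2, RCLike.inner_apply']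
  rw [e2] at h
  have hne : ((2 * π : ℝ) : ℂ) ≠ 0 := Complex.ofReal_ne_zero.mpr hpi.ne'
  have h3 := h.mul_left (((2 * π : ℝ) : ℂ) ^ 2)
  rw [sq, mul_assoc, mul_inv_cancel_left₀ hne] at h3
  refine h3.congr_fun fun k => ?_
  rw [e1 hG, ← inner_conj_symm, e1 hF, fcoefC_eq_fourierCoeff, fcoefC_eq_fourierCoeff, map_mul,
    Complex.conj_ofReal]
  ring

theorem memLp_ofReal (f : L2T) : MemLp (fun x => (f x : ℂ)) 2 (volume : Measure Torus) :=
  (Lp.memLp f).ofReal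

/-- Parseval's identity for the pairing of real-valued functions. -/
theorem hasSum_fcoef_mul {f g : Torus → ℝ} (hf : MemLp f 2 (volume : Measure Torus))
    (hg : MemLp g 2 (volume : Measure Torus)) :
    HasSum (fun k => fcoef f k * (starRingEnd ℂ) (fcoef g k))
      ((2 * π * ∫ x, f x * g x : ℝ) : ℂ) := by
  have h := hasSum_fcoefC_mul (F := fun x => (g x : ℂ)) (G := fun x => (f x : ℂ))
    hg.ofReal hf.ofReal
  have e : ((2 * π : ℝ) : ℂ) * ∫ x, (starRingEnd ℂ) (g x : ℂ) * (f x : ℂ)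
      = ((2 * π * ∫ x, f x * g x : ℝ) : ℂ) := by
    rw [Complex.ofReal_mul (2 * π)]
    congr 1
    rw [← integral_complex_ofReal]
    refine integral_congr_ae (ae_of_all _ fun x => ?_)
    simp [mul_comm]
  rw [e] at h
  exact h.congr_fun fun k => mul_comm _ _

theorem hasSum_norm_fcoef_sq (f : L2T) :
    HasSum (fun k => ‖fcoef f k‖ ^ 2) (2 * π * ‖f‖ ^ 2) := by
  have h := hasSum_fcoef_mul (Lp.memLp f) (Lp.memLp f)
  have e : ∫ x, f x * f x = ‖f‖ ^ 2 := by
    rw [← real_inner_self_eq_norm_sq, L2.inner_def]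
    rfl
  rw [e] at h
  have h2 := Complex.hasSum_re h
  rw [Complex.ofReal_re] at h2
  refine h2.congr_fun fun k => ?_
  rw [Complex.mul_conj, Complex.normSq_eq_norm_sq, Complex.ofReal_re]

theorem integrable_fourier_mul (f : L2T) (k : ℤ) :
    Integrable (fun x : Torus => fourier k x * (f x : ℂ)) volume := by
  have := ((Lp.memLp f).integrable (by norm_num)).ofReal (𝕜 := ℂ)
  refine this.bdd_mul (c := 1) (map_continuous (fourier k)).aestronglyMeasurable ?_
  refine ae_of_all _ fun x => ?_
  rw [fourier_apply, Circle.norm_coe]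

theorem fcoef_add (f g : L2T) (k : ℤ) : fcoef (f + g : L2T) k = fcoef f k + fcoef g k := by
  rw [fcoef_congr (Lp.coeFn_add f g)]
  simp only [fcoef, Pi.add_apply, Complex.ofReal_add, mul_add]
  exact integral_add (integrable_fourier_mul f _) (integrable_fourier_mul g _)

theorem fcoef_smul (c : ℝ) (f : L2T) (k : ℤ) : fcoef (c • f : L2T) k = c * fcoef f k := by
  rw [fcoef_congr (Lp.coeFn_smul c f)]
  simp only [fcoef, Pi.smul_apply, smul_eq_mul, Complex.ofReal_mul]
  rw [← integral_const_mul]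
  congr 1
  ext x
  ring

theorem norm_fcoef_le (f : L2T) (k : ℤ) : ‖fcoef f k‖ ≤ √(2 * π) * ‖f‖ := by
  have h := (hasSum_norm_fcoef_sq f).summable.le_tsum k (fun _ _ => sq_nonneg _)
  rw [(hasSum_norm_fcoef_sq f).tsum_eq] at h
  have : ‖fcoef f k‖ ≤ √(2 * π * ‖f‖ ^ 2) := Real.le_sqrt_of_sq_le h
  rwa [Real.sqrt_mul (by positivity), Real.sqrt_sq (norm_nonneg _)] at this

/-- The `k`-th Fourier coefficient as a continuous functional on `L²(𝕋)`. -/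
noncomputable def fcoefL (k : ℤ) : L2T →L[ℝ] ℂ :=
  LinearMap.mkContinuous
    { toFun := fun f => fcoef f k
      map_add' := fun f g => fcoef_add f g k
      map_smul' := fun c f => by simpa using fcoef_smul c f k }
    (√(2 * π)) (fun f => norm_fcoef_le f k)

@[simp] theorem fcoefL_apply (k : ℤ) (f : L2T) : fcoefL k f = fcoef f k := rfl

theorem fcoef_sub (f g : L2T) (k : ℤ) : fcoef (f - g : L2T) k = fcoef f k - fcoef g k :=
  map_sub (fcoefL k) f g

theorem fcoef_neg_index (f : Torus → ℝ) (k : ℤ) :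
    fcoef f (-k) = (starRingEnd ℂ) (fcoef f k) := by
  rw [fcoef, fcoef, ← integral_conj]
  refine integral_congr_ae (ae_of_all _ fun x => ?_)
  simp only [map_mul, Complex.conj_ofReal, fourier_neg, neg_neg, Complex.conj_conj]

/-- An element of `L²(𝕋)` is determined by its Fourier coefficients. -/
theorem ext_of_fcoef {f g : L2T} (h : ∀ k, fcoef f k = fcoef g k) : f = g := by
  have h1 := hasSum_norm_fcoef_sq (f - g)
  simp only [fcoef_sub, h, sub_self, norm_zero] at h1
  have h2 := h1.unique (a₂ := 0) (by simp [hasSum_zero])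
  have := Real.two_pi_pos
  have h3 : ‖f - g‖ = 0 := by
    rcases mul_eq_zero.mp h2 with h | h
    · exact absurd h this.ne'
    · exact pow_eq_zero_iff (two_ne_zero) |>.mp h
  exact sub_eq_zero.mp (norm_eq_zero.mp h3)

theorem memLp_re_haar (F : Lp ℂ 2 (AddCircle.haarAddCircle : Measure Torus)) :
    MemLp (fun x => (F x).re) 2 (volume : Measure Torus) :=
  (Lp.memLp F).of_haarAddCircle.re

/-- The real part, as a continuous map from the complex space `L²` with respect to Haar
probability measure, where Mathlib's Fourier basis lives, to `L²(𝕋)`. -/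
noncomputable def reHaar : Lp ℂ 2 (AddCircle.haarAddCircle : Measure Torus) →L[ℝ] L2T :=
  LinearMap.mkContinuous
    { toFun := fun F => (memLp_re_haar F).toLp _
      map_add' := fun F G => by
        rw [← MemLp.toLp_add]
        refine MemLp.toLp_congr _ _ ?_
        filter_upwards [ae_volume_iff_ae_haar.mpr (Lp.coeFn_add F G)] with x hx
        simp only [hx, Pi.add_apply, Complex.add_re]
      map_smul' := fun c F => by
        rw [RingHom.id_apply, ← MemLp.toLp_const_smul]
        refine MemLp.toLp_congr _ _ ?_
        filter_upwards [ae_volume_iff_ae_haar.mpr (Lp.coeFn_smul c F)] with x hx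
        simp only [hx, Pi.smul_apply, Complex.real_smul, Complex.re_ofReal_mul, smul_eq_mul] }
    (√(2 * π)) (fun F => by
      have hp := Real.two_pi_pos
      refine Real.le_sqrt_of_sq_le (y := 2 * π * ‖F‖ ^ 2) ?_ |>.trans_eq ?_
      · simp only [LinearMap.coe_mk, AddHom.coe_mk]
        have e1 : ‖(memLp_re_haar F).toLp _‖ ^ 2 = ∫ x, (F x).re ^ 2 := by
          rw [← real_inner_self_eq_norm_sq, L2.inner_def]
          refine integral_congr_ae ?_
          filter_upwards [(memLp_re_haar F).coeFn_toLp] with x hx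
          rw [hx]; simp [sq]
        have e2 : ‖F‖ ^ 2 = ∫ x, ‖F x‖ ^ 2 ∂AddCircle.haarAddCircle := by
          rw [← tsum_sq_fourierCoeff]
          simp_rw [← fourierBasis_repr]
          have H₁ : HasSum (fun i => ‖fourierBasis.repr F i‖ ^ 2) (‖fourierBasis.repr F‖ ^ 2) := by
            apply_mod_cast lp.hasSum_norm ?_ (fourierBasis.repr F)
            simp
          rw [H₁.tsum_eq]; simp
        rw [e1, e2, AddCircle.integral_haarAddCircle, smul_eq_mul, ← mul_assoc,
          mul_inv_cancel₀ hp.ne', one_mul]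
        refine integral_mono_of_nonneg (ae_of_all _ fun x => sq_nonneg _) ?_
          (ae_of_all _ fun x => ?_)
        · exact (Lp.memLp F).of_haarAddCircle.integrable_norm_pow (by norm_num)
        · simp only
          rw [← sq_abs]
          exact pow_le_pow_left₀ (abs_nonneg _) (Complex.abs_re_le_norm _) 2
      · rw [Real.sqrt_mul hp.le, Real.sqrt_sq (norm_nonneg _)])

theorem reHaar_ae (F : Lp ℂ 2 (AddCircle.haarAddCircle : Measure Torus)) :
    reHaar F =ᵐ[volume] fun x => (F x).re := (memLp_re_haar F).coeFn_toLp

theorem reHaar_toLp (f : L2T) : reHaar ((memLp_ofReal f).haarAddCircle.toLp _) = f := by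
  refine Lp.ext ?_
  filter_upwards [reHaar_ae ((memLp_ofReal f).haarAddCircle.toLp _),
    ae_volume_iff_ae_haar.mpr (memLp_ofReal f).haarAddCircle.coeFn_toLp] with x h1 h2
  rw [h1, h2, Complex.ofReal_re]

/-- The Fourier series of `f ∈ L²(𝕋)` converges to `f` in `L²(𝕋)`. -/
theorem hasSum_reHaar (f : L2T) :
    HasSum (fun k : ℤ => reHaar (((2 * π : ℝ) : ℂ)⁻¹ • fcoef f k • fourierLp (T := 2 * π) 2 k))
      f := by
  have h := hasSum_fourier_series_L2 ((memLp_ofReal f).haarAddCircle.toLp _)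
  have h2 := reHaar.hasSum h
  rw [reHaar_toLp] at h2
  refine h2.congr_fun fun k => ?_
  rw [congrFun (fourierCoeff_congr_ae (memLp_ofReal f).haarAddCircle.coeFn_toLp) k, fcoef_eq_fcoefC,
    fcoefC_eq_fourierCoeff, ← smul_assoc, smul_eq_mul, ← mul_assoc, inv_mul_cancel₀, one_mul]
  exact Complex.ofReal_ne_zero.mpr Real.two_pi_pos.ne'

theorem aestronglyMeasurable_of_fcoef {α : Type*} [MeasurableSpace α] {ν : Measure α} {u : α → L2T}
    (h : ∀ k, AEStronglyMeasurable (fun t => fcoef (u t) k) ν) : AEStronglyMeasurable u ν := by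
  refine aestronglyMeasurable_of_tendsto_ae (u := Filter.atTop)
    (f := fun (s : Finset ℤ) t =>
      ∑ k ∈ s, reHaar (((2 * π : ℝ) : ℂ)⁻¹ • fcoef (u t) k • fourierLp (T := 2 * π) 2 k))
    (fun s => ?_) (ae_of_all _ fun t => hasSum_reHaar (u t))
  refine Finset.aestronglyMeasurable_fun_sum s fun k _ => ?_
  refine reHaar.continuous.comp_aestronglyMeasurable ?_
  exact ((h k).smul_const (fourierLp (T := 2 * π) 2 k)).const_smul (((2 * π : ℝ) : ℂ)⁻¹)

theorem aestronglyMeasurable_fcoef {α : Type*} [MeasurableSpace α] {ν : Measure α} {u : α → L2T}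
    (h : AEStronglyMeasurable u ν) (k : ℤ) : AEStronglyMeasurable (fun t => fcoef (u t) k) ν :=
  (fcoefL k).continuous.comp_aestronglyMeasurable h

/-- The Riesz–Fischer theorem for real-valued functions. -/
theorem exists_fcoef_eq {c : ℤ → ℂ} (hc : ∀ k, c (-k) = (starRingEnd ℂ) (c k))
    (hs : Summable fun k => ‖c k‖ ^ 2) : ∃ u : L2T, ∀ k, fcoef u k = c k := by
  have hmem : Memℓp c 2 := by
    rw [memℓp_gen_iff (by norm_num)]
    simpa using hs
  set F := (fourierBasis (T := 2 * π)).repr.symm (⟨c, hmem⟩ : lp (fun _ : ℤ => ℂ) 2) with hF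
  have hFc : ∀ k, fourierCoeff F k = c k := by
    intro k
    rw [← fourierBasis_repr, hF, LinearIsometryEquiv.apply_symm_apply]
  have hFm := (Lp.memLp F).of_haarAddCircle
  refine ⟨(2 * π)⁻¹ • reHaar F, fun k => ?_⟩
  have hFi := hFm.integrable (by norm_num : (1:ℝ≥0∞) ≤ 2)
  have hi : ∀ k : ℤ, Integrable (fun x : Torus => fourier k x * F x) volume := fun k => by
    refine hFi.bdd_mul (c := 1) (map_continuous (fourier k)).aestronglyMeasurable ?_
    refine ae_of_all _ fun x => ?_
    rw [fourier_apply, Circle.norm_coe]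
  have e1 : fcoef (reHaar F) k = (fcoefC F k + (starRingEnd ℂ) (fcoefC F (-k))) / 2 := by
    rw [fcoef_congr (reHaar_ae F), fcoef, fcoefC, fcoefC, ← integral_conj, neg_neg,
      ← integral_add (hi _), ← integral_div]
    · refine integral_congr_ae (ae_of_all _ fun x => ?_)
      simp only [map_mul, ← fourier_neg]
      rw [Complex.re_eq_add_conj]
      ring
    · exact (Complex.conjCLE.toContinuousLinearMap.integrable_comp (hi k))
  rw [fcoef_smul, e1, fcoefC_eq_fourierCoeff, fcoefC_eq_fourierCoeff, hFc, hFc, hc, map_mul,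
    Complex.conj_conj, Complex.conj_ofReal]
  have hne : (π : ℂ) ≠ 0 := Complex.ofReal_ne_zero.mpr Real.pi_pos.ne'
  push_cast
  field_simp
  ring

theorem fcoef_fourierMultiplier {A : ℤ → ℂ} {f : L2T}
    (hA : ∀ k, A (-k) = (starRingEnd ℂ) (A k)) (hs : Summable fun k => ‖A k * fcoef f k‖ ^ 2)
    (k : ℤ) : fcoef (fourierMultiplier A f) k = A k * fcoef f k := by
  have h : ∃ u : L2T, ∀ k, fcoef u k = A k * fcoef f k :=
    exists_fcoef_eq (fun k => by rw [hA, fcoef_neg_index, map_mul]) hs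
  rw [fourierMultiplier, dif_pos h]
  exact h.choose_spec k

theorem fcoef_hilbertT (f : L2T) (k : ℤ) :
    fcoef (hilbertT f) k = -Complex.I * (Int.sign k : ℂ) * fcoef f k := by
  refine fcoef_fourierMultiplier (fun k => ?_) ?_ k
  · simp
  · refine Summable.of_nonneg_of_le (fun _ => sq_nonneg _) (fun k => ?_)
      (hasSum_norm_fcoef_sq f).summable
    refine pow_le_pow_left₀ (norm_nonneg _) ?_ 2
    rw [norm_mul, norm_mul, norm_neg, Complex.norm_I, one_mul]
    refine mul_le_of_le_one_left (norm_nonneg _) ?_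
    rcases lt_trichotomy k 0 with h | h | h
    · simp [Int.sign_eq_neg_one_of_neg h]
    · simp [h]
    · simp [Int.sign_eq_one_of_pos h]

theorem fcoef_dx {f : L2T} (hs : Summable fun k : ℤ => (k : ℝ) ^ 2 * ‖fcoef f k‖ ^ 2) (k : ℤ) :
    fcoef (dx f) k = Complex.I * k * fcoef f k := by
  refine fcoef_fourierMultiplier (fun k => ?_) ?_ k
  · simp
  · refine hs.congr fun k => ?_
    simp [mul_pow]

/-- A function with absolutely summable Fourier coefficients is essentially bounded. -/
theorem ae_bound_of_summable_fcoef {f : L2T} (hs : Summable fun k => ‖fcoef f k‖) :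
    ∃ C : ℝ, ∀ᵐ x : Torus, ‖f x‖ ≤ C := by
  set a : ℤ → C(Torus, ℂ) := fun k => (((2 * π : ℝ) : ℂ)⁻¹ * fcoef f k) • fourier k with ha
  have hsum : Summable a := by
    refine Summable.of_norm ?_
    simp only [ha, norm_smul, fourier_norm, mul_one, norm_mul]
    exact hs.mul_left _
  set Φ : C(Torus, ℂ) := ∑' k, a k
  have h1 : HasSum (fun k => ContinuousMap.toLp (E := ℂ) 2 AddCircle.haarAddCircle ℂ (a k))
      (ContinuousMap.toLp (E := ℂ) 2 AddCircle.haarAddCircle ℂ Φ) :=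
    (ContinuousMap.toLp (E := ℂ) 2 AddCircle.haarAddCircle ℂ).hasSum hsum.hasSum
  have h2 := hasSum_fourier_series_L2 ((memLp_ofReal f).haarAddCircle.toLp _)
  have h3 : ContinuousMap.toLp (E := ℂ) 2 AddCircle.haarAddCircle ℂ Φ
      = (memLp_ofReal f).haarAddCircle.toLp _ := by
    refine h1.unique ?_
    refine h2.congr_fun fun k => ?_
    rw [congrFun (fourierCoeff_congr_ae (memLp_ofReal f).haarAddCircle.coeFn_toLp) k, ha]
    simp only [map_smul]
    rw [fcoef_eq_fcoefC, fcoefC_eq_fourierCoeff, ← mul_assoc, inv_mul_cancel₀, one_mul]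
    exact Complex.ofReal_ne_zero.mpr Real.two_pi_pos.ne'
  refine ⟨‖Φ‖, ?_⟩
  rw [ae_volume_iff_ae_haar]
  filter_upwards [ContinuousMap.coeFn_toLp (𝕜 := ℂ) (p := 2) (E := ℂ)
    (AddCircle.haarAddCircle : Measure Torus) Φ, (memLp_ofReal f).haarAddCircle.coeFn_toLp]
    with x hx1 hx2
  rw [h3, hx2] at hx1
  rw [← Complex.norm_real, hx1]
  exact Φ.norm_coe_le_norm x

/-- The Fourier coefficients of a product are the convolution of those of the factors. -/
theorem hasSum_fcoef_mulL2 {f g : L2T} (hs : Summable fun k => ‖fcoef f k‖) (k : ℤ) :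
    HasSum (fun j => fcoef f (k - j) * fcoef g j) ((2 * π : ℝ) * fcoef (mulL2 f g) k) := by
  obtain ⟨C, hC⟩ := ae_bound_of_summable_fcoef hs
  have hm : MemLp (fun x => f x * g x) 2 (volume : Measure Torus) := by
    refine MemLp.of_le_mul (c := C) (Lp.memLp g)
      ((Lp.aestronglyMeasurable f).mul (Lp.aestronglyMeasurable g)) ?_
    filter_upwards [hC] with x hx
    rw [norm_mul]
    exact mul_le_mul_of_nonneg_right hx (norm_nonneg _)
  have hF : MemLp (fun x : Torus => fourier k x * (f x : ℂ)) 2 volume := by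
    refine (memLp_ofReal f).of_le ?_ (ae_of_all _ fun x => ?_)
    · exact (map_continuous (fourier k)).aestronglyMeasurable.mul
        (memLp_ofReal f).aestronglyMeasurable
    · rw [norm_mul, fourier_apply, Circle.norm_coe, one_mul]
  have h := hasSum_fcoefC_mul hF (memLp_ofReal g)
  convert h using 1
  · ext j
    congr 1
    rw [fcoef, fcoefC, ← integral_conj]
    refine integral_congr_ae (ae_of_all _ fun x => ?_)
    simp only [map_mul, ← fourier_neg, neg_neg, Complex.conj_ofReal]
    rw [← mul_assoc, ← fourier_add]
    congr 2
    ring_nf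
  · congr 1
    rw [mulL2, dif_pos hm, fcoef_congr hm.coeFn_toLp, fcoef]
    refine integral_congr_ae (ae_of_all _ fun x => ?_)
    simp only [map_mul, ← fourier_neg, Complex.conj_ofReal, Complex.ofReal_mul]
    ring

/-! ### The linearized flux in Fourier variables -/

/-- The weight `1 + |k|` defining the Sobolev norms. -/
noncomputable def wt (k : ℤ) : ℝ := 1 + |(k : ℝ)|

theorem one_le_wt (k : ℤ) : 1 ≤ wt k := le_add_of_nonneg_right (abs_nonneg _)

theorem wt_pos (k : ℤ) : 0 < wt k := zero_lt_one.trans_le (one_le_wt k)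

theorem abs_le_wt (k : ℤ) : |(k : ℝ)| ≤ wt k := by simp [wt]

@[simp] theorem wt_neg (k : ℤ) : wt (-k) = wt k := by simp [wt]

theorem summable_wt_inv_sq : Summable fun k : ℤ => (wt k ^ 2)⁻¹ := by
  have h := Real.summable_one_div_int_pow (p := 2) |>.mpr (by norm_num)
  refine Summable.of_norm_bounded_eventually (g := fun k : ℤ => 1 / (k : ℝ) ^ 2) h ?_
  filter_upwards [Filter.eventually_cofinite_ne (0 : ℤ)] with k hk
  have : (0 : ℝ) < |(k : ℝ)| := by positivity
  rw [Real.norm_of_nonneg (by positivity), one_div, ← sq_abs (k : ℝ)]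
  exact inv_anti₀ (by positivity) (pow_le_pow_left₀ this.le (abs_le_wt k) 2)

/-- The sum `∑ (1+|k|)⁻²`, the constant of the embedding of `H¹` into the Wiener algebra. -/
noncomputable def wtSum : ℝ := ∑' k : ℤ, (wt k ^ 2)⁻¹

theorem wtSum_nonneg : 0 ≤ wtSum := tsum_nonneg fun k => by have := wt_pos k; positivity

theorem le_wt_sq_mul_sq (k : ℤ) (a : ℝ) : a ≤ (wt k ^ 2 * a ^ 2 + (wt k ^ 2)⁻¹) / 2 := by
  have h := wt_pos k
  have e : (wt k ^ 2)⁻¹ = (wt k)⁻¹ ^ 2 := by rw [inv_pow]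
  have e2 : a = wt k * a * (wt k)⁻¹ := by field_simp
  rw [e]
  nlinarith [sq_nonneg (wt k * a - (wt k)⁻¹)]

theorem summable_norm_of_wt {a : ℤ → ℂ} (h : Summable fun k => wt k ^ 2 * ‖a k‖ ^ 2) :
    Summable fun k => ‖a k‖ :=
  Summable.of_nonneg_of_le (fun _ => norm_nonneg _) (fun k => le_wt_sq_mul_sq k _)
    ((h.add summable_wt_inv_sq).div_const 2)

theorem norm_sign_le (k : ℤ) : ‖(Int.sign k : ℂ)‖ ≤ 1 := by
  rcases lt_trichotomy k 0 with h | h | h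
  · simp [Int.sign_eq_neg_one_of_neg h]
  · simp [h]
  · simp [Int.sign_eq_one_of_pos h]

/-- The kernel of the linearized flux: the flux of `φ` at the state `φ₀` has the Fourier
coefficients `-π⁻¹ ∑ⱼ fluxKernel k j · φ̂₀(k-j) · (ij φ̂(j))`. It is
`sgn k · sgn j · |k| |k-j| / max(|k|, |j|, |k-j|)`. -/
noncomputable def fluxKernel (k j : ℤ) : ℝ :=
  if k * j < 0 then -|(k : ℝ)| else |((k - j : ℤ) : ℝ)| * min |(k : ℝ)| |(j : ℝ)| / |(j : ℝ)|

/-- The three terms of the flux, the product and the two commutators, add up to a single bilinear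
operator with the kernel `fluxKernel`. The second derivatives cancel: the symbol is bounded by `|k -
j| |j|`. -/
theorem fluxKernel_identity (k j : ℤ) :
    -2 * (k.sign : ℝ) * ((k - j : ℤ) * (k - j).sign) * (j * j.sign)
      + j.sign * ((k - j : ℤ) ^ 2 * (k - j).sign) * ((k - j).sign - k.sign)
      + (k - j).sign * (j ^ 2 * j.sign) * (j.sign - k.sign) = -2 * fluxKernel k j * j := by
  obtain ⟨n, rfl⟩ : ∃ n, k = n + j := ⟨k - j, by ring⟩
  simp only [add_sub_cancel_right]
  rcases lt_trichotomy j 0 with hj | rfl | hj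
  · have hj' : (j : ℝ) < 0 := by exact_mod_cast hj
    rcases lt_trichotomy n 0 with hn | rfl | hn
    · have hn' : (n : ℝ) < 0 := by exact_mod_cast hn
      have h1 : ¬ (n + j) * j < 0 := by nlinarith
      have h2 : |(j : ℝ)| ≤ |((n + j : ℤ) : ℝ)| := by
        push_cast; rw [abs_of_neg hj', abs_of_neg (by linarith)]; linarith
      rw [fluxKernel, if_neg h1, min_eq_right h2, Int.sign_eq_neg_one_of_neg hj,
        Int.sign_eq_neg_one_of_neg hn, Int.sign_eq_neg_one_of_neg (show n + j < 0 by linarith),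
        add_sub_cancel_right, mul_div_assoc, div_self (abs_pos.mpr hj'.ne).ne', abs_of_neg hn']
      push_cast; ring
    · have h1 : ¬ (0 + j) * j < 0 := by nlinarith
      rw [fluxKernel, if_neg h1]; simp
    · have hn' : (0 : ℝ) < n := by exact_mod_cast hn
      rcases lt_trichotomy (n + j) 0 with hk | hk | hk
      · have hk' : (n : ℝ) + j < 0 := by exact_mod_cast hk
        have h1 : ¬ (n + j) * j < 0 := by nlinarith
        have h2 : |((n + j : ℤ) : ℝ)| ≤ |(j : ℝ)| := by
          push_cast; rw [abs_of_neg hj', abs_of_neg (by linarith)]; linarith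
        rw [fluxKernel, if_neg h1, min_eq_left h2, Int.sign_eq_neg_one_of_neg hj,
          Int.sign_eq_one_of_pos hn, Int.sign_eq_neg_one_of_neg hk, add_sub_cancel_right,
          abs_of_pos hn', abs_of_neg hj']
        have hj0 : (j : ℝ) ≠ 0 := hj'.ne
        push_cast; rw [abs_of_neg hk']; field_simp; ring
      · have hk' : (n : ℝ) + j = 0 := by exact_mod_cast hk
        have h1 : ¬ (n + j) * j < 0 := by rw [hk]; simp
        rw [fluxKernel, if_neg h1, hk, Int.sign_eq_neg_one_of_neg hj, Int.sign_eq_one_of_pos hn]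
        have : (n : ℝ) = -j := by linarith
        simp [this]
      · have hk' : 0 < (n : ℝ) + j := by exact_mod_cast hk
        have h1 : (n + j) * j < 0 := by nlinarith
        rw [fluxKernel, if_pos h1, Int.sign_eq_neg_one_of_neg hj,
          Int.sign_eq_one_of_pos hn, Int.sign_eq_one_of_pos hk]
        push_cast; rw [abs_of_pos hk']; ring
  · simp [fluxKernel]
  · have hj' : (0 : ℝ) < j := by exact_mod_cast hj
    rcases lt_trichotomy n 0 with hn | rfl | hn
    · have hn' : (n : ℝ) < 0 := by exact_mod_cast hn
      rcases lt_trichotomy (n + j) 0 with hk | hk | hk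
      · have hk' : (n : ℝ) + j < 0 := by exact_mod_cast hk
        have h1 : (n + j) * j < 0 := by nlinarith
        rw [fluxKernel, if_pos h1, Int.sign_eq_one_of_pos hj,
          Int.sign_eq_neg_one_of_neg hn, Int.sign_eq_neg_one_of_neg hk]
        push_cast; rw [abs_of_neg hk']; ring
      · have hk' : (n : ℝ) + j = 0 := by exact_mod_cast hk
        have h1 : ¬ (n + j) * j < 0 := by rw [hk]; simp
        rw [fluxKernel, if_neg h1, hk, Int.sign_eq_one_of_pos hj, Int.sign_eq_neg_one_of_neg hn]
        have : (n : ℝ) = -j := by linarith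
        simp [this]
      · have hk' : 0 < (n : ℝ) + j := by exact_mod_cast hk
        have h1 : ¬ (n + j) * j < 0 := by nlinarith
        have h2 : |((n + j : ℤ) : ℝ)| ≤ |(j : ℝ)| := by
          push_cast; rw [abs_of_pos hj', abs_of_pos (by linarith)]; linarith
        rw [fluxKernel, if_neg h1, min_eq_left h2, Int.sign_eq_one_of_pos hj,
          Int.sign_eq_neg_one_of_neg hn, Int.sign_eq_one_of_pos hk, add_sub_cancel_right,
          abs_of_neg hn', abs_of_pos hj']
        push_cast; rw [abs_of_pos hk']; field_simp; ring
    · have h1 : ¬ (0 + j) * j < 0 := by nlinarith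
      rw [fluxKernel, if_neg h1]; simp
    · have hn' : (0 : ℝ) < n := by exact_mod_cast hn
      have h1 : ¬ (n + j) * j < 0 := by nlinarith
      have h2 : |(j : ℝ)| ≤ |((n + j : ℤ) : ℝ)| := by
        push_cast; rw [abs_of_pos hj', abs_of_pos (by linarith)]; linarith
      rw [fluxKernel, if_neg h1, min_eq_right h2, Int.sign_eq_one_of_pos hj,
        Int.sign_eq_one_of_pos hn, Int.sign_eq_one_of_pos (show 0 < n + j by linarith),
        add_sub_cancel_right, mul_div_assoc, div_self (abs_pos.mpr hj'.ne').ne', abs_of_pos hn']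
      push_cast; ring

theorem abs_fluxKernel_le (k j : ℤ) : |fluxKernel k j| ≤ |((k - j : ℤ) : ℝ)| := by
  rw [fluxKernel]
  split_ifs with h
  · rw [abs_neg, abs_abs]
    have : |k| ≤ |k - j| := by
      rcases mul_neg_iff.mp h with ⟨h1, h2⟩ | ⟨h1, h2⟩
      · rw [abs_of_pos h1, abs_of_pos (by linarith)]; linarith
      · rw [abs_of_neg h1, abs_of_neg (by linarith)]; linarith
    exact_mod_cast this
  · rw [abs_of_nonneg (by positivity), mul_div_assoc]
    exact mul_le_of_le_one_right (abs_nonneg _)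
      (div_le_one_of_le₀ (min_le_right _ _) (abs_nonneg _))

/-- Up to a factor controlled by two derivatives of the state, the flux kernel is that of the
multiplication by `∂ₓ ℍ[φ₀]`, whose Fourier coefficients are `|n| φ̂₀(n)`. -/
theorem abs_mul_sub_fluxKernel_le (k : ℤ) {j : ℤ} (hj : j ≠ 0) :
    |(k : ℝ)| * |(|((k - j : ℤ) : ℝ)| - fluxKernel k j)| ≤ 2 * ((k - j : ℤ) : ℝ) ^ 2 := by
  have hj0 : 0 < |(j : ℝ)| := by positivity
  rw [← sq_abs ((k - j : ℤ) : ℝ), fluxKernel]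
  have tri : |(k : ℝ)| ≤ |((k - j : ℤ) : ℝ)| + |(j : ℝ)| := by
    have := abs_add_le ((k - j : ℤ) : ℝ) j
    push_cast at this ⊢
    simpa using this
  have hn := abs_nonneg ((k - j : ℤ) : ℝ)
  have hk := abs_nonneg (k : ℝ)
  split_ifs with h
  · have h1 : |k| ≤ |k - j| := by
      rcases mul_neg_iff.mp h with ⟨h1, h2⟩ | ⟨h1, h2⟩
      · rw [abs_of_pos h1, abs_of_pos (by linarith)]; linarith
      · rw [abs_of_neg h1, abs_of_neg (by linarith)]; linarith
    have h2 : |(k : ℝ)| ≤ |((k - j : ℤ) : ℝ)| := by exact_mod_cast h1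
    rw [sub_neg_eq_add, abs_of_nonneg (add_nonneg hn hk)]
    nlinarith
  · rcases le_total |(j : ℝ)| |(k : ℝ)| with h1 | h1
    · rw [min_eq_right h1, mul_div_assoc, div_self hj0.ne', mul_one, sub_self, abs_zero, mul_zero]
      positivity
    · have h2 : |(j : ℝ)| - |(k : ℝ)| ≤ |((k - j : ℤ) : ℝ)| := by
        have := abs_sub_abs_le_abs_sub (j : ℝ) k
        rw [abs_sub_comm] at this
        push_cast
        exact this
      rw [min_eq_left h1]
      have e : |((k - j : ℤ) : ℝ)| - |((k - j : ℤ) : ℝ)| * |(k : ℝ)| / |(j : ℝ)|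
          = |((k - j : ℤ) : ℝ)| * (|(j : ℝ)| - |(k : ℝ)|) / |(j : ℝ)| := by
        field_simp
      rw [e, abs_of_nonneg (div_nonneg (mul_nonneg hn (sub_nonneg.mpr h1)) hj0.le), ← mul_div_assoc,
        div_le_iff₀ hj0]
      have h3 : |(k : ℝ)| * (|((k - j : ℤ) : ℝ)| * (|(j : ℝ)| - |(k : ℝ)|))
          ≤ |(j : ℝ)| * (|((k - j : ℤ) : ℝ)| * |((k - j : ℤ) : ℝ)|) := by
        refine mul_le_mul h1 (mul_le_mul_of_nonneg_left h2 hn) ?_ hj0.le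
        exact mul_nonneg hn (sub_nonneg.mpr h1)
      nlinarith [mul_nonneg hj0.le (mul_nonneg hn hn)]

section Flux

variable {f : L2T}

theorem fcoef_dx_hilbertT (hf : Summable fun k => wt k ^ 2 * ‖fcoef f k‖ ^ 2) (k : ℤ) :
    fcoef (dx (hilbertT f)) k = (k * k.sign : ℂ) * fcoef f k := by
  rw [fcoef_dx, fcoef_hilbertT]
  · linear_combination (-(k * k.sign : ℂ) * fcoef f k) * Complex.I_sq
  · refine Summable.of_nonneg_of_le (fun k => by positivity) (fun k => ?_) hf
    rw [← sq_abs]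
    refine mul_le_mul (pow_le_pow_left₀ (abs_nonneg _) (abs_le_wt k) 2) ?_ (sq_nonneg _)
      (sq_nonneg _)
    refine pow_le_pow_left₀ (norm_nonneg _) ?_ 2
    rw [fcoef_hilbertT, norm_mul, norm_mul, norm_neg, Complex.norm_I, one_mul]
    exact mul_le_of_le_one_left (norm_nonneg _) (norm_sign_le k)

theorem norm_mul_sign_le (k : ℤ) : ‖(k * k.sign : ℂ)‖ ≤ wt k := by
  rw [norm_mul, Complex.norm_intCast]
  exact (mul_le_of_le_one_right (abs_nonneg _) (norm_sign_le k)).trans (abs_le_wt k)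

theorem summable_wt_of_le {a : ℤ → ℂ} {p q : ℕ} (hpq : p ≤ q)
    (h : Summable fun k => wt k ^ q * ‖a k‖ ^ 2) : Summable fun k => wt k ^ p * ‖a k‖ ^ 2 :=
  Summable.of_nonneg_of_le (fun k => by have := wt_pos k; positivity)
    (fun k => mul_le_mul_of_nonneg_right (pow_le_pow_right₀ (one_le_wt k) hpq) (sq_nonneg _)) h

theorem fcoef_dx_dx_hilbertT (hf : Summable fun k => wt k ^ 4 * ‖fcoef f k‖ ^ 2) (k : ℤ) :
    fcoef (dx (dx (hilbertT f))) k = Complex.I * (k ^ 2 * k.sign : ℂ) * fcoef f k := by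
  have h2 := summable_wt_of_le (p := 2) (by norm_num) hf
  rw [fcoef_dx, fcoef_dx_hilbertT h2]
  · ring
  · refine Summable.of_nonneg_of_le (fun k => by positivity) (fun k => ?_) hf
    rw [fcoef_dx_hilbertT h2, norm_mul, mul_pow, ← mul_assoc, ← sq_abs]
    refine mul_le_mul_of_nonneg_right ?_ (sq_nonneg _)
    calc |(k : ℝ)| ^ 2 * ‖(k * k.sign : ℂ)‖ ^ 2 ≤ wt k ^ 2 * wt k ^ 2 := by
          gcongr
          · exact abs_le_wt k
          · exact norm_mul_sign_le k
      _ = wt k ^ 4 := by ring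

/-- The Fourier coefficients of the commutator `[h ; ℍ] u`. -/
theorem hasSum_fcoef_commH {h u : L2T} (hs : Summable fun k => ‖fcoef h k‖) (k : ℤ) :
    HasSum (fun j => fcoef h (k - j) * fcoef u j * (-Complex.I * (j.sign - k.sign : ℂ)))
      ((2 * π : ℝ) * fcoef (commH h u) k) := by
  have h1 := hasSum_fcoef_mulL2 (g := hilbertT u) hs k
  have h2 := (hasSum_fcoef_mulL2 (g := u) hs k).mul_left (-Complex.I * (k.sign : ℂ))
  have h3 := h1.sub h2
  have e : ((2 * π : ℝ) : ℂ) * fcoef (commH h u) k = (2 * π : ℝ) * fcoef (mulL2 h (hilbertT u)) k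
      - -Complex.I * (k.sign : ℂ) * ((2 * π : ℝ) * fcoef (mulL2 h u) k) := by
    rw [commH, fcoef_sub, fcoef_hilbertT]
    ring
  rw [e]
  refine h3.congr_fun fun j => ?_
  rw [fcoef_hilbertT]
  ring

theorem summable_norm_fcoef_hilbertT (hf : Summable fun k => ‖fcoef f k‖) :
    Summable fun k => ‖fcoef (hilbertT f) k‖ := by
  refine Summable.of_nonneg_of_le (fun _ => norm_nonneg _) (fun k => ?_) hf
  rw [fcoef_hilbertT, norm_mul, norm_mul, norm_neg, Complex.norm_I, one_mul]
  exact mul_le_of_le_one_left (norm_nonneg _) (norm_sign_le k)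

/-- The Fourier coefficients of the linearized flux. -/
theorem hasSum_fcoef_linFlux {f₀ f : L2T} (h₀ : Summable fun k => wt k ^ 4 * ‖fcoef f₀ k‖ ^ 2)
    (hf : Summable fun k => wt k ^ 4 * ‖fcoef f k‖ ^ 2) (k : ℤ) :
    HasSum (fun j => (fluxKernel k j : ℂ) * fcoef f₀ (k - j) * (Complex.I * j * fcoef f j))
      (-(π : ℂ) * fcoef (linFlux f₀ f) k) := by
  have h₀2 := summable_wt_of_le (p := 2) (by norm_num) h₀
  have hf2 := summable_wt_of_le (p := 2) (by norm_num) hf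
  have s1 : Summable fun k => ‖fcoef (dx (hilbertT f₀)) k‖ := by
    refine summable_norm_of_wt (Summable.of_nonneg_of_le (fun k => by positivity) (fun k => ?_) h₀)
    rw [fcoef_dx_hilbertT h₀2, norm_mul, mul_pow, ← mul_assoc]
    refine mul_le_mul_of_nonneg_right ?_ (sq_nonneg _)
    calc wt k ^ 2 * ‖(k * k.sign : ℂ)‖ ^ 2 ≤ wt k ^ 2 * wt k ^ 2 := by
          gcongr
          exact norm_mul_sign_le k
      _ = wt k ^ 4 := by ring
  have t1 := (hasSum_fcoef_mulL2 (g := dx (hilbertT f)) s1 k).mul_left (2 * (-Complex.I * k.sign))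
  have t2 := (hasSum_fcoef_commH (u := dx (dx (hilbertT f₀)))
    (summable_norm_fcoef_hilbertT (summable_norm_of_wt hf2)) k)
  have t3 := (hasSum_fcoef_commH (u := dx (dx (hilbertT f)))
    (summable_norm_fcoef_hilbertT (summable_norm_of_wt h₀2)) k)
  -- the commutator with `φ` in front has the roles of `j` and `k - j` exchanged
  rw [← (Equiv.subLeft k).hasSum_iff] at t2
  have t := ((t1.sub t2).sub t3).mul_left (-1 / 2 : ℂ)
  have e : (-(π : ℂ) * fcoef (linFlux f₀ f) k) = (-1 / 2 : ℂ) * (2 * (-Complex.I * k.sign)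
      * ((2 * π : ℝ) * fcoef (mulL2 (dx (hilbertT f₀)) (dx (hilbertT f))) k)
      - (2 * π : ℝ) * fcoef (commH (hilbertT f) (dx (dx (hilbertT f₀)))) k
      - (2 * π : ℝ) * fcoef (commH (hilbertT f₀) (dx (dx (hilbertT f)))) k) := by
    rw [linFlux, fcoef_sub, fcoef_sub, fcoef_smul, fcoef_hilbertT]
    push_cast
    ring
  rw [e]
  refine t.congr_fun fun j => ?_
  simp only [Function.comp, Equiv.subLeft_apply, sub_sub_cancel]
  rw [fcoef_dx_hilbertT h₀2, fcoef_dx_hilbertT hf2, fcoef_dx_dx_hilbertT h₀,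
    fcoef_dx_dx_hilbertT hf, fcoef_hilbertT, fcoef_hilbertT]
  have K : ((_ : ℝ) : ℂ) = _ := congrArg Complex.ofReal (fluxKernel_identity k j)
  push_cast at K ⊢
  linear_combination (1 / 2 * Complex.I * fcoef f₀ (k - j) * fcoef f j) * K
    - (1 / 2 * Complex.I * fcoef f₀ (k - j) * fcoef f j) *
      (j.sign * ((k - j : ℂ) ^ 2 * (k - j).sign) * ((k - j).sign - k.sign)
      + (k - j).sign * (j ^ 2 * j.sign) * (j.sign - k.sign)) * Complex.I_sq

end Flux

/-! ### Energy identities for the truncated system at a fixed time -/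

/-- The multiplication by `μ - 2 ∂ₓ ℍ[φ₀]`, truncated to the frequencies in `K`; here `c` stands
for the Fourier coefficients of `φ₀`. -/
noncomputable def princ (μ : ℝ) (c : ℤ → ℂ) (K : Finset ℤ) (x : ℤ → ℂ) (k : ℤ) : ℂ :=
  μ * x k - (π : ℂ)⁻¹ * ∑ j ∈ K, ((|((k - j : ℤ) : ℝ)| : ℝ) : ℂ) * c (k - j) * x j

/-- The linearized flux, including `μ φₓ`, as a function of `w = φₓ`, truncated to the frequencies
in `K`. -/
noncomputable def trFlux (μ : ℝ) (c : ℤ → ℂ) (K : Finset ℤ) (w : ℤ → ℂ) (k : ℤ) : ℂ :=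
  μ * w k - (π : ℂ)⁻¹ * ∑ j ∈ K, (fluxKernel k j : ℂ) * c (k - j) * w j

theorem wt_le_add (k j : ℤ) : wt k ≤ wt (k - j) + wt j := by
  have h := abs_add_le ((k - j : ℤ) : ℝ) j
  simp only [wt]
  push_cast at h ⊢
  rw [sub_add_cancel] at h
  linarith

theorem wt_sub_le (k j : ℤ) : |wt k - wt j| ≤ |((k - j : ℤ) : ℝ)| := by
  simp only [wt]
  push_cast
  rw [add_sub_add_left_eq_sub]
  exact abs_abs_sub_abs_le _ _

theorem wt_pow_le_add (m : ℕ) (k j : ℤ) :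
    max (wt k) (wt j) ^ m ≤ 2 ^ m * (wt (k - j) ^ m + wt j ^ m) := by
  have h1 := wt_pos (k - j)
  have h2 := wt_pos j
  have h3 : max (wt k) (wt j) ≤ 2 * max (wt (k - j)) (wt j) := by
    refine max_le ((wt_le_add k j).trans ?_) ?_
    · linarith [le_max_left (wt (k - j)) (wt j), le_max_right (wt (k - j)) (wt j)]
    · linarith [le_max_right (wt (k - j)) (wt j)]
  calc max (wt k) (wt j) ^ m ≤ (2 * max (wt (k - j)) (wt j)) ^ m :=
        pow_le_pow_left₀ (le_max_of_le_right h2.le) h3 m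
    _ = 2 ^ m * max (wt (k - j)) (wt j) ^ m := mul_pow _ _ _
    _ ≤ 2 ^ m * (wt (k - j) ^ m + wt j ^ m) := by
        refine mul_le_mul_of_nonneg_left ?_ (by positivity)
        rcases max_choice (wt (k - j)) (wt j) with h | h <;> rw [h]
        · exact le_add_of_nonneg_right (by positivity)
        · exact le_add_of_nonneg_left (by positivity)

theorem abs_pow_sub_pow_mul_max_le {a b : ℝ} (ha : 0 ≤ a) (hb : 0 ≤ b) (m : ℕ) :
    |a ^ m - b ^ m| * max a b ≤ m * |a - b| * max a b ^ m := by
  have hM : 0 ≤ max a b := le_max_of_le_left ha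
  induction m with
  | zero => simp
  | succ m ih =>
    have e : a ^ (m + 1) - b ^ (m + 1) = a ^ m * (a - b) + (a ^ m - b ^ m) * b := by ring
    have h1 : |a ^ (m + 1) - b ^ (m + 1)| ≤ a ^ m * |a - b| + |a ^ m - b ^ m| * b := by
      rw [e]
      refine (abs_add_le _ _).trans_eq ?_
      rw [abs_mul, abs_mul, abs_of_nonneg hb, abs_of_nonneg (pow_nonneg ha m)]
    have h2 : a ^ m ≤ max a b ^ m := pow_le_pow_left₀ ha (le_max_left _ _) m
    calc |a ^ (m + 1) - b ^ (m + 1)| * max a b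
        ≤ (a ^ m * |a - b| + |a ^ m - b ^ m| * b) * max a b := mul_le_mul_of_nonneg_right h1 hM
      _ = a ^ m * |a - b| * max a b + (|a ^ m - b ^ m| * max a b) * b := by ring
      _ ≤ max a b ^ m * |a - b| * max a b + (m * |a - b| * max a b ^ m) * max a b := by
          gcongr
          exact le_max_right _ _
      _ = _ := by push_cast; ring

/-- The constant of the commutator estimate at the level `m`. -/
noncomputable def commConst (m : ℕ) : ℝ := 2 + m * 2 ^ m

theorem commConst_pos (m : ℕ) : 0 < commConst m := by rw [commConst]; positivity

/-- The commutator of the weight `(1+|k|)ᵐ` with the flux, together with the difference of the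
flux and its principal part, is of order zero: of the `m + 1` derivatives falling on the product,
either at least two fall on the state or all of them do. -/
theorem abs_mul_kernel_sub_le (m : ℕ) (k : ℤ) {j : ℤ} (hj : j ≠ 0) :
    |(k : ℝ)| * |(|((k - j : ℤ) : ℝ)| * wt j ^ m - fluxKernel k j * wt k ^ m)|
      ≤ commConst m * ((k - j : ℤ) : ℝ) ^ 2 * (wt (k - j) ^ m + wt j ^ m) := by
  have hk := wt_pos k
  have hj' := wt_pos j
  have hn := wt_pos (k - j)
  set n : ℝ := ((k - j : ℤ) : ℝ) with hnd
  set M := max (wt k) (wt j) with hM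
  have hM0 : 0 < M := lt_max_of_lt_left hk
  have e : |n| * wt j ^ m - fluxKernel k j * wt k ^ m
      = (|n| - fluxKernel k j) * wt j ^ m - fluxKernel k j * (wt k ^ m - wt j ^ m) := by ring
  have h1 : |(k : ℝ)| * |(|n| - fluxKernel k j) * wt j ^ m| ≤ 2 * n ^ 2 * wt j ^ m := by
    rw [abs_mul, abs_of_pos (pow_pos hj' m), ← mul_assoc]
    exact mul_le_mul_of_nonneg_right (abs_mul_sub_fluxKernel_le k hj) (by positivity)
  have h2 : |(k : ℝ)| * |fluxKernel k j * (wt k ^ m - wt j ^ m)| ≤ m * n ^ 2 * M ^ m := by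
    have a1 : |(k : ℝ)| * |wt k ^ m - wt j ^ m| ≤ m * |n| * M ^ m := by
      calc |(k : ℝ)| * |wt k ^ m - wt j ^ m| ≤ M * |wt k ^ m - wt j ^ m| :=
            mul_le_mul_of_nonneg_right ((abs_le_wt k).trans (le_max_left _ _)) (abs_nonneg _)
        _ = |wt k ^ m - wt j ^ m| * M := mul_comm _ _
        _ ≤ m * |wt k - wt j| * M ^ m := abs_pow_sub_pow_mul_max_le hk.le hj'.le m
        _ ≤ m * |n| * M ^ m := by
            exact mul_le_mul_of_nonneg_right (mul_le_mul_of_nonneg_left (wt_sub_le k j)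
              (Nat.cast_nonneg m)) (by positivity)
    calc |(k : ℝ)| * |fluxKernel k j * (wt k ^ m - wt j ^ m)|
        = |fluxKernel k j| * (|(k : ℝ)| * |wt k ^ m - wt j ^ m|) := by rw [abs_mul]; ring
      _ ≤ |n| * (m * |n| * M ^ m) :=
          mul_le_mul (abs_fluxKernel_le k j) a1 (by positivity) (abs_nonneg _)
      _ = m * n ^ 2 * M ^ m := by rw [← sq_abs n]; ring
  have h3 := wt_pow_le_add m k j
  have h4 : 2 * n ^ 2 * wt j ^ m ≤ 2 * n ^ 2 * (wt (k - j) ^ m + wt j ^ m) := by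
    refine mul_le_mul_of_nonneg_left ?_ (by positivity)
    exact le_add_of_nonneg_left (by positivity)
  rw [e]
  calc _ ≤ |(k : ℝ)| * (|(|n| - fluxKernel k j) * wt j ^ m|
        + |fluxKernel k j * (wt k ^ m - wt j ^ m)|) :=
        mul_le_mul_of_nonneg_left (abs_sub _ _) (abs_nonneg _)
    _ ≤ 2 * n ^ 2 * wt j ^ m + m * n ^ 2 * M ^ m := by rw [mul_add]; exact add_le_add h1 h2
    _ ≤ 2 * n ^ 2 * (wt (k - j) ^ m + wt j ^ m)
        + m * n ^ 2 * (2 ^ m * (wt (k - j) ^ m + wt j ^ m)) :=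
        add_le_add h4 (mul_le_mul_of_nonneg_left h3 (by positivity))
    _ = _ := by rw [commConst]; ring

/-- Young's inequality for convolutions, in bilinear form. -/
theorem sum_conv_mul_le {b : ℤ → ℝ} {B : ℝ} (hb : ∀ n, 0 ≤ b n)
    (hB : ∀ F : Finset ℤ, ∑ n ∈ F, b n ≤ B) (K : Finset ℤ) (X Y : ℤ → ℝ) :
    ∑ k ∈ K, ∑ j ∈ K, b (k - j) * X j * Y k
      ≤ B / 2 * (∑ k ∈ K, Y k ^ 2 + ∑ k ∈ K, X k ^ 2) := by
  have h1 : ∀ k j, b (k - j) * X j * Y k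
      ≤ b (k - j) * (X j ^ 2 / 2) + b (k - j) * (Y k ^ 2 / 2) := by
    intro k j
    rw [← mul_add, mul_assoc]
    refine mul_le_mul_of_nonneg_left ?_ (hb _)
    nlinarith [sq_nonneg (X j - Y k)]
  have h2 : ∀ k, ∑ j ∈ K, b (k - j) ≤ B := fun k => by
    rw [← Finset.sum_image (f := b) (g := fun j => k - j) (fun a _ a' _ h => by simpa using h)]
    exact hB _
  have h3 : ∀ j, ∑ k ∈ K, b (k - j) ≤ B := fun j => by
    rw [← Finset.sum_image (f := b) (g := fun k => k - j) (fun a _ a' _ h => by simpa using h)]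
    exact hB _
  calc ∑ k ∈ K, ∑ j ∈ K, b (k - j) * X j * Y k
      ≤ ∑ k ∈ K, ∑ j ∈ K, (b (k - j) * (X j ^ 2 / 2) + b (k - j) * (Y k ^ 2 / 2)) :=
        Finset.sum_le_sum fun k _ => Finset.sum_le_sum fun j _ => h1 k j
    _ = ∑ j ∈ K, (∑ k ∈ K, b (k - j)) * (X j ^ 2 / 2)
        + ∑ k ∈ K, (∑ j ∈ K, b (k - j)) * (Y k ^ 2 / 2) := by
        simp only [Finset.sum_add_distrib, Finset.sum_mul]
        rw [Finset.sum_comm]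
    _ ≤ ∑ j ∈ K, B * (X j ^ 2 / 2) + ∑ k ∈ K, B * (Y k ^ 2 / 2) := by
        gcongr with j _ k _
        · exact h3 j
        · exact h2 k
    _ = _ := by rw [← Finset.mul_sum, ← Finset.mul_sum, ← Finset.sum_div, ← Finset.sum_div]; ring

/-- Convolution with a square-summable sequence, in bilinear form; the other factor is measured in
`H¹`, which embeds into the Wiener algebra. -/
theorem sum_conv_mul_le_of_sq {d : ℤ → ℝ} {D : ℝ} (hD0 : 0 ≤ D)
    (hD : ∀ F : Finset ℤ, ∑ n ∈ F, d n ^ 2 ≤ D ^ 2) (K : Finset ℤ) (X Y : ℤ → ℝ)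
    (hX : ∀ j, 0 ≤ X j) :
    ∑ k ∈ K, ∑ j ∈ K, d (k - j) * X j * Y k
      ≤ D * √wtSum * √(∑ j ∈ K, wt j ^ 2 * X j ^ 2) * √(∑ k ∈ K, Y k ^ 2) := by
  have h1 : ∀ j, ∑ k ∈ K, d (k - j) * Y k ≤ D * √(∑ k ∈ K, Y k ^ 2) := fun j => by
    refine (Real.sum_mul_le_sqrt_mul_sqrt K _ _).trans ?_
    refine mul_le_mul_of_nonneg_right ?_ (Real.sqrt_nonneg _)
    refine Real.sqrt_le_iff.mpr ⟨hD0, ?_⟩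
    rw [← Finset.sum_image (f := fun n => d n ^ 2) (g := fun k => k - j)
      (fun a _ a' _ h => by simpa using h)]
    exact hD _
  have h2 : ∑ j ∈ K, X j ≤ √wtSum * √(∑ j ∈ K, wt j ^ 2 * X j ^ 2) := by
    have e : ∀ j ∈ K, X j = (wt j)⁻¹ * (wt j * X j) := fun j _ => by
      rw [inv_mul_cancel_left₀ (wt_pos j).ne']
    rw [Finset.sum_congr rfl e]
    refine (Real.sum_mul_le_sqrt_mul_sqrt K _ _).trans ?_
    simp only [mul_pow]
    refine mul_le_mul_of_nonneg_right (Real.sqrt_le_sqrt ?_) (Real.sqrt_nonneg _)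
    simp only [inv_pow]
    exact summable_wt_inv_sq.sum_le_tsum K (fun k _ => by have := wt_pos k; positivity)
  calc ∑ k ∈ K, ∑ j ∈ K, d (k - j) * X j * Y k
      = ∑ j ∈ K, X j * ∑ k ∈ K, d (k - j) * Y k := by
        rw [Finset.sum_comm]
        refine Finset.sum_congr rfl fun j _ => ?_
        rw [Finset.mul_sum]
        exact Finset.sum_congr rfl fun k _ => by ring
    _ ≤ ∑ j ∈ K, X j * (D * √(∑ k ∈ K, Y k ^ 2)) :=
        Finset.sum_le_sum fun j _ => mul_le_mul_of_nonneg_left (h1 j) (hX j)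
    _ = (∑ j ∈ K, X j) * (D * √(∑ k ∈ K, Y k ^ 2)) := by rw [Finset.sum_mul]
    _ ≤ (√wtSum * √(∑ j ∈ K, wt j ^ 2 * X j ^ 2)) * (D * √(∑ k ∈ K, Y k ^ 2)) :=
        mul_le_mul_of_nonneg_right h2 (by positivity)
    _ = _ := by ring

theorem sum_inv_wt_sq_le (F : Finset ℤ) : ∑ n ∈ F, (wt n ^ 2)⁻¹ ≤ wtSum :=
  summable_wt_inv_sq.sum_le_tsum F (fun k _ => by have := wt_pos k; positivity)

theorem sq_mul_norm_le {c : ℤ → ℂ} {A : ℝ} (hc : ∀ n, wt n ^ 5 * ‖c n‖ ≤ A) (n : ℤ) :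
    (n : ℝ) ^ 2 * ‖c n‖ ≤ A * (wt n ^ 2)⁻¹ := by
  have h := wt_pos n
  have h1 := one_le_wt n
  rw [← div_eq_mul_inv, le_div_iff₀ (by positivity)]
  refine le_trans ?_ (hc n)
  have : (n : ℝ) ^ 2 ≤ wt n ^ 2 := by
    rw [← sq_abs]; exact pow_le_pow_left₀ (abs_nonneg _) (abs_le_wt n) 2
  calc (n : ℝ) ^ 2 * ‖c n‖ * wt n ^ 2 ≤ wt n ^ 2 * ‖c n‖ * wt n ^ 2 := by gcongr
    _ = wt n ^ 4 * ‖c n‖ := by ring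
    _ ≤ wt n ^ 5 * ‖c n‖ :=
        mul_le_mul_of_nonneg_right (pow_le_pow_right₀ h1 (by norm_num)) (norm_nonneg _)

theorem sum_sq_mul_norm_le {c : ℤ → ℂ} {A : ℝ} (hc : ∀ n, wt n ^ 5 * ‖c n‖ ≤ A) (F : Finset ℤ) :
    ∑ n ∈ F, (n : ℝ) ^ 2 * ‖c n‖ ≤ A * wtSum := by
  have hA : 0 ≤ A := le_trans (by have := wt_pos 0; positivity) (hc 0)
  calc ∑ n ∈ F, (n : ℝ) ^ 2 * ‖c n‖ ≤ ∑ n ∈ F, A * (wt n ^ 2)⁻¹ :=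
        Finset.sum_le_sum fun n _ => sq_mul_norm_le hc n
    _ = A * ∑ n ∈ F, (wt n ^ 2)⁻¹ := by rw [Finset.mul_sum]
    _ ≤ A * wtSum := mul_le_mul_of_nonneg_left (sum_inv_wt_sq_le F) hA

/-- The rate of change, in the energy of level `m`, due to the right-hand side of the truncated
system. -/
noncomputable def energyRate (μ : ℝ) (c : ℤ → ℂ) (K : Finset ℤ) (m : ℕ) (v w : ℤ → ℂ) : ℝ :=
  ∑ k ∈ K, ((starRingEnd ℂ) (wt k ^ m * v k) * (wt k ^ m * (Complex.I * k * trFlux μ c K w k))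
    + (starRingEnd ℂ) (princ μ c K (fun j => wt j ^ m * w j) k)
      * (wt k ^ m * (Complex.I * k * v k))).re

/-- In the energy rate the principal part of the flux cancels. -/
theorem energyRate_le_sum (μ : ℝ) (c : ℤ → ℂ) {K : Finset ℤ} (hK : 0 ∉ K) (m : ℕ) (v w : ℤ → ℂ) :
    energyRate μ c K m v w ≤ π⁻¹ * commConst m *
      (∑ k ∈ K, ∑ j ∈ K, ((k - j : ℤ) : ℝ) ^ 2 * ‖c (k - j)‖ * (wt j ^ m * ‖w j‖)
          * (wt k ^ m * ‖v k‖)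
      + ∑ k ∈ K, ∑ j ∈ K, ((k - j : ℤ) : ℝ) ^ 2 * wt (k - j) ^ m * ‖c (k - j)‖ * ‖w j‖
          * (wt k ^ m * ‖v k‖)) := by
  rw [energyRate, ← Finset.sum_add_distrib, Finset.mul_sum]
  refine Finset.sum_le_sum fun k _ => ?_
  set Z := princ μ c K (fun j => wt j ^ m * w j) k with hZ
  set y : ℂ := wt k ^ m * v k with hy
  -- `z + conj z` is real, so this pairing is purely imaginary: the principal part drops out
  have e1 : (starRingEnd ℂ) y * (Complex.I * k * Z) + (starRingEnd ℂ) Z * (Complex.I * k * y)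
      = Complex.I * ((k : ℝ) * (2 * ((starRingEnd ℂ) y * Z).re) : ℝ) := by
    have h := Complex.add_conj ((starRingEnd ℂ) y * Z)
    rw [map_mul _ ((starRingEnd ℂ) y), Complex.conj_conj] at h
    push_cast at h ⊢
    linear_combination (Complex.I * k) * h
  have e2 : wt k ^ m * trFlux μ c K w k - Z = (π : ℂ)⁻¹ * ∑ j ∈ K,
      ((|((k - j : ℤ) : ℝ)| * wt j ^ m - fluxKernel k j * wt k ^ m : ℝ) : ℂ) * c (k - j) * w j := by
    have : ∑ j ∈ K, ((|((k - j : ℤ) : ℝ)| * wt j ^ m - fluxKernel k j * wt k ^ m : ℝ) : ℂ)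
        * c (k - j) * w j = ∑ j ∈ K, ((|((k - j : ℤ) : ℝ)| : ℝ) : ℂ) * c (k - j) * (wt j ^ m * w j)
        - wt k ^ m * ∑ j ∈ K, (fluxKernel k j : ℂ) * c (k - j) * w j := by
      rw [Finset.mul_sum, ← Finset.sum_sub_distrib]
      refine Finset.sum_congr rfl fun j _ => ?_
      push_cast
      ring
    rw [this, hZ, princ, trFlux]
    ring
  have e3 : ((starRingEnd ℂ) y * (wt k ^ m * (Complex.I * k * trFlux μ c K w k))
      + (starRingEnd ℂ) Z * (wt k ^ m * (Complex.I * k * v k))).re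
      = ((starRingEnd ℂ) y * (Complex.I * k) * (wt k ^ m * trFlux μ c K w k - Z)).re := by
    have : (starRingEnd ℂ) y * (wt k ^ m * (Complex.I * k * trFlux μ c K w k))
        + (starRingEnd ℂ) Z * (wt k ^ m * (Complex.I * k * v k))
        = (starRingEnd ℂ) y * (Complex.I * k) * (wt k ^ m * trFlux μ c K w k - Z)
          + Complex.I * ((k : ℝ) * (2 * ((starRingEnd ℂ) y * Z).re) : ℝ) := by
      rw [← e1, hy]
      ring
    rw [this, Complex.add_re, Complex.I_mul_re, Complex.ofReal_im, neg_zero, add_zero]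
  rw [e3, e2]
  refine (Complex.re_le_norm _).trans ?_
  rw [norm_mul, norm_mul, norm_mul, norm_mul, Complex.norm_I, one_mul, Complex.norm_intCast,
    norm_inv, Complex.norm_real, Real.norm_of_nonneg Real.pi_pos.le, RCLike.norm_conj]
  have hyn : ‖y‖ = wt k ^ m * ‖v k‖ := by
    rw [hy, norm_mul, norm_pow, Complex.norm_real, Real.norm_of_nonneg (wt_pos k).le]
  rw [hyn, ← Finset.sum_add_distrib]
  calc wt k ^ m * ‖v k‖ * |(k : ℝ)| * (π⁻¹ * ‖∑ j ∈ K,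
        ((|((k - j : ℤ) : ℝ)| * wt j ^ m - fluxKernel k j * wt k ^ m : ℝ) : ℂ) * c (k - j) * w j‖)
      ≤ wt k ^ m * ‖v k‖ * |(k : ℝ)| * (π⁻¹ * ∑ j ∈ K,
        |(|((k - j : ℤ) : ℝ)| * wt j ^ m - fluxKernel k j * wt k ^ m)| * ‖c (k - j)‖ * ‖w j‖) := by
        have := wt_pos k
        have := Real.pi_pos
        refine mul_le_mul_of_nonneg_left (mul_le_mul_of_nonneg_left ?_ (by positivity))
          (by positivity)
        refine (norm_sum_le _ _).trans_eq (Finset.sum_congr rfl fun j _ => ?_)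
        rw [norm_mul, norm_mul, Complex.norm_real, Real.norm_eq_abs]
    _ = π⁻¹ * ∑ j ∈ K, (|(k : ℝ)| *
        |(|((k - j : ℤ) : ℝ)| * wt j ^ m - fluxKernel k j * wt k ^ m)|) * ‖c (k - j)‖ * ‖w j‖
          * (wt k ^ m * ‖v k‖) := by
        rw [mul_left_comm, Finset.mul_sum]
        congr 1
        exact Finset.sum_congr rfl fun j _ => by ring
    _ ≤ π⁻¹ * ∑ j ∈ K, (commConst m * ((k - j : ℤ) : ℝ) ^ 2 * (wt (k - j) ^ m + wt j ^ m))
        * ‖c (k - j)‖ * ‖w j‖ * (wt k ^ m * ‖v k‖) := by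
        have := wt_pos k
        have := Real.pi_pos
        refine mul_le_mul_of_nonneg_left (Finset.sum_le_sum fun j hj => ?_) (by positivity)
        have h := abs_mul_kernel_sub_le m k (j := j) (fun h => hK (h ▸ hj))
        exact mul_le_mul_of_nonneg_right (mul_le_mul_of_nonneg_right
          (mul_le_mul_of_nonneg_right h (norm_nonneg _)) (norm_nonneg _)) (by positivity)
    _ = _ := by
        rw [mul_assoc, Finset.mul_sum (a := commConst m)]
        congr 1
        exact Finset.sum_congr rfl fun j _ => by ring

/-- The energy estimate of level `m`, tame in the state. -/
theorem energyRate_le {μ : ℝ} {c : ℤ → ℂ} {A D : ℝ} (hc : ∀ n, wt n ^ 5 * ‖c n‖ ≤ A) (hD0 : 0 ≤ D)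
    {m : ℕ} (hD : ∀ F : Finset ℤ, ∑ n ∈ F, ((n : ℝ) ^ 2 * wt n ^ m * ‖c n‖) ^ 2 ≤ D ^ 2)
    {K : Finset ℤ} (hK : 0 ∉ K) (v w : ℤ → ℂ) :
    energyRate μ c K m v w ≤ π⁻¹ * commConst m *
      (A * wtSum / 2 * (∑ k ∈ K, (wt k ^ m * ‖v k‖) ^ 2 + ∑ k ∈ K, (wt k ^ m * ‖w k‖) ^ 2)
      + D * √wtSum * √(∑ j ∈ K, wt j ^ 2 * ‖w j‖ ^ 2) * √(∑ k ∈ K, (wt k ^ m * ‖v k‖) ^ 2)) := by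
  refine (energyRate_le_sum μ c hK m v w).trans ?_
  have := Real.pi_pos
  have := commConst_pos m
  refine mul_le_mul_of_nonneg_left (add_le_add ?_ ?_) (by positivity)
  · exact sum_conv_mul_le (b := fun n => (n : ℝ) ^ 2 * ‖c n‖) (fun n => by positivity)
      (sum_sq_mul_norm_le hc) K (fun j => wt j ^ m * ‖w j‖) (fun k => wt k ^ m * ‖v k‖)
  · exact sum_conv_mul_le_of_sq (d := fun n => (n : ℝ) ^ 2 * wt n ^ m * ‖c n‖) hD0 hD K
      (fun j => ‖w j‖) (fun k => wt k ^ m * ‖v k‖) (fun j => norm_nonneg _)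

/-- The energy estimate at the levels `m ≤ 2` only involves the low norm of the state. -/
theorem energyRate_le_of_le_two {μ : ℝ} {c : ℤ → ℂ} {A : ℝ} (hc : ∀ n, wt n ^ 5 * ‖c n‖ ≤ A)
    {m : ℕ} (hm : m ≤ 2) {K : Finset ℤ} (hK : 0 ∉ K) (v w : ℤ → ℂ) :
    energyRate μ c K m v w ≤ π⁻¹ * commConst m *
      (A * wtSum * (∑ k ∈ K, (wt k ^ m * ‖v k‖) ^ 2 + ∑ k ∈ K, (wt k ^ m * ‖w k‖) ^ 2)) := by
  have hA : 0 ≤ A := le_trans (by have := wt_pos 0; positivity) (hc 0)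
  have hpi := Real.pi_pos
  have hC := commConst_pos m
  rcases Nat.eq_zero_or_pos m with rfl | hm0
  · refine (energyRate_le_sum μ c hK 0 v w).trans ?_
    refine mul_le_mul_of_nonneg_left ?_ (by positivity)
    have h := sum_conv_mul_le (b := fun n => (n : ℝ) ^ 2 * ‖c n‖) (fun n => by positivity)
      (sum_sq_mul_norm_le hc) K (fun j => ‖w j‖) (fun k => ‖v k‖)
    simp only [pow_zero, one_mul, mul_one]
    linarith
  · have hs := wtSum_nonneg
    have hD : ∀ F : Finset ℤ, ∑ n ∈ F, ((n : ℝ) ^ 2 * wt n ^ m * ‖c n‖) ^ 2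
        ≤ (A * √wtSum) ^ 2 := by
      intro F
      rw [mul_pow, Real.sq_sqrt hs]
      calc ∑ n ∈ F, ((n : ℝ) ^ 2 * wt n ^ m * ‖c n‖) ^ 2 ≤ ∑ n ∈ F, A ^ 2 * (wt n ^ 2)⁻¹ := by
            refine Finset.sum_le_sum fun n _ => ?_
            have h := wt_pos n
            rw [← inv_pow, ← mul_pow]
            refine pow_le_pow_left₀ (by positivity) ?_ 2
            rw [← div_eq_mul_inv, le_div_iff₀ h]
            refine le_trans ?_ (hc n)
            have h2 : (n : ℝ) ^ 2 ≤ wt n ^ 2 := by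
              rw [← sq_abs]; exact pow_le_pow_left₀ (abs_nonneg _) (abs_le_wt n) 2
            have h3 : wt n ^ m ≤ wt n ^ 2 := pow_le_pow_right₀ (one_le_wt n) hm
            calc (n : ℝ) ^ 2 * wt n ^ m * ‖c n‖ * wt n ≤ wt n ^ 2 * wt n ^ 2 * ‖c n‖ * wt n := by
                  gcongr
              _ = wt n ^ 5 * ‖c n‖ := by ring
        _ ≤ A ^ 2 * wtSum := by
            rw [← Finset.mul_sum]
            exact mul_le_mul_of_nonneg_left (sum_inv_wt_sq_le F) (sq_nonneg _)
    refine (energyRate_le hc (by positivity) hD hK v w).trans ?_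
    refine mul_le_mul_of_nonneg_left ?_ (by positivity)
    set V := ∑ k ∈ K, (wt k ^ m * ‖v k‖) ^ 2
    set W := ∑ k ∈ K, (wt k ^ m * ‖w k‖) ^ 2
    have hV : 0 ≤ V := Finset.sum_nonneg fun _ _ => sq_nonneg _
    have hW1 : ∑ j ∈ K, wt j ^ 2 * ‖w j‖ ^ 2 ≤ W := by
      refine Finset.sum_le_sum fun j _ => ?_
      rw [mul_pow, ← pow_mul]
      exact mul_le_mul_of_nonneg_right (pow_le_pow_right₀ (one_le_wt j) (by omega)) (sq_nonneg _)
    have hW : 0 ≤ W := Finset.sum_nonneg fun _ _ => sq_nonneg _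
    have h1 : √(∑ j ∈ K, wt j ^ 2 * ‖w j‖ ^ 2) * √V ≤ (V + W) / 2 := by
      have a1 := Real.sqrt_le_sqrt hW1
      have a2 := Real.sq_sqrt hV
      have a3 := Real.sq_sqrt hW
      have a4 := mul_le_mul_of_nonneg_right a1 (Real.sqrt_nonneg V)
      nlinarith [sq_nonneg (√W - √V)]
    have h2 : A * √wtSum * √wtSum = A * wtSum := by rw [mul_assoc, Real.mul_self_sqrt hs]
    rw [h2, mul_assoc (A * wtSum)]
    have h3 : 0 ≤ A * wtSum := mul_nonneg hA hs
    nlinarith [mul_le_mul_of_nonneg_left h1 h3]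

/-- The truncated multiplication by a real-valued function is symmetric. -/
theorem sum_conj_mul_princ {c : ℤ → ℂ} (hherm : ∀ n, c (-n) = (starRingEnd ℂ) (c n)) (μ : ℝ)
    (K : Finset ℤ) (x y : ℤ → ℂ) :
    ∑ k ∈ K, ((starRingEnd ℂ) (x k) * princ μ c K y k).re
      = ∑ k ∈ K, ((starRingEnd ℂ) (y k) * princ μ c K x k).re := by
  have key : ∀ x y : ℤ → ℂ, ∑ k ∈ K, (starRingEnd ℂ) (x k) * princ μ c K y k
      = μ * ∑ k ∈ K, (starRingEnd ℂ) (x k) * y k - (π : ℂ)⁻¹ * ∑ k ∈ K, ∑ j ∈ K,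
        ((|((k - j : ℤ) : ℝ)| : ℝ) : ℂ) * c (k - j) * ((starRingEnd ℂ) (x k) * y j) := by
    intro x y
    simp only [princ, mul_sub, Finset.sum_sub_distrib, Finset.mul_sum]
    congr 1
    · exact Finset.sum_congr rfl fun _ _ => by ring
    · exact Finset.sum_congr rfl fun _ _ => Finset.sum_congr rfl fun _ _ => by ring
  rw [← Complex.re_sum, ← Complex.re_sum, key, key, ← Complex.conj_re]
  congr 1
  simp only [map_sub, map_mul, map_sum, Complex.conj_conj, Complex.conj_ofReal, map_inv₀]
  congr 1
  · congr 1
    exact Finset.sum_congr rfl fun _ _ => by ring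
  · congr 1
    rw [Finset.sum_comm]
    refine Finset.sum_congr rfl fun k _ => Finset.sum_congr rfl fun j _ => ?_
    rw [← hherm, neg_sub, ← abs_neg, ← Int.cast_neg, neg_sub]
    ring

/-- Lipschitz dependence of the multiplication by `μ - 2 ∂ₓ ℍ[φ₀]` on the state. -/
theorem sum_conj_mul_princ_sub_le {c c' : ℤ → ℂ} {B : ℝ}
    (hB : ∀ F : Finset ℤ, ∑ n ∈ F, |(n : ℝ)| * ‖c' n - c n‖ ≤ B) (μ : ℝ) (K : Finset ℤ)
    (x : ℤ → ℂ) :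
    ∑ k ∈ K, ((starRingEnd ℂ) (x k) * princ μ c' K x k).re
      ≤ ∑ k ∈ K, ((starRingEnd ℂ) (x k) * princ μ c K x k).re + π⁻¹ * B * ∑ k ∈ K, ‖x k‖ ^ 2 := by
  have hpi := Real.pi_pos
  have h := sum_conv_mul_le (b := fun n => |(n : ℝ)| * ‖c' n - c n‖) (fun n => by positivity)
    hB K (fun j => ‖x j‖) (fun k => ‖x k‖)
  have h1 : ∑ k ∈ K, ((starRingEnd ℂ) (x k) * princ μ c' K x k).re
      - ∑ k ∈ K, ((starRingEnd ℂ) (x k) * princ μ c K x k).re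
      ≤ π⁻¹ * ∑ k ∈ K, ∑ j ∈ K, |((k - j : ℤ) : ℝ)| * ‖c' (k - j) - c (k - j)‖ * ‖x j‖ * ‖x k‖ := by
    rw [← Finset.sum_sub_distrib, Finset.mul_sum]
    refine Finset.sum_le_sum fun k _ => ?_
    have e : (starRingEnd ℂ) (x k) * princ μ c' K x k - (starRingEnd ℂ) (x k) * princ μ c K x k
        = -((starRingEnd ℂ) (x k) * (π : ℂ)⁻¹ *
          ∑ j ∈ K, ((|((k - j : ℤ) : ℝ)| : ℝ) : ℂ) * (c' (k - j) - c (k - j)) * x j) := by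
      simp only [princ, mul_sub, sub_mul, Finset.sum_sub_distrib]
      ring
    rw [← Complex.sub_re, e]
    refine (Complex.re_le_norm _).trans ?_
    rw [norm_neg, norm_mul, norm_mul, RCLike.norm_conj, norm_inv, Complex.norm_real,
      Real.norm_of_nonneg hpi.le, mul_comm ‖x k‖, mul_assoc]
    refine mul_le_mul_of_nonneg_left ?_ (by positivity)
    refine (mul_le_mul_of_nonneg_left (norm_sum_le _ _) (norm_nonneg _)).trans_eq ?_
    rw [Finset.mul_sum]
    refine Finset.sum_congr rfl fun j _ => ?_
    rw [norm_mul, norm_mul, Complex.norm_real, Real.norm_eq_abs, abs_abs]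
    ring
  have h2 := mul_le_mul_of_nonneg_left h (inv_nonneg.mpr hpi.le)
  linarith

/-! ### Backward differences in time and the Lax–Milgram lemma -/

section Abstract

variable {E : Type*} [NormedAddCommGroup E] [InnerProductSpace ℝ E]

theorem memLp_shift {F : Type*} [NormedAddCommGroup F] {u : ℝ → F} {p : ℝ≥0∞}
    (hu : MemLp u p volume) (h : ℝ) : MemLp (fun t => u (t - h)) p volume :=
  hu.comp_measurePreserving (measurePreserving_sub_right volume h)

theorem MeasureTheory.MemLp.clm_apply {S : ℝ → E →L[ℝ] E} {B : ℝ}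
    (hS : AEStronglyMeasurable S volume) (hB : ∀ᵐ t, ‖S t‖ ≤ B) {u : ℝ → E}
    (hu : MemLp u 2 volume) : MemLp (fun t => S t (u t)) 2 volume :=
  (ContinuousLinearMap.id ℝ (E →L[ℝ] E)).memLp_of_bilin 2 (memLp_top_of_bound hS B hB) hu

theorem integrable_inner_of_memLp {u v : ℝ → E} (hu : MemLp u 2 volume) (hv : MemLp v 2 volume) :
    Integrable (fun t => inner ℝ (u t) (v t)) volume :=
  memLp_one_iff_integrable.mp ((innerSL ℝ).memLp_of_bilin 1 hu hv)

/-- A family of uniformly positive symmetric operators, Lipschitz in time from above. -/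
structure IsSymmetrizer (S : ℝ → E →L[ℝ] E) (σ L B : ℝ) : Prop where
  meas : AEStronglyMeasurable S volume
  bound : ∀ᵐ t, ‖S t‖ ≤ B
  symm : ∀ᵐ t, ∀ x y, inner ℝ (S t x) y = inner ℝ x (S t y)
  coercive : ∀ᵐ t, ∀ x, σ * ‖x‖ ^ 2 ≤ inner ℝ (S t x) x
  lipschitz : ∀ h, 0 < h → ∀ᵐ t, ∀ x, inner ℝ (S (t + h) x) x ≤ inner ℝ (S t x) x + L * h * ‖x‖ ^ 2

theorem ae_add_of_ae {p : ℝ → Prop} (hp : ∀ᵐ t, p t) (h : ℝ) : ∀ᵐ t, p (t + h) :=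
  (measurePreserving_add_right volume h).quasiMeasurePreserving.ae hp

/-- The backward difference in time is dissipative for the energy of a symmetrizer, up to the
Lipschitz constant of the latter. This is the discrete form of `(d/dt) ⟪S u, u⟫`. -/
theorem IsSymmetrizer.le_integral_inner_sub {S : ℝ → E →L[ℝ] E} {σ L B : ℝ}
    (hS : IsSymmetrizer S σ L B) (hσ : 0 ≤ σ) {u : ℝ → E} (hu : MemLp u 2 volume) {h : ℝ}
    (hh : 0 < h) :
    -(L * h / 2) * ∫ t, ‖u t‖ ^ 2 ≤ ∫ t, inner ℝ (u t - u (t - h)) (S t (u t)) := by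
  have hSu := MeasureTheory.MemLp.clm_apply hS.meas hS.bound hu
  have hus := memLp_shift hu h
  have hSus := MeasureTheory.MemLp.clm_apply hS.meas hS.bound hus
  have i1 := integrable_inner_of_memLp hSu hu
  have i2 := integrable_inner_of_memLp hSus hus
  have i3 : Integrable (fun t => ‖u t‖ ^ 2) volume := hu.integrable_norm_pow (by norm_num)
  have i4 := integrable_inner_of_memLp (hu.sub hus) hSu
  have e1 : ∫ t, inner ℝ (S t (u (t - h))) (u (t - h))
      = ∫ t, inner ℝ (S (t + h) (u t)) (u t) := by
    rw [← integral_add_right_eq_self (fun t => inner ℝ (S t (u (t - h))) (u (t - h))) h]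
    simp
  have i5 : Integrable (fun t => inner ℝ (S (t + h) (u t)) (u t)) volume := by
    have := i2.comp_add_right h
    simpa using this
  have e2 : ∫ t, inner ℝ (S (t + h) (u t)) (u t)
      ≤ (∫ t, inner ℝ (S t (u t)) (u t)) + L * h * ∫ t, ‖u t‖ ^ 2 := by
    rw [← integral_const_mul, ← integral_add i1 (i3.const_mul _)]
    refine integral_mono_ae i5 (i1.add (i3.const_mul _)) ?_
    filter_upwards [hS.lipschitz h hh] with t ht using ht (u t)
  -- `2⟪a - b, S a⟫ - ⟪S a, a⟫ + ⟪S b, b⟫ = ⟪S (a - b), a - b⟫ ≥ 0`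
  have e3 : ∫ t, (inner ℝ (S t (u t)) (u t) - inner ℝ (S t (u (t - h))) (u (t - h)))
      ≤ ∫ t, 2 * inner ℝ (u t - u (t - h)) (S t (u t)) := by
    refine integral_mono_ae (i1.sub i2) (i4.const_mul 2) ?_
    filter_upwards [hS.symm, hS.coercive] with t h1 h2
    have h3 := h2 (u t - u (t - h))
    have h4 : 0 ≤ inner ℝ (S t (u t - u (t - h))) (u t - u (t - h)) :=
      le_trans (by positivity) h3
    simp only [map_sub, inner_sub_left, inner_sub_right] at h4 ⊢
    have h5 := h1 (u t) (u (t - h))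
    have h6 := h1 (u (t - h)) (u t)
    have h7 := h1 (u t) (u t)
    have h8 := real_inner_comm (u t) (S t (u (t - h)))
    linarith
  rw [integral_sub i1 i2, integral_const_mul, e1] at e3
  linarith

variable [CompleteSpace E]

/-- Solvability of the evolution equation with the time derivative replaced by a backward
difference, on the whole real line. -/
theorem IsSymmetrizer.exists_backward_solution {S A : ℝ → E →L[ℝ] E} {σ L B BA κ γ : ℝ}
    (hS : IsSymmetrizer S σ L B) (hσ : 0 < σ) (hA : AEStronglyMeasurable A volume)
    (hBA : ∀ᵐ t, ‖A t‖ ≤ BA) (hγ0 : 0 ≤ γ)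
    (hAS : ∀ᵐ t, ∀ x, inner ℝ (A t x) (S t x) ≤ κ * ‖x‖ ^ 2) (hγ : L / 2 + κ < γ * σ)
    {h : ℝ} (hh : 0 < h) {f : ℝ → E} (hf : MemLp f 2 volume) :
    ∃ u : ℝ → E, MemLp u 2 volume ∧
      ∀ᵐ t, h⁻¹ • (u t - u (t - h)) + γ • u t - A t (u t) = f t := by
  let τ : Lp E 2 (volume : Measure ℝ) →L[ℝ] Lp E 2 (volume : Measure ℝ) :=
    (Lp.compMeasurePreservingₗᵢ ℝ (fun t : ℝ => t - h)
      (measurePreserving_sub_right volume h)).toContinuousLinearMap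
  have hτ : ∀ u : Lp E 2 (volume : Measure ℝ), τ u =ᵐ[volume] fun t => u (t - h) := fun u =>
    Lp.coeFn_compMeasurePreserving u (measurePreserving_sub_right volume h)
  let M : ∀ R : ℝ → E →L[ℝ] E, MemLp R ∞ (volume : Measure ℝ) →
      (Lp E 2 (volume : Measure ℝ) →L[ℝ] Lp E 2 (volume : Measure ℝ)) := fun R hR =>
    (ContinuousLinearMap.id ℝ (E →L[ℝ] E)).holderL volume ∞ 2 2 hR.toLp
  have hM : ∀ R (hR : MemLp R ∞ (volume : Measure ℝ)) (u : Lp E 2 (volume : Measure ℝ)),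
      M R hR u =ᵐ[volume] fun t => R t (u t) := fun R hR u => by
    filter_upwards [(ContinuousLinearMap.id ℝ (E →L[ℝ] E)).coeFn_holder (r := 2) hR.toLp u,
      hR.coeFn_toLp] with t h1 h2
    have h3 : M R hR u t = (ContinuousLinearMap.id ℝ (E →L[ℝ] E)) (hR.toLp R t) (u t) := h1
    rw [h3, h2]
    rfl
  have hAm := memLp_top_of_bound hA BA hBA
  have hSm := memLp_top_of_bound hS.meas B hS.bound
  let T : Lp E 2 (volume : Measure ℝ) →L[ℝ] Lp E 2 (volume : Measure ℝ) :=
    h⁻¹ • (ContinuousLinearMap.id ℝ _ - τ) + γ • ContinuousLinearMap.id ℝ _ - M A hAm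
  have hT : ∀ u : Lp E 2 (volume : Measure ℝ),
      T u =ᵐ[volume] fun t => h⁻¹ • (u t - u (t - h)) + γ • u t - A t (u t) := fun u => by
    have e : T u = h⁻¹ • (u - τ u) + γ • u - M A hAm u := rfl
    rw [e]
    filter_upwards [Lp.coeFn_sub (h⁻¹ • (u - τ u) + γ • u) (M A hAm u),
      Lp.coeFn_add (h⁻¹ • (u - τ u)) (γ • u), Lp.coeFn_smul h⁻¹ (u - τ u), Lp.coeFn_sub u (τ u),
      Lp.coeFn_smul γ u, hτ u, hM A hAm u] with t h1 h2 h3 h4 h5 h6 h7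
    rw [h1, Pi.sub_apply, h2, Pi.add_apply, h3, Pi.smul_apply, h4, Pi.sub_apply, h5, Pi.smul_apply,
      h6, h7]
  have hnorm : ∀ u : Lp E 2 (volume : Measure ℝ), ‖u‖ ^ 2 = ∫ t, ‖u t‖ ^ 2 := fun u => by
    rw [← real_inner_self_eq_norm_sq, L2.inner_def]
    simp only [real_inner_self_eq_norm_sq]
  have hcoer : ∀ u : Lp E 2 (volume : Measure ℝ),
      (γ * σ - (L / 2 + κ)) * ‖u‖ ^ 2 ≤ inner ℝ (T u) (M S hSm u) := fun u => by
    have hu := Lp.memLp u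
    have hSu := MeasureTheory.MemLp.clm_apply hS.meas hS.bound hu
    have hAu := MeasureTheory.MemLp.clm_apply hA hBA hu
    have hus := memLp_shift hu h
    have i1 := integrable_inner_of_memLp (hu.sub hus) hSu
    have i2 := integrable_inner_of_memLp hu hSu
    have i3 := integrable_inner_of_memLp hAu hSu
    have i4 : Integrable (fun t => ‖u t‖ ^ 2) volume := hu.integrable_norm_pow (by norm_num)
    have e1 : inner ℝ (T u) (M S hSm u)
        = ∫ t, (h⁻¹ * inner ℝ (u t - u (t - h)) (S t (u t)) + γ * inner ℝ (u t) (S t (u t))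
          - inner ℝ (A t (u t)) (S t (u t))) := by
      rw [L2.inner_def]
      refine integral_congr_ae ?_
      filter_upwards [hT u, hM S hSm u] with t h1 h2
      rw [h1, h2, inner_sub_left, inner_add_left, real_inner_smul_left, real_inner_smul_left]
    have e2 := hS.le_integral_inner_sub hσ.le hu hh
    have e3 : σ * ∫ t, ‖u t‖ ^ 2 ≤ ∫ t, inner ℝ (u t) (S t (u t)) := by
      rw [← integral_const_mul]
      refine integral_mono_ae (i4.const_mul _) i2 ?_
      filter_upwards [hS.coercive] with t ht
      rw [real_inner_comm]
      exact ht (u t)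
    have e4 : ∫ t, inner ℝ (A t (u t)) (S t (u t)) ≤ κ * ∫ t, ‖u t‖ ^ 2 := by
      rw [← integral_const_mul]
      refine integral_mono_ae i3 (i4.const_mul _) ?_
      filter_upwards [hAS] with t ht using ht (u t)
    have e5 : inner ℝ (T u) (M S hSm u) = h⁻¹ * (∫ t, inner ℝ (u t - u (t - h)) (S t (u t)))
        + γ * (∫ t, inner ℝ (u t) (S t (u t))) - ∫ t, inner ℝ (A t (u t)) (S t (u t)) := by
      rw [e1]
      refine (integral_sub ((i1.const_mul _).add (i2.const_mul _)) i3).trans ?_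
      congr 1
      refine (integral_add (i1.const_mul _) (i2.const_mul _)).trans ?_
      rw [integral_const_mul, integral_const_mul]
      rfl
    have e6 := mul_le_mul_of_nonneg_left e2 (inv_nonneg.mpr hh.le)
    have e7 : h⁻¹ * (-(L * h / 2) * ∫ t, ‖u t‖ ^ 2) = -(L / 2) * ∫ t, ‖u t‖ ^ 2 := by
      field_simp
    rw [e7] at e6
    have e8 := mul_le_mul_of_nonneg_left e3 hγ0
    rw [hnorm, e5]
    linarith
  -- Lax–Milgram for the form `⟪T u, S v⟫`, coercive by `hcoer`
  let b : Lp E 2 (volume : Measure ℝ) →L[ℝ] Lp E 2 (volume : Measure ℝ) →L[ℝ] ℝ :=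
    (innerSL ℝ).bilinearComp T (M S hSm)
  have hb : IsCoercive b := by
    refine ⟨γ * σ - (L / 2 + κ), by linarith, fun u => ?_⟩
    have := hcoer u
    rw [mul_assoc, ← sq]
    exact this
  let ℓ := hb.continuousLinearEquivOfBilin.symm
    ((InnerProductSpace.toDual ℝ (Lp E 2 (volume : Measure ℝ))).symm
      ((innerSL ℝ (hf.toLp f)).comp (M S hSm)))
  have hℓ : ∀ v, inner ℝ (T ℓ) (M S hSm v) = inner ℝ (hf.toLp f) (M S hSm v) := fun v => by
    have h1 : b ℓ v = inner ℝ (hb.continuousLinearEquivOfBilin ℓ) v :=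
      (hb.continuousLinearEquivOfBilin_apply ℓ v).symm
    rw [ContinuousLinearEquiv.apply_symm_apply, InnerProductSpace.toDual_symm_apply] at h1
    exact h1
  -- `S` is positive, hence the test elements `S v` separate points
  have hfin : T ℓ = hf.toLp f := by
    set r := T ℓ - hf.toLp f with hr
    have h1 : inner ℝ r (M S hSm r) = 0 := by
      rw [hr, inner_sub_left, ← hr, hℓ, sub_self]
    have h2 : σ * ‖r‖ ^ 2 ≤ inner ℝ r (M S hSm r) := by
      rw [L2.inner_def, hnorm, ← integral_const_mul]
      refine integral_mono_ae (((Lp.memLp r).integrable_norm_pow (by norm_num)).const_mul _)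
        (L2.integrable_inner r _) ?_
      filter_upwards [hS.coercive, hM S hSm r] with t h1 h2
      rw [h2, real_inner_comm]
      exact h1 (r t)
    rw [h1] at h2
    have h3 : ‖r‖ ^ 2 ≤ 0 := by
      by_contra hcon
      push Not at hcon
      nlinarith
    have h4 : ‖r‖ = 0 := by nlinarith [norm_nonneg r]
    exact sub_eq_zero.mp (norm_eq_zero.mp h4)
  refine ⟨ℓ, Lp.memLp ℓ, ?_⟩
  filter_upwards [hT ℓ, hf.coeFn_toLp] with t h1 h2
  rw [← h1, hfin, h2]

end Abstract

/-! ### The truncated system -/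

/-- What the hypotheses on the basic state `φ₀` give for its Fourier coefficients `c t n`: bounds
from the `H⁵` norm, coercivity of every truncation of the multiplication by `μ - 2 ∂ₓ ℍ[φ₀]` from
the stability condition, and Lipschitz continuity in time from the bound on `φ₀ₜ`. -/
structure StateCoef (c : ℝ → ℤ → ℂ) (μ δ A L : ℝ) : Prop where
  meas : ∀ n, AEStronglyMeasurable (fun t => c t n) volume
  herm : ∀ t n, c t (-n) = (starRingEnd ℂ) (c t n)
  bound : ∀ᵐ t, ∀ n, wt n ^ 5 * ‖c t n‖ ≤ A
  stable : ∀ᵐ t, ∀ (K : Finset ℤ) (x : ℤ → ℂ),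
    δ / 2 * ∑ k ∈ K, ‖x k‖ ^ 2 ≤ ∑ k ∈ K, ((starRingEnd ℂ) (x k) * princ μ (c t) K x k).re
  lipschitz : ∀ h, 0 < h → ∀ᵐ t, ∀ F : Finset ℤ, ∑ n ∈ F, |(n : ℝ)| * ‖c (t + h) n - c t n‖ ≤ L * h

/-- In finite dimension, a strongly bounded measurable family of operators is bounded and measurable
in norm. -/
theorem memLp_top_clm {E F : Type*} [NormedAddCommGroup E] [InnerProductSpace ℝ E]
    [FiniteDimensional ℝ E] [NormedAddCommGroup F] [NormedSpace ℝ F] {T : ℝ → E →L[ℝ] F}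
    (h : ∀ x, MemLp (fun t => T t x) ∞ volume) : MemLp T ∞ volume := by
  have e : T = fun t => ∑ i, (ContinuousLinearMap.smulRightL ℝ E F
      (innerSL ℝ (stdOrthonormalBasis ℝ E i))) (T t (stdOrthonormalBasis ℝ E i)) := by
    funext t
    ext x
    rw [sum_apply]
    conv_lhs => rw [← (stdOrthonormalBasis ℝ E).sum_repr' x]
    rw [map_sum]
    refine Finset.sum_congr rfl fun i _ => ?_
    rw [map_smul]
    rfl
  rw [e]
  refine memLp_finsetSum _ (f := fun i t => (ContinuousLinearMap.smulRightL ℝ E F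
      (innerSL ℝ (stdOrthonormalBasis ℝ E i))) (T t (stdOrthonormalBasis ℝ E i))) fun i _ => ?_
  exact ContinuousLinearMap.comp_memLp' (ContinuousLinearMap.smulRightL ℝ E F
      (innerSL ℝ (stdOrthonormalBasis ℝ E i))) (h (stdOrthonormalBasis ℝ E i))

theorem MeasureTheory.MemLp.exists_bound {F : Type*} [NormedAddCommGroup F] {T : ℝ → F}
    (h : MemLp T ∞ volume) : ∃ B : ℝ, ∀ᵐ t, ‖T t‖ ≤ B := by
  refine ⟨(eLpNorm T ∞ volume).toReal, ?_⟩
  filter_upwards [ae_le_eLpNormEssSup (f := T) (μ := volume)] with t ht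
  rw [← eLpNorm_exponent_top] at ht
  have := ENNReal.toReal_mono h.eLpNorm_ne_top ht
  simpa using this

/-- The state space of the truncated system: pairs of families of Fourier coefficients indexed by
the frequencies in `K`. -/
abbrev FreqSpace (K : Finset ℤ) := EuclideanSpace ℂ (K ⊕ K)

namespace FreqSpace

variable {K : Finset ℤ}

/-- The element of `FreqSpace K` with the given coefficients. -/
noncomputable def mk (K : Finset ℤ) (v w : ℤ → ℂ) : FreqSpace K :=
  WithLp.toLp 2 (Sum.elim (fun k : K => v k) (fun k : K => w k))

/-- The first family of coefficients, extended by zero. -/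
noncomputable def fst (U : FreqSpace K) (k : ℤ) : ℂ :=
  if h : k ∈ K then U (Sum.inl ⟨k, h⟩) else 0

/-- The second family of coefficients, extended by zero. -/
noncomputable def snd (U : FreqSpace K) (k : ℤ) : ℂ :=
  if h : k ∈ K then U (Sum.inr ⟨k, h⟩) else 0

@[simp] theorem mk_inl (v w : ℤ → ℂ) (k : K) : mk K v w (Sum.inl k) = v k := rfl

@[simp] theorem mk_inr (v w : ℤ → ℂ) (k : K) : mk K v w (Sum.inr k) = w k := rfl

theorem mk_fst_snd (U : FreqSpace K) : mk K U.fst U.snd = U := by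
  ext i
  rcases i with k | k
  · simp [fst]
  · simp [snd]

theorem mk_congr {v w v' w' : ℤ → ℂ} (hv : ∀ k ∈ K, v k = v' k) (hw : ∀ k ∈ K, w k = w' k) :
    mk K v w = mk K v' w' := by
  ext i
  rcases i with k | k
  · simpa using hv k k.2
  · simpa using hw k k.2

theorem fst_mk {v w : ℤ → ℂ} {k : ℤ} (hk : k ∈ K) : (mk K v w).fst k = v k := by simp [fst, hk]

theorem snd_mk {v w : ℤ → ℂ} {k : ℤ} (hk : k ∈ K) : (mk K v w).snd k = w k := by simp [snd, hk]

theorem inner_mk (v w v' w' : ℤ → ℂ) : inner ℝ (mk K v w) (mk K v' w')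
    = ∑ k ∈ K, ((starRingEnd ℂ) (v k) * v' k + (starRingEnd ℂ) (w k) * w' k).re := by
  rw [PiLp.inner_apply, Fintype.sum_sum_type]
  simp only [mk_inl, mk_inr, Complex.inner, Complex.add_re]
  rw [Finset.sum_add_distrib, ← Finset.sum_coe_sort K, ← Finset.sum_coe_sort K]
  simp only [mul_comm]

theorem norm_sq_mk (v w : ℤ → ℂ) :
    ‖mk K v w‖ ^ 2 = ∑ k ∈ K, ‖v k‖ ^ 2 + ∑ k ∈ K, ‖w k‖ ^ 2 := by
  rw [← real_inner_self_eq_norm_sq, inner_mk, ← Finset.sum_add_distrib]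
  refine Finset.sum_congr rfl fun k _ => ?_
  rw [Complex.add_re, ← Complex.normSq_eq_conj_mul_self, ← Complex.normSq_eq_conj_mul_self,
    Complex.ofReal_re, Complex.ofReal_re, Complex.normSq_eq_norm_sq, Complex.normSq_eq_norm_sq]

theorem mk_add (v w v' w' : ℤ → ℂ) :
    mk K (fun k => v k + v' k) (fun k => w k + w' k) = mk K v w + mk K v' w' := by
  ext i; rcases i with k | k <;> simp

theorem mk_sub (v w v' w' : ℤ → ℂ) :
    mk K (fun k => v k - v' k) (fun k => w k - w' k) = mk K v w - mk K v' w' := by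
  ext i; rcases i with k | k <;> simp

theorem mk_smul (a : ℝ) (v w : ℤ → ℂ) :
    mk K (fun k => a * v k) (fun k => a * w k) = a • mk K v w := by
  ext i; rcases i with k | k <;> simp

theorem fst_add (U V : FreqSpace K) (k : ℤ) : (U + V).fst k = U.fst k + V.fst k := by
  simp only [fst]; split_ifs <;> simp

theorem snd_add (U V : FreqSpace K) (k : ℤ) : (U + V).snd k = U.snd k + V.snd k := by
  simp only [snd]; split_ifs <;> simp

theorem fst_smul (a : ℝ) (U : FreqSpace K) (k : ℤ) : (a • U).fst k = a * U.fst k := by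
  simp only [fst]; split_ifs <;> simp

theorem snd_smul (a : ℝ) (U : FreqSpace K) (k : ℤ) : (a • U).snd k = a * U.snd k := by
  simp only [snd]; split_ifs <;> simp

theorem memLp_mk {v w : ℤ → ℝ → ℂ} {p : ℝ≥0∞} (hv : ∀ k ∈ K, MemLp (v k) p volume)
    (hw : ∀ k ∈ K, MemLp (w k) p volume) :
    MemLp (fun t => mk K (fun k => v k t) (fun k => w k t)) p volume := by
  refine MemLp.of_eval_piLp fun i => ?_
  rcases i with k | k
  · exact hv k k.2
  · exact hw k k.2

theorem memLp_fst {U : ℝ → FreqSpace K} {p : ℝ≥0∞} (hU : MemLp U p volume) (k : ℤ) :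
    MemLp (fun t => (U t).fst k) p volume := by
  by_cases hk : k ∈ K
  · simp only [fst, hk, dif_pos]
    exact hU.eval_piLp _
  · simp only [fst, hk]
    exact MemLp.zero

theorem memLp_snd {U : ℝ → FreqSpace K} {p : ℝ≥0∞} (hU : MemLp U p volume) (k : ℤ) :
    MemLp (fun t => (U t).snd k) p volume := by
  by_cases hk : k ∈ K
  · simp only [snd, hk, dif_pos]
    exact hU.eval_piLp _
  · simp only [snd, hk]
    exact MemLp.zero

end FreqSpace

theorem princ_add (μ : ℝ) (c : ℤ → ℂ) (K : Finset ℤ) (x y : ℤ → ℂ) (k : ℤ) :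
    princ μ c K (fun j => x j + y j) k = princ μ c K x k + princ μ c K y k := by
  simp only [princ, mul_add, Finset.sum_add_distrib]
  ring

theorem princ_smul (μ : ℝ) (c : ℤ → ℂ) (K : Finset ℤ) (a : ℂ) (x : ℤ → ℂ) (k : ℤ) :
    princ μ c K (fun j => a * x j) k = a * princ μ c K x k := by
  simp only [princ, mul_sub, Finset.mul_sum]
  congr 1
  · ring
  · exact Finset.sum_congr rfl fun _ _ => by ring

theorem trFlux_add (μ : ℝ) (c : ℤ → ℂ) (K : Finset ℤ) (x y : ℤ → ℂ) (k : ℤ) :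
    trFlux μ c K (fun j => x j + y j) k = trFlux μ c K x k + trFlux μ c K y k := by
  simp only [trFlux, mul_add, Finset.sum_add_distrib]
  ring

theorem trFlux_smul (μ : ℝ) (c : ℤ → ℂ) (K : Finset ℤ) (a : ℂ) (x : ℤ → ℂ) (k : ℤ) :
    trFlux μ c K (fun j => a * x j) k = a * trFlux μ c K x k := by
  simp only [trFlux, mul_sub, Finset.mul_sum]
  congr 1
  · ring
  · exact Finset.sum_congr rfl fun _ _ => by ring

theorem princ_congr {μ : ℝ} {c : ℤ → ℂ} {K : Finset ℤ} {x y : ℤ → ℂ} (h : ∀ k ∈ K, x k = y k)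
    {k : ℤ} (hk : k ∈ K) : princ μ c K x k = princ μ c K y k := by
  rw [princ, princ, h k hk]
  congr 2
  exact Finset.sum_congr rfl fun j hj => by rw [h j hj]

/-- The symmetrizer of the truncated system. -/
noncomputable def symmOp (μ : ℝ) (c : ℤ → ℂ) (K : Finset ℤ) : FreqSpace K →L[ℝ] FreqSpace K :=
  LinearMap.toContinuousLinearMap
    { toFun := fun U => FreqSpace.mk K U.fst (princ μ c K U.snd)
      map_add' := fun U V => by
        rw [← FreqSpace.mk_add]
        refine FreqSpace.mk_congr (fun k _ => FreqSpace.fst_add U V k) fun k _ => ?_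
        rw [← princ_add]
        congr 1
        funext j
        exact FreqSpace.snd_add U V j
      map_smul' := fun a U => by
        rw [RingHom.id_apply, ← FreqSpace.mk_smul]
        refine FreqSpace.mk_congr (fun k _ => FreqSpace.fst_smul a U k) fun k _ => ?_
        rw [← princ_smul]
        congr 1
        funext j
        exact FreqSpace.snd_smul a U j }

/-- The right-hand side of the truncated system, `(v, w) ↦ (∂ₓ(μ w + flux), ∂ₓ v)`. -/
noncomputable def systemOp (μ : ℝ) (c : ℤ → ℂ) (K : Finset ℤ) : FreqSpace K →L[ℝ] FreqSpace K :=
  LinearMap.toContinuousLinearMap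
    { toFun := fun U => FreqSpace.mk K (fun k => Complex.I * k * trFlux μ c K U.snd k)
        (fun k => Complex.I * k * U.fst k)
      map_add' := fun U V => by
        rw [← FreqSpace.mk_add]
        refine FreqSpace.mk_congr (fun k _ => ?_) fun k _ => ?_
        · rw [← mul_add, ← trFlux_add]
          congr 2
          funext j
          exact FreqSpace.snd_add U V j
        · rw [FreqSpace.fst_add, mul_add]
      map_smul' := fun a U => by
        rw [RingHom.id_apply, ← FreqSpace.mk_smul]
        refine FreqSpace.mk_congr (fun k _ => ?_) fun k _ => ?_
        · rw [mul_left_comm (a : ℂ), ← trFlux_smul μ c K (a : ℂ)]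
          congr 2
          funext j
          exact FreqSpace.snd_smul a U j
        · rw [FreqSpace.fst_smul, mul_left_comm] }

theorem symmOp_mk (μ : ℝ) (c : ℤ → ℂ) (K : Finset ℤ) (v w : ℤ → ℂ) :
    symmOp μ c K (FreqSpace.mk K v w) = FreqSpace.mk K v (princ μ c K w) :=
  FreqSpace.mk_congr (fun _ hk => FreqSpace.fst_mk hk)
    fun _ hk => princ_congr (fun _ hj => FreqSpace.snd_mk hj) hk

theorem systemOp_apply (μ : ℝ) (c : ℤ → ℂ) (K : Finset ℤ) (U : FreqSpace K) :
    systemOp μ c K U = FreqSpace.mk K (fun k => Complex.I * k * trFlux μ c K U.snd k)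
        (fun k => Complex.I * k * U.fst k) := rfl

/-- The positivity constant of the symmetrizer. -/
noncomputable def symmConst (δ : ℝ) : ℝ := min 1 (δ / 2)

section StateCoef

variable {c : ℝ → ℤ → ℂ} {μ δ A L : ℝ}

theorem StateCoef.nonneg (hc : StateCoef c μ δ A L) : 0 ≤ A := by
  obtain ⟨t, ht⟩ := hc.bound.exists
  exact le_trans (by have := wt_pos 0; positivity) (ht 0)

theorem StateCoef.memLp_top (hc : StateCoef c μ δ A L) (n : ℤ) :
    MemLp (fun t => c t n) ∞ volume := by
  refine memLp_top_of_bound (hc.meas n) A ?_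
  filter_upwards [hc.bound] with t ht
  refine le_trans ?_ (ht n)
  exact le_mul_of_one_le_left (norm_nonneg _) (one_le_pow₀ (one_le_wt n))

theorem StateCoef.memLp_top_princ (hc : StateCoef c μ δ A L) (K : Finset ℤ) (x : ℤ → ℂ) (k : ℤ) :
    MemLp (fun t => princ μ (c t) K x k) ∞ volume := by
  refine (memLp_top_const (μ * x k : ℂ)).sub (MemLp.const_mul (memLp_finsetSum K
    (f := fun j t => ((|((k - j : ℤ) : ℝ)| : ℝ) : ℂ) * c t (k - j) * x j) fun j _ => ?_) _)
  exact ((hc.memLp_top (k - j)).const_mul _).mul_const _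

theorem StateCoef.memLp_top_trFlux (hc : StateCoef c μ δ A L) (K : Finset ℤ) (x : ℤ → ℂ) (k : ℤ) :
    MemLp (fun t => trFlux μ (c t) K x k) ∞ volume := by
  refine (memLp_top_const (μ * x k : ℂ)).sub (MemLp.const_mul (memLp_finsetSum K
    (f := fun j t => (fluxKernel k j : ℂ) * c t (k - j) * x j) fun j _ => ?_) _)
  exact ((hc.memLp_top (k - j)).const_mul _).mul_const _

theorem StateCoef.memLp_top_symmOp (hc : StateCoef c μ δ A L) (K : Finset ℤ) :
    MemLp (fun t => symmOp μ (c t) K) ∞ volume :=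
  memLp_top_clm fun U => FreqSpace.memLp_mk (v := fun k _ => U.fst k)
    (w := fun k t => princ μ (c t) K U.snd k) (fun _ _ => memLp_top_const _)
    (fun k _ => hc.memLp_top_princ K _ k)

theorem StateCoef.memLp_top_systemOp (hc : StateCoef c μ δ A L) (K : Finset ℤ) :
    MemLp (fun t => systemOp μ (c t) K) ∞ volume :=
  memLp_top_clm fun U => FreqSpace.memLp_mk
    (v := fun k t => Complex.I * k * trFlux μ (c t) K U.snd k)
    (w := fun k _ => Complex.I * k * U.fst k)
    (fun k _ => (hc.memLp_top_trFlux K U.snd k).const_mul _) (fun _ _ => memLp_top_const _)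

/-- The operator `diag(1, μ - 2 ∂ₓ ℍ[φ₀])` symmetrizes the truncated system. -/
theorem StateCoef.exists_isSymmetrizer (hc : StateCoef c μ δ A L) (K : Finset ℤ) (hL : 0 ≤ L) :
    ∃ B, IsSymmetrizer (fun t => symmOp μ (c t) K) (symmConst δ) (π⁻¹ * L) B := by
  obtain ⟨B, hB⟩ := (hc.memLp_top_symmOp K).exists_bound
  refine ⟨B, (hc.memLp_top_symmOp K).1, hB, ?_, ?_, ?_⟩
  · refine ae_of_all _ fun t U V => ?_
    rw [← U.mk_fst_snd, ← V.mk_fst_snd, symmOp_mk, symmOp_mk, FreqSpace.inner_mk,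
      FreqSpace.inner_mk]
    simp only [Complex.add_re, Finset.sum_add_distrib]
    congr 1
    rw [sum_conj_mul_princ (hc.herm t)]
    refine Finset.sum_congr rfl fun k _ => ?_
    rw [← Complex.conj_re]
    simp [mul_comm]
  · filter_upwards [hc.stable] with t ht U
    rw [← U.mk_fst_snd, symmOp_mk, FreqSpace.norm_sq_mk, real_inner_comm, FreqSpace.inner_mk]
    simp only [Complex.add_re, Finset.sum_add_distrib]
    rw [mul_add]
    have h1 : 0 ≤ ∑ k ∈ K, ‖U.fst k‖ ^ 2 := Finset.sum_nonneg fun _ _ => sq_nonneg _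
    have h2 : 0 ≤ ∑ k ∈ K, ‖U.snd k‖ ^ 2 := Finset.sum_nonneg fun _ _ => sq_nonneg _
    refine add_le_add ?_ ?_
    · refine (mul_le_of_le_one_left h1 (min_le_left _ _)).trans_eq
        (Finset.sum_congr rfl fun k _ => ?_)
      rw [← Complex.normSq_eq_conj_mul_self, Complex.ofReal_re, Complex.normSq_eq_norm_sq]
    · exact (mul_le_mul_of_nonneg_right (min_le_right _ _) h2).trans (ht K U.snd)
  · intro h hh
    filter_upwards [hc.lipschitz h hh] with t ht U
    rw [← U.mk_fst_snd, symmOp_mk, symmOp_mk, FreqSpace.norm_sq_mk, real_inner_comm,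
      FreqSpace.inner_mk, real_inner_comm, FreqSpace.inner_mk]
    simp only [Complex.add_re, Finset.sum_add_distrib]
    have h1 : 0 ≤ ∑ k ∈ K, ‖U.fst k‖ ^ 2 := Finset.sum_nonneg fun _ _ => sq_nonneg _
    have h2 := sum_conj_mul_princ_sub_le ht μ K U.snd
    have h3 : 0 ≤ π⁻¹ * L * h * ∑ k ∈ K, ‖U.fst k‖ ^ 2 := by
      have := Real.pi_pos
      positivity
    rw [mul_add]
    linarith

/-- The energy identity relates the pairing with the symmetrizer to the energy rate. -/
theorem inner_systemOp_weighted (c : ℤ → ℂ) (K : Finset ℤ) (m : ℕ) (v w F G : ℤ → ℂ) :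
    inner ℝ (FreqSpace.mk K (fun k => wt k ^ m * (Complex.I * k * trFlux μ c K w k + F k))
        (fun k => wt k ^ m * (Complex.I * k * v k + G k)))
      (symmOp μ c K (FreqSpace.mk K (fun k => wt k ^ m * v k) (fun k => wt k ^ m * w k)))
    = energyRate μ c K m v w + ∑ k ∈ K, ((starRingEnd ℂ) (wt k ^ m * v k) * (wt k ^ m * F k)
        + (starRingEnd ℂ) (princ μ c K (fun j => wt j ^ m * w j) k) * (wt k ^ m * G k)).re := by
  rw [symmOp_mk, real_inner_comm, FreqSpace.inner_mk, energyRate, ← Finset.sum_add_distrib]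
  refine Finset.sum_congr rfl fun k _ => ?_
  rw [← Complex.add_re]
  congr 1
  ring

/-- The growth rate of the energy allowed by the commutators at the levels `m ≤ 2`. -/
noncomputable def rateConst (A : ℝ) (m : ℕ) : ℝ := π⁻¹ * commConst m * (A * wtSum)

theorem energyRate_le_rateConst {c : ℤ → ℂ} (hc : ∀ n, wt n ^ 5 * ‖c n‖ ≤ A) {m : ℕ} (hm : m ≤ 2)
    {K : Finset ℤ} (hK : 0 ∉ K) (v w : ℤ → ℂ) :
    energyRate μ c K m v w ≤ rateConst A m *
      (∑ k ∈ K, (wt k ^ m * ‖v k‖) ^ 2 + ∑ k ∈ K, (wt k ^ m * ‖w k‖) ^ 2) := by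
  rw [rateConst, mul_assoc]
  exact energyRate_le_of_le_two hc hm hK v w

/-- The truncated system with a backward difference in time is solvable. -/
theorem StateCoef.exists_truncated_solution (hc : StateCoef c μ δ A L) (hL : 0 ≤ L) (hδ : 0 < δ)
    {K : Finset ℤ} (hK : 0 ∉ K) {γ : ℝ} (hγ0 : 0 ≤ γ)
    (hγ : π⁻¹ * L / 2 + rateConst A 0 < γ * symmConst δ) {h : ℝ} (hh : 0 < h) {g : ℤ → ℝ → ℂ}
    (hg : ∀ k, MemLp (g k) 2 volume) :
    ∃ v w : ℤ → ℝ → ℂ, (∀ k, MemLp (v k) 2 volume) ∧ (∀ k, MemLp (w k) 2 volume) ∧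
      (∀ k, k ∉ K → v k = 0 ∧ w k = 0) ∧ ∀ᵐ t, ∀ k ∈ K,
        (h⁻¹ : ℝ) * (v k t - v k (t - h)) + γ * v k t
          = Complex.I * k * trFlux μ (c t) K (fun j => w j t) k + g k t ∧
        (h⁻¹ : ℝ) * (w k t - w k (t - h)) + γ * w k t = Complex.I * k * v k t := by
  obtain ⟨B, hS⟩ := hc.exists_isSymmetrizer K hL
  obtain ⟨BA, hBA⟩ := (hc.memLp_top_systemOp K).exists_bound
  have hσ : 0 < symmConst δ := lt_min one_pos (by linarith)
  have hAS : ∀ᵐ t, ∀ U, inner ℝ (systemOp μ (c t) K U) (symmOp μ (c t) K U)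
      ≤ rateConst A 0 * ‖U‖ ^ 2 := by
    filter_upwards [hc.bound] with t ht U
    have h1 := energyRate_le_rateConst (μ := μ) ht (m := 0) (by norm_num) hK U.fst U.snd
    have h2 := inner_systemOp_weighted (μ := μ) (c t) K 0 U.fst U.snd 0 0
    simp only [pow_zero, one_mul, Pi.zero_apply, add_zero, mul_zero, Complex.zero_re,
      Finset.sum_const_zero] at h1 h2
    rw [← FreqSpace.norm_sq_mk, FreqSpace.mk_fst_snd] at h1
    rw [FreqSpace.mk_fst_snd] at h2
    rw [systemOp_apply, h2]
    exact h1
  have hgm : MemLp (fun t => FreqSpace.mk K (fun k => g k t) (fun _ => 0)) 2 volume :=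
    FreqSpace.memLp_mk (w := fun _ _ => 0) (fun k _ => hg k) (fun _ _ => MemLp.zero)
  obtain ⟨u, hu, hsol⟩ := hS.exists_backward_solution hσ (hc.memLp_top_systemOp K).1 hBA hγ0 hAS hγ
    hh hgm
  refine ⟨fun k t => (u t).fst k, fun k t => (u t).snd k, FreqSpace.memLp_fst hu,
    FreqSpace.memLp_snd hu, fun k hk => ⟨?_, ?_⟩, ?_⟩
  · funext t; simp [FreqSpace.fst, hk]
  · funext t; simp [FreqSpace.snd, hk]
  · filter_upwards [hsol] with t ht k hk
    rw [sub_eq_iff_eq_add, systemOp_apply, ← FreqSpace.mk_add] at ht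
    have h1 := congrArg (fun U : FreqSpace K => U.fst k) ht
    have h2 := congrArg (fun U : FreqSpace K => U.snd k) ht
    simp only [FreqSpace.fst_add, FreqSpace.snd_add, FreqSpace.fst_smul, FreqSpace.snd_smul,
      FreqSpace.fst_mk hk, FreqSpace.snd_mk hk, sub_eq_add_neg, zero_add] at h1 h2
    rw [← neg_one_smul ℝ (u (t + -h)), FreqSpace.fst_smul] at h1
    rw [← neg_one_smul ℝ (u (t + -h)), FreqSpace.snd_smul] at h2
    refine ⟨?_, ?_⟩
    · rw [← sub_eq_add_neg] at h1
      rw [add_comm (Complex.I * k * _), ← h1]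
      push_cast
      ring
    · rw [← sub_eq_add_neg] at h2
      rw [← h2]
      push_cast
      ring

/-- The energy inequality of level `m` for the truncated system with residuals `F`, `G`. -/
theorem StateCoef.energy_inequality (hc : StateCoef c μ δ A L) (hL : 0 ≤ L) (hδ : 0 < δ)
    {K : Finset ℤ} (m : ℕ) {γ : ℝ} (hγ0 : 0 ≤ γ) {h : ℝ} (hh : 0 < h) {v w F G : ℤ → ℝ → ℂ}
    (hv : ∀ k, MemLp (v k) 2 volume) (hw : ∀ k, MemLp (w k) 2 volume)
    (hsol : ∀ᵐ t, ∀ k ∈ K, (h⁻¹ : ℝ) * (v k t - v k (t - h)) + γ * v k t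
          = Complex.I * k * trFlux μ (c t) K (fun j => w j t) k + F k t ∧
        (h⁻¹ : ℝ) * (w k t - w k (t - h)) + γ * w k t = Complex.I * k * v k t + G k t) :
    Integrable (fun t => energyRate μ (c t) K m (fun k => v k t) (fun k => w k t)
        + ∑ k ∈ K, ((starRingEnd ℂ) (wt k ^ m * v k t) * (wt k ^ m * F k t)
        + (starRingEnd ℂ) (princ μ (c t) K (fun j => wt j ^ m * w j t) k) * (wt k ^ m * G k t)).re)
      volume ∧
    (γ * symmConst δ - π⁻¹ * L / 2) * ∫ t, (∑ k ∈ K, (wt k ^ m * ‖v k t‖) ^ 2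
        + ∑ k ∈ K, (wt k ^ m * ‖w k t‖) ^ 2)
      ≤ ∫ t, (energyRate μ (c t) K m (fun k => v k t) (fun k => w k t)
        + ∑ k ∈ K, ((starRingEnd ℂ) (wt k ^ m * v k t) * (wt k ^ m * F k t)
        + (starRingEnd ℂ) (princ μ (c t) K (fun j => wt j ^ m * w j t) k)
          * (wt k ^ m * G k t)).re) := by
  obtain ⟨B, hS⟩ := hc.exists_isSymmetrizer K hL
  have hσ : 0 < symmConst δ := lt_min one_pos (by linarith)
  set u : ℝ → FreqSpace K := fun t =>
    FreqSpace.mk K (fun k => wt k ^ m * v k t) (fun k => wt k ^ m * w k t) with hu_def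
  have hu : MemLp u 2 volume := FreqSpace.memLp_mk (v := fun k t => wt k ^ m * v k t)
    (w := fun k t => wt k ^ m * w k t) (fun k _ => (hv k).const_mul _)
    (fun k _ => (hw k).const_mul _)
  have hus := memLp_shift hu h
  have hSu := MeasureTheory.MemLp.clm_apply hS.meas hS.bound hu
  have i1 := integrable_inner_of_memLp (hu.sub hus) hSu
  have i2 := integrable_inner_of_memLp hu hSu
  have i4 : Integrable (fun t => ‖u t‖ ^ 2) volume := hu.integrable_norm_pow (by norm_num)
  have hnorm : ∀ t, ‖u t‖ ^ 2 = ∑ k ∈ K, (wt k ^ m * ‖v k t‖) ^ 2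
      + ∑ k ∈ K, (wt k ^ m * ‖w k t‖) ^ 2 := fun t => by
    rw [hu_def, FreqSpace.norm_sq_mk]
    simp only [norm_mul, norm_pow, Complex.norm_real, Real.norm_of_nonneg (wt_pos _).le]
  have key : (fun t => h⁻¹ * inner ℝ (u t - u (t - h)) (symmOp μ (c t) K (u t))
      + γ * inner ℝ (u t) (symmOp μ (c t) K (u t))) =ᵐ[volume] fun t =>
      energyRate μ (c t) K m (fun k => v k t) (fun k => w k t)
        + ∑ k ∈ K, ((starRingEnd ℂ) (wt k ^ m * v k t) * (wt k ^ m * F k t)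
        + (starRingEnd ℂ) (princ μ (c t) K (fun j => wt j ^ m * w j t) k)
          * (wt k ^ m * G k t)).re := by
    filter_upwards [hsol] with t ht
    rw [← inner_systemOp_weighted, ← real_inner_smul_left, ← real_inner_smul_left, ← inner_add_left]
    congr 1
    rw [hu_def, ← FreqSpace.mk_sub, ← FreqSpace.mk_smul, ← FreqSpace.mk_smul, ← FreqSpace.mk_add]
    refine FreqSpace.mk_congr (fun k hk => ?_) (fun k hk => ?_)
    · rw [← (ht k hk).1]; ring
    · rw [← (ht k hk).2]; ring
  have i5 := (i1.const_mul h⁻¹).add (i2.const_mul γ)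
  refine ⟨i5.congr key, ?_⟩
  rw [← integral_congr_ae key]
  have e0 : ∫ t, (h⁻¹ * inner ℝ (u t - u (t - h)) (symmOp μ (c t) K (u t))
      + γ * inner ℝ (u t) (symmOp μ (c t) K (u t)))
      = h⁻¹ * (∫ t, inner ℝ (u t - u (t - h)) (symmOp μ (c t) K (u t)))
        + γ * ∫ t, inner ℝ (u t) (symmOp μ (c t) K (u t)) := by
    refine (integral_add (i1.const_mul _) (i2.const_mul _)).trans ?_
    rw [integral_const_mul, integral_const_mul]
    rfl
  have e2 := hS.le_integral_inner_sub hσ.le hu hh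
  have e3 : symmConst δ * ∫ t, ‖u t‖ ^ 2 ≤ ∫ t, inner ℝ (u t) (symmOp μ (c t) K (u t)) := by
    rw [← integral_const_mul]
    refine integral_mono_ae (i4.const_mul _) i2 ?_
    filter_upwards [hS.coercive] with t ht
    rw [real_inner_comm]
    exact ht (u t)
  have e6 := mul_le_mul_of_nonneg_left e2 (inv_nonneg.mpr hh.le)
  have e7 : h⁻¹ * (-(π⁻¹ * L * h / 2) * ∫ t, ‖u t‖ ^ 2) = -(π⁻¹ * L / 2) * ∫ t, ‖u t‖ ^ 2 := by
    field_simp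
  rw [e7] at e6
  have e8 := mul_le_mul_of_nonneg_left e3 hγ0
  rw [e0, ← integral_congr_ae (ae_of_all _ hnorm)]
  linarith

end StateCoef

section

open Filter Topology

/-! ### A priori estimates and weak limits -/

section StateCoef

variable {c : ℝ → ℤ → ℂ} {μ δ A L : ℝ}

theorem sum_re_conj_mul_le (K : Finset ℤ) (x y : ℤ → ℂ) :
    ∑ k ∈ K, ((starRingEnd ℂ) (x k) * y k).re ≤ √(∑ k ∈ K, ‖x k‖ ^ 2) * √(∑ k ∈ K, ‖y k‖ ^ 2) := by
  refine le_trans (Finset.sum_le_sum fun k _ => ?_) (Real.sum_mul_le_sqrt_mul_sqrt K _ _)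
  refine (Complex.re_le_norm _).trans_eq ?_
  rw [norm_mul, RCLike.norm_conj]

theorem norm_wt_pow_mul (k : ℤ) (m : ℕ) (z : ℂ) : ‖(wt k : ℂ) ^ m * z‖ = wt k ^ m * ‖z‖ := by
  rw [norm_mul, norm_pow, Complex.norm_real, Real.norm_of_nonneg (wt_pos k).le]

theorem integrable_sum_wt_sq {x : ℤ → ℝ → ℂ} (hx : ∀ k, MemLp (x k) 2 volume) (m : ℕ)
    (K : Finset ℤ) : Integrable (fun t => ∑ k ∈ K, (wt k ^ m * ‖x k t‖) ^ 2) volume := by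
  refine integrable_finsetSum _ fun k _ => ?_
  simp only [mul_pow]
  exact ((hx k).integrable_norm_pow (by norm_num)).const_mul _

/-- The a priori estimate of level `m`, uniform in the truncation and the time step. -/
theorem StateCoef.apriori_estimate (hc : StateCoef c μ δ A L) (hL : 0 ≤ L) (hδ : 0 < δ)
    {K : Finset ℤ} {m : ℕ} {κ D : ℝ} (hrate : ∀ᵐ t, ∀ v w : ℤ → ℂ, energyRate μ (c t) K m v w
      ≤ κ * (∑ k ∈ K, (wt k ^ m * ‖v k‖) ^ 2 + ∑ k ∈ K, (wt k ^ m * ‖w k‖) ^ 2)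
        + D * √(∑ k ∈ K, wt k ^ 2 * ‖w k‖ ^ 2) * √(∑ k ∈ K, (wt k ^ m * ‖v k‖) ^ 2))
    {γ : ℝ} (hγ0 : 0 < γ) (hγ : π⁻¹ * L + 2 * κ ≤ γ * symmConst δ) {h : ℝ} (hh : 0 < h)
    {v w g : ℤ → ℝ → ℂ} (hv : ∀ k, MemLp (v k) 2 volume) (hw : ∀ k, MemLp (w k) 2 volume)
    (hg : ∀ k, MemLp (g k) 2 volume)
    (hsol : ∀ᵐ t, ∀ k ∈ K, (h⁻¹ : ℝ) * (v k t - v k (t - h)) + γ * v k t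
          = Complex.I * k * trFlux μ (c t) K (fun j => w j t) k + g k t ∧
        (h⁻¹ : ℝ) * (w k t - w k (t - h)) + γ * w k t = Complex.I * k * v k t) :
    ∫ t, (∑ k ∈ K, (wt k ^ m * ‖v k t‖) ^ 2 + ∑ k ∈ K, (wt k ^ m * ‖w k t‖) ^ 2)
      ≤ 8 / (γ * symmConst δ) ^ 2 * (D ^ 2 * (∫ t, ∑ k ∈ K, (wt k ^ 1 * ‖w k t‖) ^ 2)
        + ∫ t, ∑ k ∈ K, (wt k ^ m * ‖g k t‖) ^ 2) := by
  have hσ : 0 < symmConst δ := lt_min one_pos (by linarith)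
  obtain ⟨hi, hle⟩ := hc.energy_inequality (F := g) (G := fun _ _ => 0) hL hδ m hγ0.le hh hv hw (by
    filter_upwards [hsol] with t ht k hk
    simpa using ht k hk)
  set s := γ * symmConst δ with hs
  have hs0 : 0 < s := by positivity
  have iX := (integrable_sum_wt_sq hv m K).add (integrable_sum_wt_sq hw m K)
  have iW := integrable_sum_wt_sq hw 1 K
  have iG := integrable_sum_wt_sq hg m K
  have iR := (iX.const_mul (κ + s / 4)).add (((iW.const_mul (D ^ 2)).add iG).const_mul (2 / s))
  have hle2 : ∫ t, (energyRate μ (c t) K m (fun k => v k t) (fun k => w k t)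
        + ∑ k ∈ K, ((starRingEnd ℂ) (wt k ^ m * v k t) * (wt k ^ m * g k t)
        + (starRingEnd ℂ) (princ μ (c t) K (fun j => wt j ^ m * w j t) k) * (wt k ^ m * 0)).re)
      ≤ ∫ t, ((κ + s / 4) * (∑ k ∈ K, (wt k ^ m * ‖v k t‖) ^ 2 + ∑ k ∈ K, (wt k ^ m * ‖w k t‖) ^ 2)
        + 2 / s * (D ^ 2 * (∑ k ∈ K, (wt k ^ 1 * ‖w k t‖) ^ 2)
          + ∑ k ∈ K, (wt k ^ m * ‖g k t‖) ^ 2)) := by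
    refine integral_mono_ae hi iR ?_
    filter_upwards [hrate] with t ht
    have h1 := ht (fun k => v k t) (fun k => w k t)
    have h2 := sum_re_conj_mul_le K (fun k => wt k ^ m * v k t) (fun k => wt k ^ m * g k t)
    simp only [norm_wt_pow_mul] at h2
    simp only [mul_zero, add_zero]
    set V := ∑ k ∈ K, (wt k ^ m * ‖v k t‖) ^ 2
    set W := ∑ k ∈ K, (wt k ^ m * ‖w k t‖) ^ 2
    have eW1 : ∑ k ∈ K, (wt k ^ 1 * ‖w k t‖) ^ 2 = ∑ k ∈ K, wt k ^ 2 * ‖w k t‖ ^ 2 :=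
      Finset.sum_congr rfl fun k _ => by rw [pow_one, mul_pow]
    rw [eW1]
    set W1 := ∑ k ∈ K, wt k ^ 2 * ‖w k t‖ ^ 2
    set G := ∑ k ∈ K, (wt k ^ m * ‖g k t‖) ^ 2
    have hV : 0 ≤ V := Finset.sum_nonneg fun _ _ => sq_nonneg _
    have hW : 0 ≤ W := Finset.sum_nonneg fun _ _ => sq_nonneg _
    have hW1 : 0 ≤ W1 := Finset.sum_nonneg fun _ _ => by positivity
    have hG : 0 ≤ G := Finset.sum_nonneg fun _ _ => sq_nonneg _
    -- Young's inequality with the weight `s`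
    have h3 : √V * (D * √W1 + √G) ≤ s / 4 * V + 2 / s * (D ^ 2 * W1 + G) := by
      have e1 := Real.sq_sqrt hV
      have e2 := Real.sq_sqrt hW1
      have e3 := Real.sq_sqrt hG
      have h4 : √V * (D * √W1 + √G) ≤ s / 4 * √V ^ 2 + 1 / s * (D * √W1 + √G) ^ 2 := by
        have : s / 4 * √V ^ 2 + 1 / s * (D * √W1 + √G) ^ 2 - √V * (D * √W1 + √G)
            = 1 / s * (s / 2 * √V - (D * √W1 + √G)) ^ 2 := by
          field_simp; ring
        have h5 : 0 ≤ 1 / s * (s / 2 * √V - (D * √W1 + √G)) ^ 2 := by positivity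
        linarith
      have h6 : (D * √W1 + √G) ^ 2 ≤ 2 * (D ^ 2 * W1 + G) := by
        nlinarith [sq_nonneg (D * √W1 - √G)]
      have h7 := mul_le_mul_of_nonneg_left h6 (by positivity : 0 ≤ 1 / s)
      rw [e1] at h4
      calc _ ≤ _ := h4
        _ ≤ s / 4 * V + 1 / s * (2 * (D ^ 2 * W1 + G)) := by linarith
        _ = _ := by ring
    have h8 : 0 ≤ s / 4 * W := by positivity
    nlinarith
  have e1 : ∫ t, ((κ + s / 4)
          * (∑ k ∈ K, (wt k ^ m * ‖v k t‖) ^ 2 + ∑ k ∈ K, (wt k ^ m * ‖w k t‖) ^ 2)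
        + 2 / s * (D ^ 2 * (∑ k ∈ K, (wt k ^ 1 * ‖w k t‖) ^ 2)
          + ∑ k ∈ K, (wt k ^ m * ‖g k t‖) ^ 2))
      = (κ + s / 4) * (∫ t, (∑ k ∈ K, (wt k ^ m * ‖v k t‖) ^ 2 + ∑ k ∈ K, (wt k ^ m * ‖w k t‖) ^ 2))
        + 2 / s * (D ^ 2 * (∫ t, ∑ k ∈ K, (wt k ^ 1 * ‖w k t‖) ^ 2)
          + ∫ t, ∑ k ∈ K, (wt k ^ m * ‖g k t‖) ^ 2) := by
    refine (integral_add (iX.const_mul _) (((iW.const_mul (D ^ 2)).add iG).const_mul _)).trans ?_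
    rw [integral_const_mul, integral_const_mul]
    congr 2
    refine (integral_add (iW.const_mul (D ^ 2)) iG).trans ?_
    rw [integral_const_mul]
  have h9 := hle.trans (hle2.trans_eq e1)
  set X := ∫ t, (∑ k ∈ K, (wt k ^ m * ‖v k t‖) ^ 2 + ∑ k ∈ K, (wt k ^ m * ‖w k t‖) ^ 2) with hX
  set Q := D ^ 2 * (∫ t, ∑ k ∈ K, (wt k ^ 1 * ‖w k t‖) ^ 2)
          + ∫ t, ∑ k ∈ K, (wt k ^ m * ‖g k t‖) ^ 2
  have hX0 : 0 ≤ X := integral_nonneg fun t => add_nonneg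
    (Finset.sum_nonneg fun _ _ => sq_nonneg _) (Finset.sum_nonneg fun _ _ => sq_nonneg _)
  have h10 : s / 4 * X ≤ 2 / s * Q := by nlinarith
  calc X = 4 / s * (s / 4 * X) := by field_simp
    _ ≤ 4 / s * (2 / s * Q) := mul_le_mul_of_nonneg_left h10 (by positivity)
    _ = 8 / s ^ 2 * Q := by field_simp; ring

end StateCoef

/-- Weak sequential compactness in `L²(ℝ)`, along an ultrafilter. -/
theorem exists_weak_limit {x : ℕ → ℝ → ℂ} (hx : ∀ N, MemLp (x N) 2 volume) {M : ℝ}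
    (hM : ∀ N, ∫ t, ‖x N t‖ ^ 2 ≤ M) :
    ∃ z : ℝ → ℂ, MemLp z 2 volume ∧ ∀ y : ℝ → ℂ, MemLp y 2 volume →
      Tendsto (fun N => ∫ t, y t * x N t) (hyperfilter ℕ) (𝓝 (∫ t, y t * z t)) := by
  have hxs : ∀ N, MemLp (fun t => (starRingEnd ℂ) (x N t)) 2 volume := fun N => (hx N).star
  let X : ℕ → Lp ℂ 2 (volume : Measure ℝ) := fun N => (hxs N).toLp
  have hXn : ∀ N, ‖X N‖ ≤ √M := fun N => by
    refine Real.le_sqrt_of_sq_le (le_trans (le_of_eq ?_) (hM N))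
    have h1 : ‖X N‖ ^ 2 = ∫ t, ‖X N t‖ ^ 2 := by
      have h2 := @L2.inner_def ℝ ℂ ℂ _ _ _ _ _ (X N) (X N)
      rw [inner_self_eq_norm_sq_to_K] at h2
      have h3 : ((∫ t, ‖X N t‖ ^ 2 : ℝ) : ℂ) = ∫ t, inner ℂ (X N t) (X N t) := by
        rw [← integral_complex_ofReal]
        refine integral_congr_ae (ae_of_all _ fun t => ?_)
        simp only [inner_self_eq_norm_sq_to_K]
        push_cast
        rfl
      rw [← h3] at h2
      have h4 := congrArg Complex.re h2
      rw [Complex.ofReal_re] at h4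
      rw [← h4]
      norm_cast
    rw [h1]
    refine integral_congr_ae ?_
    filter_upwards [(hxs N).coeFn_toLp] with t ht
    rw [ht, RCLike.norm_conj]
  -- Banach–Alaoglu, along an ultrafilter to avoid extracting subsequences
  let ℓ : ℕ → WeakDual ℂ (Lp ℂ 2 (volume : Measure ℝ)) := fun N =>
    StrongDual.toWeakDual (InnerProductSpace.toDual ℂ _ (X N))
  have hcomp := WeakDual.isCompact_closedBall (𝕜 := ℂ) (E := Lp ℂ 2 (volume : Measure ℝ)) 0 (√M)
  obtain ⟨a, -, ha⟩ := hcomp.ultrafilter_le_nhds' ((hyperfilter ℕ).map ℓ) (by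
    refine Filter.mem_map.mpr (Filter.univ_mem' fun N => ?_)
    simp only [Set.mem_preimage, Metric.mem_closedBall, dist_zero_right, ℓ]
    refine le_trans (le_of_eq ?_) (hXn N)
    change ‖InnerProductSpace.toDual ℂ _ (X N)‖ = _
    exact (InnerProductSpace.toDual ℂ _).norm_map (X N))
  have ha' : Tendsto ℓ (hyperfilter ℕ) (𝓝 a) := ha
  let z := (InnerProductSpace.toDual ℂ (Lp ℂ 2 (volume : Measure ℝ))).symm (WeakDual.toStrongDual a)
  refine ⟨fun t => (starRingEnd ℂ) (z t), (Lp.memLp z).star, fun y hy => ?_⟩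
  have h1 : Tendsto (fun N => ℓ N hy.toLp) (hyperfilter ℕ) (𝓝 (a hy.toLp)) :=
    ((WeakDual.eval_continuous hy.toLp).tendsto a).comp ha'
  have h2 : ∀ N, ℓ N hy.toLp = ∫ t, y t * x N t := fun N => by
    have : ℓ N hy.toLp = inner ℂ (X N) (hy.toLp) := rfl
    rw [this, L2.inner_def]
    refine integral_congr_ae ?_
    filter_upwards [(hxs N).coeFn_toLp, hy.coeFn_toLp] with t h3 h4
    rw [h3, h4, RCLike.inner_apply, Complex.conj_conj]
  have h3 : a hy.toLp = ∫ t, y t * (starRingEnd ℂ) (z t) := by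
    have : a hy.toLp = inner ℂ z hy.toLp := by
      rw [InnerProductSpace.toDual_symm_apply]; rfl
    rw [this, L2.inner_def]
    refine integral_congr_ae ?_
    filter_upwards [hy.coeFn_toLp] with t h4
    rw [h4, RCLike.inner_apply]
  simp only [h2] at h1
  rwa [h3] at h1

theorem integral_conj_mul_self {x : ℝ → ℂ} :
    ∫ t, (starRingEnd ℂ) (x t) * x t = ((∫ t, ‖x t‖ ^ 2 : ℝ) : ℂ) := by
  rw [← integral_complex_ofReal]
  refine integral_congr_ae (ae_of_all _ fun t => ?_)
  simp only
  rw [← Complex.normSq_eq_conj_mul_self, Complex.normSq_eq_norm_sq]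

theorem integrable_mul_of_memLp {x y : ℝ → ℂ} (hx : MemLp x 2 volume) (hy : MemLp y 2 volume) :
    Integrable (fun t => x t * y t) volume := hx.integrable_mul hy

theorem norm_integral_mul_le {x y : ℝ → ℂ} (hx : MemLp x 2 volume) (hy : MemLp y 2 volume) :
    ‖∫ t, x t * y t‖ ≤ ((∫ t, ‖x t‖ ^ 2) + ∫ t, ‖y t‖ ^ 2) / 2 := by
  have i1 : Integrable (fun t => ‖x t‖ ^ 2) volume := hx.integrable_norm_pow (by norm_num)
  have i2 : Integrable (fun t => ‖y t‖ ^ 2) volume := hy.integrable_norm_pow (by norm_num)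
  refine (norm_integral_le_integral_norm _).trans ?_
  rw [← integral_add i1 i2, ← integral_div]
  refine integral_mono (integrable_mul_of_memLp hx hy).norm ((i1.add i2).div_const 2) fun t => ?_
  simp only [norm_mul]
  nlinarith [sq_nonneg (‖x t‖ - ‖y t‖)]

/-- Weak lower semicontinuity of weighted sums of squared norms. -/
theorem sum_integral_sq_le_of_weak_limit {ι : Type*} {x : ι → ℕ → ℝ → ℂ} {z : ι → ℝ → ℂ}
    (hx : ∀ i N, MemLp (x i N) 2 volume) (hz : ∀ i, MemLp (z i) 2 volume)
    (hlim : ∀ i, ∀ y : ℝ → ℂ, MemLp y 2 volume →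
      Tendsto (fun N => ∫ t, y t * x i N t) (hyperfilter ℕ) (𝓝 (∫ t, y t * z i t)))
    (F : Finset ι) {a : ι → ℝ} (ha : ∀ i, 0 ≤ a i) {M : ℝ}
    (hM : ∀ᶠ N in (hyperfilter ℕ : Filter ℕ), ∑ i ∈ F, a i * ∫ t, ‖x i N t‖ ^ 2 ≤ M) :
    ∑ i ∈ F, a i * ∫ t, ‖z i t‖ ^ 2 ≤ M := by
  have hl : Tendsto (fun N => ∑ i ∈ F, a i * (∫ t, (starRingEnd ℂ) (z i t) * x i N t).re)
      (hyperfilter ℕ) (𝓝 (∑ i ∈ F, a i * ∫ t, ‖z i t‖ ^ 2)) := by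
    refine tendsto_finsetSum _ fun i _ => Tendsto.const_mul _ ?_
    have h1 := (Complex.continuous_re.tendsto _).comp (hlim i _ (hz i).star)
    have h2 : (∫ t, (starRingEnd ℂ) (z i t) * z i t).re = ∫ t, ‖z i t‖ ^ 2 := by
      rw [integral_conj_mul_self, Complex.ofReal_re]
    rw [← h2]
    exact h1
  have hle : ∀ᶠ N in (hyperfilter ℕ : Filter ℕ),
      ∑ i ∈ F, a i * (∫ t, (starRingEnd ℂ) (z i t) * x i N t).re
        ≤ (∑ i ∈ F, a i * ∫ t, ‖z i t‖ ^ 2) / 2 + M / 2 := by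
    filter_upwards [hM] with N hN
    have h3 : ∑ i ∈ F, a i * (∫ t, (starRingEnd ℂ) (z i t) * x i N t).re
        ≤ ∑ i ∈ F, a i * (((∫ t, ‖z i t‖ ^ 2) + ∫ t, ‖x i N t‖ ^ 2) / 2) := by
      refine Finset.sum_le_sum fun i _ => mul_le_mul_of_nonneg_left ?_ (ha i)
      refine (Complex.re_le_norm _).trans ((norm_integral_mul_le (hz i).star (hx i N)).trans_eq ?_)
      simp only [Pi.star_apply, norm_star]
    refine h3.trans ?_
    have h4 : ∑ i ∈ F, a i * (((∫ t, ‖z i t‖ ^ 2) + ∫ t, ‖x i N t‖ ^ 2) / 2)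
        = (∑ i ∈ F, a i * ∫ t, ‖z i t‖ ^ 2) / 2 + (∑ i ∈ F, a i * ∫ t, ‖x i N t‖ ^ 2) / 2 := by
      rw [← add_div, ← Finset.sum_add_distrib, Finset.sum_div]
      exact Finset.sum_congr rfl fun i _ => by ring
    rw [h4]
    linarith
  have := le_of_tendsto hl hle
  linarith

theorem memLp_of_test {θ : ℝ → ℝ} (hθ : Continuous θ) (hs : HasCompactSupport θ) :
    MemLp (fun t => (θ t : ℂ)) 2 volume :=
  (hθ.memLp_of_hasCompactSupport hs).ofReal

/-- The backward difference quotient converges to the derivative in the sense of distributions,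
with a rate that is uniform on bounded sets of `L²`. -/
theorem exists_norm_integral_backward_le {θ : ℝ → ℝ} (hθ : ContDiff ℝ ∞ θ)
    (hs : HasCompactSupport θ) : ∃ C : ℝ, ∀ h, 0 < h → h ≤ 1 → ∀ x : ℝ → ℂ, MemLp x 2 volume →
      ‖(∫ t, (θ t : ℂ) * ((h⁻¹ : ℝ) * (x t - x (t - h)))) + ∫ t, ((deriv θ t : ℝ) : ℂ) * x t‖
        ≤ C * h * (1 + ∫ t, ‖x t‖ ^ 2) := by
  have hd : ContDiff ℝ 1 (deriv θ) := (contDiff_infty_iff_deriv.mp hθ).2.of_le (by simp)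
  obtain ⟨Lp, hLp⟩ := hd.lipschitzWith_of_hasCompactSupport hs.deriv (by simp)
  obtain ⟨R, hR0, hR⟩ := hs.exists_pos_le_norm
  have hdiff := hθ.differentiable (by simp)
  refine ⟨(Lp : ℝ) ^ 2 * (R + 1) + 1, fun h hh hh1 x hx => ?_⟩
  have m0 := memLp_of_test hθ.continuous hs
  have m1 : MemLp (fun t => (θ (t + h) : ℂ)) 2 volume :=
    m0.comp_measurePreserving (measurePreserving_add_right volume h)
  have m2 := memLp_of_test hd.continuous hs.deriv
  have hxs := memLp_shift hx h
  have e1 : ∫ t, (θ t : ℂ) * ((h⁻¹ : ℝ) * (x t - x (t - h)))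
      = ∫ t, (h⁻¹ : ℝ) * ((θ t : ℂ) - θ (t + h)) * x t := by
    have i1 := integrable_mul_of_memLp m0 hx
    have i2 := integrable_mul_of_memLp m0 hxs
    have i3 := integrable_mul_of_memLp m1 hx
    have e2 : ∫ t, (θ t : ℂ) * x (t - h) = ∫ t, (θ (t + h) : ℂ) * x t := by
      rw [← integral_add_right_eq_self (fun t => (θ t : ℂ) * x (t - h)) h]
      simp
    have e3 : ∀ t, (θ t : ℂ) * ((h⁻¹ : ℝ) * (x t - x (t - h)))
        = (h⁻¹ : ℝ) * ((θ t : ℂ) * x t - (θ t : ℂ) * x (t - h)) := fun t => by ring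
    have e4 : ∀ t, (h⁻¹ : ℝ) * ((θ t : ℂ) - θ (t + h)) * x t
        = (h⁻¹ : ℝ) * ((θ t : ℂ) * x t - (θ (t + h) : ℂ) * x t) := fun t => by ring
    simp only [e3, e4]
    rw [integral_const_mul, integral_const_mul, integral_sub i1 i2, integral_sub i1 i3, e2]
  set ρ : ℝ → ℂ := fun t => (h⁻¹ : ℝ) * ((θ t : ℂ) - θ (t + h)) + ((deriv θ t : ℝ) : ℂ) with hρ
  have hρm : MemLp ρ 2 volume := ((m0.sub m1).const_mul _).add m2
  have e5 : (∫ t, (θ t : ℂ) * ((h⁻¹ : ℝ) * (x t - x (t - h)))) + ∫ t, ((deriv θ t : ℝ) : ℂ) * x t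
      = ∫ t, ρ t * x t := by
    rw [e1, ← integral_add]
    · refine integral_congr_ae (ae_of_all _ fun t => ?_)
      simp only [hρ]
      ring
    · exact integrable_mul_of_memLp ((m0.sub m1).const_mul _) hx
    · exact integrable_mul_of_memLp m2 hx
  -- the mean value theorem for `s ↦ θ s - s θ'(t)` on `[t, t + h]`
  have hρ1 : ∀ t, ‖ρ t‖ ≤ Lp * h := fun t => by
    have e6 : ρ t
        = ((-(h⁻¹ * ((θ (t + h) - (t + h) * deriv θ t) - (θ t - t * deriv θ t))) : ℝ) : ℂ) := by
      have hhc : (h : ℂ) ≠ 0 := Complex.ofReal_ne_zero.mpr hh.ne'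
      simp only [hρ]
      push_cast
      field_simp
      ring
    have h1 : ‖(θ (t + h) - (t + h) * deriv θ t) - (θ t - t * deriv θ t)‖
        ≤ (Lp * h) * ‖(t + h) - t‖ := by
      refine Convex.norm_image_sub_le_of_norm_hasDerivWithin_le
        (f := fun s => θ s - s * deriv θ t) (f' := fun s => deriv θ s - 1 * deriv θ t)
        (s := Set.Icc t (t + h)) (fun s hs => ?_) (fun s hs => ?_) (convex_Icc _ _) ?_ ?_
      · exact ((hdiff s).hasDerivAt.sub ((hasDerivAt_id s).mul_const _)).hasDerivWithinAt
      · have h2 := hLp.dist_le_mul s t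
        rw [Real.dist_eq, Real.dist_eq] at h2
        rw [one_mul, Real.norm_eq_abs]
        refine h2.trans (mul_le_mul_of_nonneg_left ?_ Lp.coe_nonneg)
        rw [abs_of_nonneg (by linarith [hs.1])]
        linarith [hs.2]
      · exact ⟨le_rfl, by linarith⟩
      · exact ⟨by linarith, le_rfl⟩
    rw [e6, Complex.norm_real, norm_neg, norm_mul, Real.norm_of_nonneg (inv_nonneg.mpr hh.le),
      inv_mul_le_iff₀ hh]
    refine h1.trans_eq ?_
    rw [add_sub_cancel_left, Real.norm_of_nonneg hh.le]
    ring
  have hρ2 : ∀ t, t ∉ Set.Icc (-(R + 1)) (R + 1) → ρ t = 0 := fun t ht => by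
    have h1 : R + 1 < |t| := by
      by_contra hcon
      push Not at hcon
      exact ht (abs_le.mp hcon)
    have h2 : R ≤ |t + h| := by
      have := abs_sub_abs_le_abs_sub t (-h)
      rw [abs_neg, abs_of_pos hh, sub_neg_eq_add] at this
      linarith
    have h3 : θ t = 0 := hR t (by rw [Real.norm_eq_abs]; linarith)
    have h4 : θ (t + h) = 0 := hR (t + h) (by rwa [Real.norm_eq_abs])
    have h5 : deriv θ t = 0 := by
      have : θ =ᶠ[𝓝 t] fun _ => 0 := by
        filter_upwards [(isOpen_lt continuous_const continuous_abs).mem_nhds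
          (show R < |t| by linarith)] with s hs
        exact hR s (by rw [Real.norm_eq_abs]; exact le_of_lt hs)
      rw [this.deriv_eq, deriv_const]
    simp only [hρ, h3, h4, h5]
    simp
  rw [e5]
  have iI : Integrable (Set.indicator (Set.Icc (-(R + 1)) (R + 1)) fun _ : ℝ => ((Lp : ℝ) ^ 2 : ℝ))
      volume := (integrable_indicator_iff measurableSet_Icc).mpr (integrable_const _)
  have ix : Integrable (fun t => ‖x t‖ ^ 2) volume := hx.integrable_norm_pow (by norm_num)
  have hpt : ∀ t, ‖ρ t * x t‖ ≤ h / 2 *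
      (Set.indicator (Set.Icc (-(R + 1)) (R + 1)) (fun _ : ℝ => ((Lp : ℝ) ^ 2 : ℝ)) t
        + ‖x t‖ ^ 2) := fun t => by
    by_cases ht : t ∈ Set.Icc (-(R + 1)) (R + 1)
    · rw [Set.indicator_of_mem ht, norm_mul]
      have := hρ1 t
      have h2 := norm_nonneg (ρ t)
      have h3 := mul_le_mul_of_nonneg_right this (norm_nonneg (x t))
      nlinarith [sq_nonneg ((Lp : ℝ) - ‖x t‖)]
    · rw [Set.indicator_of_notMem ht, hρ2 t ht]
      simp only [zero_mul, norm_zero, zero_add]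
      positivity
  have hint : ∫ t, ‖ρ t * x t‖ ≤ h / 2 * ((Lp : ℝ) ^ 2 * (2 * (R + 1)) + ∫ t, ‖x t‖ ^ 2) := by
    refine (integral_mono (integrable_mul_of_memLp hρm hx).norm
      ((iI.add ix).const_mul (h / 2)) hpt).trans_eq ?_
    rw [integral_const_mul]
    congr 1
    refine (integral_add iI ix).trans ?_
    rw [integral_indicator measurableSet_Icc, setIntegral_const, measureReal_def, Real.volume_Icc,
      ENNReal.toReal_ofReal (by linarith), smul_eq_mul]
    ring
  refine (norm_integral_le_integral_norm _).trans (hint.trans ?_)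
  have hx0 : 0 ≤ ∫ t, ‖x t‖ ^ 2 := integral_nonneg fun t => sq_nonneg _
  have hL0 : 0 ≤ (Lp : ℝ) ^ 2 * (R + 1) := by positivity
  nlinarith [mul_nonneg hh.le hx0, mul_nonneg hL0 (mul_nonneg hh.le hx0)]

/-! ### The linearized system for Fourier coefficients -/

/-- Young's inequality `ℓ¹ * ℓ² ⊂ ℓ²` for sums dominated by a convolution. -/
theorem sum_norm_tsum_sq_le {b x : ℤ → ℝ} {B X : ℝ} (hb : ∀ n, 0 ≤ b n)
    (hB : ∀ F : Finset ℤ, ∑ n ∈ F, b n ≤ B) (hX : ∀ F : Finset ℤ, ∑ j ∈ F, x j ^ 2 ≤ X)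
    {z : ℤ → ℤ → ℂ} (hz : ∀ k j, ‖z k j‖ ≤ b (k - j) * x j) :
    (∀ k, Summable fun j => ‖z k j‖) ∧
      ∀ F : Finset ℤ, ∑ k ∈ F, ‖∑' j, z k j‖ ^ 2 ≤ B ^ 2 * X := by
  have hB0 : 0 ≤ B := by simpa using hB ∅
  have h2 : ∀ k (J : Finset ℤ), ∑ j ∈ J, b (k - j) ≤ B := fun k J => by
    rw [← Finset.sum_image (f := b) (g := fun j => k - j) (fun a _ a' _ h => by simpa using h)]
    exact hB _
  have h3 : ∀ j (F : Finset ℤ), ∑ k ∈ F, b (k - j) ≤ B := fun j F => by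
    rw [← Finset.sum_image (f := b) (g := fun k => k - j) (fun a _ a' _ h => by simpa using h)]
    exact hB _
  have hbB : ∀ n, b n ≤ B := fun n => by simpa using hB {n}
  have hs : ∀ k, Summable fun j => ‖z k j‖ := fun k => by
    refine summable_of_sum_le (c := (B + B * X) / 2) (fun j => norm_nonneg _) fun J => ?_
    calc ∑ j ∈ J, ‖z k j‖ ≤ ∑ j ∈ J, (b (k - j) / 2 + B / 2 * x j ^ 2) := by
          refine Finset.sum_le_sum fun j _ => (hz k j).trans ?_
          have h4 := mul_le_mul_of_nonneg_right (hbB (k - j)) (sq_nonneg (x j))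
          have h5 := mul_nonneg (hb (k - j)) (sq_nonneg (x j - 1))
          nlinarith
      _ = (∑ j ∈ J, b (k - j)) / 2 + B / 2 * ∑ j ∈ J, x j ^ 2 := by
          rw [Finset.sum_add_distrib, Finset.sum_div, Finset.mul_sum]
      _ ≤ B / 2 + B / 2 * X := by
          have := h2 k J
          have := mul_le_mul_of_nonneg_left (hX J) (by linarith : 0 ≤ B / 2)
          linarith
      _ = _ := by ring
  refine ⟨hs, fun F => ?_⟩
  have hfin : ∀ J : Finset ℤ, ∑ k ∈ F, ‖∑ j ∈ J, z k j‖ ^ 2 ≤ B ^ 2 * X := fun J => by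
    calc ∑ k ∈ F, ‖∑ j ∈ J, z k j‖ ^ 2
        ≤ ∑ k ∈ F, B * ∑ j ∈ J, b (k - j) * x j ^ 2 := by
          refine Finset.sum_le_sum fun k _ => ?_
          have h4 : ‖∑ j ∈ J, z k j‖ ^ 2 ≤ (∑ j ∈ J, b (k - j) * x j) ^ 2 :=
            pow_le_pow_left₀ (norm_nonneg _)
              ((norm_sum_le _ _).trans (Finset.sum_le_sum fun j _ => hz k j)) 2
          have h5 : (∑ j ∈ J, b (k - j) * x j) ^ 2
              ≤ (∑ j ∈ J, b (k - j)) * ∑ j ∈ J, b (k - j) * x j ^ 2 :=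
            Finset.sum_sq_le_sum_mul_sum_of_sq_le_mul J (fun j _ => hb _)
              (fun j _ => mul_nonneg (hb _) (sq_nonneg _)) (fun j _ => le_of_eq (by ring))
          exact (h4.trans h5).trans (mul_le_mul_of_nonneg_right (h2 k J)
            (Finset.sum_nonneg fun j _ => mul_nonneg (hb _) (sq_nonneg _)))
      _ = B * ∑ j ∈ J, (∑ k ∈ F, b (k - j)) * x j ^ 2 := by
          rw [← Finset.mul_sum, Finset.sum_comm]
          simp only [Finset.sum_mul]
      _ ≤ B * ∑ j ∈ J, B * x j ^ 2 := by
          gcongr with j _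
          exact h3 j F
      _ = B ^ 2 * ∑ j ∈ J, x j ^ 2 := by rw [← Finset.mul_sum]; ring
      _ ≤ _ := mul_le_mul_of_nonneg_left (hX J) (sq_nonneg B)
  have hlim : Tendsto (fun J : Finset ℤ => ∑ k ∈ F, ‖∑ j ∈ J, z k j‖ ^ 2) atTop
      (𝓝 (∑ k ∈ F, ‖∑' j, z k j‖ ^ 2)) := by
    refine tendsto_finsetSum F fun k _ => ?_
    have h6 : Tendsto (fun J : Finset ℤ => ∑ j ∈ J, z k j) atTop (𝓝 (∑' j, z k j)) :=
      (hs k).of_norm.hasSum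
    exact h6.norm.pow 2
  exact le_of_tendsto' hlim hfin

/-- Monotone convergence for series with bounded sums of integrals. -/
theorem ae_summable_of_sum_integral_le {ι α : Type*} [Countable ι] [MeasurableSpace α]
    {ν : Measure α} {f : ι → α → ℝ} (hf0 : ∀ i t, 0 ≤ f i t) (hi : ∀ i, Integrable (f i) ν) {M : ℝ}
    (hM : ∀ F : Finset ι, ∑ i ∈ F, ∫ t, f i t ∂ν ≤ M) :
    (∀ᵐ t ∂ν, Summable fun i => f i t) ∧ Integrable (fun t => ∑' i, f i t) ν ∧
      HasSum (fun i => ∫ t, f i t ∂ν) (∫ t, ∑' i, f i t ∂ν) := by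
  have hs : Summable fun i => ∫ t, f i t ∂ν :=
    summable_of_sum_le (fun i => integral_nonneg (hf0 i)) hM
  have hl : ∑' i, ∫⁻ t, ENNReal.ofReal (f i t) ∂ν ≠ ⊤ := by
    have h1 : ∀ i, ∫⁻ t, ENNReal.ofReal (f i t) ∂ν = ENNReal.ofReal (∫ t, f i t ∂ν) := fun i =>
      (ofReal_integral_eq_lintegral_ofReal (hi i) (ae_of_all _ (hf0 i))).symm
    simp only [h1]
    exact hs.tsum_ofReal_ne_top
  rw [← lintegral_tsum fun i => (hi i).1.aemeasurable.ennreal_ofReal] at hl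
  have hm : AEMeasurable (fun t => ∑' i, ENNReal.ofReal (f i t)) ν :=
    AEMeasurable.tsum fun i => (hi i).1.aemeasurable.ennreal_ofReal
  have hsum : ∀ᵐ t ∂ν, Summable fun i => f i t := by
    filter_upwards [ae_lt_top' hm hl] with t ht
    have h2 := ENNReal.summable_toReal ht.ne
    simpa only [ENNReal.toReal_ofReal (hf0 _ t)] using h2
  refine ⟨hsum, ?_, ?_⟩
  · refine (integrable_toReal_of_lintegral_ne_top hm hl).congr ?_
    filter_upwards [hsum] with t ht
    rw [ENNReal.tsum_toReal_eq fun _ => ENNReal.ofReal_ne_top]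
    exact tsum_congr fun i => ENNReal.toReal_ofReal (hf0 i t)
  · refine hasSum_integral_of_summable_integral_norm hi ?_
    simpa only [Real.norm_of_nonneg (hf0 _ _)] using hs

/-- The relation `y = x'` in the sense of distributions on `ℝ`. -/
def HasWeakDeriv (x y : ℝ → ℂ) : Prop :=
  ∀ θ : ℝ → ℝ, ContDiff ℝ ∞ θ → HasCompactSupport θ →
    ∫ t, ((deriv θ t : ℝ) : ℂ) * x t = -∫ t, (θ t : ℂ) * y t

/-- The flux `μ w_k - π⁻¹ ∑ⱼ fluxKernel k j · c_{k-j} w_j` of the linearized system. -/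
noncomputable def coefFlux (μ : ℝ) (c : ℤ → ℂ) (w : ℤ → ℂ) (k : ℤ) : ℂ :=
  μ * w k - (π : ℂ)⁻¹ * ∑' j, (fluxKernel k j : ℂ) * c (k - j) * w j

theorem norm_fluxKernel_mul_le {c : ℤ → ℂ} {A : ℝ} (hc : ∀ n, wt n ^ 5 * ‖c n‖ ≤ A) (k j : ℤ) :
    ‖(fluxKernel k j : ℂ) * c (k - j)‖ ≤ A * (wt (k - j) ^ 2)⁻¹ := by
  have h := wt_pos (k - j)
  have h1 := one_le_wt (k - j)
  rw [norm_mul, Complex.norm_real, Real.norm_eq_abs, ← div_eq_mul_inv, le_div_iff₀ (by positivity)]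
  refine le_trans ?_ (hc (k - j))
  calc |fluxKernel k j| * ‖c (k - j)‖ * wt (k - j) ^ 2
      ≤ wt (k - j) * ‖c (k - j)‖ * wt (k - j) ^ 2 := by
        gcongr
        exact (abs_fluxKernel_le k j).trans (abs_le_wt _)
    _ = wt (k - j) ^ 3 * ‖c (k - j)‖ := by ring
    _ ≤ _ := mul_le_mul_of_nonneg_right (pow_le_pow_right₀ h1 (by norm_num)) (norm_nonneg _)

theorem sum_const_mul_wt_le {A : ℝ} (hA : 0 ≤ A) (F : Finset ℤ) :
    ∑ n ∈ F, A * (wt n ^ 2)⁻¹ ≤ A * wtSum := by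
  rw [← Finset.mul_sum]
  exact mul_le_mul_of_nonneg_left (sum_inv_wt_sq_le F) hA

section StateCoef

variable {c : ℝ → ℤ → ℂ} {μ δ A L : ℝ}

theorem StateCoef.integral_norm_flux_term_le (hc : StateCoef c μ δ A L) {y w : ℝ → ℂ}
    (hy : MemLp y 2 volume) (hw : MemLp w 2 volume) {M : ℝ} (hM : ∫ t, ‖w t‖ ^ 2 ≤ M) (k j : ℤ) :
    ∫ t, ‖y t * ((fluxKernel k j : ℂ) * c t (k - j) * w t)‖
      ≤ A * (wt (k - j) ^ 2)⁻¹ * (((∫ t, ‖y t‖ ^ 2) + M) / 2) := by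
  have hA := hc.nonneg
  have iy : Integrable (fun t => ‖y t‖ ^ 2) volume := hy.integrable_norm_pow (by norm_num)
  have iw : Integrable (fun t => ‖w t‖ ^ 2) volume := hw.integrable_norm_pow (by norm_num)
  have mj : MemLp (fun t => (fluxKernel k j : ℂ) * c t (k - j) * w t) 2 volume :=
    hw.mul ((hc.memLp_top (k - j)).const_mul (fluxKernel k j : ℂ))
  have hA2 : 0 ≤ A * (wt (k - j) ^ 2)⁻¹ := by have := wt_pos (k - j); positivity
  have h1 : ∫ t, ‖y t * ((fluxKernel k j : ℂ) * c t (k - j) * w t)‖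
      ≤ ∫ t, A * (wt (k - j) ^ 2)⁻¹ * ((‖y t‖ ^ 2 + ‖w t‖ ^ 2) / 2) := by
    refine integral_mono_ae (integrable_mul_of_memLp hy mj).norm
      (((iy.add iw).div_const 2).const_mul _) ?_
    filter_upwards [hc.bound] with t hb
    have h2 := norm_fluxKernel_mul_le hb k j
    have h3 : ‖y t‖ * ‖w t‖ ≤ (‖y t‖ ^ 2 + ‖w t‖ ^ 2) / 2 := by
      nlinarith [sq_nonneg (‖y t‖ - ‖w t‖)]
    calc ‖y t * ((fluxKernel k j : ℂ) * c t (k - j) * w t)‖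
        = ‖(fluxKernel k j : ℂ) * c t (k - j)‖ * (‖y t‖ * ‖w t‖) := by
          rw [norm_mul, norm_mul _ (w t)]; ring
      _ ≤ _ := mul_le_mul h2 h3 (by positivity) hA2
  refine h1.trans ?_
  rw [integral_const_mul, integral_div, integral_add iy iw]
  exact mul_le_mul_of_nonneg_left (by linarith) hA2

/-- The flux series converges in `L²(ℝ)` and may be integrated term by term. -/
theorem StateCoef.flux_series (hc : StateCoef c μ δ A L) {w : ℤ → ℝ → ℂ}
    (hw : ∀ k, MemLp (w k) 2 volume) {M : ℝ} (hM : ∀ F : Finset ℤ, ∑ k ∈ F, ∫ t, ‖w k t‖ ^ 2 ≤ M)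
    (k : ℤ) :
    (∀ᵐ t, Summable fun j => ‖(fluxKernel k j : ℂ) * c t (k - j) * w j t‖) ∧
    MemLp (fun t => ∑' j, (fluxKernel k j : ℂ) * c t (k - j) * w j t) 2 volume ∧
    ∀ y : ℝ → ℂ, MemLp y 2 volume →
      HasSum (fun j => ∫ t, y t * ((fluxKernel k j : ℂ) * c t (k - j) * w j t))
        (∫ t, y t * ∑' j, (fluxKernel k j : ℂ) * c t (k - j) * w j t) := by
  have hA := hc.nonneg
  have iw : ∀ j, Integrable (fun t => ‖w j t‖ ^ 2) volume := fun j =>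
    (hw j).integrable_norm_pow (by norm_num)
  obtain ⟨hs, hi, -⟩ := ae_summable_of_sum_integral_le (fun j t => sq_nonneg ‖w j t‖) iw hM
  have mj : ∀ j, MemLp (fun t => (fluxKernel k j : ℂ) * c t (k - j) * w j t) 2 volume := fun j =>
    (hw j).mul ((hc.memLp_top (k - j)).const_mul (fluxKernel k j : ℂ))
  have hpt : ∀ᵐ t, (Summable fun j => ‖(fluxKernel k j : ℂ) * c t (k - j) * w j t‖) ∧
      ‖∑' j, (fluxKernel k j : ℂ) * c t (k - j) * w j t‖ ^ 2
        ≤ (A * wtSum) ^ 2 * ∑' j, ‖w j t‖ ^ 2 := by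
    filter_upwards [hs, hc.bound] with t ht hb
    have := sum_norm_tsum_sq_le (b := fun n => A * (wt n ^ 2)⁻¹) (x := fun j => ‖w j t‖)
      (z := fun k j => (fluxKernel k j : ℂ) * c t (k - j) * w j t)
      (fun n => by have := wt_pos n; positivity) (sum_const_mul_wt_le hA)
      (fun F => ht.sum_le_tsum F fun _ _ => sq_nonneg _) (fun k j => by
        rw [norm_mul]
        exact mul_le_mul_of_nonneg_right (norm_fluxKernel_mul_le hb k j) (norm_nonneg _))
    exact ⟨this.1 k, by simpa using this.2 {k}⟩
  have hsum := hpt.mono fun t ht => ht.1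
  have hmeas : AEStronglyMeasurable
      (fun t => ∑' j, (fluxKernel k j : ℂ) * c t (k - j) * w j t) volume := by
    refine aestronglyMeasurable_of_tendsto_ae (atTop : Filter (Finset ℤ))
      (f := fun J t => ∑ j ∈ J, (fluxKernel k j : ℂ) * c t (k - j) * w j t)
      (fun J => (memLp_finsetSum J fun j _ => mj j).1) ?_
    filter_upwards [hsum] with t ht
    exact ht.of_norm.hasSum
  have hmem : MemLp (fun t => ∑' j, (fluxKernel k j : ℂ) * c t (k - j) * w j t) 2 volume := by
    rw [memLp_two_iff_integrable_sq_norm hmeas]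
    refine (hi.const_mul ((A * wtSum) ^ 2)).mono' (hmeas.norm.pow 2) ?_
    filter_upwards [hpt] with t ht
    rw [Real.norm_of_nonneg (sq_nonneg _)]
    exact ht.2
  refine ⟨hsum, hmem, fun y hy => ?_⟩
  have ij := fun j => integrable_mul_of_memLp hy (mj j)
  have hbd := fun j => hc.integral_norm_flux_term_le hy (hw j)
    (by simpa using hM {j} : ∫ t, ‖w j t‖ ^ 2 ≤ M) k j
  have := hasSum_integral_of_summable_integral_norm ij
    (Summable.of_nonneg_of_le (fun j => integral_nonneg fun t => norm_nonneg _) hbd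
      (((summable_wt_inv_sq.comp_injective (sub_right_injective (b := k))).mul_left A).mul_right _))
  simpa only [tsum_mul_left] using this

end StateCoef

section StateCoef

variable {c : ℝ → ℤ → ℂ} {μ δ A L : ℝ}

/-- Solutions of the linearized system for the Fourier coefficients `v = e^{-γt} φₜ` and
`w = e^{-γt} φₓ`, with `w ∈ L²(ℝ; H¹)` and forcing `g`. -/
structure IsCoefSol (c : ℝ → ℤ → ℂ) (μ γ : ℝ) (g v w : ℤ → ℝ → ℂ) : Prop where
  memLp_v : ∀ k, MemLp (v k) 2 volume
  memLp_w : ∀ k, MemLp (w k) 2 volume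
  zero_mode : ∀ᵐ t, v 0 t = 0 ∧ w 0 t = 0
  bounded : ∃ M : ℝ, ∀ F : Finset ℤ, ∑ k ∈ F, wt k ^ 2 * ∫ t, ‖w k t‖ ^ 2 ≤ M
  eqn_v : ∀ k, k ≠ 0 → HasWeakDeriv (v k) fun t =>
    Complex.I * k * coefFlux μ (c t) (fun j => w j t) k + g k t - γ * v k t
  eqn_w : ∀ k, k ≠ 0 → HasWeakDeriv (w k) fun t => Complex.I * k * v k t - γ * w k t

theorem sum_integral_sq_le_of_wt {w : ℤ → ℝ → ℂ} {M : ℝ} {m : ℕ}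
    (hM : ∀ F : Finset ℤ, ∑ k ∈ F, wt k ^ m * ∫ t, ‖w k t‖ ^ 2 ≤ M) (F : Finset ℤ) :
    ∑ k ∈ F, ∫ t, ‖w k t‖ ^ 2 ≤ M :=
  (Finset.sum_le_sum fun k _ => le_mul_of_one_le_left
    (integral_nonneg fun _ => sq_nonneg _) (one_le_pow₀ (one_le_wt k))).trans (hM F)

theorem StateCoef.memLp_coefFlux (hc : StateCoef c μ δ A L) {w : ℤ → ℝ → ℂ}
    (hw : ∀ k, MemLp (w k) 2 volume) {M : ℝ} (hM : ∀ F : Finset ℤ, ∑ k ∈ F, ∫ t, ‖w k t‖ ^ 2 ≤ M)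
    (k : ℤ) : MemLp (fun t => coefFlux μ (c t) (fun j => w j t) k) 2 volume :=
  ((hw k).const_mul (μ : ℂ)).sub ((hc.flux_series hw hM k).2.1.const_mul ((π : ℂ)⁻¹))

theorem hasWeakDeriv_lin {x y x' y' : ℝ → ℂ} (a b : ℂ) (hx : MemLp x 2 volume)
    (hy : MemLp y 2 volume) (hx' : MemLp x' 2 volume) (hy' : MemLp y' 2 volume)
    (h : HasWeakDeriv x y) (h' : HasWeakDeriv x' y') :
    HasWeakDeriv (fun t => a * x t + b * x' t) (fun t => a * y t + b * y' t) := by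
  intro θ hθ hs
  have m0 := memLp_of_test hθ.continuous hs
  have m1 := memLp_of_test (contDiff_infty_iff_deriv.mp hθ).2.continuous hs.deriv
  have key : ∀ {f u u' : ℝ → ℂ}, MemLp f 2 volume → MemLp u 2 volume → MemLp u' 2 volume →
      ∫ t, f t * (a * u t + b * u' t) = a * (∫ t, f t * u t) + b * ∫ t, f t * u' t := by
    intro f u u' hf hu hu'
    rw [← integral_const_mul, ← integral_const_mul,
      ← integral_add ((integrable_mul_of_memLp hf hu).const_mul a)
        ((integrable_mul_of_memLp hf hu').const_mul b)]
    exact integral_congr_ae (ae_of_all _ fun t => by simp only; ring)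
  rw [key m1 hx hx', key m0 hy hy', h θ hθ hs, h' θ hθ hs]
  ring

theorem HasWeakDeriv.congr {x y x' y' : ℝ → ℂ} (h : HasWeakDeriv x y) (hx : x =ᵐ[volume] x')
    (hy : y =ᵐ[volume] y') : HasWeakDeriv x' y' := by
  intro θ hθ hs
  have h1 : ∫ t, ((deriv θ t : ℝ) : ℂ) * x' t = ∫ t, ((deriv θ t : ℝ) : ℂ) * x t :=
    integral_congr_ae (by filter_upwards [hx] with t ht; rw [ht])
  have h2 : ∫ t, (θ t : ℂ) * y' t = ∫ t, (θ t : ℂ) * y t :=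
    integral_congr_ae (by filter_upwards [hy] with t ht; rw [ht])
  rw [h1, h2]
  exact h θ hθ hs

theorem norm_lin_sq_le (a b x y : ℂ) :
    ‖a * x + b * y‖ ^ 2 ≤ 2 * ‖a‖ ^ 2 * ‖x‖ ^ 2 + 2 * ‖b‖ ^ 2 * ‖y‖ ^ 2 := by
  have h1 := norm_add_le (a * x) (b * y)
  rw [norm_mul, norm_mul] at h1
  have h2 := pow_le_pow_left₀ (norm_nonneg _) h1 2
  nlinarith [sq_nonneg (‖a‖ * ‖x‖ - ‖b‖ * ‖y‖)]

theorem IsCoefSol.lin (hc : StateCoef c μ δ A L) {γ : ℝ} {g v w g' v' w' : ℤ → ℝ → ℂ}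
    (hg : ∀ k, MemLp (g k) 2 volume) (hg' : ∀ k, MemLp (g' k) 2 volume)
    (h : IsCoefSol c μ γ g v w) (h' : IsCoefSol c μ γ g' v' w') (a b : ℂ) :
    IsCoefSol c μ γ (fun k t => a * g k t + b * g' k t) (fun k t => a * v k t + b * v' k t)
      (fun k t => a * w k t + b * w' k t) := by
  obtain ⟨M, hM⟩ := h.bounded
  obtain ⟨M', hM'⟩ := h'.bounded
  have hM0 := sum_integral_sq_le_of_wt hM
  have hM0' := sum_integral_sq_le_of_wt hM'
  refine ⟨fun k => ((h.memLp_v k).const_mul a).add ((h'.memLp_v k).const_mul b),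
    fun k => ((h.memLp_w k).const_mul a).add ((h'.memLp_w k).const_mul b), ?_,
    ⟨2 * ‖a‖ ^ 2 * M + 2 * ‖b‖ ^ 2 * M', fun F => ?_⟩, fun k hk => ?_, fun k hk => ?_⟩
  · filter_upwards [h.zero_mode, h'.zero_mode] with t ht ht'
    simp [ht.1, ht.2, ht'.1, ht'.2]
  · have h1 : ∀ k ∈ F, wt k ^ 2 * ∫ t, ‖a * w k t + b * w' k t‖ ^ 2
        ≤ 2 * ‖a‖ ^ 2 * (wt k ^ 2 * ∫ t, ‖w k t‖ ^ 2)
          + 2 * ‖b‖ ^ 2 * (wt k ^ 2 * ∫ t, ‖w' k t‖ ^ 2) := fun k _ => by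
      have i1 : Integrable (fun t => ‖w k t‖ ^ 2) volume :=
        (h.memLp_w k).integrable_norm_pow (by norm_num)
      have i2 : Integrable (fun t => ‖w' k t‖ ^ 2) volume :=
        (h'.memLp_w k).integrable_norm_pow (by norm_num)
      have i3 : Integrable (fun t => ‖a * w k t + b * w' k t‖ ^ 2) volume :=
        (((h.memLp_w k).const_mul a).add ((h'.memLp_w k).const_mul b)).integrable_norm_pow
          (by norm_num)
      have h2 := integral_mono i3 ((i1.const_mul (2 * ‖a‖ ^ 2)).add (i2.const_mul (2 * ‖b‖ ^ 2)))
        fun t => norm_lin_sq_le a b (w k t) (w' k t)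
      rw [integral_add' (i1.const_mul _) (i2.const_mul _), integral_const_mul,
        integral_const_mul] at h2
      have := mul_le_mul_of_nonneg_left h2 (sq_nonneg (wt k))
      linarith
    refine (Finset.sum_le_sum h1).trans ?_
    rw [Finset.sum_add_distrib, ← Finset.mul_sum, ← Finset.mul_sum]
    gcongr
    · exact hM F
    · exact hM' F
  · refine (hasWeakDeriv_lin a b (h.memLp_v k) ?_ (h'.memLp_v k) ?_ (h.eqn_v k hk)
      (h'.eqn_v k hk)).congr (ae_of_all _ fun _ => rfl) ?_
    · exact (((hc.memLp_coefFlux h.memLp_w hM0 k).const_mul _).add (hg k)).sub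
        ((h.memLp_v k).const_mul _)
    · exact (((hc.memLp_coefFlux h'.memLp_w hM0' k).const_mul _).add (hg' k)).sub
        ((h'.memLp_v k).const_mul _)
    · filter_upwards [(hc.flux_series h.memLp_w hM0 k).1, (hc.flux_series h'.memLp_w hM0' k).1]
        with t h1 h2
      have h3 : ∑' j, (fluxKernel k j : ℂ) * c t (k - j) * (a * w j t + b * w' j t)
          = a * (∑' j, (fluxKernel k j : ℂ) * c t (k - j) * w j t)
            + b * ∑' j, (fluxKernel k j : ℂ) * c t (k - j) * w' j t := by
        rw [← tsum_mul_left, ← tsum_mul_left,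
          ← (h1.of_norm.mul_left a).tsum_add (h2.of_norm.mul_left b)]
        exact tsum_congr fun j => by ring
      simp only [coefFlux, h3]
      ring
  · refine (hasWeakDeriv_lin a b (h.memLp_w k) ?_ (h'.memLp_w k) ?_ (h.eqn_w k hk)
      (h'.eqn_w k hk)).congr (ae_of_all _ fun _ => rfl) (ae_of_all _ fun t => by simp only; ring)
    · exact ((h.memLp_v k).const_mul _).sub ((h.memLp_w k).const_mul _)
    · exact ((h'.memLp_v k).const_mul _).sub ((h'.memLp_w k).const_mul _)

theorem HasWeakDeriv.conj {x y : ℝ → ℂ} (h : HasWeakDeriv x y) :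
    HasWeakDeriv (fun t => (starRingEnd ℂ) (x t)) (fun t => (starRingEnd ℂ) (y t)) := by
  intro θ hθ hs
  have key : ∀ (f : ℝ → ℝ) (z : ℝ → ℂ), ∫ t, (f t : ℂ) * (starRingEnd ℂ) (z t)
      = (starRingEnd ℂ) (∫ t, (f t : ℂ) * z t) := fun f z => by
    rw [← integral_conj]
    exact integral_congr_ae (ae_of_all _ fun t => by simp)
  rw [key, key, h θ hθ hs, map_neg]

theorem fluxKernel_neg (k j : ℤ) : fluxKernel (-k) (-j) = fluxKernel k j := by
  have h1 : -k - -j = -(k - j) := by ring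
  simp only [fluxKernel, neg_mul_neg, h1, Int.cast_neg, abs_neg]

/-- The flux commutes with the reflection `w ↦ conj (w (-·))`, the complex conjugation of functions.
-/
theorem conj_coefFlux {t : ℝ} (hherm : ∀ n, c t (-n) = (starRingEnd ℂ) (c t n)) (w : ℤ → ℂ)
    (k : ℤ) :
    (starRingEnd ℂ) (coefFlux μ (c t) w (-k))
      = coefFlux μ (c t) (fun j => (starRingEnd ℂ) (w (-j))) k := by
  rw [coefFlux, coefFlux, map_sub, map_mul, map_mul, map_inv₀, Complex.conj_ofReal,
    Complex.conj_ofReal, Complex.conj_tsum, ← (Equiv.neg ℤ).tsum_eq]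
  congr 2
  refine tsum_congr fun j => ?_
  have h1 : -k - -j = -(k - j) := by ring
  simp only [Equiv.neg_apply, map_mul, Complex.conj_ofReal, fluxKernel_neg, h1, hherm,
    Complex.conj_conj]

/-- Complex conjugation of the functions with Fourier coefficients `v`, `w`. -/
theorem IsCoefSol.reflect (hherm : ∀ t n, c t (-n) = (starRingEnd ℂ) (c t n)) {γ : ℝ}
    {g v w : ℤ → ℝ → ℂ} (h : IsCoefSol c μ γ g v w) :
    IsCoefSol c μ γ (fun k t => (starRingEnd ℂ) (g (-k) t))
      (fun k t => (starRingEnd ℂ) (v (-k) t)) (fun k t => (starRingEnd ℂ) (w (-k) t)) := by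
  obtain ⟨M, hM⟩ := h.bounded
  refine ⟨fun k => (h.memLp_v _).star, fun k => (h.memLp_w _).star, ?_, ⟨M, fun F => ?_⟩,
    fun k hk => ?_, fun k hk => ?_⟩
  · filter_upwards [h.zero_mode] with t ht
    simp [ht.1, ht.2]
  · have h1 := hM (F.map (Equiv.neg ℤ).toEmbedding)
    rw [Finset.sum_map] at h1
    simpa using h1
  · refine (h.eqn_v (-k) (neg_ne_zero.mpr hk)).conj.congr (ae_of_all _ fun _ => rfl)
      (ae_of_all _ fun t => ?_)
    simp only [map_sub, map_add, map_mul, conj_coefFlux (hherm t), Complex.conj_I,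
      Complex.conj_ofReal, Int.cast_neg, map_neg, map_intCast]
    ring
  · refine (h.eqn_w (-k) (neg_ne_zero.mpr hk)).conj.congr (ae_of_all _ fun _ => rfl)
      (ae_of_all _ fun t => ?_)
    simp only [map_sub, map_mul, Complex.conj_I, Complex.conj_ofReal, Int.cast_neg, map_neg,
      map_intCast]
    ring

end StateCoef

section StateCoef

variable {c : ℝ → ℤ → ℂ} {μ δ A L : ℝ}

theorem integral_sum_wt_sq {x : ℤ → ℝ → ℂ} (hx : ∀ k, MemLp (x k) 2 volume) (m : ℕ)
    (K : Finset ℤ) : ∫ t, ∑ k ∈ K, (wt k ^ m * ‖x k t‖) ^ 2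
      = ∑ k ∈ K, wt k ^ (2 * m) * ∫ t, ‖x k t‖ ^ 2 := by
  rw [integral_finsetSum]
  · refine Finset.sum_congr rfl fun k _ => ?_
    rw [← integral_const_mul]
    exact integral_congr_ae (ae_of_all _ fun t => by simp only [mul_pow, ← pow_mul, mul_comm 2 m])
  · intro k _
    simp only [mul_pow]
    exact ((hx k).integrable_norm_pow (by norm_num)).const_mul _

theorem sum_le_sum_of_eq_zero {K F : Finset ℤ} {f : ℤ → ℝ} (hf : ∀ k, 0 ≤ f k)
    (h0 : ∀ k, k ∉ K → f k = 0) : ∑ k ∈ F, f k ≤ ∑ k ∈ K, f k := by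
  calc ∑ k ∈ F, f k ≤ ∑ k ∈ F ∪ K, f k :=
        Finset.sum_le_sum_of_subset_of_nonneg Finset.subset_union_left fun k _ _ => hf k
    _ = ∑ k ∈ K, f k :=
        (Finset.sum_subset Finset.subset_union_right fun k _ hk => h0 k hk).symm

/-! ### Passage to the limit and existence of solutions -/

/-- A weak limit of solutions of the truncated systems solves the full system: passage to the limit
in one of the equations. -/
theorem hasWeakDeriv_of_backward {K : ℕ → Prop} (hK : ∀ᶠ N in atTop, K N) {x R : ℕ → ℝ → ℂ}
    {z S : ℝ → ℂ} {γ M : ℝ} (hx : ∀ N, MemLp (x N) 2 volume) (hR : ∀ N, MemLp (R N) 2 volume)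
    (hz : MemLp z 2 volume) (hS : MemLp S 2 volume) (hM : ∀ N, ∫ t, ‖x N t‖ ^ 2 ≤ M)
    (hsol : ∀ N, K N → ∀ᵐ t,
      ((((1 / ((N : ℝ) + 1))⁻¹ : ℝ)) : ℂ) * (x N t - x N (t - 1 / ((N : ℝ) + 1)))
      + γ * x N t = R N t)
    (hlim : ∀ y : ℝ → ℂ, MemLp y 2 volume →
      Tendsto (fun N => ∫ t, y t * x N t) (hyperfilter ℕ) (𝓝 (∫ t, y t * z t)))
    (hlimR : ∀ y : ℝ → ℂ, MemLp y 2 volume →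
      Tendsto (fun N => ∫ t, y t * R N t) (hyperfilter ℕ) (𝓝 (∫ t, y t * S t))) :
    HasWeakDeriv z fun t => S t - γ * z t := by
  intro θ hθ hs
  have m0 := memLp_of_test hθ.continuous hs
  have m1 := memLp_of_test (contDiff_infty_iff_deriv.mp hθ).2.continuous hs.deriv
  obtain ⟨C, hC⟩ := exists_norm_integral_backward_le hθ hs
  set h : ℕ → ℝ := fun N => 1 / ((N : ℝ) + 1) with hh
  have hpos : ∀ N, 0 < h N := fun N => Nat.one_div_pos_of_nat
  have hle : ∀ N, h N ≤ 1 := fun N => by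
    simp only [hh]
    rw [div_le_one (by positivity)]
    linarith [(Nat.cast_nonneg N : (0 : ℝ) ≤ N)]
  have hh0 : Tendsto h atTop (𝓝 0) := tendsto_one_div_add_atTop_nhds_zero_nat
  have hM0 : 0 ≤ M := le_trans (integral_nonneg fun t => sq_nonneg ‖x 0 t‖) (hM 0)
  have hx0 : ∀ N, 0 ≤ ∫ t, ‖x N t‖ ^ 2 := fun N => integral_nonneg fun t => sq_nonneg _
  have l1 : Tendsto (fun N => (∫ t, (θ t : ℂ) * (((h N)⁻¹ : ℝ) * (x N t - x N (t - h N))))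
      + ∫ t, ((deriv θ t : ℝ) : ℂ) * x N t) (hyperfilter ℕ) (𝓝 0) := by
    refine Tendsto.mono_left ?_ Nat.hyperfilter_le_atTop
    refine squeeze_zero_norm (a := fun N => |C| * h N * (1 + M)) (fun N => ?_) ?_
    · refine (hC (h N) (hpos N) (hle N) (x N) (hx N)).trans ?_
      have h1 : C * h N ≤ |C| * h N := mul_le_mul_of_nonneg_right (le_abs_self C) (hpos N).le
      exact mul_le_mul h1 (by linarith [hM N]) (by linarith [hx0 N])
        (mul_nonneg (abs_nonneg _) (hpos N).le)
    · have := (hh0.const_mul |C|).mul_const (1 + M)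
      simpa using this
  have l2 := l1.sub (hlim _ m1)
  have l3 := (hlimR _ m0).sub ((hlim _ m0).const_mul (γ : ℂ))
  have e1 : ∀ᶠ N in (hyperfilter ℕ : Filter ℕ),
      (∫ t, (θ t : ℂ) * R N t) - γ * ∫ t, (θ t : ℂ) * x N t
      = (∫ t, (θ t : ℂ) * (((h N)⁻¹ : ℝ) * (x N t - x N (t - h N))))
        + (∫ t, ((deriv θ t : ℝ) : ℂ) * x N t) - ∫ t, ((deriv θ t : ℝ) : ℂ) * x N t := by
    filter_upwards [Nat.hyperfilter_le_atTop hK] with N hN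
    rw [add_sub_cancel_right, ← integral_const_mul,
      ← integral_sub (integrable_mul_of_memLp m0 (hR N))
        ((integrable_mul_of_memLp m0 (hx N)).const_mul _)]
    refine integral_congr_ae ?_
    filter_upwards [hsol N hN] with t ht
    rw [← ht]
    ring
  have e2 := tendsto_nhds_unique (l3.congr' e1) l2
  rw [zero_sub] at e2
  have e3 : ∫ t, (θ t : ℂ) * (S t - γ * z t)
      = (∫ t, (θ t : ℂ) * S t) - γ * ∫ t, (θ t : ℂ) * z t := by
    rw [← integral_const_mul, ← integral_sub (integrable_mul_of_memLp m0 hS)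
        ((integrable_mul_of_memLp m0 hz).const_mul _)]
    exact integral_congr_ae (ae_of_all _ fun t => by simp only; ring)
  rw [e3, e2, neg_neg]

theorem StateCoef.memLp_trFlux (hc : StateCoef c μ δ A L) {w : ℤ → ℝ → ℂ}
    (hw : ∀ k, MemLp (w k) 2 volume) (K : Finset ℤ) (k : ℤ) :
    MemLp (fun t => trFlux μ (c t) K (fun j => w j t) k) 2 volume :=
  ((hw k).const_mul (μ : ℂ)).sub ((memLp_finsetSum K fun j _ =>
    (hw j).mul ((hc.memLp_top (k - j)).const_mul (fluxKernel k j : ℂ))).const_mul ((π : ℂ)⁻¹))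

/-- Weak continuity of the flux. -/
theorem StateCoef.tendsto_integral_trFlux (hc : StateCoef c μ δ A L) {K : ℕ → Finset ℤ}
    {w : ℕ → ℤ → ℝ → ℂ} {z : ℤ → ℝ → ℂ} (hw : ∀ N k, MemLp (w N k) 2 volume)
    (hz : ∀ k, MemLp (z k) 2 volume) (h0 : ∀ N k, k ∉ K N → w N k = 0) {M : ℝ}
    (hM : ∀ N (F : Finset ℤ), ∑ k ∈ F, ∫ t, ‖w N k t‖ ^ 2 ≤ M)
    (hMz : ∀ F : Finset ℤ, ∑ k ∈ F, ∫ t, ‖z k t‖ ^ 2 ≤ M)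
    (hlim : ∀ k, ∀ y : ℝ → ℂ, MemLp y 2 volume →
      Tendsto (fun N => ∫ t, y t * w N k t) (hyperfilter ℕ) (𝓝 (∫ t, y t * z k t)))
    (k : ℤ) {y : ℝ → ℂ} (hy : MemLp y 2 volume) :
    Tendsto (fun N => ∫ t, y t * trFlux μ (c t) (K N) (fun j => w N j t) k) (hyperfilter ℕ)
      (𝓝 (∫ t, y t * coefFlux μ (c t) (fun j => z j t) k)) := by
  have mc : ∀ j, MemLp (fun t => (fluxKernel k j : ℂ) * c t (k - j)) ∞ volume := fun j =>
    (hc.memLp_top (k - j)).const_mul _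
  have my : ∀ j, MemLp (fun t => y t * ((fluxKernel k j : ℂ) * c t (k - j))) 2 volume := fun j =>
    (mc j).mul hy
  have mj : ∀ N j, MemLp (fun t => (fluxKernel k j : ℂ) * c t (k - j) * w N j t) 2 volume :=
    fun N j => (hw N j).mul (mc j)
  have e1 : ∀ N, ∫ t, y t * trFlux μ (c t) (K N) (fun j => w N j t) k
      = μ * (∫ t, y t * w N k t)
        - (π : ℂ)⁻¹ * ∑' j, ∫ t, y t * ((fluxKernel k j : ℂ) * c t (k - j)) * w N j t := fun N => by
    have e2 : ∑' j, ∫ t, y t * ((fluxKernel k j : ℂ) * c t (k - j)) * w N j t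
        = ∫ t, ∑ j ∈ K N, y t * ((fluxKernel k j : ℂ) * c t (k - j) * w N j t) := by
      rw [tsum_eq_sum (s := K N) (fun j hj => by simp [h0 N j hj]), integral_finsetSum]
      · exact Finset.sum_congr rfl fun j _ =>
          integral_congr_ae (ae_of_all _ fun t => by simp only; ring)
      · exact fun j _ => integrable_mul_of_memLp hy (mj N j)
    rw [e2, ← integral_const_mul, ← integral_const_mul, ← integral_sub]
    · refine integral_congr_ae (ae_of_all _ fun t => ?_)
      simp only [trFlux, ← Finset.mul_sum]
      ring
    · exact (integrable_mul_of_memLp hy (hw N k)).const_mul _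
    · exact (integrable_finsetSum _ fun j _ => integrable_mul_of_memLp hy (mj N j)).const_mul _
  have e3 : ∫ t, y t * coefFlux μ (c t) (fun j => z j t) k
      = μ * (∫ t, y t * z k t)
        - (π : ℂ)⁻¹ * ∑' j, ∫ t, y t * ((fluxKernel k j : ℂ) * c t (k - j)) * z j t := by
    obtain ⟨-, h2, h3⟩ := hc.flux_series hz hMz k
    have h4 := (h3 y hy).tsum_eq
    simp only [← mul_assoc] at h4 ⊢
    rw [h4, ← integral_const_mul, ← integral_const_mul, ← integral_sub]
    · refine integral_congr_ae (ae_of_all _ fun t => ?_)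
      simp only [coefFlux]
      ring
    · exact (integrable_mul_of_memLp hy (hz k)).const_mul _
    · exact (integrable_mul_of_memLp hy h2).const_mul _
  simp only [e1, e3]
  refine ((hlim k y hy).const_mul _).sub (Tendsto.const_mul _ ?_)
  have hsum : Summable fun j => A * (wt (k - j) ^ 2)⁻¹ * (((∫ t, ‖y t‖ ^ 2) + M) / 2) :=
    ((summable_wt_inv_sq.comp_injective (sub_right_injective (b := k))).mul_left A).mul_right _
  refine tendsto_tsum_of_dominated_convergence hsum
    (fun j => hlim j _ (my j)) (Eventually.of_forall fun N j => ?_)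
  have h1 := hc.integral_norm_flux_term_le hy (hw N j)
    (by simpa using hM N {j} : ∫ t, ‖w N j t‖ ^ 2 ≤ M) k j
  have h2 := norm_integral_le_integral_norm (μ := volume)
    (fun t => y t * ((fluxKernel k j : ℂ) * c t (k - j) * w N j t))
  have h3 : ∀ t, y t * ((fluxKernel k j : ℂ) * c t (k - j)) * w N j t
      = y t * ((fluxKernel k j : ℂ) * c t (k - j) * w N j t) := fun t => by ring
  simp only [h3]
  exact h2.trans h1

end StateCoef

section StateCoef

variable {c : ℝ → ℤ → ℂ} {μ δ A L : ℝ}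

/-- Averaging a solution with its reflection makes it the pair of coefficients of real-valued
functions. -/
theorem IsCoefSol.exists_hermitian (hc : StateCoef c μ δ A L) {γ : ℝ} {g v w : ℤ → ℝ → ℂ}
    (hg : ∀ k, MemLp (g k) 2 volume) (hherm : ∀ k t, g (-k) t = (starRingEnd ℂ) (g k t))
    (h : IsCoefSol c μ γ g v w) {m : ℕ} {M : ℝ}
    (hM : ∀ F : Finset ℤ, ∑ k ∈ F, wt k ^ m * ((∫ t, ‖v k t‖ ^ 2) + ∫ t, ‖w k t‖ ^ 2) ≤ M) :
    ∃ v' w' : ℤ → ℝ → ℂ, IsCoefSol c μ γ g v' w' ∧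
      (∀ k t, v' (-k) t = (starRingEnd ℂ) (v' k t)) ∧
      (∀ k t, w' (-k) t = (starRingEnd ℂ) (w' k t)) ∧
      ∀ F : Finset ℤ, ∑ k ∈ F, wt k ^ m * ((∫ t, ‖v' k t‖ ^ 2) + ∫ t, ‖w' k t‖ ^ 2) ≤ M := by
  have e : (fun k t => 1 / 2 * g k t + 1 / 2 * (starRingEnd ℂ) (g (-k) t)) = g := by
    funext k t
    rw [hherm, Complex.conj_conj]
    ring
  have h1 := h.lin hc hg (fun k => (hg (-k)).star) (h.reflect hc.herm) (1 / 2) (1 / 2)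
  simp only [Pi.star_apply, RCLike.star_def] at h1
  rw [e] at h1
  refine ⟨_, _, h1, fun k t => ?_, fun k t => ?_, fun F => ?_⟩
  · simp only [map_add, map_mul, neg_neg, Complex.conj_conj, map_div₀, map_one, map_ofNat]
    ring
  · simp only [map_add, map_mul, neg_neg, Complex.conj_conj, map_div₀, map_one, map_ofNat]
    ring
  · have key : ∀ {x : ℤ → ℝ → ℂ}, (∀ k, MemLp (x k) 2 volume) → ∀ k,
        ∫ t, ‖1 / 2 * x k t + 1 / 2 * (starRingEnd ℂ) (x (-k) t)‖ ^ 2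
          ≤ 1 / 2 * (∫ t, ‖x k t‖ ^ 2) + 1 / 2 * ∫ t, ‖x (-k) t‖ ^ 2 := by
      intro x hx k
      have i1 : Integrable (fun t => ‖x k t‖ ^ 2) volume := (hx k).integrable_norm_pow (by norm_num)
      have i2 : Integrable (fun t => ‖x (-k) t‖ ^ 2) volume :=
        (hx (-k)).integrable_norm_pow (by norm_num)
      have m3 : MemLp (fun t => 1 / 2 * x k t + 1 / 2 * (starRingEnd ℂ) (x (-k) t)) 2 volume :=
        ((hx k).const_mul (1 / 2)).add ((hx (-k)).star.const_mul (1 / 2))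
      have i3 := m3.integrable_norm_pow (p := 2) (by norm_num)
      rw [← integral_const_mul, ← integral_const_mul, ← integral_add (i1.const_mul _)
        (i2.const_mul _)]
      refine integral_mono i3 ((i1.const_mul _).add (i2.const_mul _)) fun t => ?_
      refine (norm_lin_sq_le (1 / 2) (1 / 2) (x k t) ((starRingEnd ℂ) (x (-k) t))).trans_eq ?_
      rw [RCLike.norm_conj]
      norm_num
    have h2 : ∀ k ∈ F, wt k ^ m * ((∫ t, ‖1 / 2 * v k t + 1 / 2 * (starRingEnd ℂ) (v (-k) t)‖ ^ 2)
          + ∫ t, ‖1 / 2 * w k t + 1 / 2 * (starRingEnd ℂ) (w (-k) t)‖ ^ 2)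
        ≤ 1 / 2 * (wt k ^ m * ((∫ t, ‖v k t‖ ^ 2) + ∫ t, ‖w k t‖ ^ 2))
          + 1 / 2 * (wt (-k) ^ m * ((∫ t, ‖v (-k) t‖ ^ 2) + ∫ t, ‖w (-k) t‖ ^ 2)) := fun k _ => by
      have h3 := mul_le_mul_of_nonneg_left (add_le_add (key h.memLp_v k) (key h.memLp_w k))
        (pow_nonneg (wt_pos k).le m)
      rw [wt_neg]
      linarith
    refine (Finset.sum_le_sum h2).trans ?_
    have h4 := hM (F.map (Equiv.neg ℤ).toEmbedding)
    rw [Finset.sum_map] at h4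
    simp only [Equiv.coe_toEmbedding, Equiv.neg_apply] at h4
    rw [Finset.sum_add_distrib, ← Finset.mul_sum, ← Finset.mul_sum]
    linarith [hM F]

set_option maxHeartbeats 800000 in
/-- Existence, with the estimate of level `m`, for the linearized system. The solution is the weak
limit of the solutions of the truncated systems. -/
theorem StateCoef.exists_isCoefSol (hc : StateCoef c μ δ A L) (hL : 0 ≤ L) (hδ : 0 < δ) {m : ℕ}
    {κ D : ℝ} (hrate : ∀ K : Finset ℤ, 0 ∉ K → ∀ᵐ t, ∀ v w : ℤ → ℂ, energyRate μ (c t) K m v w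
      ≤ κ * (∑ k ∈ K, (wt k ^ m * ‖v k‖) ^ 2 + ∑ k ∈ K, (wt k ^ m * ‖w k‖) ^ 2)
        + D * √(∑ k ∈ K, wt k ^ 2 * ‖w k‖ ^ 2) * √(∑ k ∈ K, (wt k ^ m * ‖v k‖) ^ 2))
    {γ : ℝ} (hγ0 : 0 < γ) (hγ : π⁻¹ * L + 2 * κ ≤ γ * symmConst δ)
    (hγ1 : π⁻¹ * L + 2 * rateConst A 1 ≤ γ * symmConst δ)
    (hγ2 : π⁻¹ * L / 2 + rateConst A 0 < γ * symmConst δ) {g : ℤ → ℝ → ℂ}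
    (hg : ∀ k, MemLp (g k) 2 volume) {G₁ Gm : ℝ}
    (hG₁ : ∀ F : Finset ℤ, ∑ k ∈ F, wt k ^ 2 * ∫ t, ‖g k t‖ ^ 2 ≤ G₁)
    (hGm : ∀ F : Finset ℤ, ∑ k ∈ F, wt k ^ (2 * m) * ∫ t, ‖g k t‖ ^ 2 ≤ Gm) :
    ∃ v w : ℤ → ℝ → ℂ, IsCoefSol c μ γ g v w ∧
      ∀ F : Finset ℤ, ∑ k ∈ F, wt k ^ (2 * m) * ((∫ t, ‖v k t‖ ^ 2) + ∫ t, ‖w k t‖ ^ 2)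
        ≤ 8 / (γ * symmConst δ) ^ 2 * (D ^ 2 * (8 / (γ * symmConst δ) ^ 2 * G₁) + Gm) := by
  set s := γ * symmConst δ with hs
  let K : ℕ → Finset ℤ := fun N => (Finset.Icc (-(N : ℤ)) N).erase 0
  have hK0 : ∀ N, (0 : ℤ) ∉ K N := fun N => Finset.notMem_erase 0 _
  have hKmem : ∀ k : ℤ, k ≠ 0 → ∀ᶠ N in atTop, k ∈ K N := fun k hk => by
    filter_upwards [eventually_ge_atTop k.natAbs] with N hN
    refine Finset.mem_erase.mpr ⟨hk, Finset.mem_Icc.mpr ?_⟩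
    omega
  have hpos : ∀ N : ℕ, (0 : ℝ) < 1 / ((N : ℝ) + 1) := fun N => Nat.one_div_pos_of_nat
  choose v w hv hw hvw hsol using fun N : ℕ =>
    hc.exists_truncated_solution hL hδ (hK0 N) hγ0.le hγ2 (hpos N) hg
  -- the bounds of levels `1` and `m`, uniform in the truncation
  have hb1 : ∀ N, ∑ k ∈ K N, wt k ^ 2 * ((∫ t, ‖v N k t‖ ^ 2) + ∫ t, ‖w N k t‖ ^ 2)
      ≤ 8 / s ^ 2 * G₁ := fun N => by
    have h1 := hc.apriori_estimate (m := 1) (κ := rateConst A 1) (D := 0) hL hδ (by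
      filter_upwards [hc.bound] with t ht v w
      have := energyRate_le_rateConst (μ := μ) ht (m := 1) (by norm_num) (hK0 N) v w
      linarith) hγ0 hγ1 (hpos N) (hv N) (hw N) hg (hsol N)
    rw [integral_add (integrable_sum_wt_sq (hv N) 1 _) (integrable_sum_wt_sq (hw N) 1 _),
      integral_sum_wt_sq (hv N), integral_sum_wt_sq (hw N), integral_sum_wt_sq hg] at h1
    simp only [mul_add, Finset.sum_add_distrib]
    refine h1.trans (mul_le_mul_of_nonneg_left ?_ (by positivity))
    simpa using hG₁ (K N)
  have hbm : ∀ N, ∑ k ∈ K N, wt k ^ (2 * m) * ((∫ t, ‖v N k t‖ ^ 2) + ∫ t, ‖w N k t‖ ^ 2)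
      ≤ 8 / s ^ 2 * (D ^ 2 * (8 / s ^ 2 * G₁) + Gm) := fun N => by
    have h1 := hc.apriori_estimate hL hδ (hrate (K N) (hK0 N)) hγ0 hγ (hpos N) (hv N) (hw N) hg
      (hsol N)
    rw [integral_add (integrable_sum_wt_sq (hv N) m _) (integrable_sum_wt_sq (hw N) m _),
      integral_sum_wt_sq (hv N), integral_sum_wt_sq (hw N), integral_sum_wt_sq (hw N),
      integral_sum_wt_sq hg] at h1
    simp only [mul_add, Finset.sum_add_distrib] at hb1 ⊢
    refine h1.trans ?_
    rw [← mul_add]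
    refine mul_le_mul_of_nonneg_left (add_le_add ?_ (hGm _)) (by positivity)
    refine mul_le_mul_of_nonneg_left ((le_add_of_nonneg_left ?_).trans (hb1 N)) (sq_nonneg D)
    exact Finset.sum_nonneg fun k _ => mul_nonneg (pow_nonneg (wt_pos k).le _)
      (integral_nonneg fun t => sq_nonneg _)
  have hI : ∀ (x : ℝ → ℂ), 0 ≤ ∫ t, ‖x t‖ ^ 2 := fun x => integral_nonneg fun t => sq_nonneg _
  have hF : ∀ (p : ℕ) {B : ℝ}, (∀ N, ∑ k ∈ K N, wt k ^ p *
      ((∫ t, ‖v N k t‖ ^ 2) + ∫ t, ‖w N k t‖ ^ 2) ≤ B) → ∀ N (F : Finset ℤ),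
      ∑ k ∈ F, wt k ^ p * ((∫ t, ‖v N k t‖ ^ 2) + ∫ t, ‖w N k t‖ ^ 2) ≤ B := by
    intro p B hB N F
    refine (sum_le_sum_of_eq_zero (fun k => mul_nonneg (pow_nonneg (wt_pos k).le _)
      (add_nonneg (hI _) (hI _))) fun k hk => ?_).trans (hB N)
    simp [hvw N k hk]
  have hw1 : ∀ N (F : Finset ℤ), ∑ k ∈ F, ∫ t, ‖w N k t‖ ^ 2 ≤ 8 / s ^ 2 * G₁ := fun N F => by
    refine (Finset.sum_le_sum fun k _ => ?_).trans (hF 2 hb1 N F)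
    exact (le_add_of_nonneg_left (hI _)).trans (le_mul_of_one_le_left
      (add_nonneg (hI _) (hI _)) (one_le_pow₀ (one_le_wt k)))
  have hv1 : ∀ N (F : Finset ℤ), ∑ k ∈ F, ∫ t, ‖v N k t‖ ^ 2 ≤ 8 / s ^ 2 * G₁ := fun N F => by
    refine (Finset.sum_le_sum fun k _ => ?_).trans (hF 2 hb1 N F)
    exact (le_add_of_nonneg_right (hI _)).trans (le_mul_of_one_le_left
      (add_nonneg (hI _) (hI _)) (one_le_pow₀ (one_le_wt k)))
  -- weak limits of the individual coefficients
  choose v' hv' hvlim using fun k => exists_weak_limit (fun N => hv N k)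
    (fun N => by simpa using hv1 N {k})
  choose w' hw' hwlim using fun k => exists_weak_limit (fun N => hw N k)
    (fun N => by simpa using hw1 N {k})
  -- the bounds pass to the limit by weak lower semicontinuity, in the two families at once
  have hlimF : ∀ (p : ℕ) {B : ℝ}, (∀ N, ∑ k ∈ K N, wt k ^ p *
      ((∫ t, ‖v N k t‖ ^ 2) + ∫ t, ‖w N k t‖ ^ 2) ≤ B) → ∀ F : Finset ℤ,
      ∑ k ∈ F, wt k ^ p * ((∫ t, ‖v' k t‖ ^ 2) + ∫ t, ‖w' k t‖ ^ 2) ≤ B := by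
    intro p B hB F
    have h1 := sum_integral_sq_le_of_weak_limit (ι := ℤ ⊕ ℤ)
      (x := Sum.elim (fun k N => v N k) (fun k N => w N k)) (z := Sum.elim v' w')
      (by rintro (k | k) N; exacts [hv N k, hw N k]) (by rintro (k | k); exacts [hv' k, hw' k])
      (by rintro (k | k); exacts [hvlim k, hwlim k]) (F.disjSum F)
      (a := Sum.elim (fun k => wt k ^ p) (fun k => wt k ^ p))
      (by rintro (k | k) <;> exact pow_nonneg (wt_pos k).le _) (M := B)
      (Eventually.of_forall fun N => by
        have h2 := hF p hB N F
        rw [Finset.sum_disjSum]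
        simpa only [Sum.elim_inl, Sum.elim_inr, mul_add, Finset.sum_add_distrib] using h2)
    rw [Finset.sum_disjSum] at h1
    simpa only [Sum.elim_inl, Sum.elim_inr, mul_add, Finset.sum_add_distrib] using h1
  have hw'1 : ∀ F : Finset ℤ, ∑ k ∈ F, wt k ^ 2 * ∫ t, ‖w' k t‖ ^ 2 ≤ 8 / s ^ 2 * G₁ := fun F =>
    (Finset.sum_le_sum fun k _ => mul_le_mul_of_nonneg_left (le_add_of_nonneg_left (hI _))
      (pow_nonneg (wt_pos k).le _)).trans (hlimF 2 hb1 F)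
  have hw'0 := sum_integral_sq_le_of_wt hw'1
  -- the mode `0` vanishes in every truncation, hence in the limit
  have hzero : ∀ {x : ℕ → ℝ → ℂ} {z : ℝ → ℂ}, MemLp z 2 volume → (∀ N, x N = 0) →
      (∀ y : ℝ → ℂ, MemLp y 2 volume →
        Tendsto (fun N => ∫ t, y t * x N t) (hyperfilter ℕ) (𝓝 (∫ t, y t * z t))) →
      ∀ᵐ t, z t = 0 := by
    intro x z hz hx hlim
    have h1 := hlim _ hz.star
    simp only [hx, Pi.zero_apply, mul_zero, integral_zero] at h1
    have h2 := tendsto_nhds_unique h1 tendsto_const_nhds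
    simp only [Pi.star_apply, RCLike.star_def] at h2
    rw [integral_conj_mul_self, Complex.ofReal_eq_zero] at h2
    have h3 := (integral_eq_zero_iff_of_nonneg (fun t => sq_nonneg ‖z t‖)
      (hz.integrable_norm_pow (by norm_num))).mp h2
    filter_upwards [h3] with t ht
    simpa using ht
  refine ⟨v', w', ⟨hv', hw', ?_, ⟨_, hw'1⟩, fun k hk => ?_, fun k hk => ?_⟩, hlimF _ hbm⟩
  · filter_upwards [hzero (hv' 0) (fun N => (hvw N 0 (hK0 N)).1) (hvlim 0),
      hzero (hw' 0) (fun N => (hvw N 0 (hK0 N)).2) (hwlim 0)] with t h1 h2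
    exact ⟨h1, h2⟩
  · have mF : ∀ N, MemLp (fun t => trFlux μ (c t) (K N) (fun j => w N j t) k) 2 volume := fun N =>
      hc.memLp_trFlux (hw N) _ k
    have mS := hc.memLp_coefFlux (μ := μ) hw' hw'0 k
    refine hasWeakDeriv_of_backward (hKmem k hk) (fun N => hv N k)
      (R := fun N t => Complex.I * k * trFlux μ (c t) (K N) (fun j => w N j t) k + g k t)
      (fun N => ((mF N).const_mul _).add (hg k)) (hv' k) ((mS.const_mul _).add (hg k))
      (fun N => by simpa using hv1 N {k}) (fun N hN => ?_) (hvlim k) (fun y hy => ?_)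
    · filter_upwards [hsol N] with t ht using (ht k hN).1
    · have e : ∀ {f : ℝ → ℂ}, MemLp f 2 volume → ∫ t, y t * (Complex.I * k * f t + g k t)
          = Complex.I * k * (∫ t, y t * f t) + ∫ t, y t * g k t := by
        intro f hf
        rw [← integral_const_mul, ← integral_add ((integrable_mul_of_memLp hy hf).const_mul _)
          (integrable_mul_of_memLp hy (hg k))]
        exact integral_congr_ae (ae_of_all _ fun t => by simp only; ring)
      rw [e mS]
      simp only [fun N => e (mF N)]
      exact ((hc.tendsto_integral_trFlux hw hw' (fun N k hk => (hvw N k hk).2) hw1 hw'0 hwlim k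
        hy).const_mul _).add_const _
  · refine hasWeakDeriv_of_backward (hKmem k hk) (fun N => hw N k)
      (R := fun N t => Complex.I * k * v N k t) (fun N => (hv N k).const_mul _) (hw' k)
      ((hv' k).const_mul _) (fun N => by simpa using hw1 N {k}) (fun N hN => ?_) (hwlim k)
      (fun y hy => ?_)
    · filter_upwards [hsol N] with t ht using (ht k hN).2
    · simp only [fun (f : ℝ → ℂ) t => mul_left_comm (y t) (Complex.I * k) (f t), integral_const_mul]
      exact (hvlim k y hy).const_mul _

end StateCoef

/-! ### Weak derivatives and difference quotients -/

/-- The average over a translated window of a test function is the primitive of a difference. -/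
theorem exists_test_primitive {θ : ℝ → ℝ} (hθ : ContDiff ℝ ∞ θ) (hs : HasCompactSupport θ) (h : ℝ) :
    ContDiff ℝ ∞ (fun t => ∫ s in (0 : ℝ)..h, θ (t + s)) ∧
      HasCompactSupport (fun t => ∫ s in (0 : ℝ)..h, θ (t + s)) ∧
      ∀ t, deriv (fun t => ∫ s in (0 : ℝ)..h, θ (t + s)) t = θ (t + h) - θ t := by
  set Φ : ℝ → ℝ := fun t => ∫ s in (0 : ℝ)..t, θ s with hΦ
  have hd : ∀ t, HasDerivAt Φ (θ t) t := fun t =>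
    (hθ.continuous.integral_hasStrictDerivAt 0 t).hasDerivAt
  have hΦs : ContDiff ℝ ∞ Φ := by
    rw [contDiff_infty_iff_deriv]
    refine ⟨fun t => (hd t).differentiableAt, ?_⟩
    rwa [show deriv Φ = θ from funext fun t => (hd t).deriv]
  have e : (fun t => ∫ s in (0 : ℝ)..h, θ (t + s)) = fun t => Φ (t + h) - Φ t := by
    funext t
    rw [intervalIntegral.integral_comp_add_left, add_zero, hΦ,
      intervalIntegral.integral_interval_sub_left (hθ.continuous.intervalIntegrable _ _)
        (hθ.continuous.intervalIntegrable _ _)]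
  refine ⟨?_, ?_, fun t => ?_⟩
  · rw [e]
    exact (hΦs.comp (contDiff_id.add contDiff_const)).sub hΦs
  · obtain ⟨R, hR0, hR⟩ := hs.exists_pos_le_norm
    refine HasCompactSupport.of_support_subset_isCompact (K := Set.Icc (-(R + |h|)) (R + |h|))
      isCompact_Icc fun t ht => ?_
    by_contra hcon
    refine ht ?_
    change ∫ s in (0 : ℝ)..h, θ (t + s) = 0
    rw [intervalIntegral.integral_congr (g := fun _ => (0 : ℝ)), intervalIntegral.integral_zero]
    intro s hs'
    refine hR _ ?_
    have h1 : R + |h| < |t| := by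
      by_contra h2
      push Not at h2
      exact hcon (abs_le.mp h2)
    have h2 : |s| ≤ |h| := by
      have := Set.mem_uIcc.mp hs'
      rcases this with h3 | h3
      · rw [abs_of_nonneg h3.1]; exact h3.2.trans (le_abs_self h)
      · rw [abs_of_nonpos h3.2]; exact (neg_le_neg h3.1).trans (neg_le_abs h)
    have h3 := abs_sub_abs_le_abs_sub t (-s)
    rw [abs_neg, sub_neg_eq_add] at h3
    rw [Real.norm_eq_abs]
    linarith
  · rw [e]
    exact (((hd (t + h)).comp_add_const t h).sub (hd t)).deriv

theorem integrable_test_mul {θ : ℝ → ℝ} (hθ : Continuous θ) (hs : HasCompactSupport θ) {x : ℝ → ℂ}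
    (hx : LocallyIntegrable x volume) : Integrable (fun t => (θ t : ℂ) * x t) volume := by
  refine (hx.integrable_smul_left_of_hasCompactSupport hθ hs).congr (ae_of_all _ fun t => ?_)
  simp

theorem integral_test_mul_window {θ : ℝ → ℝ} (hθ : Continuous θ) (hs : HasCompactSupport θ)
    {y : ℝ → ℂ} (hy : LocallyIntegrable y volume) {a : ℝ} (ha : 0 ≤ a) :
    ∫ t, ((∫ s in (0 : ℝ)..a, θ (t + s) : ℝ) : ℂ) * y t
      = ∫ t, (θ t : ℂ) * ∫ s in (0 : ℝ)..a, y (t - s) := by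
  obtain ⟨R, hR0, hR⟩ := hs.exists_pos_le_norm
  obtain ⟨B, hB⟩ := hs.exists_bound_of_continuous hθ
  set S := Set.Icc (-(R + a)) (R + a) with hS
  set z : ℝ → ℂ := S.indicator y with hz
  have hzi : Integrable z volume :=
    (integrable_indicator_iff measurableSet_Icc).mpr (hy.integrableOn_isCompact isCompact_Icc)
  -- on the support of the integrands `y` may be replaced by the integrable function `z`
  have hθ0 : ∀ t s, 0 < s → s ≤ a → (θ (t + s) : ℂ) * y t = θ (t + s) * z t := fun t s h1 h2 => by
    by_cases ht : t ∈ S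
    · rw [hz, Set.indicator_of_mem ht]
    · have : θ (t + s) = 0 := by
        refine hR _ ?_
        rw [Real.norm_eq_abs]
        by_contra h3
        push Not at h3
        have h4 := abs_lt.mp h3
        exact ht ⟨by linarith, by linarith⟩
      rw [this]
      simp
  set ν := (volume : Measure ℝ).restrict (Set.Ioc 0 a) with hν
  have i1 : Integrable (fun p : ℝ × ℝ => (θ (p.1 + p.2) : ℂ) * z p.1) (volume.prod ν) := by
    have h1 : Integrable (fun p : ℝ × ℝ => z p.1 * (1 : ℂ)) (volume.prod ν) :=
      hzi.mul_prod (integrable_const (1 : ℂ))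
    simp only [mul_one] at h1
    refine h1.bdd_mul (c := B) ?_ (ae_of_all _ fun p => ?_)
    · exact (Complex.continuous_ofReal.comp (hθ.comp
        (continuous_fst.add continuous_snd))).aestronglyMeasurable
    · rw [Complex.norm_real]
      exact hB _
  have i2 : Integrable (fun p : ℝ × ℝ => (θ p.1 : ℂ) * z (p.1 - p.2)) (volume.prod ν) := by
    have h1 := Integrable.convolution_integrand (ν := ν) (μ := volume) (ContinuousLinearMap.mul ℝ ℂ)
      (integrable_const (1 : ℂ)) hzi
    simp only [ContinuousLinearMap.mul_apply', one_mul] at h1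
    refine h1.bdd_mul (c := B) ?_ (ae_of_all _ fun p => ?_)
    · exact (Complex.continuous_ofReal.comp (hθ.comp continuous_fst)).aestronglyMeasurable
    · rw [Complex.norm_real]
      exact hB _
  have e1 : ∫ t, ((∫ s in (0 : ℝ)..a, θ (t + s) : ℝ) : ℂ) * y t
      = ∫ t, ∫ s, (θ (t + s) : ℂ) * z t ∂ν := by
    refine integral_congr_ae (ae_of_all _ fun t => ?_)
    simp only
    rw [← intervalIntegral.integral_ofReal, ← intervalIntegral.integral_mul_const,
      intervalIntegral.integral_of_le ha]
    exact setIntegral_congr_fun measurableSet_Ioc fun s hs => hθ0 t s hs.1 hs.2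
  have e2 : ∫ t, (θ t : ℂ) * ∫ s in (0 : ℝ)..a, y (t - s)
      = ∫ t, ∫ s, (θ t : ℂ) * z (t - s) ∂ν := by
    refine integral_congr_ae (ae_of_all _ fun t => ?_)
    simp only
    rw [← intervalIntegral.integral_const_mul, intervalIntegral.integral_of_le ha]
    refine setIntegral_congr_fun measurableSet_Ioc fun s hs => ?_
    have := hθ0 (t - s) s hs.1 hs.2
    rwa [sub_add_cancel] at this
  rw [e1, e2, integral_integral_swap (f := fun t s => (θ (t + s) : ℂ) * z t) i1,
    integral_integral_swap (f := fun t s => (θ t : ℂ) * z (t - s)) i2]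
  refine integral_congr_ae (ae_of_all _ fun s => ?_)
  simp only
  rw [← integral_sub_right_eq_self (fun t => (θ (t + s) : ℂ) * z t) s]
  simp

/-- The fundamental theorem of calculus for weak derivatives. -/
theorem HasWeakDeriv.sub_shift {x y : ℝ → ℂ} (h : HasWeakDeriv x y)
    (hx : LocallyIntegrable x volume) (hy : LocallyIntegrable y volume) {a : ℝ} (ha : 0 ≤ a) :
    ∀ᵐ t, x t - x (t - a) = ∫ s in (0 : ℝ)..a, y (t - s) := by
  have hxs : LocallyIntegrable (fun t => x (t - a)) volume := by
    refine (locallyIntegrable_map_homeomorph (Homeomorph.subRight a) (f := x)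
      (μ := (volume : Measure ℝ))).mp ?_
    have := (measurePreserving_sub_right (volume : Measure ℝ) a).map_eq
    rw [show Measure.map (Homeomorph.subRight a) (volume : Measure ℝ) = volume from this]
    exact hx
  have hyi : ∀ b d, IntervalIntegrable y volume b d := fun b d =>
    (hy.integrableOn_isCompact isCompact_uIcc).intervalIntegrable
  have hcont : Continuous fun t => ∫ s in (0 : ℝ)..a, y (t - s) := by
    have e : (fun t => ∫ s in (0 : ℝ)..a, y (t - s))
        = fun t => (∫ s in (0 : ℝ)..t, y s) - ∫ s in (0 : ℝ)..(t - a), y s := by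
      funext t
      rw [intervalIntegral.integral_comp_sub_left, sub_zero,
        intervalIntegral.integral_interval_sub_left (hyi _ _) (hyi _ _)]
    rw [e]
    have := intervalIntegral.continuous_primitive hyi 0
    exact this.sub (this.comp (continuous_id.sub continuous_const))
  have key := ae_eq_zero_of_integral_contDiff_smul_eq_zero (μ := (volume : Measure ℝ))
    ((hx.sub hxs).sub hcont.locallyIntegrable) (fun θ hθ hs => ?_)
  · filter_upwards [key] with t ht
    exact sub_eq_zero.mp ht
  obtain ⟨hΘ, hΘs, hΘd⟩ := exists_test_primitive hθ hs a
  have h1 := h _ hΘ hΘs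
  have i1 : Integrable (fun t => (θ t : ℂ) * x t) volume :=
    integrable_test_mul hθ.continuous hs hx
  have i2 : Integrable (fun t => (θ t : ℂ) * x (t - a)) volume :=
    integrable_test_mul hθ.continuous hs hxs
  have i3 : Integrable (fun t => (θ t : ℂ) * ∫ s in (0 : ℝ)..a, y (t - s)) volume :=
    integrable_test_mul hθ.continuous hs hcont.locallyIntegrable
  have e1 : ∫ t, ((deriv (fun t => ∫ s in (0 : ℝ)..a, θ (t + s)) t : ℝ) : ℂ) * x t
      = (∫ t, (θ t : ℂ) * x (t - a)) - ∫ t, (θ t : ℂ) * x t := by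
    have e2 : ∫ t, (θ t : ℂ) * x (t - a) = ∫ t, (θ (t + a) : ℂ) * x t := by
      rw [← integral_add_right_eq_self (fun t => (θ t : ℂ) * x (t - a)) a]
      simp
    have i4 : Integrable (fun t => (θ (t + a) : ℂ) * x t) volume := by
      simpa using i2.comp_add_right a
    rw [e2, ← integral_sub i4 i1]
    refine integral_congr_ae (ae_of_all _ fun t => ?_)
    simp only [hΘd]
    push_cast
    ring
  have e3 : ∫ t, ((∫ s in (0 : ℝ)..a, θ (t + s) : ℝ) : ℂ) * y t
      = ∫ t, (θ t : ℂ) * ∫ s in (0 : ℝ)..a, y (t - s) :=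
    integral_test_mul_window hθ.continuous hs hy ha
  rw [e1, e3] at h1
  have e4 : ∀ t, θ t • (x t - x (t - a) - ∫ s in (0 : ℝ)..a, y (t - s))
      = (θ t : ℂ) * x t - (θ t : ℂ) * x (t - a) - (θ t : ℂ) * ∫ s in (0 : ℝ)..a, y (t - s) :=
    fun t => by rw [Complex.real_smul]; ring
  have e5 : ∀ t, θ t • (((x - fun t => x (t - a)) - fun t => ∫ s in (0 : ℝ)..a, y (t - s)) t)
      = (θ t : ℂ) * x t - (θ t : ℂ) * x (t - a) - (θ t : ℂ) * ∫ s in (0 : ℝ)..a, y (t - s) := e4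
  simp only [e5]
  refine (integral_sub (i1.sub i2) i3).trans ?_
  rw [integral_sub' i1 i2]
  linear_combination -h1

/-- Correlations of square-integrable functions are continuous. -/
theorem continuous_integral_mul_shift {z y : ℝ → ℂ} (hz : MemLp z 2 volume)
    (hy : MemLp y 2 volume) : Continuous fun s => ∫ t, z t * y (t - s) := by
  let g : ℝ → C(ℝ, ℝ) := fun s => ⟨fun t => t - s, by fun_prop⟩
  have hg : Continuous g := by
    refine ContinuousMap.continuous_of_continuous_uncurry _ ?_
    change Continuous fun p : ℝ × ℝ => p.2 - p.1
    fun_prop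
  have hgm : ∀ s, MeasurePreserving (g s) volume volume := fun s =>
    measurePreserving_sub_right volume s
  have h1 : Continuous fun s => Lp.compMeasurePreserving (g s) (hgm s) (hy.toLp) :=
    continuous_const.compMeasurePreservingLp hg hgm (by norm_num)
  have h2 : Continuous fun s =>
      inner ℂ (hz.star.toLp) (Lp.compMeasurePreserving (g s) (hgm s) (hy.toLp)) :=
    continuous_const.inner h1
  refine h2.congr fun s => ?_
  rw [L2.inner_def]
  refine integral_congr_ae ?_
  filter_upwards [hz.star.coeFn_toLp, Lp.coeFn_compMeasurePreserving hy.toLp (hgm s),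
    (hgm s).quasiMeasurePreserving.ae hy.coeFn_toLp] with t h3 h4 h5
  rw [h3, h4, RCLike.inner_apply, Function.comp_apply, h5]
  simp [g, mul_comm]

/-- The backward difference quotients converge weakly to the weak derivative. -/
theorem HasWeakDeriv.tendsto_integral_backward {x y z : ℝ → ℂ} (h : HasWeakDeriv x y)
    (hx : MemLp x 2 volume) (hy : MemLp y 2 volume) (hz : MemLp z 2 volume) :
    Tendsto (fun a : ℝ => ∫ t, z t * ((a⁻¹ : ℝ) * (x t - x (t - a)) - y t)) (𝓝[>] 0) (𝓝 0) := by
  have hΓ := continuous_integral_mul_shift hz hy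
  set Γ : ℝ → ℂ := fun s => ∫ t, z t * y (t - s) with hΓdef
  have hd : HasDerivAt (fun a => ∫ s in (0 : ℝ)..a, Γ s) (Γ 0) 0 :=
    (hΓ.integral_hasStrictDerivAt 0 0).hasDerivAt
  have h1 := (hd.tendsto_slope_zero_right).sub_const (Γ 0)
  rw [sub_self] at h1
  refine h1.congr' ?_
  filter_upwards [self_mem_nhdsWithin] with a ha
  have ha0 : 0 < a := ha
  have e1 : ∫ t, z t * (x t - x (t - a)) = ∫ s in (0 : ℝ)..a, Γ s := by
    have e2 : ∫ t, z t * (x t - x (t - a)) = ∫ t, ∫ s in (0 : ℝ)..a, z t * y (t - s) := by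
      refine integral_congr_ae ?_
      filter_upwards [h.sub_shift (hx.locallyIntegrable (by norm_num))
        (hy.locallyIntegrable (by norm_num)) ha0.le] with t ht
      rw [ht, intervalIntegral.integral_const_mul]
    rw [e2]
    simp only [intervalIntegral.integral_of_le ha0.le]
    refine integral_integral_swap ?_
    have iy : Integrable (fun t => ‖y t‖ ^ 2) volume := hy.integrable_norm_pow (by norm_num)
    have iz : Integrable (fun t => ‖z t‖ ^ 2) volume := hz.integrable_norm_pow (by norm_num)
    have j1 := Integrable.convolution_integrand (ν := volume.restrict (Set.Ioc 0 a)) (μ := volume)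
      (ContinuousLinearMap.mul ℝ ℝ) (integrable_const (1 : ℝ)) iy
    have j2 : Integrable (fun p : ℝ × ℝ => ‖z p.1‖ ^ 2 * (1 : ℝ))
      (volume.prod (volume.restrict (Set.Ioc 0 a))) := iz.mul_prod (integrable_const (1 : ℝ))
    simp only [ContinuousLinearMap.mul_apply', one_mul] at j1
    simp only [mul_one] at j2
    refine (j2.add j1).mono' ?_ (ae_of_all _ fun p => ?_)
    · refine hz.1.comp_fst.mul ?_
      exact hy.1.comp_quasiMeasurePreserving
        (quasiMeasurePreserving_sub_of_right_invariant volume (volume.restrict (Set.Ioc 0 a)))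
    · simp only [Function.uncurry, norm_mul, Pi.add_apply]
      nlinarith [sq_nonneg (‖z p.1‖ - ‖y (p.1 - p.2)‖), sq_nonneg (‖z p.1‖),
        sq_nonneg ‖y (p.1 - p.2)‖]
  have e3 : ∫ t, z t * ((a⁻¹ : ℝ) * (x t - x (t - a)) - y t)
      = (a⁻¹ : ℝ) * (∫ t, z t * (x t - x (t - a))) - Γ 0 := by
    have i1 := integrable_mul_of_memLp hz (hx.sub (memLp_shift hx a))
    have i2 := integrable_mul_of_memLp hz hy
    simp only [hΓdef, sub_zero]
    rw [← integral_const_mul]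
    refine Eq.trans ?_ (integral_sub (i1.const_mul ((a⁻¹ : ℝ) : ℂ)) i2)
    refine integral_congr_ae (ae_of_all _ fun t => ?_)
    simp only
    ring
  rw [e3, e1]
  simp [Complex.real_smul]

/-! ### Uniqueness for the linearized system -/

section StateCoef

variable {c : ℝ → ℤ → ℂ} {μ δ A L : ℝ}

theorem StateCoef.memLp_princ (hc : StateCoef c μ δ A L) {w : ℤ → ℝ → ℂ}
    (hw : ∀ k, MemLp (w k) 2 volume) (K : Finset ℤ) (k : ℤ) :
    MemLp (fun t => princ μ (c t) K (fun j => w j t) k) 2 volume :=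
  ((hw k).const_mul (μ : ℂ)).sub ((memLp_finsetSum K fun j _ =>
    (hw j).mul ((hc.memLp_top (k - j)).const_mul
      (((|((k - j : ℤ) : ℝ)| : ℝ)) : ℂ))).const_mul ((π : ℂ)⁻¹))

/-- The truncation of a solution is an approximate solution of the truncated system, and satisfies
its energy inequality with the truncation error of the flux as forcing. -/
theorem IsCoefSol.truncated_energy_le (hc : StateCoef c μ δ A L) (hL : 0 ≤ L) (hδ : 0 < δ) {γ : ℝ}
    (hγ0 : 0 ≤ γ) {v w : ℤ → ℝ → ℂ} (h : IsCoefSol c μ γ (fun _ _ => 0) v w) {K : Finset ℤ}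
    (hK : 0 ∉ K) :
    (γ * symmConst δ - π⁻¹ * L / 2 - rateConst A 0) *
        ∫ t, (∑ k ∈ K, ‖v k t‖ ^ 2 + ∑ k ∈ K, ‖w k t‖ ^ 2)
      ≤ ∑ k ∈ K, (∫ t, (starRingEnd ℂ) (v k t) * (Complex.I * k *
        (coefFlux μ (c t) (fun j => w j t) k - trFlux μ (c t) K (fun j => w j t) k))).re := by
  obtain ⟨M, hM⟩ := h.bounded
  have hM0 := sum_integral_sq_le_of_wt hM
  set e : ℤ → ℝ → ℂ := fun k t => Complex.I * k *
    (coefFlux μ (c t) (fun j => w j t) k - trFlux μ (c t) K (fun j => w j t) k) with he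
  have mflux := fun k => hc.memLp_coefFlux (μ := μ) h.memLp_w hM0 k
  have me : ∀ k, MemLp (e k) 2 volume := fun k =>
    ((mflux k).sub (hc.memLp_trFlux h.memLp_w K k)).const_mul _
  set R : ℤ → ℝ → ℂ := fun k t =>
    Complex.I * k * coefFlux μ (c t) (fun j => w j t) k + 0 - γ * v k t with hR
  set R' : ℤ → ℝ → ℂ := fun k t => Complex.I * k * v k t - γ * w k t with hR'
  have mR : ∀ k, MemLp (R k) 2 volume := fun k =>
    (((mflux k).const_mul _).add MemLp.zero).sub ((h.memLp_v k).const_mul _)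
  have mR' : ∀ k, MemLp (R' k) 2 volume := fun k =>
    ((h.memLp_v k).const_mul _).sub ((h.memLp_w k).const_mul _)
  set P : ℤ → ℝ → ℂ := fun k t => (starRingEnd ℂ) (princ μ (c t) K (fun j => w j t) k) with hP
  have mP : ∀ k, MemLp (P k) 2 volume := fun k => (hc.memLp_princ h.memLp_w K k).star
  set V : ℤ → ℝ → ℂ := fun k t => (starRingEnd ℂ) (v k t) with hV
  have mV : ∀ k, MemLp (V k) 2 volume := fun k => (h.memLp_v k).star
  set X := ∫ t, (∑ k ∈ K, ‖v k t‖ ^ 2 + ∑ k ∈ K, ‖w k t‖ ^ 2) with hX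
  have hlim : Tendsto (fun a : ℝ =>
      ∑ k ∈ K, (∫ t, V k t * ((a⁻¹ : ℝ) * (v k t - v k (t - a)) - R k t)).re
      + ∑ k ∈ K, (∫ t, P k t * ((a⁻¹ : ℝ) * (w k t - w k (t - a)) - R' k t)).re
      + ∑ k ∈ K, (∫ t, V k t * e k t).re) (𝓝[>] 0) (𝓝 (∑ k ∈ K, (∫ t, V k t * e k t).re)) := by
    have hk0 : ∀ k ∈ K, k ≠ 0 := fun k hk hk0 => hK (hk0 ▸ hk)
    have h1 : Tendsto (fun a : ℝ =>
        ∑ k ∈ K, (∫ t, V k t * ((a⁻¹ : ℝ) * (v k t - v k (t - a)) - R k t)).re)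
        (𝓝[>] 0) (𝓝 (∑ k ∈ K, (0 : ℂ).re)) := tendsto_finsetSum K fun k hk =>
      (Complex.continuous_re.tendsto _).comp
        ((h.eqn_v k (hk0 k hk)).tendsto_integral_backward (h.memLp_v k) (mR k) (mV k))
    have h2 : Tendsto (fun a : ℝ =>
        ∑ k ∈ K, (∫ t, P k t * ((a⁻¹ : ℝ) * (w k t - w k (t - a)) - R' k t)).re)
        (𝓝[>] 0) (𝓝 (∑ k ∈ K, (0 : ℂ).re)) := tendsto_finsetSum K fun k hk =>
      (Complex.continuous_re.tendsto _).comp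
        ((h.eqn_w k (hk0 k hk)).tendsto_integral_backward (h.memLp_w k) (mR' k) (mP k))
    simpa using (h1.add h2).add_const (∑ k ∈ K, (∫ t, V k t * e k t).re)
  refine ge_of_tendsto hlim ?_
  -- the energy inequality with time step `a`, whose residuals are the differences between the
  -- difference quotients and the weak derivatives, together with the truncation error
  filter_upwards [self_mem_nhdsWithin] with a ha
  have ha0 : 0 < a := ha
  obtain ⟨hi, hle⟩ := hc.energy_inequality (v := v) (w := w) (K := K)
    (F := fun k t => ((a⁻¹ : ℝ) * (v k t - v k (t - a)) - R k t) + e k t)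
    (G := fun k t => (a⁻¹ : ℝ) * (w k t - w k (t - a)) - R' k t) hL hδ 0 hγ0 ha0 h.memLp_v
    h.memLp_w (ae_of_all _ fun t k _ => by
      simp only [hR, hR', he]
      constructor <;> ring)
  simp only [pow_zero, one_mul] at hi hle
  have dv : ∀ k, MemLp (fun t => ((a⁻¹ : ℝ) : ℂ) * (v k t - v k (t - a)) - R k t) 2 volume :=
    fun k => (((h.memLp_v k).sub (memLp_shift (h.memLp_v k) a)).const_mul _).sub (mR k)
  have dw : ∀ k, MemLp (fun t => ((a⁻¹ : ℝ) : ℂ) * (w k t - w k (t - a)) - R' k t) 2 volume :=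
    fun k => (((h.memLp_w k).sub (memLp_shift (h.memLp_w k) a)).const_mul _).sub (mR' k)
  have iX : Integrable (fun t => ∑ k ∈ K, ‖v k t‖ ^ 2 + ∑ k ∈ K, ‖w k t‖ ^ 2) volume := by
    have h1 := (integrable_sum_wt_sq h.memLp_v 0 K).add (integrable_sum_wt_sq h.memLp_w 0 K)
    simp only [pow_zero, one_mul] at h1
    exact h1
  have iT : ∀ k, Integrable (fun t => ((starRingEnd ℂ) (v k t) *
      (((a⁻¹ : ℝ) * (v k t - v k (t - a)) - R k t) + e k t)
      + (starRingEnd ℂ) (princ μ (c t) K (fun j => w j t) k) *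
        ((a⁻¹ : ℝ) * (w k t - w k (t - a)) - R' k t)).re) volume := fun k =>
    ((integrable_mul_of_memLp (mV k) ((dv k).add (me k))).add
      (integrable_mul_of_memLp (mP k) (dw k))).re
  have h3 : ∫ t, (energyRate μ (c t) K 0 (fun k => v k t) (fun k => w k t)
        + ∑ k ∈ K, ((starRingEnd ℂ) (v k t) *
      (((a⁻¹ : ℝ) * (v k t - v k (t - a)) - R k t) + e k t)
      + (starRingEnd ℂ) (princ μ (c t) K (fun j => w j t) k) *
        ((a⁻¹ : ℝ) * (w k t - w k (t - a)) - R' k t)).re)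
      ≤ ∫ t, (rateConst A 0 * (∑ k ∈ K, ‖v k t‖ ^ 2 + ∑ k ∈ K, ‖w k t‖ ^ 2)
        + ∑ k ∈ K, ((starRingEnd ℂ) (v k t) *
      (((a⁻¹ : ℝ) * (v k t - v k (t - a)) - R k t) + e k t)
      + (starRingEnd ℂ) (princ μ (c t) K (fun j => w j t) k) *
        ((a⁻¹ : ℝ) * (w k t - w k (t - a)) - R' k t)).re) := by
    refine integral_mono_ae hi ((iX.const_mul _).add (integrable_finsetSum K fun k _ => iT k)) ?_
    filter_upwards [hc.bound] with t ht
    have := energyRate_le_rateConst (μ := μ) ht (m := 0) (by norm_num) hK (fun k => v k t)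
      (fun k => w k t)
    simp only [pow_zero, one_mul] at this
    linarith
  have h4 := hle.trans h3
  rw [integral_add (iX.const_mul _) (integrable_finsetSum K fun k _ => iT k), integral_const_mul,
    integral_finsetSum K fun k _ => iT k] at h4
  have h5 : ∑ k ∈ K, ∫ t, ((starRingEnd ℂ) (v k t) *
      (((a⁻¹ : ℝ) * (v k t - v k (t - a)) - R k t) + e k t)
      + (starRingEnd ℂ) (princ μ (c t) K (fun j => w j t) k) *
        ((a⁻¹ : ℝ) * (w k t - w k (t - a)) - R' k t)).re
      = ∑ k ∈ K, (∫ t, V k t * ((a⁻¹ : ℝ) * (v k t - v k (t - a)) - R k t)).re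
      + ∑ k ∈ K, (∫ t, P k t * ((a⁻¹ : ℝ) * (w k t - w k (t - a)) - R' k t)).re
      + ∑ k ∈ K, (∫ t, V k t * e k t).re := by
    rw [← Finset.sum_add_distrib, ← Finset.sum_add_distrib]
    refine Finset.sum_congr rfl fun k _ => ?_
    have j1 := integrable_mul_of_memLp (mV k) (dv k)
    have j2 := integrable_mul_of_memLp (mP k) (dw k)
    have j3 := integrable_mul_of_memLp (mV k) (me k)
    have j4 : (∫ t, V k t * ((a⁻¹ : ℝ) * (v k t - v k (t - a)) - R k t))
        + (∫ t, P k t * ((a⁻¹ : ℝ) * (w k t - w k (t - a)) - R' k t)) + (∫ t, V k t * e k t)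
        = ∫ t, ((starRingEnd ℂ) (v k t) * (((a⁻¹ : ℝ) * (v k t - v k (t - a)) - R k t) + e k t)
          + (starRingEnd ℂ) (princ μ (c t) K (fun j => w j t) k) *
            ((a⁻¹ : ℝ) * (w k t - w k (t - a)) - R' k t)) := by
      rw [← integral_add j1 j2]
      refine (integral_add (j1.add j2) j3).symm.trans
        (integral_congr_ae (ae_of_all _ fun t => ?_))
      simp only [Pi.add_apply, hV, hP]
      ring
    rw [← Complex.add_re, ← Complex.add_re, j4]
    exact (integral_re ((integrable_mul_of_memLp (mV k) ((dv k).add (me k))).add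
      (integrable_mul_of_memLp (mP k) (dw k))))
  rw [h5] at h4
  linarith

/-- The truncation error of the flux is controlled in `L²` by the `H¹` norm of the modes left
out. -/
theorem norm_flux_sub_trFlux_le {c : ℤ → ℂ} (hb : ∀ n, wt n ^ 5 * ‖c n‖ ≤ A) {w : ℤ → ℂ}
    (hw0 : w 0 = 0) (hw : Summable fun j => wt j ^ 2 * ‖w j‖ ^ 2) (K : Finset ℤ) :
    ∑ k ∈ K, ‖Complex.I * k * (coefFlux μ c w k - trFlux μ c K w k)‖ ^ 2
      ≤ (2 * π⁻¹ * A * wtSum) ^ 2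
        * (∑' j, wt j ^ 2 * ‖w j‖ ^ 2 - ∑ j ∈ K, wt j ^ 2 * ‖w j‖ ^ 2) := by
  have hA : 0 ≤ A := le_trans (by have := wt_pos 0; positivity) (hb 0)
  have hpi := Real.pi_pos
  set f : ℤ → ℝ := fun j => wt j ^ 2 * ‖w j‖ ^ 2 with hf
  have hf0 : ∀ j, 0 ≤ f j := fun j => by positivity
  have hb0 : ∀ n, 0 ≤ A * (wt n ^ 2)⁻¹ := fun n => by have := wt_pos n; positivity
  have hs0 : ∀ k, Summable fun j => ‖(fluxKernel k j : ℂ) * c (k - j) * w j‖ := by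
    refine (sum_norm_tsum_sq_le (b := fun n => A * (wt n ^ 2)⁻¹) (x := fun j => ‖w j‖)
      (X := ∑' j, f j) hb0 (sum_const_mul_wt_le hA) (fun F => ?_) (fun k j => by
        rw [norm_mul]
        exact mul_le_mul_of_nonneg_right (norm_fluxKernel_mul_le hb k j) (norm_nonneg _))).1
    refine le_trans (Finset.sum_le_sum fun j _ => ?_) (hw.sum_le_tsum F fun j _ => hf0 j)
    exact le_mul_of_one_le_left (sq_nonneg _) (one_le_pow₀ (one_le_wt j))
  classical
  have htail : ∀ {E : Type} [NormedAddCommGroup E] [CompleteSpace E] {z : ℤ → E}, Summable z →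
      ∑' j, (if j ∈ K then 0 else z j) = ∑' j, z j - ∑ j ∈ K, z j := by
    intro E _ _ z hz
    have h1 : Summable fun j => if j ∈ K then z j else 0 :=
      summable_of_ne_finset_zero (s := K) fun j hj => by simp [hj]
    have h2 : ∑' j, (if j ∈ K then z j else 0) = ∑ j ∈ K, z j := by
      rw [tsum_eq_sum (s := K) fun j hj => by simp [hj]]
      exact Finset.sum_congr rfl fun j hj => by simp [hj]
    rw [← h2, ← hz.tsum_sub h1]
    exact tsum_congr fun j => by split_ifs <;> simp
  -- one derivative of the flux costs one derivative of `w` or of the state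
  have hker : ∀ k j : ℤ, ‖(k : ℂ) * ((fluxKernel k j : ℂ) * c (k - j) * w j)‖
      ≤ 2 * (A * (wt (k - j) ^ 2)⁻¹) * (wt j * ‖w j‖) := fun k j => by
    rcases eq_or_ne j 0 with rfl | hj
    · simp [hw0]
    have h1 : |(k : ℝ)| * |fluxKernel k j| ≤ 2 * ((k - j : ℤ) : ℝ) ^ 2 * wt j := by
      rcases eq_or_ne (k - j) 0 with h0 | h0
      · have := abs_fluxKernel_le k j
        rw [h0, Int.cast_zero, abs_zero] at this
        rw [h0, le_antisymm this (abs_nonneg _)]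
        simp
      · have h2 : (1 : ℝ) ≤ |((k - j : ℤ) : ℝ)| := by exact_mod_cast Int.one_le_abs h0
        have h3 : |(k : ℝ)| ≤ |((k - j : ℤ) : ℝ)| + |(j : ℝ)| := by
          have := abs_add_le ((k - j : ℤ) : ℝ) j
          push_cast at this ⊢
          simpa using this
        have h4 := abs_fluxKernel_le k j
        have h5 : |(k : ℝ)| ≤ |((k - j : ℤ) : ℝ)| * (2 * wt j) := by
          rw [wt]
          nlinarith [abs_nonneg (j : ℝ)]
        calc |(k : ℝ)| * |fluxKernel k j|
            ≤ |((k - j : ℤ) : ℝ)| * (2 * wt j) * |((k - j : ℤ) : ℝ)| :=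
              mul_le_mul h5 h4 (abs_nonneg _) (mul_nonneg (abs_nonneg _)
                (by have := wt_pos j; positivity))
          _ = 2 * |((k - j : ℤ) : ℝ)| ^ 2 * wt j := by ring
          _ = _ := by rw [sq_abs]
    rw [norm_mul, norm_mul, norm_mul, Complex.norm_real, Complex.norm_intCast, Real.norm_eq_abs]
    have h6 := sq_mul_norm_le hb (k - j)
    have hwj := wt_pos j
    calc |(k : ℝ)| * (|fluxKernel k j| * ‖c (k - j)‖ * ‖w j‖)
        = |(k : ℝ)| * |fluxKernel k j| * (‖c (k - j)‖ * ‖w j‖) := by ring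
      _ ≤ 2 * ((k - j : ℤ) : ℝ) ^ 2 * wt j * (‖c (k - j)‖ * ‖w j‖) :=
          mul_le_mul_of_nonneg_right h1 (by positivity)
      _ = 2 * (((k - j : ℤ) : ℝ) ^ 2 * ‖c (k - j)‖) * (wt j * ‖w j‖) := by ring
      _ ≤ _ := by gcongr
  have key := (sum_norm_tsum_sq_le (b := fun n => 2 * π⁻¹ * A * (wt n ^ 2)⁻¹)
    (B := 2 * π⁻¹ * A * wtSum)
    (x := fun j => if j ∈ K then 0 else wt j * ‖w j‖) (X := ∑' j, f j - ∑ j ∈ K, f j)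
    (z := fun k j => if j ∈ K then 0 else
      Complex.I * k * (-(π : ℂ)⁻¹ * ((fluxKernel k j : ℂ) * c (k - j) * w j)))
    (fun n => by have := wt_pos n; positivity) (sum_const_mul_wt_le (by positivity)) (fun F => ?_)
    (fun k j => ?_)).2 K
  · refine le_trans (Finset.sum_le_sum fun k _ => le_of_eq ?_) key
    rw [htail (((hs0 k).of_norm.mul_left _).mul_left _), tsum_mul_left, tsum_mul_left,
      ← Finset.mul_sum, ← Finset.mul_sum, coefFlux, trFlux]
    congr 2
    ring
  · rw [← htail hw]
    have hs : Summable fun j => if j ∈ K then 0 else f j :=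
      Summable.of_nonneg_of_le (fun j => by split_ifs; exacts [le_rfl, hf0 j])
        (fun j => by split_ifs; exacts [hf0 j, le_rfl]) hw
    refine le_trans (Finset.sum_le_sum fun j _ => ?_)
      (hs.sum_le_tsum F fun j _ => by split_ifs; exacts [le_rfl, hf0 j])
    split_ifs
    · simp
    · simp only [hf, mul_pow]; exact le_rfl
  · split_ifs
    · simp
    · have : Complex.I * k * (-(π : ℂ)⁻¹ * ((fluxKernel k j : ℂ) * c (k - j) * w j))
        = (-(π : ℂ)⁻¹ * Complex.I) * (k * ((fluxKernel k j : ℂ) * c (k - j) * w j)) := by ring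
      rw [this, norm_mul]
      have h1 : ‖-(π : ℂ)⁻¹ * Complex.I‖ = π⁻¹ := by
        rw [norm_mul, norm_neg, norm_inv, Complex.norm_real, Complex.norm_I, mul_one,
          Real.norm_of_nonneg hpi.le]
      rw [h1]
      calc _ ≤ π⁻¹ * (2 * (A * (wt (k - j) ^ 2)⁻¹) * (wt j * ‖w j‖)) :=
            mul_le_mul_of_nonneg_left (hker k j) (by positivity)
        _ = _ := by ring

/-- Uniqueness for the linearized system. -/
theorem IsCoefSol.ae_eq_zero (hc : StateCoef c μ δ A L) (hL : 0 ≤ L) (hδ : 0 < δ) {γ : ℝ}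
    (hγ0 : 0 ≤ γ) (hγ : π⁻¹ * L / 2 + rateConst A 0 < γ * symmConst δ) {v w : ℤ → ℝ → ℂ}
    (h : IsCoefSol c μ γ (fun _ _ => 0) v w) (k : ℤ) : ∀ᵐ t, v k t = 0 ∧ w k t = 0 := by
  rcases eq_or_ne k 0 with rfl | hk
  · exact h.zero_mode
  obtain ⟨M, hM⟩ := h.bounded
  have hM0 := sum_integral_sq_le_of_wt hM
  set s := γ * symmConst δ - π⁻¹ * L / 2 - rateConst A 0 with hs
  have hs0 : 0 < s := by linarith
  have iw : ∀ j, Integrable (fun t => wt j ^ 2 * ‖w j t‖ ^ 2) volume := fun j =>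
    ((h.memLp_w j).integrable_norm_pow (by norm_num)).const_mul _
  have hM' : ∀ F : Finset ℤ, ∑ j ∈ F, ∫ t, wt j ^ 2 * ‖w j t‖ ^ 2 ≤ M := fun F => by
    simpa only [integral_const_mul] using hM F
  obtain ⟨hsum, hint, hT⟩ := ae_summable_of_sum_integral_le
    (fun j t => by positivity : ∀ (j : ℤ) (t : ℝ), 0 ≤ wt j ^ 2 * ‖w j t‖ ^ 2) iw hM'
  set a : ℤ → ℝ := fun j => ∫ t, wt j ^ 2 * ‖w j t‖ ^ 2 with ha
  set T := ∫ t, ∑' j, wt j ^ 2 * ‖w j t‖ ^ 2 with hTdef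
  set B := (2 * π⁻¹ * A * wtSum) ^ 2 with hB
  have hbound : ∀ K : Finset ℤ, 0 ∉ K → k ∈ K →
      s / 2 * ((∫ t, ‖v k t‖ ^ 2) + ∫ t, ‖w k t‖ ^ 2) ≤ 1 / (2 * s) * (B * (T - ∑ j ∈ K, a j)) := by
    intro K hK hkK
    have h1 := h.truncated_energy_le hc hL hδ hγ0 hK
    set e : ℤ → ℝ → ℂ := fun k t => Complex.I * k *
      (coefFlux μ (c t) (fun j => w j t) k - trFlux μ (c t) K (fun j => w j t) k) with he
    have me : ∀ k, MemLp (e k) 2 volume := fun k =>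
      ((hc.memLp_coefFlux h.memLp_w hM0 k).sub (hc.memLp_trFlux h.memLp_w K k)).const_mul _
    have iv : ∀ k, Integrable (fun t => ‖v k t‖ ^ 2) volume := fun k =>
      (h.memLp_v k).integrable_norm_pow (by norm_num)
    have iw' : ∀ k, Integrable (fun t => ‖w k t‖ ^ 2) volume := fun k =>
      (h.memLp_w k).integrable_norm_pow (by norm_num)
    have ie : ∀ k, Integrable (fun t => ‖e k t‖ ^ 2) volume := fun k =>
      (me k).integrable_norm_pow (by norm_num)
    rw [integral_add (integrable_finsetSum K fun k _ => iv k)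
      (integrable_finsetSum K fun k _ => iw' k), integral_finsetSum K fun k _ => iv k,
      integral_finsetSum K fun k _ => iw' k] at h1
    have h2 : ∀ j ∈ K, (∫ t, (starRingEnd ℂ) (v j t) * e j t).re
        ≤ s / 2 * (∫ t, ‖v j t‖ ^ 2) + 1 / (2 * s) * ∫ t, ‖e j t‖ ^ 2 := fun j _ => by
      rw [← integral_const_mul, ← integral_const_mul, ← integral_add ((iv j).const_mul _)
        ((ie j).const_mul _)]
      refine (Complex.re_le_norm _).trans (norm_integral_le_of_norm_le
        (((iv j).const_mul _).add ((ie j).const_mul _)) (ae_of_all _ fun t => ?_))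
      rw [norm_mul, RCLike.norm_conj]
      have h3 : s / 2 * ‖v j t‖ ^ 2 + 1 / (2 * s) * ‖e j t‖ ^ 2 - ‖v j t‖ * ‖e j t‖
          = 1 / (2 * s) * (s * ‖v j t‖ - ‖e j t‖) ^ 2 := by
        field_simp; ring
      have h4 : 0 ≤ 1 / (2 * s) * (s * ‖v j t‖ - ‖e j t‖) ^ 2 := by positivity
      linarith
    have h3 := h1.trans (Finset.sum_le_sum h2)
    rw [Finset.sum_add_distrib, ← Finset.mul_sum, ← Finset.mul_sum] at h3
    have h4 : ∑ j ∈ K, ∫ t, ‖e j t‖ ^ 2 ≤ B * (T - ∑ j ∈ K, a j) := by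
      rw [← integral_finsetSum K fun k _ => ie k, ha, ← integral_finsetSum K fun j _ => iw j, hTdef,
        ← integral_sub hint (integrable_finsetSum K fun j _ => iw j), ← integral_const_mul]
      refine integral_mono_ae (integrable_finsetSum K fun k _ => ie k)
        ((hint.sub (integrable_finsetSum K fun j _ => iw j)).const_mul _) ?_
      filter_upwards [hc.bound, hsum, h.zero_mode] with t hb ht h0
      exact norm_flux_sub_trFlux_le hb h0.2 ht K
    have hV : ∫ t, ‖v k t‖ ^ 2 ≤ ∑ j ∈ K, ∫ t, ‖v j t‖ ^ 2 :=
      Finset.single_le_sum (f := fun j => ∫ t, ‖v j t‖ ^ 2)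
        (fun j _ => integral_nonneg fun t => sq_nonneg _) hkK
    have hW : ∫ t, ‖w k t‖ ^ 2 ≤ ∑ j ∈ K, ∫ t, ‖w j t‖ ^ 2 :=
      Finset.single_le_sum (f := fun j => ∫ t, ‖w j t‖ ^ 2)
        (fun j _ => integral_nonneg fun t => sq_nonneg _) hkK
    have hW0 : 0 ≤ ∫ t, ‖w k t‖ ^ 2 := integral_nonneg fun t => sq_nonneg _
    have h5 := mul_le_mul_of_nonneg_left h4 (by positivity : 0 ≤ 1 / (2 * s))
    rw [← hs] at h3
    have h6 := mul_le_mul_of_nonneg_left (add_le_add hV hW) (by positivity : 0 ≤ s / 2)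
    have h7 := mul_nonneg hs0.le (hW0.trans hW)
    linarith
  have ha0 : a 0 = 0 := by
    refine (integral_congr_ae (g := fun _ => 0) ?_).trans (by simp)
    filter_upwards [h.zero_mode] with t ht
    simp [ht.2]
  -- the truncation error is the tail of a convergent series
  have hlim : Tendsto (fun K : Finset ℤ => 1 / (2 * s) * (B * (T - ∑ j ∈ K, a j))) atTop
      (𝓝 (1 / (2 * s) * (B * (T - T)))) := ((hT.const_sub T).const_mul B).const_mul _
  rw [sub_self, mul_zero, mul_zero] at hlim
  have h0 : s / 2 * ((∫ t, ‖v k t‖ ^ 2) + ∫ t, ‖w k t‖ ^ 2) ≤ 0 := by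
    refine ge_of_tendsto hlim ?_
    filter_upwards [eventually_ge_atTop {k}] with K hkK
    have := hbound (K.erase 0) (Finset.notMem_erase 0 K)
      (Finset.mem_erase.mpr ⟨hk, hkK (Finset.mem_singleton_self k)⟩)
    rwa [Finset.sum_erase K ha0] at this
  have hv0 : 0 ≤ ∫ t, ‖v k t‖ ^ 2 := integral_nonneg fun t => sq_nonneg _
  have hw0 : 0 ≤ ∫ t, ‖w k t‖ ^ 2 := integral_nonneg fun t => sq_nonneg _
  have hzero : ∀ {x : ℝ → ℂ}, MemLp x 2 volume → ∫ t, ‖x t‖ ^ 2 = 0 → ∀ᵐ t, x t = 0 := by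
    intro x hx hx0
    have h3 := (integral_eq_zero_iff_of_nonneg (fun t => sq_nonneg ‖x t‖)
      (hx.integrable_norm_pow (by norm_num))).mp hx0
    filter_upwards [h3] with t ht
    simpa using ht
  filter_upwards [hzero (h.memLp_v k) (by nlinarith), hzero (h.memLp_w k) (by nlinarith)]
    with t h1 h2
  exact ⟨h1, h2⟩

end StateCoef

/-! ### The Fourier coefficients of the basic state -/

theorem fcoef_const (a : ℝ) (k : ℤ) :
    fcoef (fun _ => a) k = if k = 0 then (2 * π * a : ℂ) else 0 := by
  have h1 : fcoef (fun _ => a) k = a * fcoefC (fourier 0) k := by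
    rw [fcoef, fcoefC, ← integral_const_mul]
    refine integral_congr_ae (ae_of_all _ fun x => ?_)
    simp only [fourier_zero]
    ring
  rw [h1, fcoefC_eq_fourierCoeff, fourierCoeff_fourier]
  split_ifs with h
  · subst h
    simp
    ring
  · simp [h]

/-- The quadratic form of the multiplication by `q` on trigonometric polynomials. -/
theorem re_sum_conj_mul_fcoef {q : Torus → ℝ} (hq : Integrable q volume) (K : Finset ℤ)
    (x : ℤ → ℂ) : (∑ k ∈ K, (starRingEnd ℂ) (x k) * ∑ j ∈ K, fcoef q (k - j) * x j).re
      = ∫ y : Torus, q y * ‖∑ k ∈ K, x k * fourier k y‖ ^ 2 := by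
  have hi : ∀ n : ℤ, Integrable (fun y : Torus => fourier n y * (q y : ℂ)) volume := fun n => by
    refine hq.ofReal.bdd_mul (c := 1) (map_continuous (fourier n)).aestronglyMeasurable ?_
    refine ae_of_all _ fun x => ?_
    rw [fourier_apply, Circle.norm_coe]
  have e1 : ∑ k ∈ K, (starRingEnd ℂ) (x k) * ∑ j ∈ K, fcoef q (k - j) * x j
      = ∫ y : Torus, ∑ k ∈ K, ∑ j ∈ K,
        (starRingEnd ℂ) (x k) * x j * (fourier (-(k - j)) y * (q y : ℂ)) := by
    rw [integral_finsetSum]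
    · refine Finset.sum_congr rfl fun k _ => ?_
      rw [integral_finsetSum]
      · rw [Finset.mul_sum]
        refine Finset.sum_congr rfl fun j _ => ?_
        rw [integral_const_mul, fcoef]
        ring
      · exact fun j _ => (hi _).const_mul _
    · exact fun k _ => integrable_finsetSum _ fun j _ => (hi _).const_mul _
  have e2 : ∀ y : Torus, ∑ k ∈ K, ∑ j ∈ K,
      (starRingEnd ℂ) (x k) * x j * (fourier (-(k - j)) y * (q y : ℂ))
      = ((q y * ‖∑ k ∈ K, x k * fourier k y‖ ^ 2 : ℝ) : ℂ) := fun y => by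
    rw [Complex.ofReal_mul, ← Complex.normSq_eq_norm_sq, Complex.normSq_eq_conj_mul_self, map_sum,
      Finset.sum_mul_sum, Finset.mul_sum]
    refine Finset.sum_congr rfl fun k _ => ?_
    rw [Finset.mul_sum]
    refine Finset.sum_congr rfl fun j _ => ?_
    rw [show -(k - j) = -k + j by ring, fourier_add, fourier_neg, map_mul]
    ring
  rw [e1]
  simp only [e2]
  rw [integral_complex_ofReal, Complex.ofReal_re]

/-- The stability condition makes the truncations of the multiplication by `μ - 2 ∂ₓ ℍ[φ₀]`
coercive: the quadratic form of the multiplication by the nonnegative function `μ - δ/2 - 2 ∂ₓ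
ℍ[φ₀]` is nonnegative on trigonometric polynomials. -/
theorem le_re_sum_conj_mul_princ {f : L2T} (hf : Summable fun k => wt k ^ 2 * ‖fcoef f k‖ ^ 2)
    {μ δ : ℝ} (hstab : ∀ᵐ x : Torus, δ / 2 ≤ μ - 2 * dx (hilbertT f) x) (K : Finset ℤ)
    (x : ℤ → ℂ) : δ / 2 * ∑ k ∈ K, ‖x k‖ ^ 2
      ≤ ∑ k ∈ K, ((starRingEnd ℂ) (x k) * princ μ (fun n => fcoef f n) K x k).re := by
  set p := dx (hilbertT f) with hp
  have ip : Integrable p volume := (Lp.memLp p).integrable (by norm_num)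
  set q : Torus → ℝ := fun y => (μ - δ / 2) - 2 * p y with hq
  have iq : Integrable q volume := (integrable_const _).sub (ip.const_mul 2)
  have h0 : 0 ≤ ∫ y : Torus, q y * ‖∑ k ∈ K, x k * fourier k y‖ ^ 2 := by
    refine integral_nonneg_of_ae ?_
    filter_upwards [hstab] with y hy
    refine mul_nonneg ?_ (sq_nonneg _)
    simp only [hq]
    linarith
  rw [← re_sum_conj_mul_fcoef iq] at h0
  -- `∂ₓ ℍ` has the symbol `|n|`
  have e1 : ∀ n, fcoef q n = (if n = 0 then (2 * π * (μ - δ / 2) : ℂ) else 0)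
      - 2 * ((|(n : ℝ)| : ℝ) * fcoef f n) := fun n => by
    have h1 := fcoef_const (μ - δ / 2) n
    have i1 : Integrable (fun y : Torus => fourier (-n) y * ((μ - δ / 2 : ℝ) : ℂ)) volume :=
      ((map_continuous (fourier (-n))).mul continuous_const).integrable_of_hasCompactSupport
        (HasCompactSupport.of_compactSpace _)
    have h2 : fcoef q n = fcoef (fun _ => μ - δ / 2) n - 2 * fcoef p n := by
      rw [fcoef, fcoef, fcoef, ← integral_const_mul,
        ← integral_sub i1 ((integrable_fourier_mul p (-n)).const_mul 2)]
      refine integral_congr_ae (ae_of_all _ fun y => ?_)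
      simp only [hq]
      push_cast
      ring
    have h3 : (n * n.sign : ℂ) = ((|(n : ℝ)| : ℝ) : ℂ) := by
      have : (n * n.sign : ℤ) = |n| := by rw [mul_comm]; exact Int.sign_mul_self_eq_abs n
      rw [← Int.cast_abs, ← this]
      push_cast
      ring
    rw [h2, h1, hp, fcoef_dx_hilbertT hf, h3]
    push_cast
    rfl
  have e2 : ∀ k ∈ K, (starRingEnd ℂ) (x k) * ∑ j ∈ K, fcoef q (k - j) * x j
      = (2 * π : ℝ) * ((starRingEnd ℂ) (x k) * princ μ (fun n => fcoef f n) K x k)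
        - ((2 * π * (δ / 2) * ‖x k‖ ^ 2 : ℝ) : ℂ) := fun k hk => by
    have h1 : ∑ j ∈ K, fcoef q (k - j) * x j = 2 * π * (μ - δ / 2) * x k
        - 2 * ∑ j ∈ K, ((|((k - j : ℤ) : ℝ)| : ℝ) : ℂ) * fcoef f (k - j) * x j := by
      simp only [e1, sub_mul, Finset.sum_sub_distrib, Finset.mul_sum]
      congr 1
      · rw [Finset.sum_eq_single k]
        · simp
        · intro j _ hj
          rw [if_neg (sub_ne_zero.mpr hj.symm), zero_mul]
        · exact fun h => absurd hk h
      · exact Finset.sum_congr rfl fun j _ => by ring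
    rw [h1, princ]
    have hpi : (π : ℂ) ≠ 0 := Complex.ofReal_ne_zero.mpr Real.pi_pos.ne'
    have h2 : ((‖x k‖ : ℝ) : ℂ) ^ 2 = (starRingEnd ℂ) (x k) * x k := by
      rw [← Complex.ofReal_pow, ← Complex.normSq_eq_conj_mul_self, Complex.normSq_eq_norm_sq]
    push_cast
    rw [h2]
    field_simp
    ring
  rw [Finset.sum_congr rfl e2, Finset.sum_sub_distrib, ← Finset.mul_sum, Complex.sub_re,
    Complex.re_ofReal_mul, Complex.re_sum, ← Complex.ofReal_sum, Complex.ofReal_re,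
    ← Finset.mul_sum] at h0
  have := Real.pi_pos
  have h3 : 0 ≤ 2 * π * (∑ k ∈ K, ((starRingEnd ℂ) (x k) * princ μ (fun n => fcoef f n) K x k).re
      - δ / 2 * ∑ k ∈ K, ‖x k‖ ^ 2) := by linarith
  have h4 := nonneg_of_mul_nonneg_right h3 (by positivity)
  linarith

theorem sum_le_of_hsNormSq_le {f : L2T} {s : ℕ} {B : ℝ} (hB : 0 ≤ B)
    (h : hsNormSq s f ≤ ENNReal.ofReal B) (F : Finset ℤ) :
    ∑ k ∈ F, wt k ^ (2 * s) * ‖fcoef f k‖ ^ 2 ≤ 2 * π * B := by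
  have hpi := Real.two_pi_pos
  have h0 : ∀ k, 0 ≤ wt k ^ (2 * s) * ‖fcoef f k‖ ^ 2 := fun k => by
    have := wt_pos k; positivity
  have h1 : ENNReal.ofReal (2 * π)⁻¹ * ∑ k ∈ F, ENNReal.ofReal (wt k ^ (2 * s) * ‖fcoef f k‖ ^ 2)
      ≤ ENNReal.ofReal B :=
    le_trans (mul_le_mul_right (ENNReal.sum_le_tsum F) _) h
  rw [← ENNReal.ofReal_sum_of_nonneg fun k _ => h0 k, ← ENNReal.ofReal_mul (by positivity),
    ENNReal.ofReal_le_ofReal_iff hB, inv_mul_le_iff₀ hpi] at h1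
  exact h1

theorem MemLinf.ae_hsNormSq_le {f : ℝ → L2T} {s : ℕ} (h : MemLinf s f) :
    ∀ᵐ t, hsNormSq s (f t) ≤ ENNReal.ofReal ((linfNorm s f).toReal ^ 2) := by
  filter_upwards [ENNReal.ae_le_essSup (μ := volume) (fun t => hsNormSq s (f t) ^ (1 / 2 : ℝ))]
    with t ht
  have h1 : hsNormSq s (f t) ^ (1 / 2 : ℝ) ≤ linfNorm s f := ht
  have h2 := ENNReal.rpow_le_rpow h1 (by norm_num : (0 : ℝ) ≤ 2)
  rw [← ENNReal.rpow_mul] at h2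
  norm_num at h2
  rw [ENNReal.ofReal_pow ENNReal.toReal_nonneg, ENNReal.ofReal_toReal h.2.ne]
  exact h2

theorem MemLinf.ae_sum_le {f : ℝ → L2T} {s : ℕ} (h : MemLinf s f) : ∀ᵐ t, ∀ F : Finset ℤ,
    ∑ k ∈ F, wt k ^ (2 * s) * ‖fcoef (f t) k‖ ^ 2 ≤ 2 * π * (linfNorm s f).toReal ^ 2 := by
  filter_upwards [h.ae_hsNormSq_le] with t ht
  exact sum_le_of_hsNormSq_le (sq_nonneg _) ht

theorem locallyIntegrable_fcoef {u : ℝ → L2T} (hu : LocallyIntegrable u volume) (k : ℤ) :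
    LocallyIntegrable (fun t => fcoef (u t) k) volume := fun t =>
  let ⟨s, hs, hi⟩ := hu t
  ⟨s, hs, (fcoefL k).integrable_comp hi⟩

theorem IsWeakDt.hasWeakDeriv {u v : ℝ → L2T} (h : IsWeakDt u v) (k : ℤ) :
    HasWeakDeriv (fun t => fcoef (u t) k) (fun t => fcoef (v t) k) := by
  intro θ hθ hs
  obtain ⟨hu, hv, he⟩ := h
  have hθ' := (contDiff_infty_iff_deriv.mp hθ).2.continuous
  have key : ∀ {η : ℝ → ℝ} {z : ℝ → L2T}, Continuous η → HasCompactSupport η →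
      LocallyIntegrable z volume → ∫ t, (η t : ℂ) * fcoef (z t) k = fcoefL k (∫ t, η t • z t) := by
    intro η z hη hηs hz
    rw [← (fcoefL k).integral_comp_comm (hz.integrable_smul_left_of_hasCompactSupport hη hηs)]
    refine integral_congr_ae (ae_of_all _ fun t => ?_)
    simp
  rw [key hθ' hs.deriv hu, key hθ.continuous hs hv, he θ hθ hs, map_neg]

/-- The Lipschitz constant of the symmetrizer in terms of the norm `b` of `φ₀ₜ`. -/
noncomputable def lipConst (b : ℝ) : ℝ := (2 * π * b ^ 2 + wtSum) / 2

theorem lipConst_nonneg (b : ℝ) : 0 ≤ lipConst b := by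
  have := wtSum_nonneg
  have := Real.pi_pos
  rw [lipConst]
  positivity

/-- The bound on `φ₀ₜ` makes `∂ₓ ℍ[φ₀]` Lipschitz in time, with values in the functions with
absolutely summable Fourier coefficients. -/
theorem ae_sum_fcoef_shift_le {φ₀ φ₀t : ℝ → L2T} (hdt : IsWeakDt φ₀ φ₀t) (ht : MemLinf 2 φ₀t)
    {h : ℝ} (hh : 0 < h) : ∀ᵐ t, ∀ F : Finset ℤ,
      ∑ n ∈ F, |(n : ℝ)| * ‖fcoef (φ₀ (t + h)) n - fcoef (φ₀ t) n‖
        ≤ lipConst (linfNorm 2 φ₀t).toReal * h := by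
  set b := (linfNorm 2 φ₀t).toReal with hb
  have h1 : ∀ᵐ t, ∀ n, fcoef (φ₀ t) n - fcoef (φ₀ (t - h)) n
      = ∫ s in (0 : ℝ)..h, fcoef (φ₀t (t - s)) n := ae_all_iff.mpr fun n =>
    (hdt.hasWeakDeriv n).sub_shift (locallyIntegrable_fcoef hdt.1 n)
      (locallyIntegrable_fcoef hdt.2.1 n) hh.le
  have h2 : ∀ᵐ t, ∀ F : Finset ℤ, ∑ n ∈ F, |(n : ℝ)| * ‖fcoef (φ₀t t) n‖ ≤ lipConst b := by
    filter_upwards [ht.ae_sum_le] with t ht F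
    calc ∑ n ∈ F, |(n : ℝ)| * ‖fcoef (φ₀t t) n‖
        ≤ ∑ n ∈ F, (wt n ^ (2 * 2) * ‖fcoef (φ₀t t) n‖ ^ 2 + (wt n ^ 2)⁻¹) / 2 := by
          refine Finset.sum_le_sum fun n _ => (le_wt_sq_mul_sq n _).trans ?_
          have h3 : |(n : ℝ)| ^ 2 ≤ wt n ^ 2 := pow_le_pow_left₀ (abs_nonneg _) (abs_le_wt n) 2
          have h4 : wt n ^ 2 * (|(n : ℝ)| * ‖fcoef (φ₀t t) n‖) ^ 2
              ≤ wt n ^ (2 * 2) * ‖fcoef (φ₀t t) n‖ ^ 2 := by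
            calc wt n ^ 2 * (|(n : ℝ)| * ‖fcoef (φ₀t t) n‖) ^ 2
                = wt n ^ 2 * (|(n : ℝ)| ^ 2 * ‖fcoef (φ₀t t) n‖ ^ 2) := by ring
              _ ≤ wt n ^ 2 * (wt n ^ 2 * ‖fcoef (φ₀t t) n‖ ^ 2) := by gcongr
              _ = _ := by ring
          exact (div_le_div_iff_of_pos_right two_pos).mpr (add_le_add h4 le_rfl)
      _ = (∑ n ∈ F, wt n ^ (2 * 2) * ‖fcoef (φ₀t t) n‖ ^ 2 + ∑ n ∈ F, (wt n ^ 2)⁻¹) / 2 := by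
          rw [← Finset.sum_div, Finset.sum_add_distrib]
      _ ≤ _ := by
          rw [lipConst]
          linarith [ht F, sum_inv_wt_sq_le F]
  filter_upwards [ae_add_of_ae h1 h] with t ht F
  simp only [add_sub_cancel_right] at ht
  have hi : ∀ n, IntervalIntegrable (fun s => fcoef (φ₀t (t + h - s)) n) volume 0 h := fun n => by
    have h3 : IntervalIntegrable (fun s => fcoef (φ₀t s) n) volume (t + h - 0) (t + h - h) :=
      ((locallyIntegrable_fcoef hdt.2.1 n).integrableOn_isCompact isCompact_uIcc).intervalIntegrable
    simpa using h3.comp_sub_left (t + h)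
  have hsa : ∀ᵐ s, ∀ F : Finset ℤ, ∑ n ∈ F, |(n : ℝ)| * ‖fcoef (φ₀t (t + h - s)) n‖
      ≤ lipConst b :=
    (Measure.measurePreserving_sub_left volume (t + h)).quasiMeasurePreserving.ae h2
  calc ∑ n ∈ F, |(n : ℝ)| * ‖fcoef (φ₀ (t + h)) n - fcoef (φ₀ t) n‖
      ≤ ∑ n ∈ F, ∫ s in (0 : ℝ)..h, |(n : ℝ)| * ‖fcoef (φ₀t (t + h - s)) n‖ := by
        refine Finset.sum_le_sum fun n _ => ?_
        rw [ht n, intervalIntegral.integral_const_mul]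
        exact mul_le_mul_of_nonneg_left (intervalIntegral.norm_integral_le_integral_norm hh.le)
          (abs_nonneg _)
    _ = ∫ s in (0 : ℝ)..h, ∑ n ∈ F, |(n : ℝ)| * ‖fcoef (φ₀t (t + h - s)) n‖ :=
        (intervalIntegral.integral_finsetSum fun n _ => (hi n).norm.const_mul _).symm
    _ ≤ ∫ _ in (0 : ℝ)..h, lipConst b := by
        refine intervalIntegral.integral_mono_ae hh.le ?_ intervalIntegrable_const ?_
        · have := IntervalIntegrable.sum (μ := volume) (a := 0) (b := h) F
            (f := fun n s => |(n : ℝ)| * ‖fcoef (φ₀t (t + h - s)) n‖)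
            fun n _ => (hi n).norm.const_mul _
          exact this.congr (fun s _ => by simp)
        · filter_upwards [hsa] with s hs
          exact hs F
    _ = lipConst b * h := by simp [mul_comm]

/-- The hypotheses on the basic state in terms of its Fourier coefficients. -/
theorem stateCoef_fcoef {μ δ : ℝ} {φ₀ φ₀t : ℝ → L2T} (h5 : MemLinf 5 φ₀)
    (hdt : IsWeakDt φ₀ φ₀t) (h2 : MemLinf 2 φ₀t) (hstab : StabilityCond μ δ φ₀) :
    StateCoef (fun t n => fcoef (φ₀ t) n) μ δ (√(2 * π) * (linfNorm 5 φ₀).toReal)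
      (lipConst (linfNorm 2 φ₀t).toReal) where
  meas n := aestronglyMeasurable_fcoef h5.1 n
  herm t n := fcoef_neg_index _ _
  bound := by
    filter_upwards [h5.ae_sum_le] with t ht n
    have h1 := ht {n}
    rw [Finset.sum_singleton, pow_mul', ← mul_pow] at h1
    have h3 := Real.le_sqrt_of_sq_le h1
    rwa [Real.sqrt_mul Real.two_pi_pos.le, Real.sqrt_sq ENNReal.toReal_nonneg] at h3
  stable := by
    filter_upwards [h5.ae_sum_le, hstab] with t ht hs K x
    refine le_re_sum_conj_mul_princ ?_ hs K x
    exact summable_wt_of_le (by norm_num) (summable_of_sum_le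
      (fun k => by have := wt_pos k; positivity) ht)
  lipschitz h hh := ae_sum_fcoef_shift_le hdt h2 hh

/-! ### Square-integrable functions of time with values in `L²(𝕋)` -/

theorem fcoef_zero (f : L2T) : fcoef f 0 = ((∫ x : Torus, f x : ℝ) : ℂ) := by
  rw [fcoef, ← integral_complex_ofReal]
  refine integral_congr_ae (ae_of_all _ fun x => ?_)
  simp

/-- Square-integrability of a function with values in `L²(𝕋)` from that of its coefficients. -/
theorem memLp_of_fcoef {u : ℝ → L2T} (hu : ∀ k, MemLp (fun t => fcoef (u t) k) 2 volume) {M : ℝ}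
    (hM : ∀ F : Finset ℤ, ∑ k ∈ F, ∫ t, ‖fcoef (u t) k‖ ^ 2 ≤ M) : MemLp u 2 volume := by
  have hm : AEStronglyMeasurable u volume := aestronglyMeasurable_of_fcoef fun k => (hu k).1
  obtain ⟨-, hi, -⟩ := ae_summable_of_sum_integral_le (fun k t => sq_nonneg ‖fcoef (u t) k‖)
    (fun k => (hu k).integrable_norm_pow (by norm_num)) hM
  rw [memLp_two_iff_integrable_sq_norm hm]
  refine (hi.const_mul (2 * π)⁻¹).congr (ae_of_all _ fun t => ?_)
  have := Real.two_pi_pos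
  simp only [(hasSum_norm_fcoef_sq (u t)).tsum_eq]
  rw [inv_mul_cancel_left₀ this.ne']

theorem memLp_fcoef {u : ℝ → L2T} (hu : MemLp u 2 volume) (k : ℤ) :
    MemLp (fun t => fcoef (u t) k) 2 volume := (fcoefL k).comp_memLp' hu

theorem sum_integral_fcoef_sq_le {u : ℝ → L2T} (hu : MemLp u 2 volume) (F : Finset ℤ) :
    ∑ k ∈ F, ∫ t, ‖fcoef (u t) k‖ ^ 2 ≤ 2 * π * ∫ t, ‖u t‖ ^ 2 := by
  have hi : ∀ k, Integrable (fun t => ‖fcoef (u t) k‖ ^ 2) volume := fun k =>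
    (memLp_fcoef hu k).integrable_norm_pow (by norm_num)
  rw [← integral_finsetSum F fun k _ => hi k, ← integral_const_mul]
  refine integral_mono (integrable_finsetSum F fun k _ => hi k)
    ((hu.integrable_norm_pow (by norm_num)).const_mul _) fun t => ?_
  exact sum_le_hasSum F (fun _ _ => sq_nonneg _) (hasSum_norm_fcoef_sq (u t))

/-- A Riesz–Fischer theorem for functions of time: square-integrable Fourier coefficients with
the symmetry of real functions are those of a function in `L²(ℝ; L²(𝕋))`. -/
theorem exists_memLp_fcoef_eq {w : ℤ → ℝ → ℂ} (hw : ∀ k, MemLp (w k) 2 volume)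
    (hherm : ∀ k t, w (-k) t = (starRingEnd ℂ) (w k t)) {M : ℝ}
    (hM : ∀ F : Finset ℤ, ∑ k ∈ F, ∫ t, ‖w k t‖ ^ 2 ≤ M) :
    ∃ u : ℝ → L2T, MemLp u 2 volume ∧ ∀ᵐ t, ∀ k, fcoef (u t) k = w k t := by
  obtain ⟨hs, -, -⟩ := ae_summable_of_sum_integral_le (fun k t => sq_nonneg ‖w k t‖)
    (fun k => (hw k).integrable_norm_pow (by norm_num)) hM
  have h1 : ∀ t, ∃ u : L2T, (Summable fun k => ‖w k t‖ ^ 2) → ∀ k, fcoef u k = w k t := fun t => by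
    by_cases h : Summable fun k => ‖w k t‖ ^ 2
    · obtain ⟨u, hu⟩ := exists_fcoef_eq (fun k => hherm k t) h
      exact ⟨u, fun _ => hu⟩
    · exact ⟨0, fun h' => absurd h' h⟩
  choose u hu using h1
  have h2 : ∀ᵐ t, ∀ k, fcoef (u t) k = w k t := hs.mono fun t ht => hu t ht
  have h3 : ∀ k, (fun t => fcoef (u t) k) =ᵐ[volume] w k := fun k => h2.mono fun t ht => ht k
  refine ⟨u, memLp_of_fcoef (fun k => (memLp_congr_ae (h3 k)).mpr (hw k)) (M := M) fun F => ?_, h2⟩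
  refine le_trans (le_of_eq (Finset.sum_congr rfl fun k _ => integral_congr_ae ?_)) (hM F)
  filter_upwards [h3 k] with t ht
  rw [ht]

/-- Parseval's identity for functions in `L²(ℝ; L²(𝕋))`. -/
theorem hasSum_integral_fcoef_mul {u v : ℝ → L2T} (hu : MemLp u 2 volume)
    (hv : MemLp v 2 volume) :
    HasSum (fun k => ∫ t, fcoef (u t) k * (starRingEnd ℂ) (fcoef (v t) k))
      ((2 * π * ∫ t, ∫ x : Torus, u t x * v t x : ℝ) : ℂ) := by
  have hsu := summable_of_sum_le (fun k => integral_nonneg fun t => sq_nonneg _)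
    (sum_integral_fcoef_sq_le hu)
  have hsv := summable_of_sum_le (fun k => integral_nonneg fun t => sq_nonneg _)
    (sum_integral_fcoef_sq_le hv)
  have hc : ∀ k, MemLp (fun t => (starRingEnd ℂ) (fcoef (v t) k)) 2 volume := fun k =>
    (memLp_fcoef hv k).star
  have hi := fun k => integrable_mul_of_memLp (memLp_fcoef hu k) (hc k)
  have h := hasSum_integral_of_summable_integral_norm hi
    (Summable.of_nonneg_of_le (fun k => integral_nonneg fun t => norm_nonneg _) (fun k => ?_)
      ((hsu.add hsv).div_const 2))
  · have e : ((2 * π * ∫ t, ∫ x : Torus, u t x * v t x : ℝ) : ℂ)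
        = ∫ t, ∑' k, fcoef (u t) k * (starRingEnd ℂ) (fcoef (v t) k) := by
      rw [← integral_const_mul, ← integral_complex_ofReal]
      refine integral_congr_ae (ae_of_all _ fun t => ?_)
      exact (hasSum_fcoef_mul (Lp.memLp _) (Lp.memLp _)).tsum_eq.symm
    rw [e]
    exact h
  · have iu := (memLp_fcoef hu k).integrable_norm_pow (p := 2) (by norm_num)
    have iv := (memLp_fcoef hv k).integrable_norm_pow (p := 2) (by norm_num)
    calc ∫ t, ‖fcoef (u t) k * (starRingEnd ℂ) (fcoef (v t) k)‖
        ≤ ∫ t, (‖fcoef (u t) k‖ ^ 2 + ‖fcoef (v t) k‖ ^ 2) / 2 := by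
          refine integral_mono (hi k).norm ((iu.add iv).div_const 2) fun t => ?_
          simp only [norm_mul, RCLike.norm_conj]
          nlinarith [sq_nonneg (‖fcoef (u t) k‖ - ‖fcoef (v t) k‖)]
      _ = _ := by
          rw [integral_div]
          congr 1
          exact integral_add iu iv

/-! ### The exponentially weighted spaces -/

/-- The function `e^{-γt} f(t)`, which is in `L²(ℝ; H^s)` when `f` is in `L²_γ(ℝ; H^s)`. -/
noncomputable def expWeight (γ : ℝ) (f : ℝ → L2T) (t : ℝ) : L2T := Real.exp (-(γ * t)) • f t

theorem fcoef_expWeight (γ : ℝ) (f : ℝ → L2T) (t : ℝ) (k : ℤ) :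
    fcoef (expWeight γ f t) k = (Real.exp (-(γ * t)) : ℂ) * fcoef (f t) k := fcoef_smul _ _ _

theorem expWeight_neg (γ : ℝ) (f : ℝ → L2T) : expWeight γ (expWeight (-γ) f) = f := by
  ext1 t
  rw [expWeight, expWeight, smul_smul, ← Real.exp_add]
  simp

theorem expWeight_neg' (γ : ℝ) (f : ℝ → L2T) : expWeight (-γ) (expWeight γ f) = f := by
  simpa using expWeight_neg (-γ) f

theorem aestronglyMeasurable_expWeight {f : ℝ → L2T} (hf : AEStronglyMeasurable f volume) (γ : ℝ) :
    AEStronglyMeasurable (expWeight γ f) volume :=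
  (by fun_prop : Continuous fun t : ℝ => Real.exp (-(γ * t))).aestronglyMeasurable.smul hf

theorem l2gNormSq_eq_tsum {f : ℝ → L2T} (hf : AEStronglyMeasurable f volume) (γ : ℝ) (s : ℕ) :
    l2gNormSq γ s f = ENNReal.ofReal (2 * π)⁻¹ * ∑' k : ℤ, ENNReal.ofReal (wt k ^ (2 * s)) *
      ∫⁻ t, ENNReal.ofReal (‖fcoef (expWeight γ f t) k‖ ^ 2) := by
  have hm : ∀ k, AEMeasurable (fun t => ENNReal.ofReal (‖fcoef (expWeight γ f t) k‖ ^ 2)) volume :=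
    fun k => ((aestronglyMeasurable_fcoef
      (aestronglyMeasurable_expWeight hf γ) k).norm.aemeasurable.pow_const 2).ennreal_ofReal
  have h1 : ∀ k : ℤ, ENNReal.ofReal (wt k ^ (2 * s)) *
      ∫⁻ t, ENNReal.ofReal (‖fcoef (expWeight γ f t) k‖ ^ 2)
      = ∫⁻ t, ENNReal.ofReal (wt k ^ (2 * s)) *
        ENNReal.ofReal (‖fcoef (expWeight γ f t) k‖ ^ 2) := fun k =>
    (lintegral_const_mul'' _ (hm k)).symm
  simp only [h1]
  rw [← lintegral_tsum fun k => (hm k).const_mul _, ← lintegral_const_mul'' _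
    (AEMeasurable.tsum fun k => (hm k).const_mul _), l2gNormSq]
  refine lintegral_congr fun t => ?_
  rw [hsNormSq, mul_left_comm, ← ENNReal.tsum_mul_left]
  congr 1
  refine tsum_congr fun k => ?_
  rw [← ENNReal.ofReal_mul (Real.exp_pos _).le, 
    ← ENNReal.ofReal_mul (by have := wt_pos k; positivity), fcoef_expWeight,
    norm_mul, mul_pow, Complex.norm_real, Real.norm_of_nonneg (Real.exp_pos _).le,
    ← Real.exp_nat_mul, wt]
  congr 1
  push_cast
  ring_nf

theorem l2gNormSq_mono (γ : ℝ) {s s' : ℕ} (h : s ≤ s') (f : ℝ → L2T) :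
    l2gNormSq γ s f ≤ l2gNormSq γ s' f := by
  refine lintegral_mono fun t => ?_
  simp only [hsNormSq]
  gcongr
  simp

theorem MemL2g.memLp_fcoef {γ : ℝ} {s : ℕ} {f : ℝ → L2T} (h : MemL2g γ s f) (k : ℤ) :
    MemLp (fun t => fcoef (expWeight γ f t) k) 2 volume := by
  have hm := aestronglyMeasurable_fcoef (aestronglyMeasurable_expWeight h.1 γ) k
  have hlt := h.2
  rw [l2gNormSq_eq_tsum h.1] at hlt
  have h1 := ENNReal.lt_top_of_mul_ne_top_right hlt.ne
    (by have := Real.pi_pos; rw [ne_eq, ENNReal.ofReal_eq_zero, not_le]; positivity)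
  have h2 := ENNReal.lt_top_of_mul_ne_top_right ((ENNReal.le_tsum k).trans_lt h1).ne
    (by have := wt_pos k; rw [ne_eq, ENNReal.ofReal_eq_zero, not_le]; positivity)
  rw [memLp_two_iff_integrable_sq_norm hm]
  refine ⟨hm.norm.pow 2, ?_⟩
  rwa [hasFiniteIntegral_iff_ofReal (ae_of_all _ fun t => sq_nonneg _)]

theorem MemL2g.sum_le {γ : ℝ} {s : ℕ} {f : ℝ → L2T} (h : MemL2g γ s f) (F : Finset ℤ) :
    ∑ k ∈ F, wt k ^ (2 * s) * ∫ t, ‖fcoef (expWeight γ f t) k‖ ^ 2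
      ≤ 2 * π * (l2gNormSq γ s f).toReal := by
  have hpi := Real.two_pi_pos
  have h1 : ∀ k, ∫⁻ t, ENNReal.ofReal (‖fcoef (expWeight γ f t) k‖ ^ 2)
      = ENNReal.ofReal (∫ t, ‖fcoef (expWeight γ f t) k‖ ^ 2) := fun k =>
    (ofReal_integral_eq_lintegral_ofReal ((h.memLp_fcoef k).integrable_norm_pow (by norm_num))
      (ae_of_all _ fun t => sq_nonneg _)).symm
  have h2 : ENNReal.ofReal ((2 * π)⁻¹ * ∑ k ∈ F, wt k ^ (2 * s) *
      ∫ t, ‖fcoef (expWeight γ f t) k‖ ^ 2) ≤ l2gNormSq γ s f := by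
    rw [l2gNormSq_eq_tsum h.1, ENNReal.ofReal_mul (by positivity), ENNReal.ofReal_sum_of_nonneg
      fun k _ => by have := wt_pos k; positivity]
    gcongr
    refine le_trans (le_of_eq (Finset.sum_congr rfl fun k _ => ?_)) (ENNReal.sum_le_tsum F)
    rw [h1, ENNReal.ofReal_mul (by have := wt_pos k; positivity)]
  have h3 := (ENNReal.ofReal_le_iff_le_toReal h.2.ne).mp h2
  rwa [inv_mul_le_iff₀ hpi] at h3

theorem l2gNormSq_le_of_sum_le {γ : ℝ} {s : ℕ} {f : ℝ → L2T} (hf : AEStronglyMeasurable f volume)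
    (hi : ∀ k, MemLp (fun t => fcoef (expWeight γ f t) k) 2 volume) {M : ℝ}
    (hM : ∀ F : Finset ℤ, ∑ k ∈ F, wt k ^ (2 * s) * ∫ t, ‖fcoef (expWeight γ f t) k‖ ^ 2 ≤ M) :
    l2gNormSq γ s f ≤ ENNReal.ofReal ((2 * π)⁻¹ * M) := by
  have hpi := Real.two_pi_pos
  have h1 : ∀ k, ∫⁻ t, ENNReal.ofReal (‖fcoef (expWeight γ f t) k‖ ^ 2)
      = ENNReal.ofReal (∫ t, ‖fcoef (expWeight γ f t) k‖ ^ 2) := fun k =>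
    (ofReal_integral_eq_lintegral_ofReal ((hi k).integrable_norm_pow (by norm_num))
      (ae_of_all _ fun t => sq_nonneg _)).symm
  rw [l2gNormSq_eq_tsum hf, ENNReal.ofReal_mul (by positivity)]
  gcongr
  refine ENNReal.summable.tsum_le_of_sum_le fun F => ?_
  refine le_trans (le_of_eq ?_) (ENNReal.ofReal_le_ofReal (hM F))
  rw [ENNReal.ofReal_sum_of_nonneg fun k _ => by have := wt_pos k; positivity]
  refine Finset.sum_congr rfl fun k _ => ?_
  rw [h1, ENNReal.ofReal_mul (by have := wt_pos k; positivity)]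

theorem MemL2g.memLp {γ : ℝ} {s : ℕ} {f : ℝ → L2T} (h : MemL2g γ s f) :
    MemLp (expWeight γ f) 2 volume :=
  memLp_of_fcoef h.memLp_fcoef (sum_integral_sq_le_of_wt h.sum_le)

theorem locallyIntegrable_of_expWeight {γ : ℝ} {f : ℝ → L2T} (h : MemLp (expWeight γ f) 2 volume) :
    LocallyIntegrable f volume := by
  have h1 : LocallyIntegrable (expWeight γ f) volume := h.locallyIntegrable (by norm_num)
  rw [← expWeight_neg' γ f, locallyIntegrable_iff]
  intro K hK
  exact ((h1.integrableOn_isCompact hK).continuousOn_smul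
    (by fun_prop : Continuous fun t : ℝ => Real.exp (-(-γ * t))).continuousOn hK)

/-! ### Test functions on `ℝ × 𝕋` -/

theorem hasDerivAt_fst {Ψ : ℝ × ℝ → ℝ} (h : ContDiff ℝ ∞ Ψ) (t y : ℝ) :
    HasDerivAt (fun s => Ψ (s, y)) (fderiv ℝ Ψ (t, y) (1, 0)) t := by
  have h1 : HasFDerivAt Ψ (fderiv ℝ Ψ (t, y)) (t, y) :=
    ((h.differentiable (by simp)) (t, y)).hasFDerivAt
  exact h1.comp_hasDerivAt t ((hasDerivAt_id t).prodMk (hasDerivAt_const t y))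

theorem hasDerivAt_snd {Ψ : ℝ × ℝ → ℝ} (h : ContDiff ℝ ∞ Ψ) (t y : ℝ) :
    HasDerivAt (fun z => Ψ (t, z)) (fderiv ℝ Ψ (t, y) (0, 1)) y := by
  have h1 : HasFDerivAt Ψ (fderiv ℝ Ψ (t, y)) (t, y) :=
    ((h.differentiable (by simp)) (t, y)).hasFDerivAt
  exact h1.comp_hasDerivAt y ((hasDerivAt_const y t).prodMk (hasDerivAt_id y))

theorem contDiff_fderiv_apply {Ψ : ℝ × ℝ → ℝ} (h : ContDiff ℝ ∞ Ψ) (v : ℝ × ℝ) :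
    ContDiff ℝ ∞ (fun p => fderiv ℝ Ψ p v) :=
  (h.fderiv_right (m := ∞) (by simp)).clm_apply contDiff_const

theorem testDt_one_coe {ψ : ℝ → Torus → ℝ} (h : IsTest ψ) (t y : ℝ) :
    testDt 1 ψ t (y : Torus) = fderiv ℝ (fun p : ℝ × ℝ => ψ p.1 (p.2 : Torus)) (t, y) (1, 0) := by
  rw [testDt, iteratedDeriv_one]
  exact (hasDerivAt_fst h.1 t y).deriv

theorem testDx_one_coe {ψ : ℝ → Torus → ℝ} (h : IsTest ψ) (t y : ℝ) :
    testDx 1 ψ t (y : Torus) = fderiv ℝ (fun p : ℝ × ℝ => ψ p.1 (p.2 : Torus)) (t, y) (0, 1) := by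
  rw [testDx, iteratedDeriv_one]
  have h1 := (hasDerivAt_snd h.1 t y)
  rw [← add_zero y] at h1
  have h2 := HasDerivAt.comp_const_add y 0 h1
  simpa only [AddCircle.coe_add, add_zero] using h2.deriv

theorem IsTest.testDt_one {ψ : ℝ → Torus → ℝ} (h : IsTest ψ) : IsTest (testDt 1 ψ) := by
  obtain ⟨R, hR⟩ := h.2
  refine ⟨?_, R, fun t x ht => ?_⟩
  · simp only [testDt_one_coe h]
    exact contDiff_fderiv_apply h.1 (1, 0)
  · rw [testDt, iteratedDeriv_one]
    have h1 : (fun s => ψ s x) =ᶠ[𝓝 t] fun _ => 0 := by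
      filter_upwards [(isOpen_lt continuous_const continuous_abs).mem_nhds ht] with s hs
      exact hR s x hs
    rw [h1.deriv_eq, deriv_const]

theorem IsTest.testDx_one {ψ : ℝ → Torus → ℝ} (h : IsTest ψ) : IsTest (testDx 1 ψ) := by
  obtain ⟨R, hR⟩ := h.2
  refine ⟨?_, R, fun t x ht => ?_⟩
  · simp only [testDx_one_coe h]
    exact contDiff_fderiv_apply h.1 (0, 1)
  · rw [testDx, iteratedDeriv_one]
    simp only [hR t _ ht, deriv_const]

theorem testDt_two (ψ : ℝ → Torus → ℝ) : testDt 2 ψ = testDt 1 (testDt 1 ψ) := by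
  ext t x
  simp only [testDt, iteratedDeriv_succ, iteratedDeriv_zero]

theorem testDx_two (ψ : ℝ → Torus → ℝ) : testDx 2 ψ = testDx 1 (testDx 1 ψ) := by
  ext t x
  simp only [testDx, iteratedDeriv_succ, iteratedDeriv_zero]
  congr 1
  ext y
  have := deriv_comp_const_add (f := fun z : ℝ => ψ t (x + (z : Torus))) y 0
  simpa only [AddCircle.coe_add, add_zero, add_assoc] using this.symm

theorem IsTest.continuous_right {ψ : ℝ → Torus → ℝ} (h : IsTest ψ) (t : ℝ) :
    Continuous (ψ t) := by
  refine (QuotientAddGroup.isQuotientMap_mk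
    (N := AddSubgroup.zmultiples (2 * π))).continuous_iff.mpr ?_
  exact h.1.continuous.comp (by fun_prop : Continuous fun y : ℝ => (t, y))

theorem IsTest.exists_bound {ψ : ℝ → Torus → ℝ} (h : IsTest ψ) : ∃ B, ∀ t x, ‖ψ t x‖ ≤ B := by
  obtain ⟨R, hR⟩ := h.2
  obtain ⟨B, hB⟩ := (isCompact_Icc.prod isCompact_Icc : IsCompact
    (Set.Icc (-R) R ×ˢ Set.Icc (0 : ℝ) (2 * π))).exists_bound_of_continuousOn
      h.1.continuous.continuousOn
  refine ⟨max B 0, fun t x => ?_⟩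
  by_cases ht : R < |t|
  · simp [hR t x ht]
  · obtain ⟨y, hy, rfl⟩ := AddCircle.coe_image_Ico_eq (2 * π) 0 ▸ Set.mem_univ x
    rw [zero_add] at hy
    exact (hB (t, y) ⟨abs_le.mp (not_lt.mp ht), hy.1, hy.2.le⟩).trans (le_max_left _ _)

/-- The Fourier coefficients of a test function are continuously differentiable in time. -/
theorem IsTest.hasDerivAt_fcoef {ψ : ℝ → Torus → ℝ} (h : IsTest ψ) (k : ℤ) (t : ℝ) :
    HasDerivAt (fun t => fcoef (ψ t) k) (fcoef (testDt 1 ψ t) k) t := by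
  obtain ⟨B, hB⟩ := h.testDt_one.exists_bound
  have hc : ∀ {ψ : ℝ → Torus → ℝ}, IsTest ψ → ∀ t, Continuous fun x : Torus =>
      fourier (-k) x * (ψ t x : ℂ) := fun hψ t =>
    (map_continuous (fourier (-k))).mul (Complex.continuous_ofReal.comp (hψ.continuous_right t))
  have hci : ∀ {f : Torus → ℂ}, Continuous f → Integrable f volume := fun hf =>
    hf.integrable_of_hasCompactSupport (HasCompactSupport.of_compactSpace _)
  refine (hasDerivAt_integral_of_dominated_loc_of_deriv_le (s := Set.univ) (bound := fun _ => B)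
    (F' := fun t x => fourier (-k) x * (testDt 1 ψ t x : ℂ))
    univ_mem (Eventually.of_forall fun t => (hc h t).aestronglyMeasurable) (hci (hc h t))
    (hc h.testDt_one t).aestronglyMeasurable (ae_of_all _ fun x s _ => ?_)
    (integrable_const _) (ae_of_all _ fun x s _ => ?_)).2
  · rw [norm_mul, fourier_apply, Circle.norm_coe, one_mul, Complex.norm_real]
    exact hB s x
  · refine HasDerivAt.const_mul _ (HasDerivAt.ofReal_comp ?_)
    induction x using QuotientAddGroup.induction_on with
    | H y =>
      have h1 := hasDerivAt_fst h.1 s y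
      rw [← testDt_one_coe h] at h1
      exact h1

theorem IsTest.contDiff_fcoef {ψ : ℝ → Torus → ℝ} (h : IsTest ψ) (k : ℤ) :
    ContDiff ℝ ∞ (fun t => fcoef (ψ t) k) := by
  rw [contDiff_infty]
  intro n
  induction n generalizing ψ with
  | zero =>
    exact contDiff_zero.mpr (continuous_iff_continuousAt.mpr fun t =>
      (h.hasDerivAt_fcoef k t).continuousAt)
  | succ n ih =>
    have := contDiff_succ_iff_deriv (𝕜 := ℝ) (n := n) (f := fun t => fcoef (ψ t) k)
    push_cast
    rw [this]
    refine ⟨fun t => (h.hasDerivAt_fcoef k t).differentiableAt, by simp, ?_⟩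
    rw [funext fun t => (h.hasDerivAt_fcoef k t).deriv]
    exact ih h.testDt_one

theorem IsTest.hasCompactSupport_fcoef {ψ : ℝ → Torus → ℝ} (h : IsTest ψ) (k : ℤ) :
    HasCompactSupport (fun t => fcoef (ψ t) k) := by
  obtain ⟨R, hR⟩ := h.2
  refine HasCompactSupport.intro (isCompact_Icc (a := -R) (b := R)) fun t ht => ?_
  have h1 : R < |t| := by
    by_contra h2
    exact ht (abs_le.mp (not_lt.mp h2))
  simp [fcoef, hR t _ h1]

theorem IsTest.fcoef_testDx_one {ψ : ℝ → Torus → ℝ} (h : IsTest ψ) (t : ℝ) (k : ℤ) :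
    fcoef (testDx 1 ψ t) k = Complex.I * k * fcoef (ψ t) k := by
  have hpi : (π : ℂ) ≠ 0 := Complex.ofReal_ne_zero.mpr Real.pi_pos.ne'
  have hc : ∀ {ψ : ℝ → Torus → ℝ}, IsTest ψ → Continuous fun x : Torus =>
      fourier (-k) x * (ψ t x : ℂ) := fun hψ =>
    (map_continuous (fourier (-k))).mul (Complex.continuous_ofReal.comp (hψ.continuous_right t))
  have hci : ∀ {f : Torus → ℂ}, Continuous f → Integrable f volume := fun hf =>
    hf.integrable_of_hasCompactSupport (HasCompactSupport.of_compactSpace _)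
  set f : Torus → ℂ := fun x => fourier (-k) x * (testDx 1 ψ t x : ℂ)
    - Complex.I * k * (fourier (-k) x * (ψ t x : ℂ)) with hf
  have hfc : Continuous f := (hc h.testDx_one).sub (continuous_const.mul (hc h))
  have hd : ∀ y : ℝ, HasDerivAt (fun y : ℝ => fourier (-k) (y : Torus) * (ψ t (y : Torus) : ℂ))
      (f (y : Torus)) y := fun y => by
    have h1 := hasDerivAt_snd h.1 t y
    rw [← testDx_one_coe h] at h1
    refine ((hasDerivAt_fourier_neg (2 * π) k y).mul h1.ofReal_comp).congr_deriv ?_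
    simp only [hf]
    push_cast
    field_simp
    ring
  have h0 : ∫ x : Torus, f x = 0 := by
    rw [← AddCircle.intervalIntegral_preimage (2 * π) 0 f,
      intervalIntegral.integral_eq_sub_of_hasDerivAt (fun y _ => hd y)
        ((hfc.comp (AddCircle.continuous_mk' _)).intervalIntegrable _ _)]
    have h2 : ((0 + 2 * π : ℝ) : Torus) = ((0 : ℝ) : Torus) := by
      rw [zero_add, AddCircle.coe_period, QuotientAddGroup.mk_zero]
    rw [h2, sub_self]
  rw [hf, integral_sub (hci (hc h.testDx_one)) ((hci (hc h)).const_mul _), integral_const_mul,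
    sub_eq_zero] at h0
  exact h0

/-- A test function as a function of time with values in `L²(𝕋)`. -/
noncomputable def IsTest.toL2T {ψ : ℝ → Torus → ℝ} (h : IsTest ψ) (t : ℝ) : L2T :=
  ((h.continuous_right t).memLp_of_hasCompactSupport (p := 2) (μ := volume)
    (HasCompactSupport.of_compactSpace _)).toLp (ψ t)

theorem IsTest.coeFn_toL2T {ψ : ℝ → Torus → ℝ} (h : IsTest ψ) (t : ℝ) :
    h.toL2T t =ᵐ[volume] ψ t := MemLp.coeFn_toLp _

theorem IsTest.fcoef_toL2T {ψ : ℝ → Torus → ℝ} (h : IsTest ψ) (t : ℝ) (k : ℤ) :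
    fcoef (h.toL2T t) k = fcoef (ψ t) k := fcoef_congr (h.coeFn_toL2T t) k

theorem IsTest.memLp_expWeight {ψ : ℝ → Torus → ℝ} (h : IsTest ψ) (γ : ℝ) :
    MemLp (expWeight γ h.toL2T) 2 volume := by
  obtain ⟨R, hR⟩ := h.2
  obtain ⟨B, hB⟩ := h.exists_bound
  have hm : AEStronglyMeasurable h.toL2T volume := aestronglyMeasurable_of_fcoef fun k => by
    simp only [h.fcoef_toL2T]
    exact (h.contDiff_fcoef k).continuous.aestronglyMeasurable
  have hB0 : 0 ≤ B := (norm_nonneg _).trans (hB 0 0)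
  have hn : ∀ t, ‖h.toL2T t‖
      ≤ measureUnivNNReal (volume : Measure Torus) ^ (2 : ℝ≥0∞).toReal⁻¹ * B := fun t =>
    Lp.norm_le_of_ae_bound hB0 ((h.coeFn_toL2T t).mono fun x hx => by rw [hx]; exact hB t x)
  set C := measureUnivNNReal (volume : Measure Torus) ^ (2 : ℝ≥0∞).toReal⁻¹ * B
  refine MemLp.mono' (memLp_indicator_const 2 (measurableSet_Icc (a := -R) (b := R))
    (Real.exp (|γ| * R) * C) (Or.inr measure_Icc_lt_top.ne))
    (aestronglyMeasurable_expWeight hm γ) (ae_of_all _ fun t => ?_)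
  by_cases ht : |t| ≤ R
  · rw [Set.indicator_of_mem (Set.mem_Icc.mpr (abs_le.mp ht)), expWeight, norm_smul,
      Real.norm_of_nonneg (Real.exp_pos _).le]
    have h1 : -(γ * t) ≤ |γ| * R := by
      calc -(γ * t) ≤ |γ * t| := neg_le_abs _
        _ = |γ| * |t| := abs_mul _ _
        _ ≤ _ := by gcongr
    have := hn t
    gcongr
  · have h1 : h.toL2T t = 0 := by
      refine Lp.ext ?_
      filter_upwards [h.coeFn_toL2T t, Lp.coeFn_zero ℝ 2 (volume : Measure Torus)] with x h2 h3
      rw [h2, h3, hR t x (not_le.mp ht), Pi.zero_apply]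
    rw [Set.indicator_of_notMem fun h2 => ht (abs_le.mpr (Set.mem_Icc.mp h2)), expWeight, h1,
      smul_zero, norm_zero]

/-! ### Weak derivatives in time -/

theorem integrable_complex_test_mul {η x : ℝ → ℂ} (hη : Continuous η) (hs : HasCompactSupport η)
    (hx : LocallyIntegrable x volume) : Integrable (fun t => η t * x t) volume :=
  hx.integrable_smul_left_of_hasCompactSupport hη hs

/-- Complex-valued test functions are allowed in the definition of the weak derivative. -/
theorem HasWeakDeriv.complex {x y : ℝ → ℂ} (h : HasWeakDeriv x y) (hx : LocallyIntegrable x volume)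
    (hy : LocallyIntegrable y volume) {η : ℝ → ℂ} (hη : ContDiff ℝ ∞ η)
    (hs : HasCompactSupport η) : ∫ t, deriv η t * x t = -∫ t, η t * y t := by
  have hr : ContDiff ℝ ∞ fun t => (η t).re := Complex.reCLM.contDiff.comp hη
  have hi : ContDiff ℝ ∞ fun t => (η t).im := Complex.imCLM.contDiff.comp hη
  have hrs : HasCompactSupport fun t => (η t).re := hs.comp_left (g := Complex.re) rfl
  have his : HasCompactSupport fun t => (η t).im := hs.comp_left (g := Complex.im) rfl
  have hd : ∀ t, deriv η t = ((deriv (fun t => (η t).re) t : ℝ) : ℂ)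
      + Complex.I * ((deriv (fun t => (η t).im) t : ℝ) : ℂ) := fun t => by
    have h1 : HasDerivAt η (deriv η t) t := (hη.differentiable (by simp) t).hasDerivAt
    have h2 : HasDerivAt (fun t => (η t).re) (deriv η t).re t :=
      Complex.reCLM.hasFDerivAt.comp_hasDerivAt t h1
    have h3 : HasDerivAt (fun t => (η t).im) (deriv η t).im t :=
      Complex.imCLM.hasFDerivAt.comp_hasDerivAt t h1
    rw [h2.deriv, h3.deriv, mul_comm, Complex.re_add_im]
  have key : ∀ {a b : ℝ → ℝ} {z : ℝ → ℂ}, Continuous a → HasCompactSupport a → Continuous b →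
      HasCompactSupport b → LocallyIntegrable z volume →
      ∫ t, ((a t : ℂ) + Complex.I * (b t : ℂ)) * z t
        = (∫ t, (a t : ℂ) * z t) + Complex.I * ∫ t, (b t : ℂ) * z t := by
    intro a b z ha has hb hbs hz
    rw [← integral_const_mul, ← integral_add (integrable_test_mul ha has hz)
      ((integrable_test_mul hb hbs hz).const_mul _)]
    exact integral_congr_ae (ae_of_all _ fun t => by simp only; ring)
  have e : ∀ t, η t = (((η t).re : ℝ) : ℂ) + Complex.I * (((η t).im : ℝ) : ℂ) := fun t => by
    rw [mul_comm, Complex.re_add_im]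
  have e1 : ∫ t, η t * y t = ∫ t, ((((η t).re : ℝ) : ℂ) + Complex.I * (((η t).im : ℝ) : ℂ)) * y t :=
    integral_congr_ae (ae_of_all _ fun t => by simp only; rw [← e t])
  simp only [hd]
  rw [e1, key (contDiff_infty_iff_deriv.mp hr).2.continuous hrs.deriv
    (contDiff_infty_iff_deriv.mp hi).2.continuous his.deriv hx,
    key hr.continuous hrs hi.continuous his hy, h _ hr hrs, h _ hi his]
  ring

theorem HasWeakDeriv.const_mul {x y : ℝ → ℂ} (h : HasWeakDeriv x y) (a : ℂ) :
    HasWeakDeriv (fun t => a * x t) (fun t => a * y t) := by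
  intro θ hθ hs
  simp only [mul_left_comm _ a]
  rw [integral_const_mul, integral_const_mul, h θ hθ hs, mul_neg]

/-- Conjugation of `d/dt` by `e^{-γt}`. -/
theorem HasWeakDeriv.exp_mul {x y : ℝ → ℂ} (h : HasWeakDeriv x y)
    (hx : LocallyIntegrable x volume) (hy : LocallyIntegrable y volume) (γ : ℝ) :
    HasWeakDeriv (fun t => (Real.exp (-(γ * t)) : ℂ) * x t)
      (fun t => (Real.exp (-(γ * t)) : ℂ) * y t - γ * ((Real.exp (-(γ * t)) : ℂ) * x t)) := by
  intro θ hθ hs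
  have hec : ContDiff ℝ ∞ fun t : ℝ => Real.exp (-(γ * t)) := by fun_prop
  have hE : ContDiff ℝ ∞ fun t => Real.exp (-(γ * t)) * θ t := hec.mul hθ
  have hEs : HasCompactSupport fun t => Real.exp (-(γ * t)) * θ t := hs.mul_left
  have hθ' := (contDiff_infty_iff_deriv.mp hθ).2.continuous
  have hd : ∀ t, deriv (fun t => Real.exp (-(γ * t)) * θ t) t
      = Real.exp (-(γ * t)) * deriv θ t - γ * (Real.exp (-(γ * t)) * θ t) := fun t => by
    have h1 : HasDerivAt (fun t : ℝ => Real.exp (-(γ * t))) (Real.exp (-(γ * t)) * -(γ * 1)) t :=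
      ((hasDerivAt_id t).const_mul γ).neg.exp
    refine (h1.mul (hθ.differentiable (by simp) t).hasDerivAt).deriv.trans ?_
    ring
  have i1 := integrable_test_mul (hec.continuous.mul hθ') hs.deriv.mul_left hx
  have i2 := integrable_test_mul hE.continuous hEs hx
  have e1 : ∫ t, ((deriv θ t : ℝ) : ℂ) * ((Real.exp (-(γ * t)) : ℂ) * x t)
      = (∫ t, ((deriv (fun t => Real.exp (-(γ * t)) * θ t) t : ℝ) : ℂ) * x t)
        + γ * ∫ t, ((Real.exp (-(γ * t)) * θ t : ℝ) : ℂ) * x t := by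
    rw [← integral_const_mul, ← integral_add ?_ (i2.const_mul _)]
    · refine integral_congr_ae (ae_of_all _ fun t => ?_)
      simp only [hd]
      push_cast
      ring
    · refine (i1.sub (i2.const_mul γ)).congr (ae_of_all _ fun t => ?_)
      simp only [hd, Pi.sub_apply, Pi.mul_apply]
      push_cast
      ring
  rw [e1, h _ hE hEs]
  have i3 := integrable_test_mul hE.continuous hEs hy
  have e2 : ∫ t, (θ t : ℂ) * ((Real.exp (-(γ * t)) : ℂ) * y t
      - γ * ((Real.exp (-(γ * t)) : ℂ) * x t))
      = (∫ t, ((Real.exp (-(γ * t)) * θ t : ℝ) : ℂ) * y t)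
      - γ * ∫ t, ((Real.exp (-(γ * t)) * θ t : ℝ) : ℂ) * x t := by
    rw [← integral_const_mul, ← integral_sub i3 (i2.const_mul _)]
    refine integral_congr_ae (ae_of_all _ fun t => ?_)
    push_cast
    ring
  rw [e2]
  ring

theorem HasWeakDeriv.ae_eq_zero {x y : ℝ → ℂ} (h : HasWeakDeriv x y) (hx : x =ᵐ[volume] 0)
    (hy : LocallyIntegrable y volume) : ∀ᵐ t, y t = 0 := by
  refine ae_eq_zero_of_integral_contDiff_smul_eq_zero hy fun θ hθ hs => ?_
  have h1 := h θ hθ hs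
  have h2 : ∫ t, ((deriv θ t : ℝ) : ℂ) * x t = 0 := by
    refine integral_eq_zero_of_ae ?_
    filter_upwards [hx] with t ht
    simp [ht]
  rw [h2, eq_comm, neg_eq_zero] at h1
  simpa using h1

theorem isWeakDt_of_hasWeakDeriv {u v : ℝ → L2T} (hu : LocallyIntegrable u volume)
    (hv : LocallyIntegrable v volume)
    (h : ∀ k, HasWeakDeriv (fun t => fcoef (u t) k) (fun t => fcoef (v t) k)) : IsWeakDt u v := by
  refine ⟨hu, hv, fun θ hθ hs => ext_of_fcoef fun k => ?_⟩
  have hθ' := (contDiff_infty_iff_deriv.mp hθ).2.continuous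
  have key : ∀ {η : ℝ → ℝ} {z : ℝ → L2T}, Continuous η → HasCompactSupport η →
      LocallyIntegrable z volume → ∫ t, (η t : ℂ) * fcoef (z t) k = fcoefL k (∫ t, η t • z t) := by
    intro η z hη hηs hz
    rw [← (fcoefL k).integral_comp_comm (hz.integrable_smul_left_of_hasCompactSupport hη hηs)]
    refine integral_congr_ae (ae_of_all _ fun t => ?_)
    simp
  rw [← fcoefL_apply, ← fcoefL_apply, map_neg, ← key hθ' hs.deriv hu, ← key hθ.continuous hs hv]
  exact h k θ hθ hs

/-! ### The linearized equation and its Fourier coefficients -/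

theorem integrable_integral_mul {u v : ℝ → L2T} (hu : MemLp u 2 volume) (hv : MemLp v 2 volume) :
    Integrable (fun t => ∫ x : Torus, u t x * v t x) volume := by
  have e : ∀ t, ∫ x : Torus, u t x * v t x = inner ℝ (v t) (u t) := fun t => by
    rw [L2.inner_def]
    rfl
  simp only [e]
  refine (((hu.integrable_norm_pow (by norm_num)).add
    (hv.integrable_norm_pow (by norm_num))).div_const 2).mono' (hv.1.inner hu.1)
    (ae_of_all _ fun t => ?_)
  refine (norm_inner_le_norm _ _).trans ?_
  simp only [Pi.add_apply]
  nlinarith [sq_nonneg (‖u t‖ - ‖v t‖)]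

theorem integral_expWeight_mul_test {ψ : ℝ → Torus → ℝ} (h : IsTest ψ) (γ : ℝ) (f : ℝ → L2T)
    (t : ℝ) :
    ∫ x : Torus, expWeight γ f t x * expWeight (-γ) h.toL2T t x = ∫ x : Torus, f t x * ψ t x := by
  refine integral_congr_ae ?_
  filter_upwards [h.coeFn_toL2T t, Lp.coeFn_smul (Real.exp (-(γ * t))) (f t),
    Lp.coeFn_smul (Real.exp (-(-γ * t))) (h.toL2T t)] with x h1 h2 h3
  rw [expWeight, expWeight, h2, h3, Pi.smul_apply, Pi.smul_apply, smul_eq_mul, smul_eq_mul, h1,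
    show ∀ a b c d : ℝ, a * b * (c * d) = (a * c) * (b * d) by intros; ring, ← Real.exp_add]
  simp

theorem integrable_integral_mul_test {ψ : ℝ → Torus → ℝ} (h : IsTest ψ) {γ : ℝ} {f : ℝ → L2T}
    (hf : MemLp (expWeight γ f) 2 volume) :
    Integrable (fun t => ∫ x : Torus, f t x * ψ t x) volume := by
  simpa only [integral_expWeight_mul_test] using integrable_integral_mul hf (h.memLp_expWeight (-γ))

/-- Parseval's identity for the pairing of a function in `L²_γ(ℝ; L²(𝕋))` with a test function. -/
theorem hasSum_integral_fcoef_mul_test {ψ : ℝ → Torus → ℝ} (h : IsTest ψ) {γ : ℝ} {f : ℝ → L2T}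
    (hf : MemLp (expWeight γ f) 2 volume) :
    HasSum (fun k => ∫ t, fcoef (f t) k * (starRingEnd ℂ) (fcoef (ψ t) k))
      ((2 * π * ∫ t, ∫ x : Torus, f t x * ψ t x : ℝ) : ℂ) := by
  have h1 := hasSum_integral_fcoef_mul hf (h.memLp_expWeight (-γ))
  simp only [integral_expWeight_mul_test] at h1
  convert h1 using 4 with k t
  rw [fcoef_expWeight, fcoef_expWeight, h.fcoef_toL2T, map_mul, Complex.conj_ofReal,
    show ∀ a b c d : ℂ, a * b * (c * d) = (a * c) * (b * d) by intros; ring, ← Complex.ofReal_mul,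
    ← Real.exp_add]
  simp

theorem integrable_mul_test (f : L2T) {ψ : ℝ → Torus → ℝ} (h : IsTest ψ) (t : ℝ) :
    Integrable (fun x => f x * ψ t x) volume := by
  refine (L2.integrable_inner (𝕜 := ℝ) (h.toL2T t) f).congr ?_
  filter_upwards [h.coeFn_toL2T t] with x hx
  rw [← hx]
  rfl

theorem integral_sub_add {α : Type*} [MeasurableSpace α] {ν : Measure α} {f g h : α → ℝ}
    (hf : Integrable f ν) (hg : Integrable g ν) (hh : Integrable h ν) :
    ∫ x, (f x - g x + h x) ∂ν = (∫ x, f x ∂ν) - (∫ x, g x ∂ν) + ∫ x, h x ∂ν := by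
  refine (integral_add (hf.sub hg) hh).trans ?_
  rw [← integral_sub hf hg]
  rfl

theorem integral_lin {f g h : ℝ → ℂ} (a b : ℂ) (hf : Integrable f volume)
    (hg : Integrable g volume) (hh : Integrable h volume) :
    ∫ t, (a * f t + b * g t + h t) = a * (∫ t, f t) + b * (∫ t, g t) + ∫ t, h t := by
  refine (integral_add ((hf.const_mul a).add (hg.const_mul b)) hh).trans ?_
  rw [← integral_const_mul, ← integral_const_mul, ← integral_add (hf.const_mul a) (hg.const_mul b)]
  rfl

theorem integral_linearized_test (μ : ℝ) (f j : L2T) {ψ : ℝ → Torus → ℝ} (hψ : IsTest ψ) (t : ℝ) :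
    ∫ x : Torus, (f x * testDt 2 ψ t x - μ * (f x * testDx 2 ψ t x) + j x * testDx 1 ψ t x)
      = (∫ x : Torus, f x * testDt 2 ψ t x) - μ * (∫ x : Torus, f x * testDx 2 ψ t x)
        + ∫ x : Torus, j x * testDx 1 ψ t x := by
  have tt : IsTest (testDt 2 ψ) := testDt_two ψ ▸ hψ.testDt_one.testDt_one
  have txx : IsTest (testDx 2 ψ) := testDx_two ψ ▸ hψ.testDx_one.testDx_one
  rw [integral_sub_add (integrable_mul_test f tt t) ((integrable_mul_test f txx t).const_mul μ)
    (integrable_mul_test j hψ.testDx_one t), integral_const_mul]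

/-- The equation `φₜₜ - μ φₓₓ - Jₓ = g` holds in the sense of distributions when it holds for
each Fourier coefficient. -/
theorem linearized_of_hasWeakDeriv {μ γ : ℝ} {φ φt J g : ℝ → L2T}
    (hφ : MemLp (expWeight γ φ) 2 volume) (hφt : MemLp (expWeight γ φt) 2 volume)
    (hJ : MemLp (expWeight γ J) 2 volume) (hg : MemLp (expWeight γ g) 2 volume)
    (h1 : ∀ k, HasWeakDeriv (fun t => fcoef (φ t) k) (fun t => fcoef (φt t) k))
    (h2 : ∀ k : ℤ, HasWeakDeriv (fun t => fcoef (φt t) k) (fun t => -μ * k ^ 2 * fcoef (φ t) k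
      + Complex.I * k * fcoef (J t) k + fcoef (g t) k))
    {ψ : ℝ → Torus → ℝ} (hψ : IsTest ψ) :
    ∫ t, ∫ x : Torus, (φ t x * testDt 2 ψ t x - μ * (φ t x * testDx 2 ψ t x)
        + J t x * testDx 1 ψ t x) = ∫ t, ∫ x : Torus, g t x * ψ t x := by
  have lφ := fun k => locallyIntegrable_fcoef (locallyIntegrable_of_expWeight hφ) k
  have lφt := fun k => locallyIntegrable_fcoef (locallyIntegrable_of_expWeight hφt) k
  have lJ := fun k => locallyIntegrable_fcoef (locallyIntegrable_of_expWeight hJ) k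
  have lg := fun k => locallyIntegrable_fcoef (locallyIntegrable_of_expWeight hg) k
  have tt : IsTest (testDt 2 ψ) := testDt_two ψ ▸ hψ.testDt_one.testDt_one
  have txx : IsTest (testDx 2 ψ) := testDx_two ψ ▸ hψ.testDx_one.testDx_one
  have tx := hψ.testDx_one
  simp only [integral_linearized_test μ _ _ hψ]
  rw [integral_sub_add (integrable_integral_mul_test tt hφ)
    ((integrable_integral_mul_test txx hφ).const_mul μ) (integrable_integral_mul_test tx hJ),
    integral_const_mul]
  have s1 := hasSum_integral_fcoef_mul_test tt hφ
  have s2 := hasSum_integral_fcoef_mul_test txx hφ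
  have s3 := hasSum_integral_fcoef_mul_test tx hJ
  have s4 := hasSum_integral_fcoef_mul_test hψ hg
  have hs := (s1.sub (s2.mul_left (μ : ℂ))).add s3
  -- by Parseval's identity it suffices to compare the coefficients of each frequency, where the
  -- conjugate of the coefficient of `ψ` is a complex test function of time
  have hk : ∀ k, (∫ t, fcoef (φ t) k * (starRingEnd ℂ) (fcoef (testDt 2 ψ t) k))
      - μ * (∫ t, fcoef (φ t) k * (starRingEnd ℂ) (fcoef (testDx 2 ψ t) k))
      + (∫ t, fcoef (J t) k * (starRingEnd ℂ) (fcoef (testDx 1 ψ t) k))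
      = ∫ t, fcoef (g t) k * (starRingEnd ℂ) (fcoef (ψ t) k) := fun k => by
    set η : ℝ → ℂ := fun t => (starRingEnd ℂ) (fcoef (ψ t) k) with hη
    have c0 : ContDiff ℝ ∞ η := Complex.conjCLE.contDiff.comp (hψ.contDiff_fcoef k)
    have c1 : ContDiff ℝ ∞ fun t => (starRingEnd ℂ) (fcoef (testDt 1 ψ t) k) :=
      Complex.conjCLE.contDiff.comp (hψ.testDt_one.contDiff_fcoef k)
    have k0 : HasCompactSupport η := (hψ.hasCompactSupport_fcoef k).comp_left (map_zero _)
    have k1 : HasCompactSupport fun t => (starRingEnd ℂ) (fcoef (testDt 1 ψ t) k) :=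
      (hψ.testDt_one.hasCompactSupport_fcoef k).comp_left (map_zero _)
    have hd : ∀ {ψ : ℝ → Torus → ℝ}, IsTest ψ → deriv (fun t => (starRingEnd ℂ) (fcoef (ψ t) k))
        = fun t => (starRingEnd ℂ) (fcoef (testDt 1 ψ t) k) := fun h => by
      ext1 t
      exact (h.hasDerivAt_fcoef k t).star.deriv
    have l2 : LocallyIntegrable (fun t => -μ * k ^ 2 * fcoef (φ t) k
        + Complex.I * k * fcoef (J t) k + fcoef (g t) k) volume :=
      (((lφ k).smul (-μ * k ^ 2 : ℂ)).add ((lJ k).smul (Complex.I * k))).add (lg k)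
    have w1 := (h1 k).complex (lφ k) (lφt k) c1 k1
    have w2 := (h2 k).complex (lφt k) l2 c0 k0
    rw [hd hψ] at w2
    rw [hd hψ.testDt_one, w2, neg_neg] at w1
    have j1 := integrable_complex_test_mul c0.continuous k0 (lφ k)
    have j2 := integrable_complex_test_mul c0.continuous k0 (lJ k)
    have j3 := integrable_complex_test_mul c0.continuous k0 (lg k)
    have e1 : ∫ t, η t * (-μ * k ^ 2 * fcoef (φ t) k + Complex.I * k * fcoef (J t) k
        + fcoef (g t) k) = (-μ * k ^ 2) * (∫ t, η t * fcoef (φ t) k)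
        + (Complex.I * k) * (∫ t, η t * fcoef (J t) k) + ∫ t, η t * fcoef (g t) k := by
      rw [← integral_lin _ _ j1 j2 j3]
      exact integral_congr_ae (ae_of_all _ fun t => by simp only; ring)
    have e2 : ∫ t, fcoef (φ t) k * (starRingEnd ℂ) (fcoef (testDt 2 ψ t) k)
        = ∫ t, (starRingEnd ℂ) (fcoef (testDt 1 (testDt 1 ψ) t) k) * fcoef (φ t) k := by
      simp only [testDt_two, mul_comm]
    have e3 : ∫ t, fcoef (φ t) k * (starRingEnd ℂ) (fcoef (testDx 2 ψ t) k)
        = (-k ^ 2) * ∫ t, η t * fcoef (φ t) k := by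
      rw [← integral_const_mul]
      refine integral_congr_ae (ae_of_all _ fun t => ?_)
      simp only [testDx_two, hψ.testDx_one.fcoef_testDx_one, hψ.fcoef_testDx_one, map_mul,
        Complex.conj_I, map_intCast, hη]
      linear_combination (fcoef (φ t) k * k ^ 2 * (starRingEnd ℂ) (fcoef (ψ t) k)) * Complex.I_mul_I
    have e4 : ∫ t, fcoef (J t) k * (starRingEnd ℂ) (fcoef (testDx 1 ψ t) k)
        = (-Complex.I * k) * ∫ t, η t * fcoef (J t) k := by
      rw [← integral_const_mul]
      refine integral_congr_ae (ae_of_all _ fun t => ?_)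
      simp only [hψ.fcoef_testDx_one, map_mul, Complex.conj_I, map_intCast, hη]
      ring
    rw [e2, w1, e1, e3, e4]
    simp only [mul_comm (η _)]
    ring
  rw [funext hk] at hs
  have := hs.unique s4
  have hpi := Real.two_pi_pos
  norm_cast at this
  have h3 : 2 * π * ((∫ t, ∫ x : Torus, φ t x * testDt 2 ψ t x)
      - μ * (∫ t, ∫ x : Torus, φ t x * testDx 2 ψ t x) + ∫ t, ∫ x : Torus, J t x * testDx 1 ψ t x)
      = 2 * π * ∫ t, ∫ x : Torus, g t x * ψ t x := by linarith
  exact mul_left_cancel₀ hpi.ne' h3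

/-- The test function `θ(t) Re (a e^{-ikx})`. -/
noncomputable def trigTest (θ : ℝ → ℝ) (k : ℤ) (a : ℂ) (t : ℝ) (x : Torus) : ℝ :=
  θ t * (a * fourier (-k) x).re

theorem hasDerivAt_re_mul_fourier (k : ℤ) (a : ℂ) (y : ℝ) :
    HasDerivAt (fun y : ℝ => (a * fourier (-k) (y : Torus)).re)
      (-Complex.I * k * a * fourier (-k) (y : Torus)).re y := by
  have hpi : (π : ℂ) ≠ 0 := Complex.ofReal_ne_zero.mpr Real.pi_pos.ne'
  have h1 := (hasDerivAt_fourier_neg (2 * π) k y).const_mul a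
  have h2 := Complex.reCLM.hasFDerivAt.comp_hasDerivAt y h1
  refine h2.congr_deriv ?_
  simp only [Complex.reCLM_apply]
  congr 1
  push_cast
  field_simp

theorem isTest_trigTest {θ : ℝ → ℝ} (hθ : ContDiff ℝ ∞ θ) (hs : HasCompactSupport θ) (k : ℤ)
    (a : ℂ) : IsTest (trigTest θ k a) := by
  obtain ⟨R, hR⟩ := hs.isBounded.subset_closedBall 0
  refine ⟨?_, R, fun t x ht => ?_⟩
  · have h1 : ContDiff ℝ ∞ fun y : ℝ => (a * fourier (-k) (y : Torus)).re := by
      refine Complex.reCLM.contDiff.comp (contDiff_const.mul ?_)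
      simp only [fourier_coe_apply]
      exact ((contDiff_const.mul Complex.ofRealCLM.contDiff).div_const _).cexp
    exact (hθ.comp contDiff_fst).mul (h1.comp contDiff_snd)
  · have h1 : t ∉ tsupport θ := fun h => by
      have := hR h
      rw [mem_closedBall_zero_iff, Real.norm_eq_abs] at this
      linarith
    rw [trigTest, image_eq_zero_of_notMem_tsupport h1, zero_mul]

theorem testDt_trigTest {θ : ℝ → ℝ} (hθ : ContDiff ℝ ∞ θ) (k : ℤ) (a : ℂ) :
    testDt 1 (trigTest θ k a) = trigTest (deriv θ) k a := by
  ext t x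
  rw [testDt, iteratedDeriv_one]
  exact ((hθ.differentiable (by simp) t).hasDerivAt.mul_const _).deriv

theorem testDx_trigTest (θ : ℝ → ℝ) (k : ℤ) (a : ℂ) :
    testDx 1 (trigTest θ k a) = trigTest θ k (-Complex.I * k * a) := by
  ext t x
  rw [testDx, iteratedDeriv_one]
  induction x using QuotientAddGroup.induction_on with
  | H z =>
    have h1 := (hasDerivAt_re_mul_fourier k a (z + 0)).const_mul (θ t)
    have h2 := HasDerivAt.comp_const_add z 0 h1
    refine h2.deriv.trans ?_
    rw [add_zero]
    rfl

theorem integral_mul_trigTest (f : L2T) (θ : ℝ → ℝ) (k : ℤ) (a : ℂ) (t : ℝ) :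
    ∫ x : Torus, f x * trigTest θ k a t x = (a * (θ t * fcoef f k)).re := by
  have h1 := (integrable_fourier_mul f (-k)).const_mul (a * θ t)
  rw [fcoef, ← mul_assoc, ← integral_const_mul, ← RCLike.re_eq_complex_re, ← integral_re h1]
  refine integral_congr_ae (ae_of_all _ fun x => ?_)
  simp only [trigTest, RCLike.re_eq_complex_re]
  rw [show a * (θ t : ℂ) * (fourier (-k) x * (f x : ℂ))
    = ((f x * θ t : ℝ) : ℂ) * (a * fourier (-k) x) by push_cast; ring, Complex.re_ofReal_mul]
  ring

/-- The converse of `linearized_of_hasWeakDeriv`, by testing with `θ(t) cos kx`, `θ(t) sin kx`. -/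
theorem hasWeakDeriv_of_linearized {μ : ℝ} {φ φt J g : ℝ → L2T}
    (hφ : LocallyIntegrable φ volume) (hJ : LocallyIntegrable J volume)
    (hg : LocallyIntegrable g volume)
    (h : ∀ ψ : ℝ → Torus → ℝ, IsTest ψ →
      ∫ t, ∫ x : Torus, (φ t x * testDt 2 ψ t x - μ * (φ t x * testDx 2 ψ t x)
        + J t x * testDx 1 ψ t x) = ∫ t, ∫ x : Torus, g t x * ψ t x) (k : ℤ)
    (h1 : HasWeakDeriv (fun t => fcoef (φ t) k) (fun t => fcoef (φt t) k)) :
    HasWeakDeriv (fun t => fcoef (φt t) k) (fun t => -μ * k ^ 2 * fcoef (φ t) k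
      + Complex.I * k * fcoef (J t) k + fcoef (g t) k) := by
  intro θ hθ hs
  have lφ := locallyIntegrable_fcoef hφ k
  have lJ := locallyIntegrable_fcoef hJ k
  have lg := locallyIntegrable_fcoef hg k
  have hθ1 := (contDiff_infty_iff_deriv.mp hθ).2
  have hθ2 := (contDiff_infty_iff_deriv.mp hθ1).2
  have i0 := integrable_test_mul hθ2.continuous hs.deriv.deriv lφ
  have i1 := integrable_test_mul hθ.continuous hs lφ
  have i2 := integrable_test_mul hθ.continuous hs lJ
  have i3 := integrable_test_mul hθ.continuous hs lg
  set Z : ℝ → ℂ := fun t => ((deriv (deriv θ) t : ℝ) : ℂ) * fcoef (φ t) k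
    + μ * k ^ 2 * ((θ t : ℂ) * fcoef (φ t) k) - Complex.I * k * ((θ t : ℂ) * fcoef (J t) k) with hZ
  have iZ : Integrable Z volume := (i0.add (i1.const_mul _)).sub (i2.const_mul _)
  have ha : ∀ a : ℂ, (a * ∫ t, Z t).re = (a * ∫ t, (θ t : ℂ) * fcoef (g t) k).re := fun a => by
    have hψ := isTest_trigTest hθ hs k a
    have tt : testDt 2 (trigTest θ k a) = trigTest (deriv (deriv θ)) k a := by
      rw [testDt_two, testDt_trigTest hθ, testDt_trigTest hθ1]
    have txx : testDx 2 (trigTest θ k a) = trigTest θ k (-(k ^ 2) * a) := by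
      rw [testDx_two, testDx_trigTest, testDx_trigTest]
      congr 1
      linear_combination (k ^ 2 * a) * Complex.I_mul_I
    have e := h _ hψ
    rw [← integral_const_mul, ← integral_const_mul, ← RCLike.re_eq_complex_re,
      ← integral_re (iZ.const_mul a), ← integral_re (i3.const_mul a)]
    simp only [integral_mul_trigTest] at e
    refine Eq.trans ?_ e
    refine integral_congr_ae (ae_of_all _ fun t => ?_)
    beta_reduce
    rw [integral_linearized_test μ _ _ hψ, tt, txx, testDx_trigTest, integral_mul_trigTest,
      integral_mul_trigTest, integral_mul_trigTest, ← Complex.re_ofReal_mul, ← Complex.sub_re,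
      ← Complex.add_re, RCLike.re_eq_complex_re]
    congr 1
    simp only [hZ]
    ring
  have hZg : ∫ t, Z t = ∫ t, (θ t : ℂ) * fcoef (g t) k := by
    refine Complex.ext (by simpa using ha 1) ?_
    have := ha Complex.I
    simpa using this
  have h3 := h1 (deriv θ) hθ1 hs.deriv
  have e1 : ∫ t, Z t = (∫ t, ((deriv (deriv θ) t : ℝ) : ℂ) * fcoef (φ t) k)
      + μ * k ^ 2 * (∫ t, (θ t : ℂ) * fcoef (φ t) k)
      - Complex.I * k * ∫ t, (θ t : ℂ) * fcoef (J t) k := by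
    rw [sub_eq_add_neg, add_comm (∫ t, ((deriv (deriv θ) t : ℝ) : ℂ) * fcoef (φ t) k), ← neg_mul,
      add_right_comm, ← integral_lin _ _ i1 i2 i0]
    exact integral_congr_ae (ae_of_all _ fun t => by simp only [hZ]; ring)
  have e2 : ∫ t, (θ t : ℂ) * (-μ * k ^ 2 * fcoef (φ t) k + Complex.I * k * fcoef (J t) k
      + fcoef (g t) k) = -(μ * k ^ 2) * (∫ t, (θ t : ℂ) * fcoef (φ t) k)
      + Complex.I * k * (∫ t, (θ t : ℂ) * fcoef (J t) k) + ∫ t, (θ t : ℂ) * fcoef (g t) k := by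
    rw [← integral_lin _ _ i1 i2 i3]
    exact integral_congr_ae (ae_of_all _ fun t => by simp only; ring)
  rw [e2]
  rw [h3] at e1
  linear_combination e1 - hZg

/-! ### Solutions of the linearized equation and of the system for their coefficients -/

theorem MemL2g.mono {γ : ℝ} {s s' : ℕ} (h : s ≤ s') {f : ℝ → L2T} (hf : MemL2g γ s' f) :
    MemL2g γ s f := ⟨hf.1, (l2gNormSq_mono γ h f).trans_lt hf.2⟩

theorem ZeroMean.ae_fcoef {f : ℝ → L2T} (h : ZeroMean f) : ∀ᵐ t, fcoef (f t) 0 = 0 := by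
  filter_upwards [h] with t ht
  rw [fcoef_zero, ht, Complex.ofReal_zero]

theorem IsDx.norm_fcoef_le {f h : L2T} (hx : IsDx f h) (h0 : fcoef f 0 = 0) (k : ℤ) :
    wt k * ‖fcoef f k‖ ≤ 2 * ‖fcoef h k‖ := by
  rcases eq_or_ne k 0 with rfl | hk
  · simp [h0]
  · have h1 : (1 : ℝ) ≤ |(k : ℝ)| := by exact_mod_cast Int.one_le_abs hk
    rw [hx k, norm_mul, norm_mul, Complex.norm_I, one_mul, Complex.norm_intCast, ← mul_assoc]
    refine mul_le_mul_of_nonneg_right ?_ (norm_nonneg _)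
    rw [wt]
    linarith

theorem ae_summable_wt_fcoef {γ : ℝ} {φ φx : ℝ → L2T} (hz : ZeroMean φ)
    (hx : ∀ᵐ t, IsDx (φ t) (φx t)) (hm : MemL2g γ 1 φx) :
    ∀ᵐ t, Summable fun k => wt k ^ 4 * ‖fcoef (φ t) k‖ ^ 2 := by
  obtain ⟨hs, -, -⟩ := ae_summable_of_sum_integral_le
    (f := fun k t => wt k ^ (2 * 1) * ‖fcoef (expWeight γ φx t) k‖ ^ 2)
    (fun k t => by have := wt_pos k; positivity)
    (fun k => ((hm.memLp_fcoef k).integrable_norm_pow (by norm_num)).const_mul _)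
    (fun F => (Finset.sum_congr rfl fun k _ => integral_const_mul _ _).trans_le (hm.sum_le F))
  filter_upwards [hs, hx, hz.ae_fcoef] with t ht hd h0
  refine Summable.of_nonneg_of_le (fun k => by have := wt_pos k; positivity) (fun k => ?_)
    (ht.mul_left (4 * Real.exp (γ * t) ^ 2))
  have h1 := pow_le_pow_left₀ (by have := wt_pos k; positivity) (hd.norm_fcoef_le h0 k) 2
  have h2 : ‖fcoef (φx t) k‖ = Real.exp (γ * t) * ‖fcoef (expWeight γ φx t) k‖ := by
    rw [fcoef_expWeight, norm_mul, Complex.norm_real, Real.norm_of_nonneg (Real.exp_pos _).le,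
      ← mul_assoc, ← Real.exp_add]
    simp
  rw [h2] at h1
  calc wt k ^ 4 * ‖fcoef (φ t) k‖ ^ 2 = wt k ^ 2 * (wt k * ‖fcoef (φ t) k‖) ^ 2 := by ring
    _ ≤ wt k ^ 2 * (2 * (Real.exp (γ * t) * ‖fcoef (expWeight γ φx t) k‖)) ^ 2 := by gcongr
    _ = _ := by ring

section

variable {φ₀ φ φx : ℝ → L2T} {μ δ γ A L : ℝ}

/-- The Fourier coefficients of the weighted flux of a function with derivative in `L²_γ(ℝ; H¹)`. -/
theorem ae_fcoef_linFlux (h5 : MemLinf 5 φ₀) (hz : ZeroMean φ)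
    (hx : ∀ᵐ t, IsDx (φ t) (φx t)) (hm : MemL2g γ 1 φx) :
    ∀ᵐ t, ∀ k, fcoef (expWeight γ (fun t => linFlux (φ₀ t) (φ t)) t) k
      = -(π : ℂ)⁻¹ * ∑' j, (fluxKernel k j : ℂ) * fcoef (φ₀ t) (k - j)
        * fcoef (expWeight γ φx t) j := by
  have hpi : (π : ℂ) ≠ 0 := Complex.ofReal_ne_zero.mpr Real.pi_pos.ne'
  filter_upwards [ae_summable_wt_fcoef hz hx hm, h5.ae_sum_le, hx] with t ht h0 hd k
  have hs0 : Summable fun k => wt k ^ 4 * ‖fcoef (φ₀ t) k‖ ^ 2 :=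
    summable_wt_of_le (by norm_num) (summable_of_sum_le
      (fun k => by have := wt_pos k; positivity) h0)
  have h1 := (hasSum_fcoef_linFlux hs0 ht k).mul_left (Real.exp (-(γ * t)) : ℂ)
  have h2 : ∀ j, (fluxKernel k j : ℂ) * fcoef (φ₀ t) (k - j) * fcoef (expWeight γ φx t) j
      = (Real.exp (-(γ * t)) : ℂ) * ((fluxKernel k j : ℂ) * fcoef (φ₀ t) (k - j)
        * (Complex.I * j * fcoef (φ t) j)) := fun j => by
    rw [fcoef_expWeight, hd j]
    ring
  simp only [h2, h1.tsum_eq]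
  rw [fcoef_expWeight]
  field_simp

theorem ae_coefFlux_eq (h5 : MemLinf 5 φ₀) (hz : ZeroMean φ)
    (hx : ∀ᵐ t, IsDx (φ t) (φx t)) (hm : MemL2g γ 1 φx) (μ : ℝ) :
    ∀ᵐ t, ∀ k, coefFlux μ (fun n => fcoef (φ₀ t) n) (fun j => fcoef (expWeight γ φx t) j) k
      = μ * fcoef (expWeight γ φx t) k
        + fcoef (expWeight γ (fun t => linFlux (φ₀ t) (φ t)) t) k := by
  filter_upwards [ae_fcoef_linFlux h5 hz hx hm] with t ht k
  rw [ht, coefFlux]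
  ring

theorem memLp_expWeight_linFlux (hc : StateCoef (fun t n => fcoef (φ₀ t) n) μ δ A L)
    (h5 : MemLinf 5 φ₀) (hz : ZeroMean φ) (hx : ∀ᵐ t, IsDx (φ t) (φx t)) (hm : MemL2g γ 1 φx) :
    MemLp (expWeight γ (fun t => linFlux (φ₀ t) (φ t))) 2 volume := by
  have hM := sum_integral_sq_le_of_wt hm.sum_le
  have hfl := ae_fcoef_linFlux h5 hz hx hm
  have iw : ∀ j, Integrable (fun t => ‖fcoef (expWeight γ φx t) j‖ ^ 2) volume := fun j =>
    (hm.memLp_fcoef j).integrable_norm_pow (by norm_num)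
  obtain ⟨hs, hi, -⟩ := ae_summable_of_sum_integral_le (fun j t => sq_nonneg _) iw hM
  have mk : ∀ k, MemLp (fun t => fcoef (expWeight γ (fun t => linFlux (φ₀ t) (φ t)) t) k) 2
      volume := fun k => by
    refine ((hc.flux_series hm.memLp_fcoef hM k).2.1.const_mul (-(π : ℂ)⁻¹)).ae_eq ?_
    filter_upwards [hfl] with t ht
    exact (ht k).symm
  refine memLp_of_fcoef mk (M := ∫ t, ((π⁻¹) ^ 2 * ((A * wtSum) ^ 2
    * ∑' j, ‖fcoef (expWeight γ φx t) j‖ ^ 2))) fun F => ?_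
  rw [← integral_finsetSum F fun k _ => (mk k).integrable_norm_pow (by norm_num)]
  refine integral_mono_ae (integrable_finsetSum F fun k _ =>
    (mk k).integrable_norm_pow (by norm_num)) ((hi.const_mul _).const_mul _) ?_
  filter_upwards [hfl, hc.bound, hs] with t ht hb hst
  have h1 := (sum_norm_tsum_sq_le (b := fun n => A * (wt n ^ 2)⁻¹)
    (x := fun j => ‖fcoef (expWeight γ φx t) j‖)
    (z := fun k j => (fluxKernel k j : ℂ) * fcoef (φ₀ t) (k - j) * fcoef (expWeight γ φx t) j)
    (fun n => by have := hc.nonneg; have := wt_pos n; positivity)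
    (sum_const_mul_wt_le hc.nonneg)
    (fun F => hst.sum_le_tsum F fun _ _ => sq_nonneg _) (fun k j => by
      rw [norm_mul]
      exact mul_le_mul_of_nonneg_right (norm_fluxKernel_mul_le hb k j) (norm_nonneg _))).2 F
  have hpi : ‖-(π : ℂ)⁻¹‖ = π⁻¹ := by
    rw [norm_neg, norm_inv, Complex.norm_real, Real.norm_of_nonneg Real.pi_pos.le]
  simp only [ht, norm_mul, mul_pow, hpi, ← Finset.mul_sum]
  exact mul_le_mul_of_nonneg_left (by simpa only [mul_pow] using h1) (by positivity)

theorem memLp_expWeight_of_isDx (hφ : AEStronglyMeasurable φ volume) (hz : ZeroMean φ)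
    (hx : ∀ᵐ t, IsDx (φ t) (φx t)) (hm : MemL2g γ 1 φx) : MemLp (expWeight γ φ) 2 volume := by
  have hle : ∀ k, ∀ᵐ t, ‖fcoef (expWeight γ φ t) k‖
      ≤ 2 * ‖fcoef (expWeight γ φx t) k‖ := fun k => by
    filter_upwards [hx, hz.ae_fcoef] with t hd h0
    have h1 := hd.norm_fcoef_le h0 k
    have h2 := (le_mul_of_one_le_left (norm_nonneg (fcoef (φ t) k)) (one_le_wt k)).trans h1
    rw [fcoef_expWeight, fcoef_expWeight, norm_mul, norm_mul, mul_left_comm]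
    exact mul_le_mul_of_nonneg_left h2 (norm_nonneg _)
  have hmem : ∀ k, MemLp (fun t => fcoef (expWeight γ φ t) k) 2 volume := fun k =>
    (hm.memLp_fcoef k).of_le_mul
      (aestronglyMeasurable_fcoef (aestronglyMeasurable_expWeight hφ γ) k) (hle k)
  refine memLp_of_fcoef hmem (M := 4 * (2 * π * (l2gNormSq γ 1 φx).toReal)) fun F => ?_
  refine le_trans ?_ (mul_le_mul_of_nonneg_left (sum_integral_sq_le_of_wt hm.sum_le F)
    (by norm_num : (0 : ℝ) ≤ 4))
  rw [Finset.mul_sum]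
  refine Finset.sum_le_sum fun k _ => ?_
  rw [← integral_const_mul]
  refine integral_mono_ae ((hmem k).integrable_norm_pow (by norm_num))
    (((hm.memLp_fcoef k).integrable_norm_pow (by norm_num)).const_mul _) ?_
  filter_upwards [hle k] with t ht
  have := pow_le_pow_left₀ (norm_nonneg _) ht 2
  linarith

end

theorem hasWeakDeriv_zero : HasWeakDeriv (fun _ => 0) (fun _ => 0) := fun θ _ _ => by simp

theorem IsCoefSol.congr {c : ℝ → ℤ → ℂ} {μ γ : ℝ} {g g' v w v' w' : ℤ → ℝ → ℂ}
    (h : IsCoefSol c μ γ g v w) (hg : ∀ᵐ t, ∀ k, g k t = g' k t) (hv : ∀ᵐ t, ∀ k, v k t = v' k t)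
    (hw : ∀ᵐ t, ∀ k, w k t = w' k t) : IsCoefSol c μ γ g' v' w' := by
  have hv' : ∀ k, v k =ᵐ[volume] v' k := fun k => hv.mono fun t ht => ht k
  have hw' : ∀ k, w k =ᵐ[volume] w' k := fun k => hw.mono fun t ht => ht k
  refine ⟨fun k => (memLp_congr_ae (hv' k)).mp (h.memLp_v k),
    fun k => (memLp_congr_ae (hw' k)).mp (h.memLp_w k), ?_, ?_, fun k hk => ?_, fun k hk => ?_⟩
  · filter_upwards [h.zero_mode, hv, hw] with t ht h1 h2
    rwa [← h1, ← h2]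
  · obtain ⟨M, hM⟩ := h.bounded
    refine ⟨M, fun F => le_trans (le_of_eq (Finset.sum_congr rfl fun k _ => ?_)) (hM F)⟩
    congr 1
    exact integral_congr_ae ((hw' k).mono fun t ht => by simp only [ht])
  · refine (h.eqn_v k hk).congr (hv' k) ?_
    filter_upwards [hg, hv, hw] with t h0 h1 h2
    rw [h0, h1, funext h2]
  · refine (h.eqn_w k hk).congr (hw' k) ?_
    filter_upwards [hv, hw] with t h1 h2
    rw [h1, h2]

section

variable {φ₀ g φ φt φx : ℝ → L2T} {μ δ γ A L : ℝ} {m : ℕ}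

/-- The weighted Fourier coefficients of a solution of the linearized equation solve the system. -/
theorem IsLinSol.isCoefSol (hc : StateCoef (fun t n => fcoef (φ₀ t) n) μ δ A L)
    (h5 : MemLinf 5 φ₀) (hm : 1 ≤ m) (hg : MemL2g γ m g) (h : IsLinSol μ γ m φ₀ g φ φt φx) :
    IsCoefSol (fun t n => fcoef (φ₀ t) n) μ γ (fun k t => fcoef (expWeight γ g t) k)
      (fun k t => fcoef (expWeight γ φt t) k) (fun k t => fcoef (expWeight γ φx t) k) := by
  have hx1 := h.mem_x.mono hm
  have lφ := h.deriv_t.1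
  have lφt := h.deriv_t.2.1
  have lJ := locallyIntegrable_of_expWeight
    (memLp_expWeight_linFlux hc h5 h.zero_mean h.deriv_x hx1)
  have lg := locallyIntegrable_of_expWeight hg.memLp
  have w1 := h.deriv_t.hasWeakDeriv
  have z1 := h.zero_mean.ae_fcoef
  refine ⟨h.mem_t.memLp_fcoef, h.mem_x.memLp_fcoef, ?_, ⟨_, hx1.sum_le⟩, fun k _ => ?_,
    fun k _ => ?_⟩
  · filter_upwards [(w1 0).ae_eq_zero z1 (locallyIntegrable_fcoef lφt 0), h.deriv_x] with t h1 h2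
    rw [fcoef_expWeight, fcoef_expWeight, h1, h2 0]
    simp
  · have w2 := hasWeakDeriv_of_linearized lφ lJ lg h.eqn k (w1 k)
    have l2 : LocallyIntegrable (fun t => -μ * k ^ 2 * fcoef (φ t) k
        + Complex.I * k * fcoef (linFlux (φ₀ t) (φ t)) k + fcoef (g t) k) volume :=
      (((locallyIntegrable_fcoef lφ k).smul (-μ * k ^ 2 : ℂ)).add
        ((locallyIntegrable_fcoef lJ k).smul (Complex.I * k))).add (locallyIntegrable_fcoef lg k)
    refine (w2.exp_mul (locallyIntegrable_fcoef lφt k) l2 γ).congr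
      (ae_of_all _ fun t => (fcoef_expWeight _ _ _ _).symm) ?_
    filter_upwards [ae_coefFlux_eq h5 h.zero_mean h.deriv_x hx1 μ, h.deriv_x] with t h1 h2
    rw [h1]
    simp only [fcoef_expWeight, h2 k]
    linear_combination (-(Real.exp (-(γ * t)) : ℂ) * μ * k ^ 2 * fcoef (φ t) k) * Complex.I_mul_I
  · refine (((w1 k).exp_mul (locallyIntegrable_fcoef lφ k) (locallyIntegrable_fcoef lφt k)
      γ).const_mul (Complex.I * k)).congr ?_ ?_
    · filter_upwards [h.deriv_x] with t h2
      rw [fcoef_expWeight, h2 k]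
      ring
    · filter_upwards [h.deriv_x] with t h2
      rw [fcoef_expWeight, fcoef_expWeight, h2 k]
      ring

/-- A function whose weighted Fourier coefficients solve the system is a solution of the linearized
equation. -/
theorem IsCoefSol.isLinSol (hc : StateCoef (fun t n => fcoef (φ₀ t) n) μ δ A L)
    (h5 : MemLinf 5 φ₀) (hm : 1 ≤ m) (hg : MemL2g γ m g) (hg0 : ZeroMean g)
    (hφ : AEStronglyMeasurable φ volume) (hz : ZeroMean φ)
    (hx : ∀ᵐ t, IsDx (φ t) (φx t)) (mt : MemL2g γ m φt) (mx : MemL2g γ m φx)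
    (h : IsCoefSol (fun t n => fcoef (φ₀ t) n) μ γ (fun k t => fcoef (expWeight γ g t) k)
      (fun k t => fcoef (expWeight γ φt t) k) (fun k t => fcoef (expWeight γ φx t) k)) :
    IsLinSol μ γ m φ₀ g φ φt φx := by
  have hx1 := mx.mono hm
  have mφ := memLp_expWeight_of_isDx hφ hz hx hx1
  have mJ := memLp_expWeight_linFlux hc h5 hz hx hx1
  have lm : ∀ {u : ℝ → ℂ}, MemLp u 2 volume → LocallyIntegrable u volume := fun hu =>
    hu.locallyIntegrable (by norm_num)
  have lφ := locallyIntegrable_of_expWeight mφ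
  have lφt := locallyIntegrable_of_expWeight mt.memLp
  -- `e^{γt}` undoes the weight in the equations for the coefficients
  have hE : ∀ t : ℝ, (Real.exp (-(-γ * t)) : ℂ) * (Real.exp (-(γ * t)) : ℂ) = 1 := fun t => by
    rw [← Complex.ofReal_mul, ← Real.exp_add]
    simp
  have hE' : ∀ (f : ℝ → L2T) (t : ℝ) (k : ℤ),
      (Real.exp (-(-γ * t)) : ℂ) * fcoef (expWeight γ f t) k = fcoef (f t) k := fun f t k => by
    rw [fcoef_expWeight, ← mul_assoc, hE, one_mul]
  have h0 : ∀ᵐ t, fcoef (φt t) 0 = 0 := by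
    filter_upwards [h.zero_mode] with t ht
    rw [← hE' φt, ht.1, mul_zero]
  have w1 : ∀ k, HasWeakDeriv (fun t => fcoef (φ t) k) (fun t => fcoef (φt t) k) := fun k => by
    rcases eq_or_ne k 0 with rfl | hk
    · exact hasWeakDeriv_zero.congr (hz.ae_fcoef.mono fun t ht => ht.symm)
        (h0.mono fun t ht => ht.symm)
    · have hk' : (k : ℂ) ≠ 0 := Int.cast_ne_zero.mpr hk
      have e1 := ((h.eqn_w k hk).exp_mul (lm (h.memLp_w k)) (lm
        (((h.memLp_v k).const_mul (Complex.I * k)).sub ((h.memLp_w k).const_mul (γ : ℂ))))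
        (-γ)).const_mul (Complex.I * k)⁻¹
      refine e1.congr ?_ ?_
      · filter_upwards [hx] with t ht
        rw [hE', ht k]
        field_simp
      · filter_upwards [hx] with t ht
        rw [Complex.ofReal_neg]
        linear_combination hE' φt t k + ((Real.exp (-(-γ * t)) : ℂ) * fcoef (expWeight γ φt t) k)
          * inv_mul_cancel₀ (mul_ne_zero Complex.I_ne_zero hk')
  have w2 : ∀ k : ℤ, HasWeakDeriv (fun t => fcoef (φt t) k) (fun t => -μ * k ^ 2 * fcoef (φ t) k
      + Complex.I * k * fcoef (linFlux (φ₀ t) (φ t)) k + fcoef (g t) k) := fun k => by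
    rcases eq_or_ne k 0 with rfl | hk
    · refine hasWeakDeriv_zero.congr (h0.mono fun t ht => ht.symm) ?_
      filter_upwards [hg0.ae_fcoef] with t ht
      rw [ht]
      simp
    · have mfl : MemLp (fun t => coefFlux μ (fun n => fcoef (φ₀ t) n)
          (fun j => fcoef (expWeight γ φx t) j) k) 2 volume :=
        hc.memLp_coefFlux h.memLp_w (sum_integral_sq_le_of_wt hx1.sum_le) k
      have e1 := (h.eqn_v k hk).exp_mul (lm (h.memLp_v k)) (lm
        (((mfl.const_mul (Complex.I * k)).add (hg.memLp_fcoef k)).sub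
          ((h.memLp_v k).const_mul (γ : ℂ)))) (-γ)
      refine e1.congr (ae_of_all _ fun t => hE' _ _ _) ?_
      filter_upwards [ae_coefFlux_eq h5 hz hx hx1 μ, hx] with t ht hd
      rw [ht, Complex.ofReal_neg]
      linear_combination (Complex.I * k * μ) * hE' φx t k
        + (Complex.I * k) * hE' (fun t => linFlux (φ₀ t) (φ t)) t k + hE' g t k
        + (Complex.I * k * μ) * hd k + (μ * k ^ 2 * fcoef (φ t) k) * Complex.I_mul_I
  exact ⟨hz, isWeakDt_of_hasWeakDeriv lφ lφt w1, hx, mt, mx, fun ψ hψ =>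
    linearized_of_hasWeakDeriv mφ mt.memLp mJ hg.memLp w1 w2 hψ⟩

end

section

variable {φ₀ g φ φt φx : ℝ → L2T} {μ δ γ A L : ℝ} {m : ℕ}

/-- Uniqueness for the linearized equation: the difference of the weighted coefficients solves the
homogeneous system, and the zero mean recovers `φ` from its derivative. -/
theorem IsLinSol.ae_eq (hc : StateCoef (fun t n => fcoef (φ₀ t) n) μ δ A L) (hL : 0 ≤ L)
    (hδ : 0 < δ) (hγ0 : 0 ≤ γ) (hγ : π⁻¹ * L / 2 + rateConst A 0 < γ * symmConst δ)
    (h5 : MemLinf 5 φ₀) (hm : 1 ≤ m) (hg : MemL2g γ m g) (h : IsLinSol μ γ m φ₀ g φ φt φx)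
    {u ut ux : ℝ → L2T} (h' : IsLinSol μ γ m φ₀ g u ut ux) : u =ᵐ[volume] φ := by
  have h1 := (h'.isCoefSol hc h5 hm hg).lin hc hg.memLp_fcoef hg.memLp_fcoef
    (h.isCoefSol hc h5 hm hg) 1 (-1)
  have e : (fun (k : ℤ) t => 1 * fcoef (expWeight γ g t) k + -1 * fcoef (expWeight γ g t) k)
      = fun _ _ => 0 := by
    funext k t
    ring
  rw [e] at h1
  have h2 := ae_all_iff.mpr fun k => h1.ae_eq_zero hc hL hδ hγ0 hγ k
  filter_upwards [h2, h.zero_mean.ae_fcoef, h'.zero_mean.ae_fcoef, h.deriv_x, h'.deriv_x]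
    with t ht z z' hx hx'
  refine ext_of_fcoef fun k => ?_
  rcases eq_or_ne k 0 with rfl | hk
  · rw [z, z']
  · have h3 := (ht k).2
    rw [fcoef_expWeight, fcoef_expWeight, hx k, hx' k] at h3
    have hE : (Real.exp (-(γ * t)) : ℂ) ≠ 0 := Complex.ofReal_ne_zero.mpr (Real.exp_pos _).ne'
    have hk' : (k : ℂ) ≠ 0 := Int.cast_ne_zero.mpr hk
    have h4 : (Real.exp (-(γ * t)) : ℂ) * (Complex.I * k)
        * (fcoef (u t) k - fcoef (φ t) k) = 0 := by
      linear_combination h3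
    rcases mul_eq_zero.mp h4 with h5 | h5
    · exact absurd h5 (mul_ne_zero hE (mul_ne_zero Complex.I_ne_zero hk'))
    · exact sub_eq_zero.mp h5

/-- A solution of the system for the Fourier coefficients, with the symmetry of real functions,
yields a solution of the linearized equation. -/
theorem IsCoefSol.exists_isLinSol (hc : StateCoef (fun t n => fcoef (φ₀ t) n) μ δ A L)
    (h5 : MemLinf 5 φ₀) (hm : 1 ≤ m) (hg : MemL2g γ m g) (hg0 : ZeroMean g) {v w : ℤ → ℝ → ℂ}
    (h : IsCoefSol (fun t n => fcoef (φ₀ t) n) μ γ (fun k t => fcoef (expWeight γ g t) k) v w)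
    (hv : ∀ k t, v (-k) t = (starRingEnd ℂ) (v k t))
    (hw : ∀ k t, w (-k) t = (starRingEnd ℂ) (w k t)) {M : ℝ}
    (hM : ∀ F : Finset ℤ, ∑ k ∈ F, wt k ^ (2 * m) * ((∫ t, ‖v k t‖ ^ 2) + ∫ t, ‖w k t‖ ^ 2) ≤ M) :
    ∃ φ φt φx : ℝ → L2T, IsLinSol μ γ m φ₀ g φ φt φx ∧
      l2gNormSq γ m φt ≤ ENNReal.ofReal ((2 * π)⁻¹ * M) ∧
      l2gNormSq γ m φx ≤ ENNReal.ofReal ((2 * π)⁻¹ * M) := by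
  have hMv : ∀ F : Finset ℤ, ∑ k ∈ F, wt k ^ (2 * m) * ∫ t, ‖v k t‖ ^ 2 ≤ M := fun F =>
    (Finset.sum_le_sum fun k _ => mul_le_mul_of_nonneg_left
      (le_add_of_nonneg_right (integral_nonneg fun t => sq_nonneg _))
      (pow_nonneg (wt_pos k).le _)).trans (hM F)
  have hMw : ∀ F : Finset ℤ, ∑ k ∈ F, wt k ^ (2 * m) * ∫ t, ‖w k t‖ ^ 2 ≤ M := fun F =>
    (Finset.sum_le_sum fun k _ => mul_le_mul_of_nonneg_left
      (le_add_of_nonneg_left (integral_nonneg fun t => sq_nonneg _))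
      (pow_nonneg (wt_pos k).le _)).trans (hM F)
  -- the Fourier coefficients of the spatial primitive of zero mean
  set z : ℤ → ℝ → ℂ := fun k t => if k = 0 then 0 else (Complex.I * k)⁻¹ * w k t with hz
  have zle : ∀ k t, ‖z k t‖ ≤ ‖w k t‖ := fun k t => by
    by_cases hk : k = 0
    · simp [hz, hk]
    · have h1 : (1 : ℝ) ≤ |(k : ℝ)| := by exact_mod_cast Int.one_le_abs hk
      simp only [hz, if_neg hk]
      rw [norm_mul, norm_inv, norm_mul, Complex.norm_I, one_mul, Complex.norm_intCast]
      exact mul_le_of_le_one_left (norm_nonneg _) (inv_le_one_of_one_le₀ h1)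
  have zmem : ∀ k, MemLp (z k) 2 volume := fun k => by
    by_cases hk : k = 0
    · have : z k = fun _ => 0 := by simp [hz, hk]
      rw [this]
      exact MemLp.zero
    · have : z k = fun t => (Complex.I * k)⁻¹ * w k t := by simp [hz, hk]
      rw [this]
      exact (h.memLp_w k).const_mul _
  have zherm : ∀ k t, z (-k) t = (starRingEnd ℂ) (z k t) := fun k t => by
    by_cases hk : k = 0
    · simp [hz, hk]
    · simp only [hz, neg_eq_zero, if_neg hk, hw, map_mul, map_inv₀, Complex.conj_I, map_intCast]
      push_cast
      ring
  obtain ⟨V, mV, eV⟩ := exists_memLp_fcoef_eq h.memLp_v hv (sum_integral_sq_le_of_wt hMv)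
  obtain ⟨W, mW, eW⟩ := exists_memLp_fcoef_eq h.memLp_w hw (sum_integral_sq_le_of_wt hMw)
  obtain ⟨Z, mZ, eZ⟩ := exists_memLp_fcoef_eq zmem zherm (M := M) fun F =>
    (Finset.sum_le_sum fun k _ => integral_mono ((zmem k).integrable_norm_pow (by norm_num))
      ((h.memLp_w k).integrable_norm_pow (by norm_num)) fun t =>
        pow_le_pow_left₀ (norm_nonneg _) (zle k t) 2).trans (sum_integral_sq_le_of_wt hMw F)
  have key : ∀ {U : ℝ → L2T} {y : ℤ → ℝ → ℂ}, MemLp U 2 volume → (∀ k, MemLp (y k) 2 volume) →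
      (∀ᵐ t, ∀ k, fcoef (U t) k = y k t) →
      (∀ F : Finset ℤ, ∑ k ∈ F, wt k ^ (2 * m) * ∫ t, ‖y k t‖ ^ 2 ≤ M) →
      l2gNormSq γ m (expWeight (-γ) U) ≤ ENNReal.ofReal ((2 * π)⁻¹ * M) := by
    intro U y mU my eU hy
    refine l2gNormSq_le_of_sum_le (aestronglyMeasurable_expWeight mU.1 _) (fun k => ?_) fun F => ?_
    · rw [expWeight_neg]
      exact memLp_fcoef mU k
    · rw [expWeight_neg]
      refine le_trans (le_of_eq (Finset.sum_congr rfl fun k _ => ?_)) (hy F)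
      congr 1
      exact integral_congr_ae (eU.mono fun t ht => by simp only [ht k])
  have lv := key mV h.memLp_v eV hMv
  have lw := key mW h.memLp_w eW hMw
  refine ⟨expWeight (-γ) Z, expWeight (-γ) V, expWeight (-γ) W, ?_, lv, lw⟩
  refine IsCoefSol.isLinSol hc h5 hm hg hg0 (aestronglyMeasurable_expWeight mZ.1 _) ?_ ?_
    ⟨aestronglyMeasurable_expWeight mV.1 _, lv.trans_lt ENNReal.ofReal_lt_top⟩
    ⟨aestronglyMeasurable_expWeight mW.1 _, lw.trans_lt ENNReal.ofReal_lt_top⟩ ?_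
  · filter_upwards [eZ] with t ht
    have h1 := fcoef_expWeight (-γ) Z t 0
    rw [ht 0, fcoef_zero] at h1
    simp only [hz, if_true, mul_zero] at h1
    exact_mod_cast h1
  · filter_upwards [eZ, eW, h.zero_mode] with t h1 h2 h3 k
    rw [fcoef_expWeight, fcoef_expWeight, h1, h2]
    by_cases hk : k = 0
    · subst hk
      simp [h3.2]
    · have hk' : (k : ℂ) ≠ 0 := Int.cast_ne_zero.mpr hk
      simp only [hz, if_neg hk]
      field_simp
  · rw [expWeight_neg, expWeight_neg]
    exact h.congr (ae_of_all _ fun t k => rfl) (eV.mono fun t ht k => (ht k).symm)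
      (eW.mono fun t ht k => (ht k).symm)

end

/-! ### The estimate in terms of the norms of the basic state -/

theorem fcoef_dx_of_summable_wt {f : L2T} (hf : Summable fun k => wt k ^ 2 * ‖fcoef f k‖ ^ 2)
    (k : ℤ) : fcoef (dx f) k = Complex.I * k * fcoef f k := by
  refine fcoef_dx (Summable.of_nonneg_of_le (fun k => by positivity) (fun k => ?_) hf) k
  rw [← sq_abs (k : ℝ)]
  gcongr
  exact abs_le_wt k

theorem hsNormSq_dx_le {f : L2T} (hf : Summable fun k => wt k ^ 2 * ‖fcoef f k‖ ^ 2) (s : ℕ) :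
    hsNormSq s (dx f) ≤ hsNormSq (s + 1) f := by
  rw [hsNormSq, hsNormSq]
  refine mul_le_mul_right (ENNReal.tsum_le_tsum fun k => ENNReal.ofReal_le_ofReal ?_) _
  rw [fcoef_dx_of_summable_wt hf, norm_mul, norm_mul, Complex.norm_I, one_mul, Complex.norm_intCast]
  have h1 : |(k : ℝ)| ≤ 1 + |(k : ℝ)| := by linarith
  calc (1 + |(k : ℝ)|) ^ (2 * s) * (|(k : ℝ)| * ‖fcoef f k‖) ^ 2
      ≤ (1 + |(k : ℝ)|) ^ (2 * s) * ((1 + |(k : ℝ)|) * ‖fcoef f k‖) ^ 2 := by gcongr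
    _ = _ := by ring

/-- The norm `H⁵` only serves to make the derivative defined; the bound comes from `H^{s+1}`. -/
theorem memLinf_dx {φ₀ : ℝ → L2T} {s : ℕ} (h5 : MemLinf 5 φ₀) (h : MemLinf (s + 1) φ₀) :
    MemLinf s (fun t => dx (φ₀ t)) := by
  have hs : ∀ᵐ t, Summable fun k => wt k ^ 2 * ‖fcoef (φ₀ t) k‖ ^ 2 := by
    filter_upwards [h5.ae_sum_le] with t ht
    exact summable_wt_of_le (by norm_num) (summable_of_sum_le
      (fun k => by have := wt_pos k; positivity) ht)
  refine ⟨aestronglyMeasurable_of_fcoef fun k => ?_, lt_of_le_of_lt (essSup_mono_ae ?_) h.2⟩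
  · refine ((aestronglyMeasurable_fcoef h.1 k).const_mul (Complex.I * k)).congr ?_
    filter_upwards [hs] with t ht
    exact (fcoef_dx_of_summable_wt ht k).symm
  · filter_upwards [hs] with t ht
    exact ENNReal.rpow_le_rpow (hsNormSq_dx_le ht s) (by norm_num)

/-- The tame energy estimate with the high norm of the state expressed through `φ₀ₓ`. -/
theorem ae_energyRate_le {φ₀ : ℝ → L2T} {μ δ A L : ℝ}
    (hc : StateCoef (fun t n => fcoef (φ₀ t) n) μ δ A L) {m : ℕ} (h5 : MemLinf 5 φ₀)
    (hx : MemLinf (m + 2) fun t => dx (φ₀ t)) {K : Finset ℤ} (hK : 0 ∉ K) :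
    ∀ᵐ t, ∀ v w : ℤ → ℂ, energyRate μ (fun n => fcoef (φ₀ t) n) K m v w
      ≤ rateConst A m * (∑ k ∈ K, (wt k ^ m * ‖v k‖) ^ 2 + ∑ k ∈ K, (wt k ^ m * ‖w k‖) ^ 2)
        + π⁻¹ * commConst m * (√(2 * π) * (linfNorm (m + 2) fun t => dx (φ₀ t)).toReal * √wtSum)
          * √(∑ k ∈ K, wt k ^ 2 * ‖w k‖ ^ 2) * √(∑ k ∈ K, (wt k ^ m * ‖v k‖) ^ 2) := by
  set N := (linfNorm (m + 2) fun t => dx (φ₀ t)).toReal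
  filter_upwards [hc.bound, hx.ae_sum_le, h5.ae_sum_le] with t hb hd h0 v w
  have hs : Summable fun k => wt k ^ 2 * ‖fcoef (φ₀ t) k‖ ^ 2 :=
    summable_wt_of_le (by norm_num) (summable_of_sum_le
      (fun k => by have := wt_pos k; positivity) h0)
  have hD : ∀ F : Finset ℤ, ∑ n ∈ F, ((n : ℝ) ^ 2 * wt n ^ m * ‖fcoef (φ₀ t) n‖) ^ 2
      ≤ (√(2 * π) * N) ^ 2 := fun F => by
    rw [mul_pow, Real.sq_sqrt Real.two_pi_pos.le]
    refine le_trans (Finset.sum_le_sum fun n _ => ?_) (hd F)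
    rw [fcoef_dx_of_summable_wt hs, norm_mul, norm_mul, Complex.norm_I, one_mul,
      Complex.norm_intCast]
    have h1 := wt_pos n
    have h2 : |(n : ℝ)| ≤ wt n ^ 2 := (abs_le_wt n).trans (le_self_pow₀ (one_le_wt n) (by norm_num))
    calc ((n : ℝ) ^ 2 * wt n ^ m * ‖fcoef (φ₀ t) n‖) ^ 2
        = (|(n : ℝ)| * wt n ^ m * (|(n : ℝ)| * ‖fcoef (φ₀ t) n‖)) ^ 2 := by
          rw [← sq_abs (n : ℝ)]; ring
      _ ≤ (wt n ^ 2 * wt n ^ m * (|(n : ℝ)| * ‖fcoef (φ₀ t) n‖)) ^ 2 := by gcongr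
      _ = _ := by ring
  have hA := hc.nonneg
  have hN : 0 ≤ N := ENNReal.toReal_nonneg
  refine (energyRate_le hb (by positivity) hD hK v w).trans ?_
  set X := ∑ k ∈ K, (wt k ^ m * ‖v k‖) ^ 2 + ∑ k ∈ K, (wt k ^ m * ‖w k‖) ^ 2 with hX
  have hX0 : 0 ≤ X := by positivity
  have h1 : 0 ≤ π⁻¹ * commConst m * (A * wtSum * X) := by
    have := commConst_pos m
    have := wtSum_nonneg
    have := Real.pi_pos
    positivity
  rw [rateConst, mul_add]
  refine add_le_add ?_ (le_of_eq (by ring))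
  linarith

/-! ### The constants -/

/-- The reciprocal of `symmConst δ` for `δ > 0`. -/
noncomputable def symmBound (δ : ℝ) : ℝ := max 1 (2 / δ)

theorem one_le_symmBound (δ : ℝ) : 1 ≤ symmBound δ := le_max_left _ _

theorem symmBound_mul_symmConst {δ : ℝ} (hδ : 0 < δ) : symmBound δ * symmConst δ = 1 := by
  rw [symmBound, symmConst]
  rcases le_total δ 2 with h | h
  · rw [max_eq_right ((one_le_div hδ).mpr h), min_eq_right (by linarith)]
    field_simp
  · rw [max_eq_left ((div_le_one hδ).mpr h), min_eq_left (by linarith), one_mul]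

theorem symmBound_anti {δ δ' : ℝ} (h0 : 0 < δ') (h : δ' ≤ δ) : symmBound δ ≤ symmBound δ' :=
  max_le_max le_rfl (div_le_div_of_nonneg_left (by norm_num) h0 h)

theorem commConst_mono {m m' : ℕ} (h : m ≤ m') : commConst m ≤ commConst m' := by
  rw [commConst, commConst]
  gcongr
  norm_num

theorem rateConst_nonneg {A : ℝ} (hA : 0 ≤ A) (m : ℕ) : 0 ≤ rateConst A m := by
  have := commConst_pos m
  have := wtSum_nonneg
  have := Real.pi_pos
  rw [rateConst]
  positivity

theorem rateConst_mono {A A' : ℝ} (hA : 0 ≤ A) (h : A ≤ A') {m m' : ℕ} (hm : m ≤ m') :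
    rateConst A m ≤ rateConst A' m' := by
  have := commConst_pos m'
  have := commConst_mono hm
  have := wtSum_nonneg
  have := Real.pi_pos
  rw [rateConst, rateConst]
  gcongr

theorem lipConst_mono {b b' : ℝ} (hb : 0 ≤ b) (h : b ≤ b') : lipConst b ≤ lipConst b' := by
  have := Real.pi_pos
  rw [lipConst, lipConst]
  gcongr

/-- The threshold for the weight `γ`, where `a` and `b` are the norms of `φ₀` and `φ₀ₜ`. Taking the
absolute value of `a` makes it at least `1` for all arguments, those that are not norms included. -/
noncomputable def weightThreshold (m : ℕ) (δ a b : ℝ) : ℝ :=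
  1 + symmBound δ * (π⁻¹ * lipConst b + 2 * rateConst (√(2 * π) * |a|) m)

/-- The constant of the energy estimate. -/
noncomputable def energyConst (m : ℕ) (δ : ℝ) : ℝ :=
  16 * symmBound δ ^ 2 * (1 + 16 * π⁻¹ * commConst m ^ 2 * wtSum * symmBound δ ^ 2)

theorem energyConst_pos (m : ℕ) (δ : ℝ) : 0 < energyConst m δ := by
  have := one_le_symmBound δ
  have := wtSum_nonneg
  have := Real.pi_pos
  rw [energyConst]
  positivity

theorem one_le_weightThreshold (m : ℕ) (δ a b : ℝ) : 1 ≤ weightThreshold m δ a b := by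
  have := one_le_symmBound δ
  have := lipConst_nonneg b
  have := rateConst_nonneg (A := √(2 * π) * |a|) (by positivity) m
  have := Real.pi_pos
  rw [weightThreshold]
  have : 0 ≤ symmBound δ * (π⁻¹ * lipConst b + 2 * rateConst (√(2 * π) * |a|) m) := by positivity
  linarith

theorem weightThreshold_mono {m m' : ℕ} {δ δ' a a' b b' : ℝ} (hm : m ≤ m') (hδ : 0 < δ')
    (hδ' : δ' ≤ δ) (ha : 0 ≤ a) (ha' : a ≤ a') (hb : 0 ≤ b) (hb' : b ≤ b') :
    weightThreshold m δ a b ≤ weightThreshold m' δ' a' b' := by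
  have h1 := one_le_symmBound δ'
  have h2 := symmBound_anti hδ hδ'
  have h3 := lipConst_nonneg b
  have h4 := lipConst_mono hb hb'
  have h5 := rateConst_nonneg (A := √(2 * π) * |a|) (by positivity) m
  have h6 : rateConst (√(2 * π) * |a|) m ≤ rateConst (√(2 * π) * |a'|) m' :=
    rateConst_mono (by positivity) (mul_le_mul_of_nonneg_left (abs_le_abs_of_nonneg ha ha')
      (Real.sqrt_nonneg _)) hm
  have := Real.pi_pos
  rw [weightThreshold, weightThreshold]
  gcongr

theorem energyConst_mono {m m' : ℕ} {δ δ' : ℝ} (hm : m ≤ m') (hδ : 0 < δ') (hδ' : δ' ≤ δ) :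
    energyConst m δ ≤ energyConst m' δ' := by
  have h1 := one_le_symmBound δ
  have h2 := symmBound_anti hδ hδ'
  have h3 := commConst_pos m
  have h4 := commConst_mono hm
  have := Real.pi_pos
  have := wtSum_nonneg
  rw [energyConst, energyConst]
  gcongr

/-- The bound of `exists_isCoefSol` in terms of the constant of the energy estimate. The factor
`(2 * π)⁻¹` and the factors `2 * π` come from the normalization of the norms of `H^s`; the
additional factor `γ⁻²` in front of the norm of level `1` is bounded by `1`. -/
theorem mul_bound_le {δ γ N g₁ G : ℝ} {m : ℕ} (hδ : 0 < δ) (hγ : 1 ≤ γ) (hg₁ : 0 ≤ g₁)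
    (hG : 0 ≤ G) :
    γ * (2 * ((2 * π)⁻¹ * (8 / (γ * symmConst δ) ^ 2 *
      ((π⁻¹ * commConst m * (√(2 * π) * N * √wtSum)) ^ 2
        * (8 / (γ * symmConst δ) ^ 2 * (2 * π * g₁)) + 2 * π * G))))
      ≤ energyConst m δ / γ * (N ^ 2 * g₁ + G) := by
  have hpi := Real.pi_pos
  have hγ0 : 0 < γ := by linarith
  have hw := wtSum_nonneg
  have hρ := one_le_symmBound δ
  have hs := symmBound_mul_symmConst hδ
  have hs0 : symmConst δ ≠ 0 := fun h => by rw [h, mul_zero] at hs; exact zero_ne_one hs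
  have e1 : 8 / (γ * symmConst δ) ^ 2 = 8 * symmBound δ ^ 2 / γ ^ 2 := by
    rw [div_eq_div_iff (by positivity) (by positivity)]
    linear_combination (-(8 * γ ^ 2)) * (symmBound δ * symmConst δ + 1) * hs
  set ρ := symmBound δ
  set Q := 16 * π⁻¹ * commConst m ^ 2 * wtSum * ρ ^ 2 with hQ
  have hQ0 : 0 ≤ Q := by positivity
  have e2 : (π⁻¹ * commConst m * (√(2 * π) * N * √wtSum)) ^ 2
      = π⁻¹ ^ 2 * commConst m ^ 2 * (2 * π * N ^ 2 * wtSum) := by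
    rw [mul_pow, mul_pow, mul_pow, mul_pow, Real.sq_sqrt (by positivity), Real.sq_sqrt hw]
  have e3 : γ * (2 * ((2 * π)⁻¹ * (8 / (γ * symmConst δ) ^ 2 *
      ((π⁻¹ * commConst m * (√(2 * π) * N * √wtSum)) ^ 2
        * (8 / (γ * symmConst δ) ^ 2 * (2 * π * g₁)) + 2 * π * G))))
      = 16 * ρ ^ 2 / γ * (Q * (N ^ 2 * g₁) / γ ^ 2 + G) := by
    rw [e1, e2, hQ]
    field_simp
    ring
  rw [e3, show energyConst m δ / γ * (N ^ 2 * g₁ + G)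
    = 16 * ρ ^ 2 / γ * ((1 + Q) * (N ^ 2 * g₁ + G)) by rw [energyConst]; ring]
  refine mul_le_mul_of_nonneg_left ?_ (by positivity)
  have h1 : Q * (N ^ 2 * g₁) / γ ^ 2 ≤ Q * (N ^ 2 * g₁) :=
    div_le_self (by positivity) (one_le_pow₀ hγ)
  have h2 : 0 ≤ Q * G := by positivity
  have h3 : 0 ≤ N ^ 2 * g₁ := by positivity
  nlinarith

end

theorem proposition4p1 :
    ∃ γ₁ C : ℕ → ℝ → ℝ → ℝ → ℝ,
      (∀ m δ a b, 1 ≤ γ₁ m δ a b ∧ 0 < C m δ a b) ∧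
      (∀ m m' δ δ' a a' b b', m ≤ m' → 0 < δ' → δ' ≤ δ → 0 ≤ a → a ≤ a' → 0 ≤ b → b ≤ b' →
        γ₁ m δ a b ≤ γ₁ m' δ' a' b' ∧ C m δ a b ≤ C m' δ' a' b') ∧
      ∀ (m : ℕ) (μ δ : ℝ) (φ₀ φ₀t : ℝ → L2T), 1 ≤ m → 0 < δ →
        ZeroMean φ₀ → MemLinf 5 φ₀ → MemLinf (m + 3) φ₀ →
        IsWeakDt φ₀ φ₀t → MemLinf 2 φ₀t → StabilityCond μ δ φ₀ →
        ∀ γ : ℝ, γ₁ m δ (linfNorm 5 φ₀).toReal (linfNorm 2 φ₀t).toReal ≤ γ →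
        ∀ g : ℝ → L2T, MemL2g γ m g → ZeroMean g →
          ∃ φ φt φx : ℝ → L2T,
            IsLinSol μ γ m φ₀ g φ φt φx ∧
            (∀ u ut ux : ℝ → L2T, IsLinSol μ γ m φ₀ g u ut ux → u =ᵐ[volume] φ) ∧
            ENNReal.ofReal γ * (l2gNormSq γ m φt + l2gNormSq γ m φx) ≤
              ENNReal.ofReal (C m δ (linfNorm 5 φ₀).toReal (linfNorm 2 φ₀t).toReal / γ) *
                (linfNorm (m + 2) (fun t => dx (φ₀ t)) ^ 2 * l2gNormSq γ 2 g + l2gNormSq γ m g) := by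
  refine ⟨weightThreshold, fun m δ _ _ => energyConst m δ,
    fun m δ a b => ⟨one_le_weightThreshold m δ a b, energyConst_pos m δ⟩,
    fun m m' δ δ' a a' b b' hm hδ hδ' ha ha' hb hb' =>
      ⟨weightThreshold_mono hm hδ hδ' ha ha' hb hb', energyConst_mono hm hδ hδ'⟩,
    fun m μ δ φ₀ φ₀t hm hδ _ h5 hm3 hdt h2 hstab γ hγ g hg hg0 => ?_⟩
  have hc := stateCoef_fcoef h5 hdt h2 hstab
  have hx := memLinf_dx h5 hm3
  set a := (linfNorm 5 φ₀).toReal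
  set L := lipConst (linfNorm 2 φ₀t).toReal
  set N := (linfNorm (m + 2) fun t => dx (φ₀ t)).toReal with hN
  set A := √(2 * π) * a with hA
  have hA0 : 0 ≤ A := mul_nonneg (Real.sqrt_nonneg _) ENNReal.toReal_nonneg
  have hL : 0 ≤ L := lipConst_nonneg _
  have hL' : 0 ≤ π⁻¹ * L := mul_nonneg (inv_nonneg.mpr Real.pi_pos.le) hL
  have hγ1 : 1 ≤ γ := (one_le_weightThreshold _ _ _ _).trans hγ
  have hσ : 0 < symmConst δ := lt_min one_pos (by linarith)
  have hlow : symmConst δ + (π⁻¹ * L + 2 * rateConst A m) ≤ γ * symmConst δ := by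
    have h3 := mul_le_mul_of_nonneg_right hγ hσ.le
    rw [weightThreshold, abs_of_nonneg ENNReal.toReal_nonneg] at h3
    have h4 := symmBound_mul_symmConst hδ
    refine le_trans (le_of_eq ?_) h3
    linear_combination (-(π⁻¹ * L + 2 * rateConst A m)) * h4
  have hr0 := rateConst_mono hA0 le_rfl (Nat.zero_le m)
  have hr1 := rateConst_mono hA0 le_rfl hm
  have hrm := rateConst_nonneg hA0 m
  have hγ2 : π⁻¹ * L / 2 + rateConst A 0 < γ * symmConst δ := by linarith
  obtain ⟨v, w, hvw, hM⟩ := hc.exists_isCoefSol hL hδ (fun K hK => ae_energyRate_le hc h5 hx hK)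
    (by linarith) (by linarith) (by linarith) hγ2 hg.memLp_fcoef (hg.mono hm).sum_le hg.sum_le
  obtain ⟨v', w', hvw', hv', hw', hM'⟩ := hvw.exists_hermitian hc hg.memLp_fcoef
    (fun k t => fcoef_neg_index _ _) hM
  obtain ⟨φ, φt, φx, hsol, ht, hxx⟩ := hvw'.exists_isLinSol hc h5 hm hg hg0 hv' hw' hM'
  refine ⟨φ, φt, φx, hsol, fun u ut ux hu =>
    hsol.ae_eq hc hL hδ (by linarith) hγ2 h5 hm hg hu, ?_⟩
  have hg₁ := (hg.mono hm).2.ne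
  calc ENNReal.ofReal γ * (l2gNormSq γ m φt + l2gNormSq γ m φx)
      ≤ ENNReal.ofReal γ * (ENNReal.ofReal 2 * ENNReal.ofReal ((2 * π)⁻¹ * _)) := by
        refine mul_le_mul_right ((add_le_add ht hxx).trans (le_of_eq ?_)) _
        rw [← two_mul, ENNReal.ofReal_ofNat]
    _ ≤ ENNReal.ofReal (energyConst m δ / γ * (N ^ 2 * (l2gNormSq γ 1 g).toReal
          + (l2gNormSq γ m g).toReal)) := by
        rw [← ENNReal.ofReal_mul (by norm_num), ← ENNReal.ofReal_mul (by linarith)]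
        exact ENNReal.ofReal_le_ofReal
          (mul_bound_le hδ hγ1 ENNReal.toReal_nonneg ENNReal.toReal_nonneg)
    _ = ENNReal.ofReal (energyConst m δ / γ) * (linfNorm (m + 2) (fun t => dx (φ₀ t)) ^ 2
          * l2gNormSq γ 1 g + l2gNormSq γ m g) := by
        rw [ENNReal.ofReal_mul (div_nonneg (energyConst_pos m δ).le (by linarith)),
          ENNReal.ofReal_add (by positivity) ENNReal.toReal_nonneg,
          ENNReal.ofReal_mul (sq_nonneg _), ENNReal.ofReal_pow ENNReal.toReal_nonneg,
          ENNReal.ofReal_toReal hx.2.ne, ENNReal.ofReal_toReal hg₁, ENNReal.ofReal_toReal hg.2.ne]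
    _ ≤ _ := by
        gcongr
        exact l2gNormSq_mono γ (by norm_num) g
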